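/- \textbf{Setting.} Let $\mathcal W$ be the $\beta\gamma$–$bc$ system of rank $d$, with strong generators $\beta^i,\gamma^i$ (even) and $b^i,c^i$ (odd), $1\le i\le d$, and OPEs $\beta^i(z)\gamma^j(w)\sim\delta_{ij}(z-w)^{-1}$, $b^i(z)c^j(w)\sim\delta_{ij}(z-w)^{-1}$. For a complex manifold $X$ of dimension $d$, the chiral de Rham complex $\Omega^{\mathrm{ch}}_X$ is the sheaf of vertex (super)algebras on $X$ which, on an open set $U$ with coordinates $\gamma^1,\dots,\gamma^d$, is the sheaf associated with $\Omega^{\mathrm{ch}}_X(U)=\mathcal W\otimes_{\mathbb C[\gamma^1_{(-1)},\dots,\gamma^d_{(-1)}]}\mathcal O(U)$, where $\beta^i(z)f(w)\sim\frac{\partial f}{\partial\gamma^i}(w)(z-w)^{-1}$ for $f\in\mathcal O(U)$. For another coordinate system $\tilde\gamma=f(\gamma)$, with inverse $\gamma=g(\tilde\gamma)$, the two descriptions are identified by the isomorphism of vertex algebras that identifies functions with functions and is given by $$\tilde b^i=\sum_j :\tfrac{\partial g^j}{\partial\tilde\gamma^i}(f(\gamma))\,b^j:,\qquad \tilde c^i=\sum_j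 :\tfrac{\partial f^i}{\partial\gamma^j}\,c^j:,$$ $$\tilde\beta^i=\sum_j :\tfrac{\partial g^j}{\partial\tilde\gamma^i}(f(\gamma))\,\beta^j:+\sum_{j,k}:\bigl(:\tfrac{\partial}{\partial\gamma^k}\bigl(\tfrac{\partial g^j}{\partial\tilde\gamma^i}(f(\gamma))\bigr)c^k:\bigr)b^j:.$$ A locally biholomorphic map $p:Y\to X$ induces a pullback $p^*:\Gamma(X,\Omega^{\mathrm{ch}}_X)\to\Gamma(Y,\Omega^{\mathrm{ch}}_Y)$ of global sections: $p^*s$ is the section of $\Omega^{\mathrm{ch}}_Y$ that corresponds to $s$ under the local isomorphisms given by $p$. \textbf{Proposition.} Let $X$ and $Y$ be compact complex manifolds of dimension $d$ and let $p:Y\to X$ be a finite normal covering map, i.e. a surjective, locally biholomorphic covering map with finite fibres such that the group $G(Y,p)$ of covering transformations (homeomorphisms $g:Y\to Y$ with $p\circ g=p$) acts transitively on every fibre. For $g\in G(Y,p)$ let $\rho(g)^*$ be the pullback along $g$, and let $$\Gamma(Y,\Omega^{\mathrm{ch}}_Y)^{G(Y,p)}=\{t\in\Gamma(Y,\Omega^{\mathrm{ch}}_Y)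 : \rho(g)^*t=t\ \text{for all } g\in G(Y,p)\}$$ be the invariant vertex subalgebra. Then every $s\in\Gamma(X,\Omega^{\mathrm{ch}}_X)$ has exactly one pullback $p^*s$, and $s\mapsto p^*s$ is an isomorphism of vertex algebras (an even linear bijection that preserves the vacuum, all $n$-th products and the translation operator) $$p^*:\Gamma(X,\Omega^{\mathrm{ch}}_X)\xrightarrow{\ \cong\ }\Gamma(Y,\Omega^{\mathrm{ch}}_Y)^{G(Y,p)}.$$ -/

import Mathlib

open Set Filter
open scoped Manifold ContDiff Topology VertexOperator

namespace ChiralDeRham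

noncomputable section

/-! ## Vertex algebra operations -/

/-- The data of a vertex (super)algebra over `ℂ`: the vacuum vector `1`, the state-field map
`Y(a) = a(z) = ∑ a_(n) z^(-n-1)`, given by its modes `a_(n) = nprod n a`, and the even and odd
parts. The translation operator is `a ↦ a_(-2) 1`, see `transl`. -/
class VertexData (V : Type*) [AddCommGroup V] [Module ℂ V] where
  vac : V
  nprod : ℤ → V →ₗ[ℂ] V →ₗ[ℂ] V
  parity : ZMod 2 → Submodule ℂ V

section VertexData

variable {V W : Type*} [AddCommGroup V] [Module ℂ V] [VertexData V]
  [AddCommGroup W] [Module ℂ W] [VertexData W]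

/-- The translation operator `L_{-1}` of a vertex algebra, `L_{-1} a = a_(-2) 1`. -/
def transl : V →ₗ[ℂ] V := (VertexData.nprod (-2)).flip VertexData.vac

/-- A vertex subalgebra: a subspace that contains the vacuum and is closed under all
`n`-th products (hence under translation). -/
structure VertexSubalgebra (V : Type*) [AddCommGroup V] [Module ℂ V] [VertexData V]
    extends Submodule ℂ V where
  vac_mem' : VertexData.vac ∈ carrier
  nprod_mem' : ∀ (n : ℤ) {a b : V}, a ∈ carrier → b ∈ carrier →
    VertexData.nprod n a b ∈ carrier

/-- The elements of a vertex subalgebra. -/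
def VertexSubalgebra.Elem (S : VertexSubalgebra V) : Type _ := S.toSubmodule

instance : CoeSort (VertexSubalgebra V) (Type _) := ⟨VertexSubalgebra.Elem⟩

instance (S : VertexSubalgebra V) : AddCommGroup S :=
  inferInstanceAs (AddCommGroup S.toSubmodule)

instance (S : VertexSubalgebra V) : Module ℂ S :=
  inferInstanceAs (Module ℂ S.toSubmodule)

lemma VertexSubalgebra.vac_mem (S : VertexSubalgebra V) : VertexData.vac ∈ S.toSubmodule :=
  S.vac_mem'

lemma VertexSubalgebra.nprod_mem (S : VertexSubalgebra V) (n : ℤ) {a b : V}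
    (ha : a ∈ S.toSubmodule) (hb : b ∈ S.toSubmodule) :
    VertexData.nprod n a b ∈ S.toSubmodule := S.nprod_mem' n ha hb

/-- The inclusion of a vertex subalgebra. -/
def VertexSubalgebra.incl (S : VertexSubalgebra V) : S →ₗ[ℂ] V := S.toSubmodule.subtype

/-- A vertex subalgebra with the restricted operations. -/
instance (S : VertexSubalgebra V) : VertexData S where
  vac := ⟨VertexData.vac, S.vac_mem'⟩
  nprod n := LinearMap.mk₂ ℂ
    (fun a b => ⟨VertexData.nprod n a.1 b.1, S.nprod_mem' n a.2 b.2⟩)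
    (fun a b c => Subtype.ext (LinearMap.map_add₂ (VertexData.nprod n) a.1 b.1 c.1))
    (fun r a b => Subtype.ext (LinearMap.map_smul₂ (VertexData.nprod n) r a.1 b.1))
    (fun a b c => Subtype.ext (map_add (VertexData.nprod n a.1) b.1 c.1))
    (fun r a b => Subtype.ext (map_smul (VertexData.nprod n a.1) r b.1))
  parity ε := (VertexData.parity ε).comap S.incl

/-- The vertex subalgebra generated by a set: the intersection of all vertex subalgebras that
contain it. -/
def VertexSubalgebra.closure (s : Set V) : VertexSubalgebra V where
  carrier := {v | ∀ S : VertexSubalgebra V, s ⊆ S.carrier → v ∈ S.carrier}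
  add_mem' ha hb S hS := S.add_mem' (ha S hS) (hb S hS)
  zero_mem' S _ := S.zero_mem'
  smul_mem' c _ ha S hS := S.smul_mem' c (ha S hS)
  vac_mem' S _ := S.vac_mem'
  nprod_mem' n _ _ ha hb S hS := S.nprod_mem' n (ha S hS) (hb S hS)

/-- The product of two vertex algebras (as vector spaces the direct sum), with componentwise
operations. -/
instance : VertexData (V × W) where
  vac := (VertexData.vac, VertexData.vac)
  nprod n := LinearMap.mk₂ ℂ
    (fun a b => (VertexData.nprod n a.1 b.1, VertexData.nprod n a.2 b.2))
    (fun _ _ _ => by simp) (fun _ _ _ => by simp)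
    (fun _ _ _ => by simp) (fun _ _ _ => by simp)
  parity ε := (VertexData.parity ε).prod (VertexData.parity ε)

lemma VertexSubalgebra.nprod_val (S : VertexSubalgebra V) (n : ℤ) (a b : S) :
    (VertexData.nprod n a b).1 = VertexData.nprod n a.1 b.1 := rfl

lemma VertexSubalgebra.nprod_mem_prod (S : VertexSubalgebra (V × W)) (n : ℤ) {a b : V} {a' b' : W}
    (h : (a, a') ∈ S.toSubmodule) (h' : (b, b') ∈ S.toSubmodule) :
    (VertexData.nprod n a b, VertexData.nprod n a' b') ∈ S.toSubmodule := S.nprod_mem n h h'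

/-- Families in vertex algebras, with componentwise operations. -/
instance {ι : Type*} {V : ι → Type*} [∀ i, AddCommGroup (V i)] [∀ i, Module ℂ (V i)]
    [∀ i, VertexData (V i)] : VertexData (∀ i, V i) where
  vac := fun _ => VertexData.vac
  nprod n := LinearMap.mk₂ ℂ (fun a b i => VertexData.nprod n (a i) (b i))
    (fun _ _ _ => by ext; simp) (fun _ _ _ => by ext; simp)
    (fun _ _ _ => by ext; simp) (fun _ _ _ => by ext; simp)
  parity ε := Submodule.pi Set.univ fun _ => VertexData.parity ε

lemma nprod_pi {ι : Type*} {V : ι → Type*} [∀ i, AddCommGroup (V i)] [∀ i, Module ℂ (V i)]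
    [∀ i, VertexData (V i)] (n : ℤ) (a b : ∀ i, V i) (i : ι) :
    VertexData.nprod n a b i = VertexData.nprod n (a i) (b i) := rfl

/-- An isomorphism of vertex algebras: an even linear bijection that preserves the vacuum, all
`n`-th products and the translation operator. -/
structure VertexIso (V W : Type*) [AddCommGroup V] [Module ℂ V] [VertexData V]
    [AddCommGroup W] [Module ℂ W] [VertexData W] extends V ≃ₗ[ℂ] W where
  map_vac : toFun VertexData.vac = VertexData.vac
  map_nprod : ∀ (n : ℤ) (a b : V),
    toFun (VertexData.nprod n a b) = VertexData.nprod n (toFun a) (toFun b)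
  map_transl : ∀ a : V, toFun (transl a) = transl (toFun a)
  map_parity : ∀ (ε : ZMod 2) (a : V),
    toFun a ∈ VertexData.parity ε ↔ a ∈ VertexData.parity ε

end VertexData

/-! ## Fields and normally ordered products -/

section Fields

variable {V : Type*} [AddCommGroup V] [Module ℂ V]

lemma exists_ncoeff_eq_zero (A : VertexOperator ℂ V) (x : V) :
    ∃ N : ℤ, ∀ n, N ≤ n → (A[[n]]) x = 0 :=
  ⟨-(HahnSeries.order ((HahnModule.of ℂ).symm (A x))), fun n hn =>
    VertexOperator.ncoeff_eq_zero_of_lt_order A n x (by lia)⟩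

/-- The field with prescribed modes, `A(z) = ∑ f n z^(-n-1)`. -/
def fieldOfModes (f : ℤ → Module.End ℂ V) (hf : ∀ x, ∃ N : ℤ, ∀ n, N ≤ n → f n x = 0) :
    VertexOperator ℂ V :=
  VertexOperator.of_coeff (fun n => f (-n - 1)) fun x => by
    obtain ⟨N, hN⟩ := hf x
    refine ⟨-N - 1, fun n hn => ?_⟩
    by_contra h
    exact hn (hN (-n - 1) (by lia))

@[simp] lemma fieldOfModes_ncoeff (f : ℤ → Module.End ℂ V) (hf) (n : ℤ) :
    ((fieldOfModes f hf)[[n]]) = f n := by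
  simp [fieldOfModes]

/-- The `j`-th summand of the `n`-th mode of the normally ordered product below. -/
def wickTerm (τ : Module.End ℂ V) (u : VertexOperator ℂ V) (k : ℕ) (A : VertexOperator ℂ V)
    (n : ℤ) (j : ℕ) : Module.End ℂ V :=
  ((k + j).choose j : ℂ) •
    ((u[[-(k + 1) - j]]) ∘ₗ (A[[n + j]]) +
      (-1 : ℂ) ^ k • (τ ∘ₗ (A[[n - (k + 1) - j]]) ∘ₗ τ ∘ₗ (u[[(j : ℤ)]])))

lemma wickTerm_finite (τ : Module.End ℂ V) (u : VertexOperator ℂ V) (k : ℕ)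
    (A : VertexOperator ℂ V) (n : ℤ) (x : V) :
    Function.HasFiniteSupport fun j => wickTerm τ u k A n j x := by
  obtain ⟨N, hN⟩ := exists_ncoeff_eq_zero A x
  obtain ⟨M, hM⟩ := exists_ncoeff_eq_zero u x
  refine (Set.finite_Iio (max (N - n) M).toNat).subset fun j hj => ?_
  by_contra h
  refine hj ?_
  have h' : (max (N - n) M).toNat ≤ j := by simpa using h
  have h1 : (A[[n + j]]) x = 0 := hN _ (by lia)
  have h2 : (u[[(j : ℤ)]]) x = 0 := hM _ (by lia)
  simp [wickTerm, h1, h2]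

/-- The `n`-th mode of the normally ordered product below. -/
def wickMode (τ : Module.End ℂ V) (u : VertexOperator ℂ V) (k : ℕ) (A : VertexOperator ℂ V)
    (n : ℤ) : Module.End ℂ V where
  toFun x := ∑ᶠ j, wickTerm τ u k A n j x
  map_add' x y := by
    simp only [map_add]
    exact finsum_add_distrib (wickTerm_finite τ u k A n x) (wickTerm_finite τ u k A n y)
  map_smul' c x := by
    simp only [map_smul, RingHom.id_apply]
    exact (smul_finsum c _).symm

lemma wickMode_apply (τ : Module.End ℂ V) (u : VertexOperator ℂ V) (k : ℕ)
    (A : VertexOperator ℂ V) (n : ℤ) (x : V) :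
    wickMode τ u k A n x = ∑ᶠ j, wickTerm τ u k A n j x := rfl

lemma exists_wickMode_eq_zero (τ : Module.End ℂ V) (u : VertexOperator ℂ V) (k : ℕ)
    (A : VertexOperator ℂ V) (x : V) : ∃ N : ℤ, ∀ n, N ≤ n → wickMode τ u k A n x = 0 := by
  obtain ⟨N, hN⟩ := exists_ncoeff_eq_zero A x
  obtain ⟨M, hM⟩ := exists_ncoeff_eq_zero u x
  choose P hP using fun j : ℕ => exists_ncoeff_eq_zero A (τ ((u[[(j : ℤ)]]) x))
  obtain ⟨Q, hQ⟩ := ((Finset.range M.toNat).image P).exists_le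
  refine ⟨max N (Q + (k + 1) + M.toNat), fun n hn => ?_⟩
  rw [wickMode_apply]
  refine finsum_eq_zero_of_forall_eq_zero fun j => ?_
  have h1 : (A[[n + j]]) x = 0 := hN _ (by lia)
  have h2 : (A[[n - (k + 1) - j]]) (τ ((u[[(j : ℤ)]]) x)) = 0 := by
    by_cases hj : M ≤ j
    · rw [hM _ hj]; simp
    · have : P j ≤ Q := hQ _ (Finset.mem_image_of_mem P (by simp; lia))
      exact hP j _ (by lia)
  simp [wickTerm, h1, h2]

/-- The normally ordered product `:∂ᵏu(z) A(z): / k!` of a field `u(z)` and a field `A(z)`, as a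
linear function of `A(z)`. Its `n`-th mode is
`∑ (k+j choose j) (u_(-k-1-j) A_(n+j) + (-1)ᵏ (-1)^{|u||A|} A_(n-k-1-j) u_(j))`, sum over `j ≥ 0`,
where `(-1)^{|u||A|} A` is written as `τ A τ`; here `τ = 1` if `u` is even, and `τ` is the parity
operator (`1` on even and `-1` on odd vectors) if `u` is odd. -/
def wick (τ : Module.End ℂ V) (u : VertexOperator ℂ V) (k : ℕ) :
    VertexOperator ℂ V →ₗ[ℂ] VertexOperator ℂ V where
  toFun A := fieldOfModes (wickMode τ u k A) (exists_wickMode_eq_zero τ u k A)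
  map_add' A B := by
    refine HVertexOperator.coeff_inj (funext fun n => ?_)
    simp only [VertexOperator.coeff_eq_ncoeff, map_add, Pi.add_apply, fieldOfModes_ncoeff]
    ext x
    simp only [LinearMap.add_apply, wickMode_apply]
    rw [← finsum_add_distrib (wickTerm_finite ..) (wickTerm_finite ..)]
    refine finsum_congr fun j => ?_
    simp only [wickTerm, map_add, Pi.add_apply, LinearMap.smul_apply, LinearMap.add_apply,
      LinearMap.comp_apply, smul_add]
    abel
  map_smul' c A := by
    refine HVertexOperator.coeff_inj (funext fun n => ?_)
    simp only [VertexOperator.coeff_eq_ncoeff, map_smul, Pi.smul_apply, fieldOfModes_ncoeff,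
      RingHom.id_apply]
    ext x
    simp only [LinearMap.smul_apply, wickMode_apply]
    rw [smul_finsum]
    refine finsum_congr fun j => ?_
    simp only [wickTerm, map_smul, Pi.smul_apply, LinearMap.smul_apply, LinearMap.add_apply,
      LinearMap.comp_apply, smul_add, smul_comm c]

@[simp] lemma wick_ncoeff (τ : Module.End ℂ V) (u : VertexOperator ℂ V) (k : ℕ)
    (A : VertexOperator ℂ V) (n : ℤ) : (wick τ u k A)[[n]] = wickMode τ u k A n :=
  fieldOfModes_ncoeff _ (exists_wickMode_eq_zero τ u k A) n

end Fields

/-! ## The `βγ-bc` system over an algebra of functions -/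

/-- A commutative `ℂ`-algebra of functions of `γ¹, …, γᵈ`: one that carries the `d` partial
derivatives. -/
class Partials (d : outParam ℕ) (A : Type*) [CommRing A] [Algebra ℂ A] where
  pd : Fin d → Derivation ℂ A A

open Partials (pd)

set_option linter.unusedSectionVars false

/-- `(i, k)` labels the creation operator `βⁱ_(-k-1)`, or `αⁱ_(-k-1)` where `αⁱ = ∂γⁱ`. -/
abbrev BosonVar (d : ℕ) := Fin d × ℕ

/-- Labels of the odd creation operators `bⁱ_(-k-1)` and `cⁱ_(-k-1)`, linearly ordered. -/
abbrev FermionVar (d : ℕ) := Bool ×ₗ (Fin d ×ₗ ℕ)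

/-- The label of `bⁱ_(-k-1)`. -/
abbrev bVar {d : ℕ} (i : Fin d) (k : ℕ) : FermionVar d := toLex (false, toLex (i, k))

/-- The label of `cⁱ_(-k-1)`. -/
abbrev cVar {d : ℕ} (i : Fin d) (k : ℕ) : FermionVar d := toLex (true, toLex (i, k))

/-- Monomials in the creation operators: a multiset of `β`'s, a multiset of `α`'s, and a finite
set of `b`'s and `c`'s (multiplied in increasing order). -/
abbrev Mono (d : ℕ) := Multiset (BosonVar d) × Multiset (BosonVar d) × Finset (FermionVar d)

/-- `𝒲 ⊗_{ℂ[γ¹,…,γᵈ]} A = SW ⊗_ℂ A`: the free `A`-module on the monomials in the creation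
operators `βⁱ_(n), αⁱ_(n), bⁱ_(n), cⁱ_(n)`, `n < 0`. The basis vector `single m f` is the state
`β ⋯ β α ⋯ α (b or c) ⋯ (b or c) f 1`. -/
abbrev Fock (d : ℕ) (A : Type*) [CommRing A] := Mono d →₀ A

section Fock

variable {d : ℕ} {A : Type*} [CommRing A] [Algebra ℂ A]

/-- The creation operator `βⁱ_(-k-1)`, `v = (i, k)`. -/
def createBeta (v : BosonVar d) : Module.End ℂ (Fock d A) :=
  Finsupp.lsum ℂ fun m => Finsupp.lsingle (v ::ₘ m.1, m.2)

/-- The creation operator `αⁱ_(-k-1)`, `v = (i, k)`. -/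
def createAlpha (v : BosonVar d) : Module.End ℂ (Fock d A) :=
  Finsupp.lsum ℂ fun m => Finsupp.lsingle (m.1, v ::ₘ m.2.1, m.2.2)

/-- The partial derivative `∂/∂βⁱ_(-k-1)`, `v = (i, k)`. -/
def derivBeta (v : BosonVar d) : Module.End ℂ (Fock d A) :=
  Finsupp.lsum ℂ fun m => (m.1.count v : ℂ) • Finsupp.lsingle (m.1.erase v, m.2)

/-- The partial derivative `∂/∂αⁱ_(-k-1)`, `v = (i, k)`. -/
def derivAlpha (v : BosonVar d) : Module.End ℂ (Fock d A) :=
  Finsupp.lsum ℂ fun m => (m.2.1.count v : ℂ) • Finsupp.lsingle (m.1, m.2.1.erase v, m.2.2)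

/-- The sign from moving an odd operator with label `v` to its place among the `S`. -/
def fermionSign (v : FermionVar d) (S : Finset (FermionVar d)) : ℂ :=
  (-1) ^ (S.filter (· < v)).card

/-- The odd creation operator with label `v`. -/
def createFermion (v : FermionVar d) : Module.End ℂ (Fock d A) :=
  Finsupp.lsum ℂ fun m => if v ∈ m.2.2 then 0 else
    fermionSign v m.2.2 • Finsupp.lsingle (m.1, m.2.1, insert v m.2.2)

/-- The odd partial derivative with respect to the odd creation operator with label `v`. -/
def derivFermion (v : FermionVar d) : Module.End ℂ (Fock d A) :=
  Finsupp.lsum ℂ fun m => if v ∈ m.2.2 then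
    fermionSign v m.2.2 • Finsupp.lsingle (m.1, m.2.1, m.2.2.erase v) else 0

/-- The parity operator: `1` on even and `-1` on odd vectors. -/
def parityOp : Module.End ℂ (Fock d A) :=
  Finsupp.lsum ℂ fun m => ((-1 : ℂ) ^ m.2.2.card) • Finsupp.lsingle m

/-- Multiplication by `f ∈ A`. -/
def mulFun (f : A) : Module.End ℂ (Fock d A) :=
  Finsupp.mapRange.linearMap (LinearMap.mulLeft ℂ f)

variable [Partials d A]

/-- `∂/∂γⁱ`, acting on the coefficients. -/
def derivGamma (i : Fin d) : Module.End ℂ (Fock d A) :=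
  Finsupp.mapRange.linearMap (pd i : Derivation ℂ A A).toLinearMap

/-- The modes `βⁱ_(n)`: creation for `n < 0`, `βⁱ_(0) = ∂/∂γⁱ`, and `βⁱ_(n) = n ∂/∂αⁱ_(-n)` for
`n > 0`. -/
def betaMode (i : Fin d) : ℤ → Module.End ℂ (Fock d A)
  | .negSucc k => createBeta (i, k)
  | .ofNat 0 => derivGamma i
  | .ofNat (k + 1) => ((k : ℂ) + 1) • derivAlpha (i, k)

/-- The modes `αⁱ_(n)`: creation for `n < 0`, `αⁱ_(0) = 0`, and `αⁱ_(n) = n ∂/∂βⁱ_(-n)` for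
`n > 0`. -/
def alphaMode (i : Fin d) : ℤ → Module.End ℂ (Fock d A)
  | .negSucc k => createAlpha (i, k)
  | .ofNat 0 => 0
  | .ofNat (k + 1) => ((k : ℂ) + 1) • derivBeta (i, k)

/-- The modes `bⁱ_(n)`: creation for `n < 0`, and `∂/∂cⁱ_(-n-1)` for `n ≥ 0`. -/
def bMode (i : Fin d) : ℤ → Module.End ℂ (Fock d A)
  | .negSucc k => createFermion (bVar i k)
  | .ofNat k => derivFermion (cVar i k)

/-- The modes `cⁱ_(n)`: creation for `n < 0`, and `∂/∂bⁱ_(-n-1)` for `n ≥ 0`. -/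
def cMode (i : Fin d) : ℤ → Module.End ℂ (Fock d A)
  | .negSucc k => createFermion (cVar i k)
  | .ofNat k => derivFermion (bVar i k)

/-- Multiplication by the coefficient of `zᵏ` in the Taylor expansion of
`f(γ + ∑_{j ≥ 1} α_(-j) zʲ / j)`. By `z d/dz`, the coefficient `E k f` of `zᵏ` satisfies
`k E k f = ∑ᵢ ∑_{1 ≤ j ≤ k} αⁱ_(-j) E (k-j) (∂f/∂γⁱ)`. -/
def jet : ℕ → A → Module.End ℂ (Fock d A)
  | 0, f => mulFun f
  | k + 1, f => ((k : ℂ) + 1)⁻¹ • ∑ j : Fin (k + 1), ∑ i : Fin d,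
      createAlpha (i, (j : ℕ)) ∘ₗ jet (k - j) (pd i f)
  termination_by k => k

/-- The `n`-th mode of `f(z)` composed with `βs ⋯ β`, restricted to vectors without `β`. It is
obtained by moving `f_(n)` to the right by `[f_(n), βⁱ_(-k-1)] = -(∂f/∂γⁱ)_(n-k-1)`; on a vector
without `β` only the part of `γ(z)` with nonnegative powers of `z` acts. -/
def funOnWord : List (BosonVar d) → A → ℤ → Module.End ℂ (Fock d A)
  | [], f, .negSucc k => jet k f
  | [], _, .ofNat _ => 0
  | v :: L, f, n => createBeta v ∘ₗ funOnWord L f n - funOnWord L (pd v.1 f) (n - (v.2 + 1))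

/-- The modes `f_(n)` of the field `f(z)`, `f ∈ A`. -/
def funMode (f : A) (n : ℤ) : Module.End ℂ (Fock d A) :=
  Finsupp.lsum ℂ fun m => funOnWord m.1.toList f n ∘ₗ Finsupp.lsingle (0, m.2)

lemma lsum_eventually_zero {d : ℕ} {A : Type*} [CommRing A] [Algebra ℂ A]
    {ι : Type*} [LinearOrder ι] [Nonempty ι]
    {T : ι → Mono d → A →ₗ[ℂ] Fock d A} (hT : ∀ m, ∃ N, ∀ n, N ≤ n → T n m = 0)
    (x : Fock d A) : ∃ N, ∀ n, N ≤ n → Finsupp.lsum ℂ (T n) x = 0 := by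
  choose N hN using hT
  obtain ⟨M, hM⟩ := (x.support.image N).exists_le
  refine ⟨M, fun n hn => ?_⟩
  rw [Finsupp.lsum_apply, Finsupp.sum]
  refine Finset.sum_eq_zero fun m hm => ?_
  rw [hN m n ((hM _ (Finset.mem_image_of_mem N hm)).trans hn)]
  rfl

lemma exists_label_bound {ι : Type*} [DecidableEq ι] (S : Finset ι) (g : ι → ℕ) :
    ∃ N : ℕ, ∀ v ∈ S, g v < N := by
  obtain ⟨N, hN⟩ := (S.image g).exists_le
  exact ⟨N + 1, fun v hv => Nat.lt_succ_of_le (hN _ (Finset.mem_image_of_mem g hv))⟩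

lemma exists_betaMode_eq_zero (i : Fin d) (x : Fock d A) :
    ∃ N : ℤ, ∀ n, N ≤ n → betaMode i n x = 0 := by
  obtain ⟨N, hN⟩ := lsum_eventually_zero (A := A) (T := fun (k : ℕ) (m : Mono d) =>
    (m.2.1.count (i, k) : ℂ) • Finsupp.lsingle (m.1, m.2.1.erase (i, k), m.2.2)) (fun m => by
      obtain ⟨N, hN⟩ := exists_label_bound m.2.1.toFinset Prod.snd
      refine ⟨N, fun k hk => ?_⟩
      have : (i, k) ∉ m.2.1 := fun h => absurd (hN _ (Multiset.mem_toFinset.2 h)) (not_lt.2 hk)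
      simp [this]) x
  refine ⟨N + 1, fun n hn => ?_⟩
  obtain ⟨k, rfl⟩ : ∃ k : ℕ, n = .ofNat (k + 1) := ⟨(n - 1).toNat, by simp; lia⟩
  change ((k : ℂ) + 1) • derivAlpha (i, k) x = 0
  have h : derivAlpha (i, k) x = 0 := hN k (by simp at hn; lia)
  rw [h, smul_zero]

lemma exists_alphaMode_eq_zero (i : Fin d) (x : Fock d A) :
    ∃ N : ℤ, ∀ n, N ≤ n → alphaMode i n x = 0 := by
  obtain ⟨N, hN⟩ := lsum_eventually_zero (A := A) (T := fun (k : ℕ) (m : Mono d) =>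
    (m.1.count (i, k) : ℂ) • Finsupp.lsingle (m.1.erase (i, k), m.2)) (fun m => by
      obtain ⟨N, hN⟩ := exists_label_bound m.1.toFinset Prod.snd
      refine ⟨N, fun k hk => ?_⟩
      have : (i, k) ∉ m.1 := fun h => absurd (hN _ (Multiset.mem_toFinset.2 h)) (not_lt.2 hk)
      simp [this]) x
  refine ⟨N + 1, fun n hn => ?_⟩
  obtain ⟨k, rfl⟩ : ∃ k : ℕ, n = .ofNat (k + 1) := ⟨(n - 1).toNat, by simp; lia⟩
  change ((k : ℂ) + 1) • derivBeta (i, k) x = 0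
  have h : derivBeta (i, k) x = 0 := hN k (by simp at hn; lia)
  rw [h, smul_zero]

lemma exists_derivFermion_eq_zero {d : ℕ} {A : Type*} [CommRing A] [Algebra ℂ A]
    (e : ℕ → FermionVar d) (he : ∀ k, (ofLex (ofLex (e k)).2).2 = k)
    (x : Fock d A) : ∃ N : ℕ, ∀ k, N ≤ k → derivFermion (e k) x = 0 := by
  refine lsum_eventually_zero (fun m => ?_) x
  obtain ⟨N, hN⟩ := exists_label_bound m.2.2 fun v => (ofLex (ofLex v).2).2
  refine ⟨N, fun k hk => if_neg fun h => ?_⟩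
  have := hN _ h
  rw [he] at this
  exact absurd this (not_lt.2 hk)

lemma exists_bMode_eq_zero (i : Fin d) (x : Fock d A) :
    ∃ N : ℤ, ∀ n, N ≤ n → bMode i n x = 0 := by
  obtain ⟨N, hN⟩ := exists_derivFermion_eq_zero (cVar i) (fun _ => rfl) x
  refine ⟨N, fun n hn => ?_⟩
  obtain ⟨k, rfl⟩ : ∃ k : ℕ, n = .ofNat k := ⟨n.toNat, by simp; lia⟩
  exact hN k (by simpa using hn)

lemma exists_cMode_eq_zero (i : Fin d) (x : Fock d A) :
    ∃ N : ℤ, ∀ n, N ≤ n → cMode i n x = 0 := by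
  obtain ⟨N, hN⟩ := exists_derivFermion_eq_zero (bVar i) (fun _ => rfl) x
  refine ⟨N, fun n hn => ?_⟩
  obtain ⟨k, rfl⟩ : ∃ k : ℕ, n = .ofNat k := ⟨n.toNat, by simp; lia⟩
  exact hN k (by simpa using hn)

lemma exists_funOnWord_eq_zero (L : List (BosonVar d)) :
    ∃ N : ℤ, ∀ (f : A) (n : ℤ), N ≤ n → funOnWord L f n = 0 := by
  induction L with
  | nil =>
    refine ⟨0, fun f n hn => ?_⟩
    obtain ⟨k, rfl⟩ : ∃ k : ℕ, n = .ofNat k := ⟨n.toNat, by simp; lia⟩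
    rfl
  | cons v L ih =>
    obtain ⟨N, hN⟩ := ih
    refine ⟨N + (v.2 + 1), fun f n hn => ?_⟩
    rw [funOnWord, hN _ _ (by lia), hN _ _ (by lia), LinearMap.comp_zero]
    exact sub_zero (0 : Module.End ℂ (Fock d A))

lemma exists_funMode_eq_zero (f : A) (x : Fock d A) :
    ∃ N : ℤ, ∀ n, N ≤ n → funMode f n x = 0 :=
  lsum_eventually_zero (fun m => by
    obtain ⟨N, hN⟩ := exists_funOnWord_eq_zero (A := A) m.1.toList
    exact ⟨N, fun n hn => by rw [hN f n hn]; rfl⟩) x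

/-- The field `βⁱ(z)`. -/
def betaField (i : Fin d) : VertexOperator ℂ (Fock d A) :=
  fieldOfModes (betaMode i) (exists_betaMode_eq_zero i)

/-- The field `αⁱ(z) = ∂γⁱ(z)`. -/
def alphaField (i : Fin d) : VertexOperator ℂ (Fock d A) :=
  fieldOfModes (alphaMode i) (exists_alphaMode_eq_zero i)

/-- The field `bⁱ(z)`. -/
def bField (i : Fin d) : VertexOperator ℂ (Fock d A) :=
  fieldOfModes (bMode i) (exists_bMode_eq_zero i)

/-- The field `cⁱ(z)`. -/
def cField (i : Fin d) : VertexOperator ℂ (Fock d A) :=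
  fieldOfModes (cMode i) (exists_cMode_eq_zero i)

lemma jet_add (k : ℕ) (f g : A) : (jet k (f + g) : Module.End ℂ (Fock d A)) =
    jet k f + jet k g := by
  induction k using Nat.strong_induction_on generalizing f g with
  | _ k ih =>
    cases k with
    | zero =>
      rw [jet, jet, jet]
      ext m a n
      simp [mulFun, add_mul]
    | succ k =>
      rw [jet, jet, jet, ← smul_add, ← Finset.sum_add_distrib]
      refine congrArg _ (Finset.sum_congr rfl fun j _ => ?_)
      rw [← Finset.sum_add_distrib]
      refine Finset.sum_congr rfl fun i _ => ?_
      rw [map_add, ih _ (by lia), LinearMap.comp_add]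

lemma jet_smul (k : ℕ) (c : ℂ) (f : A) : (jet k (c • f) : Module.End ℂ (Fock d A)) =
    c • jet k f := by
  induction k using Nat.strong_induction_on generalizing f with
  | _ k ih =>
    cases k with
    | zero =>
      rw [jet, jet]
      ext m a n
      simp only [mulFun, LinearMap.comp_apply, Finsupp.mapRange.linearMap_apply,
        LinearMap.smul_apply, Finsupp.smul_apply, Finsupp.mapRange_apply, LinearMap.mulLeft_apply,
        smul_mul_assoc]
    | succ k =>
      rw [jet, jet, smul_comm c, Finset.smul_sum (r := c)]
      refine congrArg _ (Finset.sum_congr rfl fun j _ => ?_)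
      rw [Finset.smul_sum]
      refine Finset.sum_congr rfl fun i _ => ?_
      rw [Derivation.map_smul, ih _ (by lia), LinearMap.comp_smul]

lemma funOnWord_add (L : List (BosonVar d)) (f g : A) (n : ℤ) :
    funOnWord L (f + g) n = funOnWord L f n + funOnWord L g n := by
  induction L generalizing f g n with
  | nil => cases n <;> simp [funOnWord, jet_add]
  | cons v L ih =>
    simp only [funOnWord, map_add, ih, LinearMap.comp_add]
    abel

lemma funOnWord_smul (L : List (BosonVar d)) (c : ℂ) (f : A) (n : ℤ) :
    funOnWord L (c • f) n = c • funOnWord L f n := by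
  induction L generalizing f n with
  | nil => cases n <;> simp [funOnWord, jet_smul]
  | cons v L ih =>
    simp only [funOnWord, Derivation.map_smul, ih, LinearMap.comp_smul]
    exact (smul_sub c (createBeta v ∘ₗ funOnWord L f n : Module.End ℂ (Fock d A)) _).symm

/-- The field `f(z)`, as a linear function of `f ∈ A`. -/
def funField : A →ₗ[ℂ] VertexOperator ℂ (Fock d A) where
  toFun f := fieldOfModes (funMode f) (exists_funMode_eq_zero f)
  map_add' f g := by
    refine HVertexOperator.coeff_inj (funext fun n => ?_)
    simp only [VertexOperator.coeff_eq_ncoeff, map_add, Pi.add_apply, fieldOfModes_ncoeff]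
    refine Finsupp.lhom_ext fun m a => ?_
    simp [funMode, funOnWord_add]
  map_smul' c f := by
    refine HVertexOperator.coeff_inj (funext fun n => ?_)
    simp only [VertexOperator.coeff_eq_ncoeff, map_smul, Pi.smul_apply, fieldOfModes_ncoeff,
      RingHom.id_apply]
    refine Finsupp.lhom_ext fun m a => ?_
    simp [funMode, funOnWord_smul]

@[simp] lemma funField_ncoeff (f : A) (n : ℤ) :
    (funField f : VertexOperator ℂ (Fock d A))[[n]] = funMode f n :=
  fieldOfModes_ncoeff _ (exists_funMode_eq_zero f) n

/-- The linear map that sends the field `f(z)`, `f ∈ A`, to the iterated normally ordered product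
of the (divided derivatives of) fields of the factors of the monomial `m`, and `f(z)`. -/
def monoField (m : Mono d) : Module.End ℂ (VertexOperator ℂ (Fock d A)) :=
  (m.1.toList.map fun v => wick 1 (betaField v.1) v.2).prod *
  (m.2.1.toList.map fun v => wick 1 (alphaField v.1) v.2).prod *
  (m.2.2.sort.map fun v =>
    wick parityOp (if (ofLex v).1 then cField (ofLex (ofLex v).2).1
      else bField (ofLex (ofLex v).2).1) (ofLex (ofLex v).2).2).prod

/-- The state-field map. -/
def stateField : Fock d A →ₗ[ℂ] VertexOperator ℂ (Fock d A) :=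
  Finsupp.lsum ℂ fun m => monoField m ∘ₗ funField

/-- The vertex algebra `𝒲 ⊗_{ℂ[γ¹,…,γᵈ]} A`. -/
instance : VertexData (Fock d A) where
  vac := Finsupp.single (0, 0, ∅) 1
  nprod n := LinearMap.mk₂ ℂ (fun a b => ((stateField a)[[n]]) b)
    (fun _ _ _ => by simp) (fun _ _ _ => by simp) (fun _ _ _ => by simp) (fun _ _ _ => by simp)
  parity ε := Finsupp.supported A ℂ {m | (m.2.2.card : ZMod 2) = ε}

/-- The state `f`, for `f ∈ A`. -/
def stF (f : A) : Fock d A := Finsupp.single (0, 0, ∅) f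

variable (A) in
/-- The state `βⁱ = βⁱ_(-1) 1`. -/
def stBeta (i : Fin d) : Fock d A := Finsupp.single ({(i, 0)}, 0, ∅) 1

variable (A) in
/-- The state `bⁱ = bⁱ_(-1) 1`. -/
def stB (i : Fin d) : Fock d A := Finsupp.single (0, 0, {bVar i 0}) 1

variable (A) in
/-- The state `cⁱ = cⁱ_(-1) 1`. -/
def stC (i : Fin d) : Fock d A := Finsupp.single (0, 0, {cVar i 0}) 1

end Fock

/-! ### Change of the algebra of functions -/

section Map

variable {d : ℕ} {A B : Type*} [CommRing A] [Algebra ℂ A] [Partials d A]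
  [CommRing B] [Algebra ℂ B] [Partials d B]

/-- The map `𝒲 ⊗ A → 𝒲 ⊗ B` induced by a homomorphism `A → B`. -/
def fockMap (φ : A →ₐ[ℂ] B) : Fock d A →ₗ[ℂ] Fock d B :=
  Finsupp.mapRange.linearMap φ.toLinearMap

@[simp] lemma fockMap_single (φ : A →ₐ[ℂ] B) (m : Mono d) (a : A) :
    fockMap φ (Finsupp.single m a) = Finsupp.single m (φ a) := by
  simp [fockMap]

variable (φ : A →ₐ[ℂ] B)

/-- `φ` intertwines the operators `S` and `T`. -/
def Intertwines (S : Module.End ℂ (Fock d A)) (T : Module.End ℂ (Fock d B)) : Prop :=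
  ∀ x, fockMap φ (S x) = T (fockMap φ x)

lemma intertwines_of_single {S : Module.End ℂ (Fock d A)} {T : Module.End ℂ (Fock d B)}
    (h : ∀ m a, fockMap φ (S (Finsupp.single m a)) = T (Finsupp.single m (φ a))) :
    Intertwines φ S T := fun x => by
  have : fockMap φ ∘ₗ S = T ∘ₗ fockMap φ := Finsupp.lhom_ext fun m a => by simp [h]
  exact LinearMap.congr_fun this x

lemma Intertwines.comp {φ : A →ₐ[ℂ] B} {S S' : Module.End ℂ (Fock d A)}
    {T T' : Module.End ℂ (Fock d B)} (h : Intertwines φ S T) (h' : Intertwines φ S' T') :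
    Intertwines φ (S ∘ₗ S') (T ∘ₗ T') := fun x => by
  simp [h _, h' _]

lemma Intertwines.smul {φ : A →ₐ[ℂ] B} {S : Module.End ℂ (Fock d A)}
    {T : Module.End ℂ (Fock d B)} (h : Intertwines φ S T) (c : ℂ) :
    Intertwines φ (c • S) (c • T) := fun x => by
  simp [h _]

lemma Intertwines.add {φ : A →ₐ[ℂ] B} {S S' : Module.End ℂ (Fock d A)}
    {T T' : Module.End ℂ (Fock d B)} (h : Intertwines φ S T) (h' : Intertwines φ S' T') :
    Intertwines φ (S + S') (T + T') := fun x => by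
  simp [h _, h' _]

lemma Intertwines.sub {φ : A →ₐ[ℂ] B} {S S' : Module.End ℂ (Fock d A)}
    {T T' : Module.End ℂ (Fock d B)} (h : Intertwines φ S T) (h' : Intertwines φ S' T') :
    Intertwines φ (S - S') (T - T') := fun x => by
  simp [h _, h' _]

lemma Intertwines.sum {φ : A →ₐ[ℂ] B} {ι : Type*} {s : Finset ι}
    {S : ι → Module.End ℂ (Fock d A)} {T : ι → Module.End ℂ (Fock d B)}
    (h : ∀ i ∈ s, Intertwines φ (S i) (T i)) :
    Intertwines φ (∑ i ∈ s, S i) (∑ i ∈ s, T i) := fun x => by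
  simp only [LinearMap.sum_apply, map_sum]
  exact Finset.sum_congr rfl fun i hi => h i hi x

lemma intertwines_zero : Intertwines φ (0 : Module.End ℂ (Fock d A)) 0 := fun x => by simp

lemma intertwines_one : Intertwines φ (1 : Module.End ℂ (Fock d A)) 1 := fun _ => rfl

lemma intertwines_createBeta (v : BosonVar d) :
    Intertwines φ (createBeta v) (createBeta v) :=
  intertwines_of_single φ fun m a => by simp [createBeta]

lemma intertwines_createAlpha (v : BosonVar d) :
    Intertwines φ (createAlpha v) (createAlpha v) :=
  intertwines_of_single φ fun m a => by simp [createAlpha]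

lemma intertwines_derivBeta (v : BosonVar d) :
    Intertwines φ (derivBeta v) (derivBeta v) :=
  intertwines_of_single φ fun m a => by simp [derivBeta]

lemma intertwines_derivAlpha (v : BosonVar d) :
    Intertwines φ (derivAlpha v) (derivAlpha v) :=
  intertwines_of_single φ fun m a => by simp [derivAlpha]

lemma intertwines_createFermion (v : FermionVar d) :
    Intertwines φ (createFermion v) (createFermion v) :=
  intertwines_of_single φ fun m a => by
    by_cases h : v ∈ m.2.2 <;> simp [createFermion, h]

lemma intertwines_derivFermion (v : FermionVar d) :
    Intertwines φ (derivFermion v) (derivFermion v) :=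
  intertwines_of_single φ fun m a => by
    by_cases h : v ∈ m.2.2 <;> simp [derivFermion, h]

lemma intertwines_parityOp : Intertwines φ (parityOp (d := d)) parityOp :=
  intertwines_of_single φ fun m a => by simp [parityOp]

lemma intertwines_mulFun (f : A) : Intertwines φ (mulFun (d := d) f) (mulFun (φ f)) :=
  intertwines_of_single φ fun m a => by
    simp only [mulFun, Finsupp.mapRange.linearMap_apply, Finsupp.mapRange_single,
      LinearMap.mulLeft_apply, fockMap_single, map_mul]

/-- `φ` is compatible with the partial derivatives. -/
def PreservesPd : Prop := ∀ (i : Fin d) (a : A), φ (pd i a) = pd i (φ a)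

/-- `φ` intertwines the modes of the fields `S(z)` and `T(z)`. -/
def FieldIntertwines (S : VertexOperator ℂ (Fock d A)) (T : VertexOperator ℂ (Fock d B)) : Prop :=
  ∀ n : ℤ, Intertwines φ (S[[n]]) (T[[n]])

variable {φ}

lemma intertwines_derivGamma (hφ : PreservesPd φ) (i : Fin d) :
    Intertwines φ (derivGamma i) (derivGamma i) :=
  intertwines_of_single φ fun m a => by simp [derivGamma, hφ i a]

lemma intertwines_jet (hφ : PreservesPd φ) (k : ℕ) (f : A) :
    Intertwines φ (jet k f) (jet k (φ f)) := by
  induction k using Nat.strong_induction_on generalizing f with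
  | _ k ih =>
    cases k with
    | zero => rw [jet, jet]; exact intertwines_mulFun φ f
    | succ k =>
      rw [jet, jet]
      refine Intertwines.smul (Intertwines.sum fun j _ => Intertwines.sum fun i _ => ?_) _
      rw [← hφ]
      exact (intertwines_createAlpha φ _).comp (ih _ (by lia) _)

lemma intertwines_funOnWord (hφ : PreservesPd φ) (L : List (BosonVar d)) (f : A) (n : ℤ) :
    Intertwines φ (funOnWord L f n) (funOnWord L (φ f) n) := by
  induction L generalizing f n with
  | nil =>
    cases n with
    | ofNat k => exact intertwines_zero φ
    | negSucc k => exact intertwines_jet hφ k f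
  | cons v L ih =>
    rw [funOnWord, funOnWord, ← hφ]
    exact ((intertwines_createBeta φ v).comp (ih _ _)).sub (ih _ _)

lemma fieldIntertwines_funField (hφ : PreservesPd φ) (f : A) :
    FieldIntertwines φ (funField f) (funField (φ f)) := fun n => by
  rw [funField_ncoeff, funField_ncoeff]
  refine intertwines_of_single φ fun m a => ?_
  simp [funMode, intertwines_funOnWord hφ m.1.toList f n _]

lemma fieldIntertwines_betaField (hφ : PreservesPd φ) (i : Fin d) :
    FieldIntertwines φ (betaField i) (betaField i) := fun n => by
  rw [betaField, betaField, fieldOfModes_ncoeff, fieldOfModes_ncoeff]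
  match n with
  | .negSucc k => exact intertwines_createBeta φ _
  | .ofNat 0 => exact intertwines_derivGamma hφ i
  | .ofNat (k + 1) => exact (intertwines_derivAlpha φ _).smul _

lemma fieldIntertwines_alphaField (i : Fin d) :
    FieldIntertwines φ (alphaField i) (alphaField i) := fun n => by
  rw [alphaField, alphaField, fieldOfModes_ncoeff, fieldOfModes_ncoeff]
  match n with
  | .negSucc k => exact intertwines_createAlpha φ _
  | .ofNat 0 => exact intertwines_zero φ
  | .ofNat (k + 1) => exact (intertwines_derivBeta φ _).smul _

lemma fieldIntertwines_bField (i : Fin d) :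
    FieldIntertwines φ (bField i) (bField i) := fun n => by
  rw [bField, bField, fieldOfModes_ncoeff, fieldOfModes_ncoeff]
  match n with
  | .negSucc k => exact intertwines_createFermion φ _
  | .ofNat k => exact intertwines_derivFermion φ _

lemma fieldIntertwines_cField (i : Fin d) :
    FieldIntertwines φ (cField i) (cField i) := fun n => by
  rw [cField, cField, fieldOfModes_ncoeff, fieldOfModes_ncoeff]
  match n with
  | .negSucc k => exact intertwines_createFermion φ _
  | .ofNat k => exact intertwines_derivFermion φ _

lemma fieldIntertwines_wick {τ : Module.End ℂ (Fock d A)} {τ' : Module.End ℂ (Fock d B)}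
    (hτ : Intertwines φ τ τ') {u S : VertexOperator ℂ (Fock d A)}
    {u' S' : VertexOperator ℂ (Fock d B)} (hu : FieldIntertwines φ u u') (k : ℕ)
    (hS : FieldIntertwines φ S S') : FieldIntertwines φ (wick τ u k S) (wick τ' u' k S') :=
  fun n x => by
  rw [wick_ncoeff, wick_ncoeff, wickMode_apply, wickMode_apply]
  refine ((fockMap φ).toAddMonoidHom.map_finsum (wickTerm_finite τ u k S n x)).trans ?_
  refine finsum_congr fun j => ?_
  exact Intertwines.smul (((hu _).comp (hS _)).add
    ((hτ.comp ((hS _).comp (hτ.comp (hu _)))).smul _)) _ x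

lemma fieldIntertwines_list_prod {ι : Type*} (L : List ι)
    {F : ι → Module.End ℂ (VertexOperator ℂ (Fock d A))}
    {G : ι → Module.End ℂ (VertexOperator ℂ (Fock d B))}
    (h : ∀ (i : ι) S T, FieldIntertwines φ S T → FieldIntertwines φ (F i S) (G i T))
    {S : VertexOperator ℂ (Fock d A)} {T : VertexOperator ℂ (Fock d B)}
    (hST : FieldIntertwines φ S T) :
    FieldIntertwines φ ((L.map F).prod S) ((L.map G).prod T) := by
  induction L with
  | nil => exact hST
  | cons i L ih =>
    rw [List.map_cons, List.map_cons, List.prod_cons, List.prod_cons]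
    exact h i _ _ ih

lemma fieldIntertwines_stateField (hφ : PreservesPd φ) (a : Fock d A) :
    FieldIntertwines φ (stateField a) (stateField (fockMap φ a)) := by
  induction a using Finsupp.induction_linear with
  | zero => intro n x; simp
  | add a b ha hb => intro n x; simp [ha n x, hb n x]
  | single m f =>
    rw [fockMap_single, stateField, stateField, Finsupp.lsum_single, Finsupp.lsum_single]
    refine fieldIntertwines_list_prod _ (fun v S T h => fieldIntertwines_wick
      (intertwines_one φ) (fieldIntertwines_betaField hφ _) _ h) ?_
    refine fieldIntertwines_list_prod _ (fun v S T h => fieldIntertwines_wick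
      (intertwines_one φ) (fieldIntertwines_alphaField _) _ h) ?_
    refine fieldIntertwines_list_prod _ (fun v S T h => fieldIntertwines_wick
      (intertwines_parityOp φ) ?_ _ h) (fieldIntertwines_funField hφ f)
    split
    · exact fieldIntertwines_cField _
    · exact fieldIntertwines_bField _

/-- The map `𝒲 ⊗ A → 𝒲 ⊗ B` induced by a homomorphism that is compatible with the partial
derivatives preserves `n`-th products. -/
lemma fockMap_nprod (hφ : PreservesPd φ) (n : ℤ) (a b : Fock d A) :
    fockMap φ (VertexData.nprod n a b) = VertexData.nprod n (fockMap φ a) (fockMap φ b) :=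
  fieldIntertwines_stateField hφ a n b

end Map

/-! ## Germs of holomorphic functions -/

section Germs

/-- `ℂᵈ`. -/
abbrev Cn (d : ℕ) := EuclideanSpace ℂ (Fin d)

instance {α : Type*} (l : Filter α) : Algebra ℂ (Germ l ℂ) :=
  Algebra.ofModule
    (fun _ f g => Germ.inductionOn₂ f g fun _ _ => congrArg _ (funext fun _ => smul_mul_assoc ..))
    (fun _ f g => Germ.inductionOn₂ f g fun _ _ => congrArg _ (funext fun _ => mul_smul_comm ..))

variable {d : ℕ}

/-- The germs along `S ⊆ ℂᵈ` of holomorphic functions. -/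
def holSubalgebra (S : Set (Cn d)) : Subalgebra ℂ (Germ (𝓝ˢ S) ℂ) where
  carrier := {g | ∃ f : Cn d → ℂ, AnalyticOnNhd ℂ f S ∧ g = (f : Germ (𝓝ˢ S) ℂ)}
  mul_mem' := by
    rintro _ _ ⟨f, hf, rfl⟩ ⟨g, hg, rfl⟩
    exact ⟨f * g, hf.mul hg, rfl⟩
  add_mem' := by
    rintro _ _ ⟨f, hf, rfl⟩ ⟨g, hg, rfl⟩
    exact ⟨f + g, hf.add hg, rfl⟩
  algebraMap_mem' c := ⟨fun _ => c • 1, analyticOnNhd_const, rfl⟩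

/-- The algebra of germs along `S ⊆ ℂᵈ` of holomorphic functions. For open `S` these are the
holomorphic functions on `S`, and for `S = {x}` the elements of the stalk at `x`. -/
def Hol (S : Set (Cn d)) : Type := holSubalgebra S

instance (S : Set (Cn d)) : CommRing (Hol S) := inferInstanceAs (CommRing (holSubalgebra S))

instance (S : Set (Cn d)) : Algebra ℂ (Hol S) := inferInstanceAs (Algebra ℂ (holSubalgebra S))

/-- The partial derivative `∂f/∂γⁱ` of a function on `ℂᵈ`. -/
def partialDeriv (i : Fin d) (f : Cn d → ℂ) (x : Cn d) : ℂ :=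
  fderiv ℂ f x (EuclideanSpace.single i 1)

lemma partialDeriv_congr (S : Set (Cn d)) (i : Fin d) {f g : Cn d → ℂ} (h : f =ᶠ[𝓝ˢ S] g) :
    partialDeriv i f =ᶠ[𝓝ˢ S] partialDeriv i g := by
  filter_upwards [h.eventually_nhdsSet] with x hx
  rw [partialDeriv, partialDeriv, Filter.EventuallyEq.fderiv_eq hx]

lemma analyticOnNhd_partialDeriv {S : Set (Cn d)} (i : Fin d) {f : Cn d → ℂ}
    (hf : AnalyticOnNhd ℂ f S) : AnalyticOnNhd ℂ (partialDeriv i f) S := fun x hx =>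
  ((ContinuousLinearMap.apply ℂ ℂ (EuclideanSpace.single i (1 : ℂ))).analyticAt _).comp
    (hf x hx).fderiv

/-- The partial derivative of a germ of a holomorphic function. -/
def Hol.pdFun (S : Set (Cn d)) (i : Fin d) (g : Hol S) : Hol S :=
  ⟨Germ.map' (partialDeriv i) (fun _ _ h => partialDeriv_congr S i h) g.1, by
    obtain ⟨f, hf, e⟩ := g.2
    exact ⟨partialDeriv i f, analyticOnNhd_partialDeriv i hf, by rw [e]; rfl⟩⟩

lemma Hol.eventually_differentiableAt {S : Set (Cn d)} {f : Cn d → ℂ}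
    (hf : AnalyticOnNhd ℂ f S) : ∀ᶠ x in 𝓝ˢ S, DifferentiableAt ℂ f x :=
  eventually_nhdsSet_iff_forall.2 fun x hx =>
    (hf x hx).eventually_analyticAt.mono fun _ h => h.differentiableAt

instance (S : Set (Cn d)) : Partials d (Hol S) where
  pd i := Derivation.mk'
    { toFun := Hol.pdFun S i
      map_add' := by
        rintro ⟨_, f, hf, rfl⟩ ⟨_, g, hg, rfl⟩
        refine Subtype.ext (Germ.coe_eq.2 ?_)
        filter_upwards [Hol.eventually_differentiableAt hf, Hol.eventually_differentiableAt hg]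
          with x hfx hgx
        exact congrArg (fun L => L (EuclideanSpace.single i 1)) (fderiv_add hfx hgx)
      map_smul' := by
        rintro c ⟨_, f, hf, rfl⟩
        refine Subtype.ext (Germ.coe_eq.2 ?_)
        filter_upwards [Hol.eventually_differentiableAt hf] with x hfx
        exact congrArg (fun L => L (EuclideanSpace.single i 1)) (fderiv_const_smul hfx c) }
    (by
      rintro ⟨_, f, hf, rfl⟩ ⟨_, g, hg, rfl⟩
      refine Subtype.ext (Germ.coe_eq.2 ?_)
      filter_upwards [Hol.eventually_differentiableAt hf, Hol.eventually_differentiableAt hg]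
        with x hfx hgx
      exact congrArg (fun L => L (EuclideanSpace.single i 1)) (fderiv_mul hfx hgx))

/-- Restriction of germs along `S` to `T ⊆ S`. -/
def Hol.res {S T : Set (Cn d)} (h : T ⊆ S) : Hol S →ₐ[ℂ] Hol T where
  toFun g := ⟨g.1.compTendsto id (tendsto_id'.2 (nhdsSet_mono h)), by
    obtain ⟨f, hf, e⟩ := g.2
    exact ⟨f, hf.mono h, by rw [e]; rfl⟩⟩
  map_one' := rfl
  map_mul' := by
    rintro ⟨_, f, hf, rfl⟩ ⟨_, g, hg, rfl⟩
    rfl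
  map_zero' := rfl
  map_add' := by
    rintro ⟨_, f, hf, rfl⟩ ⟨_, g, hg, rfl⟩
    rfl
  commutes' _ := rfl

lemma Hol.preservesPd_res {S T : Set (Cn d)} (h : T ⊆ S) : PreservesPd (Hol.res h) := by
  rintro i ⟨_, f, hf, rfl⟩
  rfl

end Germs

/-! ## The chiral de Rham complex -/

section ChiralDeRham

variable {d : ℕ}

/-- The vertex algebra `Ω^ch(N) = 𝒲 ⊗_{ℂ[γ¹,…,γᵈ]} 𝒪(N)` for `N ⊆ ℂᵈ` open. -/
abbrev OmegaOn (N : Set (Cn d)) := Fock d (Hol N)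

/-- The stalk `Ω^ch_x = 𝒲 ⊗_{ℂ[γ¹,…,γᵈ]} 𝒪_x` at `x ∈ ℂᵈ`. -/
abbrev OmegaStalk (x : Cn d) := Fock d (Hol {x})

/-- The germ at `x ∈ N` of an element of `Ω^ch(N)`. -/
def germAt {N : Set (Cn d)} {x : Cn d} (hx : x ∈ N) : OmegaOn N →ₗ[ℂ] OmegaStalk x :=
  fockMap (Hol.res (Set.singleton_subset_iff.2 hx))

/-- The germ of a function at `x`. -/
abbrev funGerm (x : Cn d) (f : Cn d → ℂ) : Germ (𝓝ˢ ({x} : Set (Cn d))) ℂ := f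

/-- The entry `∂fⁱ/∂γʲ` of the Jacobian matrix of a map `f`. -/
def jac (f : Cn d → Cn d) (i j : Fin d) (z : Cn d) : ℂ :=
  fderiv ℂ f z (EuclideanSpace.single j 1) i

/-- The entry `(∂gʲ/∂γ̃ⁱ)(f(γ))` of the inverse of the Jacobian matrix of `f`, where `g` is the
inverse of `f`. -/
def invJac (f : Cn d → Cn d) (j i : Fin d) (z : Cn d) : ℂ :=
  (fderiv ℂ f z).inverse (EuclideanSpace.single i 1) j

/-- The normally ordered product `:ab: = a_(-1) b`. -/
abbrev wickProd {V : Type*} [AddCommGroup V] [Module ℂ V] [VertexData V] (a b : V) : V :=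
  VertexData.nprod (-1) a b

/-- The coordinate change equations on the strong generators, for a change of coordinates
`γ̃ = f(γ)` near `x`, with `y = f(x)`: `CoordGen f x y u v` says that `v` is one of the generators
`F`, `b̃ⁱ`, `c̃ⁱ`, `β̃ⁱ` of `Ω^ch_y` and that `u` is its expression in `Ω^ch_x`. -/
inductive CoordGen (f : Cn d → Cn d) (x y : Cn d) : OmegaStalk x → OmegaStalk y → Prop
  | func (F : Cn d → ℂ) (u : Hol {x}) (v : Hol {y}) (hv : v.1 = funGerm y F)
      (hu : u.1 = funGerm x (F ∘ f)) : CoordGen f x y (stF u) (stF v)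
  | b (i : Fin d) (G : Fin d → Hol {x}) (hG : ∀ j, (G j).1 = funGerm x (invJac f j i)) :
      CoordGen f x y (∑ j, wickProd (stF (G j)) (stB _ j)) (stB _ i)
  | c (i : Fin d) (J : Fin d → Hol {x}) (hJ : ∀ j, (J j).1 = funGerm x (jac f i j)) :
      CoordGen f x y (∑ j, wickProd (stF (J j)) (stC _ j)) (stC _ i)
  | beta (i : Fin d) (G : Fin d → Hol {x}) (hG : ∀ j, (G j).1 = funGerm x (invJac f j i)) :
      CoordGen f x y
        (∑ j, (wickProd (stF (G j)) (stBeta _ j) +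
          ∑ k, wickProd (wickProd (stF (pd k (G j))) (stC _ k)) (stB _ j)))
        (stBeta _ i)

/-- The coordinate change `Ω^ch_x ≅ Ω^ch_y` along `γ̃ = f(γ)`, `y = f(x)`, given by its graph. It is
the isomorphism of vertex algebras given on generators by the coordinate change equations, so its
graph is the vertex subalgebra of `Ω^ch_x × Ω^ch_y` generated by the pairs in `CoordGen`. -/
def coordChange (f : Cn d → Cn d) (x y : Cn d) : VertexSubalgebra (OmegaStalk x × OmegaStalk y) :=
  VertexSubalgebra.closure {w | CoordGen f x y w.1 w.2}

variable (d) in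
/-- A complex coordinate system on (an open subset of) a complex manifold `X`. -/
abbrev Chart (X : Type*) [TopologicalSpace X] [ChartedSpace (Cn d) X] :=
  {φ : OpenPartialHomeomorph X (Cn d) // φ ∈ IsManifold.maximalAtlas 𝓘(ℂ, Cn d) ω X}

variable (d) in
/-- Families of germs: for every coordinate system `φ` and point `x` in its domain, an element of
the stalk of `Ω^ch` at `φ(x)`. -/
abbrev GermFamily (X : Type*) [TopologicalSpace X] [ChartedSpace (Cn d) X] :=
  ∀ (φ : Chart d X) (x : φ.1.source), OmegaStalk (φ.1 x)

/-- A family of germs is locally given by elements of `Ω^ch(N) = 𝒲 ⊗ 𝒪(N)`, in every coordinate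
system. -/
def IsLocallyGiven {X : Type*} [TopologicalSpace X] [ChartedSpace (Cn d) X]
    (s : GermFamily d X) : Prop :=
  ∀ (φ : Chart d X) (x : φ.1.source), ∃ N : Set (Cn d), IsOpen N ∧ φ.1 x ∈ N ∧
    ∃ a : OmegaOn N, ∀ (y : φ.1.source) (hy : φ.1 y ∈ N), s φ y = germAt hy a

/-- In a family of germs, the germs at a point in two coordinate systems correspond to each other
under the change of coordinates. -/
def IsCompatible {X : Type*} [TopologicalSpace X] [ChartedSpace (Cn d) X]
    (s : GermFamily d X) : Prop :=
  ∀ (φ ψ : Chart d X) (x : X) (hφ : x ∈ φ.1.source) (hψ : x ∈ ψ.1.source),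
    (s φ ⟨x, hφ⟩, s ψ ⟨x, hψ⟩) ∈
      (coordChange (ψ.1 ∘ φ.1.symm) (φ.1 x) (ψ.1 x)).toSubmodule

lemma Hol.res_res {R S T : Set (Cn d)} (h : S ⊆ R) (h' : T ⊆ S) (f : Hol R) :
    Hol.res h' (Hol.res h f) = Hol.res (h'.trans h) f := by
  obtain ⟨_, f, hf, rfl⟩ := f
  rfl

lemma germAt_res {M N : Set (Cn d)} (h : M ⊆ N) {x : Cn d} (hx : x ∈ M) (a : OmegaOn N) :
    germAt hx (fockMap (Hol.res h) a) = germAt (h hx) a := by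
  induction a using Finsupp.induction_linear with
  | zero => simp
  | add a b ha hb => simp [ha, hb]
  | single m f =>
    simp only [germAt, fockMap_single, Hol.res_res]

lemma germAt_nprod {N : Set (Cn d)} {x : Cn d} (hx : x ∈ N) (n : ℤ) (a b : OmegaOn N) :
    germAt hx (VertexData.nprod n a b) = VertexData.nprod n (germAt hx a) (germAt hx b) :=
  fockMap_nprod (Hol.preservesPd_res _) n a b

lemma germAt_vac {N : Set (Cn d)} {x : Cn d} (hx : x ∈ N) :
    germAt hx (VertexData.vac : OmegaOn N) = VertexData.vac :=
  (fockMap_single _ _ _).trans (by rw [map_one]; rfl)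

section Sections

variable {X : Type*} [TopologicalSpace X] [ChartedSpace (Cn d) X]

lemma IsLocallyGiven.binary {s t u : GermFamily d X} (hs : IsLocallyGiven s)
    (ht : IsLocallyGiven t) (F : ∀ N : Set (Cn d), OmegaOn N → OmegaOn N → OmegaOn N)
    (hu : ∀ (φ : Chart d X) (y : φ.1.source) (N : Set (Cn d)) (hy : φ.1 y ∈ N)
      (a b : OmegaOn N), s φ y = germAt hy a → t φ y = germAt hy b →
      u φ y = germAt hy (F N a b)) : IsLocallyGiven u := by
  intro φ x
  obtain ⟨M, hM, hxM, a, ha⟩ := hs φ x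
  obtain ⟨N, hN, hxN, b, hb⟩ := ht φ x
  exact ⟨M ∩ N, hM.inter hN, ⟨hxM, hxN⟩, _, fun y hy => hu φ y (M ∩ N) hy
    (fockMap (Hol.res Set.inter_subset_left) a) (fockMap (Hol.res Set.inter_subset_right) b)
    ((ha y hy.1).trans (germAt_res _ hy a).symm) ((hb y hy.2).trans (germAt_res _ hy b).symm)⟩

lemma IsLocallyGiven.add {s t : GermFamily d X} (hs : IsLocallyGiven s)
    (ht : IsLocallyGiven t) : IsLocallyGiven (s + t) :=
  hs.binary ht (fun _ a b => a + b) fun φ y N hy a b ha hb => by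
    rw [map_add, ← ha, ← hb]; rfl

lemma IsLocallyGiven.smul {s : GermFamily d X} (hs : IsLocallyGiven s) (c : ℂ) :
    IsLocallyGiven (c • s) :=
  hs.binary hs (fun _ a _ => c • a) fun φ y N hy a b ha _ => by
    rw [map_smul, ← ha]; rfl

lemma IsLocallyGiven.nprod {s t : GermFamily d X} (hs : IsLocallyGiven s)
    (ht : IsLocallyGiven t) (n : ℤ) : IsLocallyGiven (VertexData.nprod n s t) :=
  hs.binary ht (fun _ a b => VertexData.nprod n a b) fun φ y N hy a b ha hb => by
    rw [germAt_nprod, ← ha, ← hb]; rfl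

lemma IsCompatible.nprod {s t : GermFamily d X} (hs : IsCompatible s)
    (ht : IsCompatible t) (n : ℤ) : IsCompatible (VertexData.nprod n s t) :=
  fun φ ψ x hφ hψ => by
    rw [nprod_pi, nprod_pi, nprod_pi, nprod_pi]
    exact VertexSubalgebra.nprod_mem_prod _ n (hs φ ψ x hφ hψ) (ht φ ψ x hφ hψ)

lemma isCompatible_vac : IsCompatible (VertexData.vac : GermFamily d X) :=
  fun φ ψ x _ _ => (coordChange (ψ.1 ∘ φ.1.symm) (φ.1 x) (ψ.1 x)).vac_mem'

lemma isLocallyGiven_zero : IsLocallyGiven (0 : GermFamily d X) := fun _ _ =>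
  ⟨Set.univ, isOpen_univ, Set.mem_univ _, 0, fun _ _ => (map_zero _).symm⟩

lemma isLocallyGiven_vac : IsLocallyGiven (VertexData.vac : GermFamily d X) := fun _ _ =>
  ⟨Set.univ, isOpen_univ, Set.mem_univ _, VertexData.vac, fun _ hy => (germAt_vac hy).symm⟩

end Sections

variable (d) in
/-- The vertex algebra `Γ(X, Ω^ch_X)` of global sections of the chiral de Rham complex of a complex
manifold `X` of dimension `d`. A section is a family of germs, one for each coordinate system and
each point in its domain, that is locally given by elements of `Ω^ch(N) = 𝒲 ⊗ 𝒪(N)` and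
compatible with the coordinate changes. The operations are those of the stalks. -/
def GlobalSections (X : Type*) [TopologicalSpace X] [ChartedSpace (Cn d) X] :
    VertexSubalgebra (GermFamily d X) where
  carrier := {s | IsLocallyGiven s ∧ IsCompatible s}
  zero_mem' := ⟨isLocallyGiven_zero, fun _ _ _ _ _ => Submodule.zero_mem _⟩
  add_mem' hs ht := ⟨hs.1.add ht.1, fun φ ψ x hφ hψ =>
    Submodule.add_mem _ (hs.2 φ ψ x hφ hψ) (ht.2 φ ψ x hφ hψ)⟩
  smul_mem' c _ hs := ⟨hs.1.smul c, fun φ ψ x hφ hψ =>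
    Submodule.smul_mem _ c (hs.2 φ ψ x hφ hψ)⟩
  vac_mem' := ⟨isLocallyGiven_vac, isCompatible_vac⟩
  nprod_mem' n _ _ hs ht := ⟨IsLocallyGiven.nprod hs.1 ht.1 n, IsCompatible.nprod hs.2 ht.2 n⟩

variable {X Y : Type*} [TopologicalSpace X] [ChartedSpace (Cn d) X]
  [TopologicalSpace Y] [ChartedSpace (Cn d) Y]

/-- `t` is the pullback `p^* s` of the section `s` along the local biholomorphism `p : Y → X`: at
every `y ∈ Y`, and for all coordinate systems `ψ` at `y` and `φ` at `p(y)`, the germ of `t` at `y`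
corresponds to the germ of `s` at `p(y)` under the coordinate change along `φ ∘ p ∘ ψ⁻¹`, the
expression of `p` in the coordinates. -/
def IsPullback (p : Y → X) (s : GlobalSections d X)
    (t : GlobalSections d Y) : Prop :=
  ∀ (ψ : Chart d Y) (φ : Chart d X) (y : Y) (hψ : y ∈ ψ.1.source) (hφ : p y ∈ φ.1.source),
    (t.1 ψ ⟨y, hψ⟩, s.1 φ ⟨p y, hφ⟩) ∈
      (coordChange (φ.1 ∘ p ∘ ψ.1.symm) (ψ.1 y) (φ.1 (p y))).toSubmodule

/-- The covering transformation group `G(Y, p)` of a covering map `p : Y → X`. -/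
def deckGroup {X Y : Type*} [TopologicalSpace Y] (p : Y → X) : Subgroup (Y ≃ₜ Y) where
  carrier := {g | ∀ y, p (g y) = p y}
  one_mem' _ := rfl
  mul_mem' {_ h} hg hh y := (hg (h y)).trans (hh y)
  inv_mem' {g} hg y := (hg (g.symm y)).symm.trans (congrArg p (g.apply_symm_apply y))

/-- The invariant subalgebra `Γ(Y, Ω^ch_Y)^{G(Y,p)}`: the sections `t` with `ρ(g)^* t = t` for all
covering transformations `g`. -/
def invariantSections (p : Y → X) : VertexSubalgebra (GlobalSections d Y) where
  carrier := {t | ∀ g ∈ deckGroup p, IsPullback g t t}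
  zero_mem' _ _ _ _ _ _ _ := Submodule.zero_mem _
  add_mem' hs ht g hg ψ φ y hψ hφ :=
    Submodule.add_mem _ (hs g hg ψ φ y hψ hφ) (ht g hg ψ φ y hψ hφ)
  smul_mem' c _ hs g hg ψ φ y hψ hφ := Submodule.smul_mem _ c (hs g hg ψ φ y hψ hφ)
  vac_mem' _ _ _ _ _ _ _ := VertexSubalgebra.vac_mem' _
  nprod_mem' n _ _ hs ht g hg ψ φ y hψ hφ := by
    rw [VertexSubalgebra.nprod_val, nprod_pi, nprod_pi, nprod_pi, nprod_pi]
    exact VertexSubalgebra.nprod_mem_prod _ n (hs g hg ψ φ y hψ hφ) (ht g hg ψ φ y hψ hφ)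

end ChiralDeRham

end

end ChiralDeRham

open Set Filter
open scoped Manifold ContDiff Topology VertexOperator
namespace ChiralDeRham
noncomputable section

set_option linter.unusedSectionVars false
set_option linter.unusedVariables false

open Partials (pd)

/-! ## Formal distributions in two variables -/

section Distributions

variable {M M' : Type*} [AddCommGroup M] [Module ℂ M] [AddCommGroup M'] [Module ℂ M']

/-! The geometric part is descent along `p`. Since `p` is locally biholomorphic, it identifies the
stalk at `y` with the stalk at `p y`, and pulling back means transporting germs. A pullback is
invariant because `p ∘ g = p` for every covering transformation `g`. Conversely, if `t` is
invariant, transitivity on the fibres makes the germs of `t` at all points over `x` correspond to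
one germ at `x`, and the local inverses of `p` show that these germs are locally given by sections
(`exists_isPullback`). Surjectivity of `p` gives injectivity of the pullback. Vacuum, products and
parity are tested on germs, so they are preserved.

The work lies in the word "correspond". `coordChange` is only a relation, the vertex subalgebra
generated by the pairs of corresponding generators. The argument needs it to be the graph of a
homomorphism of vertex algebras (`IsLB.mem_coordChange`) that is functorial in the map
(`IsLB.map_map`). In other words, the transformed generators must satisfy the same operator product
expansions as the original ones, and the transformation formulas must compose.

This requires the vertex algebra calculus of `𝒲 ⊗ A`, where the state-field map is given by iterated
normally ordered products. Mutual locality of the generating fields follows from their mode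
commutators. Dong's lemma (`Loc.resProd`, `Loc.wick`) carries locality over to products of fields.
Goddard's uniqueness theorem (`IsHomField.ext`) says that a creative, translation covariant field
that is local with respect to the generators is determined by its state. Together these give
Borcherds' commutator formula (`exists_commutator_formula`) and identify the field of `a_(-k-1) b`
with a normally ordered product (`stateField_nprod_negSucc`).

A homomorphism out of `𝒲 ⊗ B` is then the same as a system of states with the right commutation
relations (`FreeSystem.map_nprod`). For a change of coordinates these relations are organised by the
chiral de Rham differential `Q`, the zero mode of `∑ βⁱ cⁱ`. It is an odd derivation with `Q² = 0`,
`Q b = β` and `Q f = ∑ cⁱ ∂f/∂γⁱ`. Define `b̃` by the inverse Jacobian and put `β̃ = Q b̃`, `c̃ = Q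
γ̃`, `α̃ = ∂γ̃`. Most relations involving `β̃` and `c̃` then follow from simpler ones by applying
`Q`. The one essential computation, the regularity of the expansion of `b̃ⁱ` with `β̃ʲ`
(`Coords.stateB_diffOp_stateB`), comes down to the fact that coordinate vector fields commute. The
explicit formula for `β̃` with its `bc` correction is exactly `Q b̃` written with normally ordered
products (`Coords.diffOp_stateB_eq_wickProd`). Finally, the homomorphisms commute with `Q`, so they
are determined by their values on functions and on `b`; functoriality thereby reduces to the
multiplicativity of inverse Jacobians. -/

/-- Multiplication of a formal distribution `∑ F l m z^(-l-1) w^(-m-1)` by `z - w`. -/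
def dzw : Module.End ℂ (ℤ → ℤ → M) where
  toFun F l m := F (l + 1) m - F l (m + 1)
  map_add' F G := by ext l m; simp; abel
  map_smul' c F := by ext l m; simp [smul_sub]

lemma dzw_apply (F : ℤ → ℤ → M) (l m : ℤ) : dzw F l m = F (l + 1) m - F l (m + 1) := rfl

lemma dzw_pow_succ (n : ℕ) (F : ℤ → ℤ → M) : (dzw ^ (n + 1)) F = (dzw ^ n) (dzw F) := by
  rw [pow_succ]; rfl

lemma dzw_pow_succ' (n : ℕ) (F : ℤ → ℤ → M) : (dzw ^ (n + 1)) F = dzw ((dzw ^ n) F) := by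
  rw [pow_succ']; rfl

lemma dzw_pow_map (L : M →ₗ[ℂ] M') (n : ℕ) (F : ℤ → ℤ → M) (l m : ℤ) :
    (dzw ^ n) (fun l m => L (F l m)) l m = L ((dzw ^ n) F l m) := by
  induction n generalizing l m with
  | zero => rfl
  | succ n ih => rw [dzw_pow_succ', dzw_pow_succ', dzw_apply, dzw_apply, ih, ih, map_sub]

lemma dzw_pow_flip (n : ℕ) (F : ℤ → ℤ → M) (l m : ℤ) :
    (dzw ^ n) (fun l m => F m l) l m = (-1 : ℂ) ^ n • (dzw ^ n) F m l := by
  induction n generalizing l m with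
  | zero => simp
  | succ n ih =>
    rw [dzw_pow_succ', dzw_pow_succ', dzw_apply, dzw_apply, ih, ih, ← smul_sub, pow_succ,
      mul_smul, neg_one_smul, neg_sub]

lemma dzw_pow_eq_zero_of_le {n n' : ℕ} (h : n ≤ n') {F : ℤ → ℤ → M} (hF : (dzw ^ n) F = 0) :
    (dzw ^ n') F = 0 := by
  obtain ⟨k, rfl⟩ := Nat.exists_eq_add_of_le' h
  rw [pow_add, Module.End.mul_apply, hF, map_zero]

/-- The formal distribution involves only finitely many negative powers of `w`. -/
def Trunc (F : ℤ → ℤ → M) : Prop := ∃ N, ∀ l m, N ≤ m → F l m = 0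

lemma Trunc.dzw {F : ℤ → ℤ → M} (h : Trunc F) : Trunc (dzw F) := by
  obtain ⟨N, hN⟩ := h
  exact ⟨N, fun l m hm => by rw [dzw_apply, hN _ _ hm, hN _ _ (by lia), sub_zero]⟩

lemma Trunc.sub {F G : ℤ → ℤ → M} (h : Trunc F) (h' : Trunc G) : Trunc (F - G) := by
  obtain ⟨N, hN⟩ := h
  obtain ⟨N', hN'⟩ := h'
  exact ⟨max N N', fun l m hm => by
    rw [Pi.sub_apply, Pi.sub_apply, hN _ _ (by lia), hN' _ _ (by lia), sub_zero]⟩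

/-- The equation `(z - w) F = 0` makes the coefficients constant along the antidiagonals `l + m =
const`, and each antidiagonal meets the range where truncation forces zero. Truncation is essential:
`z - w` kills the delta distribution. -/
lemma Trunc.eq_zero_of_dzw {F : ℤ → ℤ → M} (h : Trunc F) (h0 : ChiralDeRham.dzw F = 0) :
    F = 0 := by
  obtain ⟨N, hN⟩ := h
  have key : ∀ (k : ℕ) (l m : ℤ), N - k ≤ m → F l m = 0 := by
    intro k
    induction k with
    | zero => intro l m hm; exact hN l m (by simpa using hm)
    | succ k ih =>
      intro l m hm
      have := congrFun (congrFun h0 (l - 1)) m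
      rw [dzw_apply, ih _ (m + 1) (by push_cast at hm; lia), sub_zero, sub_add_cancel] at this
      exact this
  ext l m
  exact key (N - m).toNat l m (by lia)

/-- This cancellation is the standard tool below: an identity between expanded products is
multiplied by a power of `z - w`, checked there, and divided again. -/
lemma Trunc.eq_zero {F : ℤ → ℤ → M} (h : Trunc F) {n : ℕ}
    (h0 : (ChiralDeRham.dzw ^ n) F = 0) : F = 0 := by
  induction n generalizing F with
  | zero => exact h0
  | succ n ih => exact h.eq_zero_of_dzw (ih h.dzw (by rwa [← dzw_pow_succ]))

lemma finsum_nat_succ {f : ℕ → M} (hf : f.HasFiniteSupport) :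
    ∑ᶠ j, f j = f 0 + ∑ᶠ j, f (j + 1) := by
  obtain ⟨N, hN⟩ := Set.Finite.bddAbove hf
  have h0 : ∀ j, N < j → f j = 0 := fun j hj => by
    by_contra h
    exact absurd (hN h) (by simpa using hj)
  rw [finsum_eq_sum_of_support_subset (s := Finset.range (N + 1)) f (fun j hj => by
      simpa [Nat.lt_succ_iff] using hN hj),
    finsum_eq_sum_of_support_subset (s := Finset.range N) (fun j => f (j + 1)) (fun j hj => by
      have := hN (show j + 1 ∈ f.support from hj)
      simpa using this), Finset.sum_range_succ', add_comm]

/-- The product of `F` and the expansion of `(z - w)^(-k-1)` in `|z| > |w|`. -/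
def expand (k : ℕ) (F : ℤ → ℤ → M) (l m : ℤ) : M :=
  ∑ᶠ j : ℕ, ((k + j).choose j : ℂ) • F (l - (k + 1) - j) (m + j)

lemma Trunc.finite {F : ℤ → ℤ → M} (h : Trunc F) (k : ℕ) (l m : ℤ) :
    Function.HasFiniteSupport fun j : ℕ =>
      ((k + j).choose j : ℂ) • F (l - (k + 1) - j) (m + j) := by
  obtain ⟨N, hN⟩ := h
  refine (Set.finite_Iio (N - m).toNat).subset fun j hj => ?_
  by_contra h
  refine hj ?_
  have h' : (N - m).toNat ≤ j := by simpa using h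
  simp only
  rw [hN _ _ (by lia), smul_zero]

lemma Trunc.expand {F : ℤ → ℤ → M} (h : Trunc F) (k : ℕ) : Trunc (expand k F) := by
  obtain ⟨N, hN⟩ := h
  refine ⟨N, fun l m hm => finsum_eq_zero_of_forall_eq_zero fun j => ?_⟩
  rw [hN _ _ (by lia), smul_zero]

lemma dzw_expand_zero {F : ℤ → ℤ → M} (h : Trunc F) : dzw (expand 0 F) = F := by
  ext l m
  rw [dzw_apply, expand, expand, finsum_nat_succ (h.finite 0 (l + 1) m)]
  simp only [zero_add, Nat.choose_self, Nat.cast_one, one_smul]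
  rw [add_sub_assoc]
  have : ∀ j : ℕ, F (l + 1 - (((0 : ℕ) : ℤ) + 1) - ((j + 1 : ℕ) : ℤ)) (m + ((j + 1 : ℕ) : ℤ)) =
      F (l - (((0 : ℕ) : ℤ) + 1) - j) (m + 1 + j) := fun j => by
    congr 1 <;> push_cast <;> ring
  simp only [this]
  simp

/-- Pascal's rule for the binomial coefficients of `(z - w)^(-k-2)`. -/
lemma dzw_expand_succ {F : ℤ → ℤ → M} (h : Trunc F) (k : ℕ) :
    dzw (expand (k + 1) F) = expand k F := by
  ext l m
  rw [dzw_apply, expand, expand, expand, finsum_nat_succ (h.finite (k + 1) (l + 1) m),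
    finsum_nat_succ (h.finite k l m), add_sub_assoc, ← finsum_sub_distrib]
  · congr 1
    · simp
    · refine finsum_congr fun j => ?_
      have e1 : l + 1 - (((k + 1 : ℕ) : ℤ) + 1) - ((j + 1 : ℕ) : ℤ) =
        l - ((k : ℤ) + 1) - ((j + 1 : ℕ) : ℤ) := by push_cast; ring
      have e2 : l - (((k + 1 : ℕ) : ℤ) + 1) - (j : ℤ) =
        l - ((k : ℤ) + 1) - ((j + 1 : ℕ) : ℤ) := by push_cast; ring
      have e3 : m + 1 + (j : ℤ) = m + ((j + 1 : ℕ) : ℤ) := by push_cast; ring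
      rw [e1, e2, e3, ← sub_smul]
      congr 1
      have : (k + 1 + (j + 1)).choose (j + 1) = (k + 1 + j).choose j +
        (k + (j + 1)).choose (j + 1) := by
        rw [show k + 1 + (j + 1) = (k + 1 + j) + 1 by ring, Nat.choose_succ_succ]
        congr 2
        ring
      rw [this]
      push_cast
      ring
  · have := (h.finite (k + 1) (l + 1) m)
    exact this.preimage (f := fun j => j + 1) (add_left_injective 1).injOn
  · exact h.finite (k + 1) l (m + 1)

lemma dzw_pow_expand {F : ℤ → ℤ → M} (h : Trunc F) (k : ℕ) :
    (dzw ^ (k + 1)) (expand k F) = F := by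
  induction k with
  | zero => simpa using dzw_expand_zero h
  | succ k ih => rw [dzw_pow_succ, dzw_expand_succ h, ih]

/-- A formal distribution killed by `(z - w)^N` is a combination of derivatives of the delta
distribution. -/
lemma eq_sum_of_dzw_pow_eq_zero {N : ℕ} {F : ℤ → ℤ → M} (h : (dzw ^ N) F = 0) (l m : ℤ) :
    F l m = ∑ j ∈ Finset.range N,
      ((Ring.choose l j : ℤ) : ℂ) • (dzw ^ j) F 0 (l + m - j) := by
  induction N generalizing F l m with
  | zero => simpa using congrFun (congrFun h l) m
  | succ N ih =>
    have h' := fun l m => ih (F := dzw F) (by rwa [← dzw_pow_succ]) l m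
    -- `S` is the claimed right-hand side. It agrees with `F` at `l = 0`, where only `j = 0`
    -- contributes, and `(z - w) S = (z - w) F` by Pascal's rule and the induction hypothesis. So `F
    -- - S` is constant along antidiagonals and vanishes at `l = 0`, hence everywhere.
    set S : ℤ → ℤ → M := fun l m => ∑ j ∈ Finset.range (N + 1),
      ((Ring.choose l j : ℤ) : ℂ) • (dzw ^ j) F 0 (l + m - j) with hS
    have hS0 : ∀ m, S 0 m = F 0 m := fun m => by
      simp only [hS]
      rw [Finset.sum_range_succ']
      simp [Ring.choose_zero_succ]
    have hdS : dzw S = dzw F := by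
      ext l m
      rw [h', dzw_apply]
      simp only [hS]
      rw [← Finset.sum_sub_distrib, Finset.sum_range_succ']
      simp only [Ring.choose_zero_right, dzw_pow_succ]
      rw [show l + 1 + m - ((0 : ℕ) : ℤ) = l + (m + 1) - ((0 : ℕ) : ℤ) by ring, sub_self, add_zero]
      refine Finset.sum_congr rfl fun j _ => ?_
      rw [show l + 1 + m - ((j + 1 : ℕ) : ℤ) = l + m - j by push_cast; ring,
        show l + (m + 1) - ((j + 1 : ℕ) : ℤ) = l + m - j by push_cast; ring, ← sub_smul,
        Ring.choose_succ_succ]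
      congr 1
      push_cast
      ring
    have hU : ∀ l m, F (l + 1) m - S (l + 1) m = F l (m + 1) - S l (m + 1) := fun l m => by
      have := congrFun (congrFun hdS l) m
      rw [dzw_apply, dzw_apply] at this
      rw [sub_eq_sub_iff_sub_eq_sub, ← this]
    have key : ∀ l m, F l m - S l m = 0 := by
      intro l
      induction l using Int.induction_on with
      | zero => intro m; rw [hS0, sub_self]
      | succ i hi => intro m; rw [hU, hi]
      | pred i hi =>
        intro m
        have := hU (-(i : ℤ) - 1) (m - 1)
        rw [sub_add_cancel, sub_add_cancel] at this
        rw [← this, hi]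
    exact sub_eq_zero.1 (key l m)

/-- The derivation `∂_z + ∂_w` of formal distributions. -/
def dsum (F : ℤ → ℤ → M) (l m : ℤ) : M :=
  -((l : ℂ) • F (l - 1) m) - (m : ℂ) • F l (m - 1)

/-- The derivation `∂_z + ∂_w` kills `z - w`, so it commutes with multiplication by it. -/
lemma dzw_dsum (F : ℤ → ℤ → M) : dzw (dsum F) = dsum (dzw F) := by
  ext l m
  simp only [dzw_apply, dsum]
  rw [show l + 1 - 1 = l - 1 + 1 by ring, show m + 1 - 1 = m - 1 + 1 by ring]
  simp only [sub_add_cancel]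
  push_cast
  module

lemma dzw_pow_dsum (n : ℕ) (F : ℤ → ℤ → M) : (dzw ^ n) (dsum F) = dsum ((dzw ^ n) F) := by
  induction n with
  | zero => rfl
  | succ n ih => rw [dzw_pow_succ', dzw_pow_succ', ih, dzw_dsum]

lemma Trunc.dsum {F : ℤ → ℤ → M} (h : Trunc F) : Trunc (dsum F) := by
  obtain ⟨N, hN⟩ := h
  exact ⟨N + 1, fun l m hm => by
    rw [ChiralDeRham.dsum, hN _ _ (by lia), hN _ _ (by lia)]; simp⟩

lemma Trunc.map {F : ℤ → ℤ → M} (h : Trunc F) (L : M →ₗ[ℂ] M') :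
    Trunc fun l m => L (F l m) := by
  obtain ⟨N, hN⟩ := h
  exact ⟨N, fun l m hm => by simp only [hN l m hm, map_zero]⟩

end Distributions

/-! ## Locality of fields and Dong's lemma -/

section Locality

variable {V : Type*} [AddCommGroup V] [Module ℂ V]

lemma field_ext {A B : VertexOperator ℂ V} (h : ∀ n : ℤ, (A[[n]]) = (B[[n]])) : A = B :=
  HVertexOperator.coeff_inj (funext fun n => by
    rw [VertexOperator.coeff_eq_ncoeff, VertexOperator.coeff_eq_ncoeff, h])

/-- The commutator `[A(z), B(w)] = A(z)B(w) - s B(w)A(z)` with sign `s`. -/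
def fcomm (s : ℂ) (A B : VertexOperator ℂ V) (l m : ℤ) : Module.End ℂ V :=
  (A[[l]]) * (B[[m]]) - s • ((B[[m]]) * (A[[l]]))

lemma fcomm_apply (s : ℂ) (A B : VertexOperator ℂ V) (l m : ℤ) (x : V) :
    fcomm s A B l m x = (A[[l]]) ((B[[m]]) x) - s • (B[[m]]) ((A[[l]]) x) := rfl

/-- Two fields are mutually local: `(z - w)^N (A(z)B(w) - s B(w)A(z)) = 0` for some `N`. -/
def Loc (s : ℂ) (A B : VertexOperator ℂ V) : Prop := ∃ N : ℕ, (dzw ^ N) (fcomm s A B) = 0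

lemma Loc.symm {s : ℂ} (hs : s * s = 1) {A B : VertexOperator ℂ V} (h : Loc s A B) :
    Loc s B A := by
  obtain ⟨N, hN⟩ := h
  refine ⟨N, ?_⟩
  have : fcomm s B A = -(s • fun l m => fcomm s A B m l) := by
    ext l m x
    simp only [Pi.neg_apply, Pi.smul_apply, LinearMap.neg_apply, LinearMap.smul_apply,
      fcomm_apply, smul_sub, smul_smul, hs]
    simp
  rw [this, map_neg, map_smul]
  have h0 : (dzw ^ N) (fun l m => fcomm s A B m l) = 0 := by
    ext l m x
    rw [dzw_pow_flip, hN]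
    simp
  rw [h0, smul_zero, neg_zero]

lemma loc_zero (s : ℂ) (A : VertexOperator ℂ V) : Loc s A 0 := ⟨0, by
  ext l m x
  simp [fcomm_apply]⟩

lemma Loc.add {s : ℂ} {A B C : VertexOperator ℂ V} (h : Loc s A B) (h' : Loc s A C) :
    Loc s A (B + C) := by
  obtain ⟨N, hN⟩ := h
  obtain ⟨N', hN'⟩ := h'
  refine ⟨max N N', ?_⟩
  have : fcomm s A (B + C) = fcomm s A B + fcomm s A C := by
    ext l m x
    simp only [Pi.add_apply, LinearMap.add_apply, fcomm_apply, map_add, smul_add]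
    abel
  rw [this, map_add, dzw_pow_eq_zero_of_le (le_max_left _ _) hN,
    dzw_pow_eq_zero_of_le (le_max_right _ _) hN', add_zero]

lemma Loc.smul {s : ℂ} {A B : VertexOperator ℂ V} (h : Loc s A B) (c : ℂ) :
    Loc s A (c • B) := by
  obtain ⟨N, hN⟩ := h
  refine ⟨N, ?_⟩
  have : fcomm s A (c • B) = c • fcomm s A B := by
    ext l m x
    simp only [Pi.smul_apply, LinearMap.smul_apply, fcomm_apply, map_smul, smul_sub, smul_comm c]
  rw [this, map_smul, hN, smul_zero]

lemma loc_sub {s : ℂ} {A B C : VertexOperator ℂ V} (h : Loc s A B) (h' : Loc s A C) :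
    Loc s A (B - C) := by
  rw [sub_eq_add_neg, ← neg_one_smul ℂ C]
  exact h.add (h'.smul _)

/-- The bound depends on `l`, because `B` also acts on `A_(l) x`. Its case `l = 0` is the field
condition needed to define `resProd`. -/
lemma exists_dzw_pow_fcomm_eq_zero (s : ℂ) (A B : VertexOperator ℂ V) (n : ℕ) (l : ℤ) (x : V) :
    ∃ N : ℤ, ∀ m, N ≤ m → (dzw ^ n) (fcomm s A B) l m x = 0 := by
  induction n generalizing l with
  | zero =>
    obtain ⟨N, hN⟩ := exists_ncoeff_eq_zero B x
    obtain ⟨N', hN'⟩ := exists_ncoeff_eq_zero B ((A[[l]]) x)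
    refine ⟨max N N', fun m hm => ?_⟩
    rw [pow_zero, Module.End.one_apply, fcomm_apply, hN _ (by lia), hN' _ (by lia)]
    simp
  | succ n ih =>
    obtain ⟨N, hN⟩ := ih (l + 1)
    obtain ⟨N', hN'⟩ := ih l
    refine ⟨max N N', fun m hm => ?_⟩
    rw [dzw_pow_succ', dzw_apply, LinearMap.sub_apply, hN _ (by lia), hN' _ (by lia), sub_zero]

/-- The `n`-th product `A(w)_(n) B(w)` of fields for `n ≥ 0`, the residue in `z` of
`(z - w)^n [A(z), B(w)]`. -/
def resProd (s : ℂ) (n : ℕ) (A B : VertexOperator ℂ V) : VertexOperator ℂ V :=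
  fieldOfModes (fun m => (dzw ^ n) (fcomm s A B) 0 m)
    (exists_dzw_pow_fcomm_eq_zero s A B n 0)

@[simp] lemma resProd_ncoeff (s : ℂ) (n : ℕ) (A B : VertexOperator ℂ V) (m : ℤ) :
    (resProd s n A B)[[m]] = (dzw ^ n) (fcomm s A B) 0 m :=
  fieldOfModes_ncoeff _ (exists_dzw_pow_fcomm_eq_zero s A B n 0) m

/-- Borcherds' commutator formula for local fields. -/
lemma fcomm_eq_sum {s : ℂ} {A B : VertexOperator ℂ V} {N : ℕ}
    (h : (dzw ^ N) (fcomm s A B) = 0) (l m : ℤ) :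
    fcomm s A B l m = ∑ j ∈ Finset.range N,
      ((Ring.choose l j : ℤ) : ℂ) • ((resProd s j A B)[[l + m - j]]) := by
  simp only [resProd_ncoeff]
  exact eq_sum_of_dzw_pow_eq_zero h l m

lemma trunc_modes (A B : VertexOperator ℂ V) (x : V) :
    Trunc fun l m => (A[[l]]) ((B[[m]]) x) := by
  obtain ⟨N, hN⟩ := exists_ncoeff_eq_zero B x
  exact ⟨N, fun l m hm => by simp only [hN m hm, map_zero]⟩

/-- The product of `[A(z), B(w)] x` and `(z - w)^(-k-1)`, suitably expanded. Its residue in `z` is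
the normally ordered product. -/
def wickKer (s : ℂ) (A : VertexOperator ℂ V) (k : ℕ) (B : VertexOperator ℂ V) (x : V)
    (l m : ℤ) : V :=
  expand k (fun l m => (A[[l]]) ((B[[m]]) x)) l m +
    ((-1) ^ k * s) • expand k (fun l m => (B[[l]]) ((A[[m]]) x)) m l

/-- When `B` is homogeneous, conjugation by `τ` is the scalar `s`. The normally ordered product then
becomes the residue in `z` of a two-variable distribution, to which multiplication by `z - w` can be
applied. -/
lemma wickMode_eq_wickKer {τ : Module.End ℂ V} {s : ℂ} (A : VertexOperator ℂ V) (k : ℕ)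
    {B : VertexOperator ℂ V} (hτ : ∀ n : ℤ, τ ∘ₗ (B[[n]]) ∘ₗ τ = s • (B[[n]])) (m : ℤ) (x : V) :
    wickMode τ A k B m x = wickKer s A k B x 0 m := by
  rw [wickMode_apply, wickKer, expand, expand, smul_finsum, ← finsum_add_distrib]
  · refine finsum_congr fun j => ?_
    have h := LinearMap.congr_fun (hτ (m - (k + 1) - j)) ((A[[(j : ℤ)]]) x)
    simp only [LinearMap.comp_apply, LinearMap.smul_apply] at h
    simp only [wickTerm, LinearMap.smul_apply, LinearMap.add_apply, LinearMap.comp_apply, h,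
      zero_sub, zero_add, smul_add, mul_smul]
    congr 1
    rw [smul_comm _ (s), smul_comm (((k + j).choose j : ℂ)), smul_comm (((k + j).choose j : ℂ))]
    exact smul_comm _ _ _
  · exact (trunc_modes A B x).finite k 0 m
  · exact ((trunc_modes B A x).finite k m 0).subset fun j hj h => hj (by
      simp only at h ⊢
      rw [h, smul_zero])

/-- The two halves of `wickKer` contain the expansions of the same rational function in `|z| > |w|`
and in `|w| > |z|`; multiplication by `(z - w)^(k+1)` clears both denominators. -/
lemma dzw_pow_wickKer (s : ℂ) (A : VertexOperator ℂ V) (k : ℕ) (B : VertexOperator ℂ V) (x : V) :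
    (dzw ^ (k + 1)) (wickKer s A k B x) = fun l m => fcomm s A B l m x := by
  have : wickKer s A k B x = expand k (fun l m => (A[[l]]) ((B[[m]]) x)) +
      ((-1) ^ k * s) • fun l m => expand k (fun l m => (B[[l]]) ((A[[m]]) x)) m l := rfl
  rw [this, map_add, map_smul, dzw_pow_expand (trunc_modes A B x)]
  ext l m
  simp only [Pi.add_apply, Pi.smul_apply]
  rw [dzw_pow_flip, dzw_pow_expand (trunc_modes B A x), fcomm_apply, smul_smul, sub_eq_add_neg,
    ← neg_smul]
  congr 2
  -- The factor `(-1)^k` of `wickKer` meets `(-1)^(k+1)` from exchanging the variables, which leaves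
  -- the sign of the commutator.
  have : (-1 : ℂ) ^ k * (-1) ^ k = 1 := by rw [← mul_pow]; simp
  rw [pow_succ]
  linear_combination -s * this

/-- Every term of the binomial expansion contains `a` to a power at least `N` or `b` to a power at
least `K`. -/
lemma End.add_pow_apply_eq_zero {W : Type*} [AddCommGroup W] [Module ℂ W] {a b : Module.End ℂ W}
    (h : Commute a b) {N K : ℕ} {x : W} (ha : (a ^ N) x = 0) (hb : (b ^ K) x = 0) :
    ((a + b) ^ (N + K)) x = 0 := by
  rw [h.add_pow, LinearMap.sum_apply]
  refine Finset.sum_eq_zero fun i hi => ?_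
  rw [← Nat.cast_comm, Module.End.mul_apply]
  suffices (a ^ i * b ^ (N + K - i)) x = 0 by rw [this, map_zero]
  by_cases hN : N ≤ i
  · rw [(h.pow_pow _ _).eq, ← Nat.sub_add_cancel hN, pow_add, Module.End.mul_apply,
      Module.End.mul_apply, ha, map_zero, map_zero]
  · rw [show N + K - i = (N - i) + K by lia, pow_add, Module.End.mul_apply,
      Module.End.mul_apply, hb, map_zero, map_zero]

/-- Multiplication of a formal distribution in `z, w, t` by `z - t`. -/
def dzt : Module.End ℂ (ℤ → ℤ → ℤ → V) where
  toFun F l m n := F (l + 1) m n - F l m (n + 1)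
  map_add' F G := by ext l m; simp; abel
  map_smul' c F := by ext l m; simp [smul_sub]

/-- Multiplication of a formal distribution in `z, w, t` by `w - t`. -/
def dwt : Module.End ℂ (ℤ → ℤ → ℤ → V) where
  toFun F l := dzw (F l)
  map_add' F G := by ext l m; simp
  map_smul' c F := by ext l m; simp

lemma dzt_pow_apply (N : ℕ) (F : ℤ → ℤ → ℤ → V) (l m n : ℤ) :
    (dzt ^ N) F l m n = (dzw ^ N) (fun l n => F l m n) l n := by
  induction N generalizing F with
  | zero => rfl
  | succ N ih => rw [pow_succ, pow_succ, Module.End.mul_apply, ih]; rfl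

lemma dwt_pow_apply (N : ℕ) (F : ℤ → ℤ → ℤ → V) (l : ℤ) :
    (dwt ^ N) F l = (dzw ^ N) (F l) := by
  induction N generalizing F with
  | zero => rfl
  | succ N ih => rw [pow_succ, pow_succ, Module.End.mul_apply, ih]; rfl

lemma dzw_pow_apply (N : ℕ) (F : ℤ → ℤ → ℤ → V) (l m n : ℤ) :
    (dzw ^ N) F l m n = (dzw ^ N) (fun l m => F l m n) l m :=
  (dzw_pow_map (LinearMap.proj (R := ℂ) (φ := fun _ : ℤ => V) n) N F l m).symm

lemma dwt_eq : (dwt : Module.End ℂ (ℤ → ℤ → ℤ → V)) =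
    dzt + (-1 : ℂ) • dzw (M := ℤ → V) := by
  ext F l m n
  simp [dwt, dzt, dzw_apply]

lemma commute_dzt_dzw : Commute (dzt : Module.End ℂ (ℤ → ℤ → ℤ → V)) (dzw (M := ℤ → V)) := by
  ext F l m n
  simp [dzt, dzw_apply]
  abel

lemma commute_dwt_dzw : Commute (dwt : Module.End ℂ (ℤ → ℤ → ℤ → V)) (dzw (M := ℤ → V)) := by
  rw [dwt_eq]
  exact commute_dzt_dzw.add_left ((Commute.refl _).smul_left _)

lemma commute_dzt_dwt : Commute (dzt : Module.End ℂ (ℤ → ℤ → ℤ → V)) dwt := by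
  rw [dwt_eq]
  exact (Commute.refl _).add_right (commute_dzt_dzw.smul_right _)

/-- The core of Dong's argument. As `w - t = (z - t) - (z - w)`, every term of `(w - t)^(N+K)`
contains `(z - t)^N` or `(z - w)^K`. The additional factor `(w - t)^N` makes `h'` applicable to the
terms of the first kind. -/
lemma dwt_pow_eq_zero {E : ℤ → ℤ → ℤ → V} {K N : ℕ} (h : (dzw ^ K) E = 0)
    (h' : (dzt ^ N) ((dwt ^ N) E) = 0) : (dwt ^ (N + K + N)) E = 0 := by
  rw [pow_add, Module.End.mul_apply]
  nth_rewrite 1 [dwt_eq]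
  refine End.add_pow_apply_eq_zero (commute_dzt_dzw.smul_right _) h' ?_
  rw [smul_pow, LinearMap.smul_apply, ← Module.End.mul_apply (dzw ^ K),
    ← (commute_dwt_dzw.pow_pow N K).eq, Module.End.mul_apply, h, map_zero, smul_zero]

/-- Up to signs, commuting `C` past a product of `A` and `B` gives one term with `[A, C]`, killed by
`(z - t)^N`, and one term with `[B, C]`, killed by `(w - t)^N`. For example `ABC - s₁ s₂ CAB = s₂
[A, C] B + A [B, C]`. -/
lemma dzt_pow_dwt_pow_triple {s₁ s₂ : ℂ} {A B C : VertexOperator ℂ V} {N : ℕ}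
    (hA : (dzw ^ N) (fcomm s₁ A C) = 0) (hB : (dzw ^ N) (fcomm s₂ B C) = 0) (x : V) :
    (dzt ^ N) ((dwt ^ N) fun l m n => (A[[l]]) ((B[[m]]) ((C[[n]]) x)) -
      (s₁ * s₂) • (C[[n]]) ((A[[l]]) ((B[[m]]) x))) = 0 ∧
    (dzt ^ N) ((dwt ^ N) fun l m n => (B[[m]]) ((A[[l]]) ((C[[n]]) x)) -
      (s₁ * s₂) • (C[[n]]) ((B[[m]]) ((A[[l]]) x))) = 0 := by
  have key : ∀ (F G : ℤ → ℤ → ℤ → V), (dzt ^ N) F = 0 → (dwt ^ N) G = 0 →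
      (dzt ^ N) ((dwt ^ N) (F + G)) = 0 := fun F G hF hG => by
    rw [map_add, hG, add_zero, ← Module.End.mul_apply, (commute_dzt_dwt.pow_pow N N).eq,
      Module.End.mul_apply, hF, map_zero]
  have hA' : ∀ (y : V) (l n : ℤ),
      (dzw ^ N) (fun l n => fcomm s₁ A C l n y) l n = 0 := fun y l n => by
    exact (dzw_pow_map (LinearMap.applyₗ y) N (fcomm s₁ A C) l n).trans (by rw [hA]; rfl)
  have hB' : ∀ (y : V) (m n : ℤ),
      (dzw ^ N) (fun m n => fcomm s₂ B C m n y) m n = 0 := fun y m n => by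
    exact (dzw_pow_map (LinearMap.applyₗ y) N (fcomm s₂ B C) m n).trans (by rw [hB]; rfl)
  constructor
  · rw [← key (fun l m n => s₂ • fcomm s₁ A C l n ((B[[m]]) x))
      (fun l m n => (A[[l]]) (fcomm s₂ B C m n x))]
    · congr 2
      ext l m n
      simp only [Pi.add_apply, fcomm_apply, map_sub, map_smul, smul_sub, mul_smul, smul_comm s₁]
      abel
    · ext l m n
      rw [dzt_pow_apply]
      refine (dzw_pow_map (s₂ • LinearMap.id : V →ₗ[ℂ] V) N
        (fun l n => fcomm s₁ A C l n ((B[[m]]) x)) l n).trans ?_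
      rw [hA', map_zero]
      rfl
    · ext l m n
      rw [dwt_pow_apply, dzw_pow_map (A[[l]]), hB']
      simp
  · rw [← key (fun l m n => (B[[m]]) (fcomm s₁ A C l n x))
      (fun l m n => s₁ • fcomm s₂ B C m n ((A[[l]]) x))]
    · congr 2
      ext l m n
      simp only [Pi.add_apply, fcomm_apply, map_sub, map_smul, smul_sub, mul_smul]
      abel
    · ext l m n
      rw [dzt_pow_apply, dzw_pow_map (B[[m]]), hA']
      simp
    · ext l m n
      rw [dwt_pow_apply]
      refine (dzw_pow_map (s₁ • LinearMap.id : V →ₗ[ℂ] V) N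
        (fun m n => fcomm s₂ B C m n ((A[[l]]) x)) m n).trans ?_
      rw [hB', map_zero]
      rfl

lemma exists_common_order {s₁ s₂ s : ℂ} {A B C : VertexOperator ℂ V} (h₁ : Loc s₁ A C)
    (h₂ : Loc s₂ B C) (h : Loc s A B) : ∃ N : ℕ, (dzw ^ N) (fcomm s₁ A C) = 0 ∧
      (dzw ^ N) (fcomm s₂ B C) = 0 ∧ (dzw ^ N) (fcomm s A B) = 0 := by
  obtain ⟨N₁, h₁⟩ := h₁
  obtain ⟨N₂, h₂⟩ := h₂
  obtain ⟨N₃, h₃⟩ := h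
  exact ⟨max N₁ (max N₂ N₃), dzw_pow_eq_zero_of_le (by simp) h₁,
    dzw_pow_eq_zero_of_le (by simp) h₂, dzw_pow_eq_zero_of_le (by simp) h₃⟩

/-- A criterion for locality of the residue `X` of a formal distribution in three variables. -/
lemma loc_of_triple {s : ℂ} {X C : VertexOperator ℂ V} (Y : V → ℤ → ℤ → V) {K N : ℕ}
    (hX : ∀ (n : ℤ) x, (X[[n]]) x = Y x 0 n)
    (h : ∀ x, (dzw ^ K) (fun l m n => Y ((C[[n]]) x) l m - s • (C[[n]]) (Y x l m)) = 0)
    (h' : ∀ x, (dzt ^ N) ((dwt ^ N) fun l m n =>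
      Y ((C[[n]]) x) l m - s • (C[[n]]) (Y x l m)) = 0) : Loc s X C := by
  refine ⟨N + K + N, ?_⟩
  ext m n x
  have := congrFun (congrFun (congrFun (dwt_pow_eq_zero (h x) (h' x)) 0) m) n
  rw [dwt_pow_apply] at this
  rw [Pi.zero_apply, Pi.zero_apply, LinearMap.zero_apply]
  refine Eq.trans ?_ this
  refine (dzw_pow_map (LinearMap.applyₗ x) _ (fcomm s X C) m n).symm.trans ?_
  have e : (fun l m => LinearMap.applyₗ x (fcomm s X C l m)) =
      fun m n => Y ((C[[n]]) x) 0 m - s • (C[[n]]) (Y x 0 m) :=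
    funext fun m => funext fun n => by
      rw [← hX, ← hX]
      rfl
  rw [e]

/-- **Dong's lemma** for the products `A_(n) B` with `n ≥ 0`. -/
lemma Loc.resProd {s₁ s₂ s : ℂ} {A B C : VertexOperator ℂ V} (h₁ : Loc s₁ A C)
    (h₂ : Loc s₂ B C) (h : Loc s A B) (k : ℕ) : Loc (s₁ * s₂) (resProd s k A B) C := by
  obtain ⟨N, h₁, h₂, h⟩ := exists_common_order h₁ h₂ h
  -- Multiplication by `(z - w)^k` does not involve `t` and can be pulled out of the commutator with
  -- `C`.
  have e1 : ∀ x, (fun l m n => (dzw ^ k) (fcomm s A B) l m ((C[[n]]) x) -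
      (s₁ * s₂) • (C[[n]]) ((dzw ^ k) (fcomm s A B) l m x)) = (dzw ^ k) (fun l m n =>
        fcomm s A B l m ((C[[n]]) x) - (s₁ * s₂) • (C[[n]]) (fcomm s A B l m x)) := fun x => by
    ext l m n
    rw [dzw_pow_apply]
    exact (dzw_pow_map (LinearMap.applyₗ ((C[[n]]) x) -
      (s₁ * s₂) • ((C[[n]]) ∘ₗ LinearMap.applyₗ x)) k (fcomm s A B) l m).symm
  refine loc_of_triple (K := N) (N := N) (fun x l m => (dzw ^ k) (fcomm s A B) l m x)
    (fun n x => by rw [resProd_ncoeff]) (fun x => ?_) (fun x => ?_)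
  · rw [e1, ← Module.End.mul_apply, ← pow_add]
    ext l m n
    rw [dzw_pow_apply]
    refine (dzw_pow_map (LinearMap.applyₗ ((C[[n]]) x) -
      (s₁ * s₂) • ((C[[n]]) ∘ₗ LinearMap.applyₗ x)) (N + k) (fcomm s A B) l m).trans ?_
    rw [dzw_pow_eq_zero_of_le (by lia) h]
    simp
  · rw [e1, ← Module.End.mul_apply, ← Module.End.mul_apply,
      ((((commute_dzt_dzw).pow_left N).mul_left ((commute_dwt_dzw).pow_left N)).pow_right k).eq,
      Module.End.mul_apply, Module.End.mul_apply]
    obtain ⟨t1, t2⟩ := dzt_pow_dwt_pow_triple h₁ h₂ x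
    have : (fun l m n => fcomm s A B l m ((C[[n]]) x) -
        (s₁ * s₂) • (C[[n]]) (fcomm s A B l m x)) =
      (fun l m n => (A[[l]]) ((B[[m]]) ((C[[n]]) x)) -
        (s₁ * s₂) • (C[[n]]) ((A[[l]]) ((B[[m]]) x))) - s • (fun l m n =>
        (B[[m]]) ((A[[l]]) ((C[[n]]) x)) - (s₁ * s₂) • (C[[n]]) ((B[[m]]) ((A[[l]]) x))) := by
      ext l m n
      simp only [fcomm_apply, Pi.sub_apply, Pi.smul_apply, map_sub, map_smul, smul_sub,
        smul_comm s]
      abel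
    rw [this, map_sub, map_smul, map_sub, map_smul, t1, t2, smul_zero, sub_zero, map_zero]

/-- Truncation in `w`, for every power of `t`. -/
def TruncW (F : ℤ → ℤ → ℤ → V) : Prop := ∀ n, Trunc fun l m => F l m n

lemma TruncW.dzt {F : ℤ → ℤ → ℤ → V} (h : TruncW F) : TruncW (dzt F) := fun n => by
  obtain ⟨N, hN⟩ := h n
  obtain ⟨N', hN'⟩ := h (n + 1)
  simp only at hN hN'
  refine ⟨max N N', fun l m hm => ?_⟩
  change F (l + 1) m n - F l m (n + 1) = 0
  rw [hN _ _ (by lia), hN' _ _ (by lia), sub_zero]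

lemma TruncW.dwt {F : ℤ → ℤ → ℤ → V} (h : TruncW F) : TruncW (dwt F) := fun n => by
  obtain ⟨N, hN⟩ := h n
  obtain ⟨N', hN'⟩ := h (n + 1)
  simp only at hN hN'
  refine ⟨max N N', fun l m hm => ?_⟩
  change F l (m + 1) n - F l m (n + 1) = 0
  rw [hN _ _ (by lia), hN' _ _ (by lia), sub_zero]

lemma TruncW.pow {F : ℤ → ℤ → ℤ → V} (h : TruncW F) (N N' : ℕ) :
    TruncW ((ChiralDeRham.dzt ^ N) ((ChiralDeRham.dwt ^ N') F)) := by
  have h1 : ∀ N', TruncW ((ChiralDeRham.dwt ^ N') F) := fun N' => by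
    induction N' with
    | zero => exact h
    | succ N' ih => rw [pow_succ']; exact ih.dwt
  induction N with
  | zero => exact h1 N'
  | succ N ih => rw [pow_succ']; exact ih.dzt

lemma TruncW.eq_zero {F : ℤ → ℤ → ℤ → V} (h : TruncW F) {K : ℕ} (h0 : (dzw ^ K) F = 0) :
    F = 0 := by
  ext l m n
  have := (h n).eq_zero (n := K) (by
    ext l m
    rw [← dzw_pow_apply, h0]
    rfl)
  exact congrFun (congrFun this l) m

/-- Exchange of the variables `z` and `w`. -/
def flipZW (F : ℤ → ℤ → ℤ → V) : ℤ → ℤ → ℤ → V := fun l m n => F m l n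

lemma flipZW_pow (N : ℕ) (F : ℤ → ℤ → ℤ → V) :
    flipZW ((dzt ^ N) ((dwt ^ N) F)) = (dzt ^ N) ((dwt ^ N) (flipZW F)) := by
  have h1 : ∀ F : ℤ → ℤ → ℤ → V, flipZW ((dzt ^ N) F) = (dwt ^ N) (flipZW F) := fun F => by
    ext l m n
    rw [dwt_pow_apply]
    exact dzt_pow_apply N F m l n
  have h2 : ∀ F : ℤ → ℤ → ℤ → V, flipZW ((dwt ^ N) F) = (dzt ^ N) (flipZW F) := fun F => by
    ext l m n
    rw [dzt_pow_apply]
    exact congrFun (congrFun (dwt_pow_apply N F m) l) n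
  rw [h1, h2, ← Module.End.mul_apply, ← (commute_dzt_dwt.pow_pow N N).eq, Module.End.mul_apply]

/-- The factor `(z - w)^(-k-1)` is removed by multiplying with `(z - w)^(k+1)`. This commutes with
the powers of `z - t` and `w - t` and is injective on distributions truncated in `w`. -/
lemma dzt_pow_dwt_pow_expand {s : ℂ} {A B C : VertexOperator ℂ V} {N : ℕ} (k : ℕ) (x : V)
    (h : (dzt ^ N) ((dwt ^ N) fun l m n => (A[[l]]) ((B[[m]]) ((C[[n]]) x)) -
      s • (C[[n]]) ((A[[l]]) ((B[[m]]) x))) = 0) :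
    (dzt ^ N) ((dwt ^ N) fun l m n =>
      expand k (fun l m => (A[[l]]) ((B[[m]]) ((C[[n]]) x))) l m -
      s • (C[[n]]) (expand k (fun l m => (A[[l]]) ((B[[m]]) x)) l m)) = 0 := by
  refine TruncW.eq_zero (K := k + 1) (TruncW.pow (fun n => ?_) _ _) ?_
  · exact ((trunc_modes A B ((C[[n]]) x)).expand k).sub
      (((trunc_modes A B x).expand k).map (s • (C[[n]])))
  · rw [← Module.End.mul_apply (dzt ^ N), ← Module.End.mul_apply,
      ← ((((commute_dzt_dzw).pow_left N).mul_left
        ((commute_dwt_dzw).pow_left N)).pow_right (k + 1)).eq,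
      Module.End.mul_apply, Module.End.mul_apply, ← h]
    congr 2
    ext l m n
    rw [dzw_pow_apply]
    change (dzw ^ (k + 1)) (expand k (fun l m => (A[[l]]) ((B[[m]]) ((C[[n]]) x))) -
      s • (fun l m => (C[[n]]) (expand k (fun l m => (A[[l]]) ((B[[m]]) x)) l m))) l m = _
    rw [map_sub, map_smul, dzw_pow_expand (trunc_modes A B ((C[[n]]) x))]
    simp only [Pi.sub_apply, Pi.smul_apply]
    rw [dzw_pow_map, dzw_pow_expand (trunc_modes A B x)]

/-- **Dong's lemma** for normally ordered products. -/
lemma Loc.wick {s₁ s₂ s : ℂ} {A B C : VertexOperator ℂ V} (h₁ : Loc s₁ A C)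
    (h₂ : Loc s₂ B C) (h : Loc s A B) {τ : Module.End ℂ V}
    (hτ : ∀ n : ℤ, τ ∘ₗ (B[[n]]) ∘ₗ τ = s • (B[[n]])) (k : ℕ) :
    Loc (s₁ * s₂) (wick τ A k B) C := by
  obtain ⟨N, h₁, h₂, h⟩ := exists_common_order h₁ h₂ h
  refine loc_of_triple (K := N + (k + 1)) (N := N) (wickKer s A k B)
    (fun n x => by rw [wick_ncoeff, wickMode_eq_wickKer A k hτ]) (fun x => ?_) (fun x => ?_)
  · ext l m n
    rw [dzw_pow_apply]
    change (dzw ^ (N + (k + 1))) (wickKer s A k B ((C[[n]]) x) - (s₁ * s₂) • fun l m =>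
      (C[[n]]) (wickKer s A k B x l m)) l m = 0
    rw [pow_add, Module.End.mul_apply, map_sub, map_smul, dzw_pow_wickKer]
    have e : (dzw ^ (k + 1)) (fun l m => (C[[n]]) (wickKer s A k B x l m)) =
        fun l m => (C[[n]]) (fcomm s A B l m x) := by
      ext l m
      rw [dzw_pow_map, dzw_pow_wickKer]
    rw [e]
    refine (dzw_pow_map (LinearMap.applyₗ ((C[[n]]) x) -
      (s₁ * s₂) • ((C[[n]]) ∘ₗ LinearMap.applyₗ x)) N (fcomm s A B) l m).trans ?_
    rw [h]
    simp
  · obtain ⟨t1, t2⟩ := dzt_pow_dwt_pow_triple h₁ h₂ x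
    have u1 := dzt_pow_dwt_pow_expand (s := s₁ * s₂) (A := A) (B := B) (C := C) k x t1
    -- The second half of the normally ordered product is expanded in `|w| > |z|`. Exchanging `z`
    -- and `w` puts it into the form treated by `dzt_pow_dwt_pow_expand`.
    have t2' : (dzt ^ N) ((dwt ^ N) (fun l m n => (B[[l]]) ((A[[m]]) ((C[[n]]) x)) -
      (s₁ * s₂) • (C[[n]]) ((B[[l]]) ((A[[m]]) x)))) = 0 := by
      have := flipZW_pow N (fun l m n => (B[[l]]) ((A[[m]]) ((C[[n]]) x)) -
        (s₁ * s₂) • (C[[n]]) ((B[[l]]) ((A[[m]]) x)))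
      have t3 := this.trans t2
      ext l m n
      exact congrFun (congrFun (congrFun t3 m) l) n
    have u2 := dzt_pow_dwt_pow_expand (s := s₁ * s₂) (A := B) (B := A) (C := C) k x t2'
    have u2' := (flipZW_pow N _).symm.trans (congrArg flipZW u2)
    have : (fun l m n => wickKer s A k B ((C[[n]]) x) l m -
        (s₁ * s₂) • (C[[n]]) (wickKer s A k B x l m)) =
      (fun l m n => expand k (fun l m => (A[[l]]) ((B[[m]]) ((C[[n]]) x))) l m -
        (s₁ * s₂) • (C[[n]]) (expand k (fun l m => (A[[l]]) ((B[[m]]) x)) l m)) +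
      ((-1) ^ k * s) • flipZW (fun l m n =>
        expand k (fun l m => (B[[l]]) ((A[[m]]) ((C[[n]]) x))) l m -
        (s₁ * s₂) • (C[[n]]) (expand k (fun l m => (B[[l]]) ((A[[m]]) x)) l m)) := by
      ext l m n
      simp only [wickKer, flipZW, Pi.add_apply, Pi.smul_apply, map_add, map_smul, smul_sub,
        smul_add]
      rw [smul_comm (s₁ * s₂)]
      abel
    rw [this, map_add, map_smul, map_add, map_smul, u1, u2']
    rw [zero_add, show flipZW (0 : ℤ → ℤ → ℤ → V) = 0 from rfl, smul_zero]

/-! ### Translation covariance -/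

/-- Translation covariance of a field, `[D, A(z)] = ∂A(z)`. -/
def Cov (D : Module.End ℂ V) (A : VertexOperator ℂ V) : Prop :=
  ∀ (n : ℤ) (x : V), D ((A[[n]]) x) - (A[[n]]) (D x) = -((n : ℂ) • (A[[n - 1]]) x)

lemma Cov.modes {D : Module.End ℂ V} {A B : VertexOperator ℂ V} (hA : Cov D A) (hB : Cov D B)
    (l m : ℤ) (x : V) : D ((A[[l]]) ((B[[m]]) x)) - (A[[l]]) ((B[[m]]) (D x)) =
      dsum (fun l m => (A[[l]]) ((B[[m]]) x)) l m := by
  rw [dsum, ← sub_add_sub_cancel _ ((A[[l]]) (D ((B[[m]]) x))), hA, ← map_sub, hB, map_neg,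
    map_smul, ← sub_eq_add_neg]

lemma Cov.resProd {D : Module.End ℂ V} {A B : VertexOperator ℂ V} (hA : Cov D A) (hB : Cov D B)
    (s : ℂ) (k : ℕ) : Cov D (resProd s k A B) := fun n x => by
  rw [resProd_ncoeff, resProd_ncoeff]
  have h : ∀ l m, D (fcomm s A B l m x) - fcomm s A B l m (D x) =
      dsum (fun l m => fcomm s A B l m x) l m := fun l m => by
    have h1 := hA.modes hB l m x
    have h2 := hB.modes hA m l x
    simp only [dsum, fcomm_apply, map_sub, map_smul] at h1 h2 ⊢
    rw [sub_sub_sub_comm, h1, ← smul_sub, h2]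
    module
  have e := congrFun (congrFun (congrArg (dzw ^ k) (funext fun l => funext fun m => h l m)) 0) n
  rw [dzw_pow_dsum] at e
  refine Eq.trans ?_ (e.trans ?_)
  · exact (dzw_pow_map (D ∘ₗ LinearMap.applyₗ x - LinearMap.applyₗ (D x)) k (fcomm s A B) 0 n).symm
  · rw [dsum]
    simp only [Int.cast_zero, zero_smul, neg_zero, zero_sub]
    congr 2
    exact dzw_pow_map (LinearMap.applyₗ x) k (fcomm s A B) 0 (n - 1)

/-- Both sides are truncated in `w`. After multiplication by `(z - w)^(k+1)`, which commutes with
`∂_z + ∂_w`, the identity is the Leibniz rule `Cov.modes`, and the factor can be cancelled. -/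
lemma Cov.expand {D : Module.End ℂ V} {A B : VertexOperator ℂ V} (hA : Cov D A) (hB : Cov D B)
    (k : ℕ) (l m : ℤ) (x : V) :
    D (expand k (fun l m => (A[[l]]) ((B[[m]]) x)) l m) -
      ChiralDeRham.expand k (fun l m => (A[[l]]) ((B[[m]]) (D x))) l m =
      dsum (ChiralDeRham.expand k fun l m => (A[[l]]) ((B[[m]]) x)) l m := by
  have t := trunc_modes A B
  have : ((fun l m => D (ChiralDeRham.expand k (fun l m => (A[[l]]) ((B[[m]]) x)) l m)) -
      ChiralDeRham.expand k (fun l m => (A[[l]]) ((B[[m]]) (D x)))) -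
      dsum (ChiralDeRham.expand k fun l m => (A[[l]]) ((B[[m]]) x)) = 0 := by
    refine Trunc.eq_zero (n := k + 1) (((((t x).expand k).map D).sub ((t (D x)).expand k)).sub
      ((t x).expand k).dsum) ?_
    rw [map_sub, map_sub, dzw_pow_dsum, dzw_pow_expand (t x), dzw_pow_expand (t (D x))]
    ext l m
    simp only [Pi.sub_apply]
    rw [dzw_pow_map, dzw_pow_expand (t x), hA.modes hB, sub_self]
    rfl
  exact sub_eq_zero.1 (congrFun (congrFun this l) m)

lemma Cov.wick {D : Module.End ℂ V} {A B : VertexOperator ℂ V} (hA : Cov D A) (hB : Cov D B)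
    {s : ℂ} {τ : Module.End ℂ V} (hτ : ∀ n : ℤ, τ ∘ₗ (B[[n]]) ∘ₗ τ = s • (B[[n]])) (k : ℕ) :
    Cov D (wick τ A k B) := fun n x => by
  simp only [wick_ncoeff, wickMode_eq_wickKer A k hτ, wickKer]
  have h1 := hA.expand hB k 0 n x
  have h2 := hB.expand hA k n 0 x
  rw [map_add, map_smul, add_sub_add_comm, h1, ← smul_sub, h2]
  -- A residue in `z` does not see `∂_z`: the coefficient of that term is the index `0`.
  simp only [dsum, Int.cast_zero]
  module

lemma Cov.sub {D : Module.End ℂ V} {A B : VertexOperator ℂ V} (hA : Cov D A) (hB : Cov D B) :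
    Cov D (A - B) := fun n x => by
  have h1 := hA n x
  have h2 := hB n x
  simp only [map_sub, Pi.sub_apply, LinearMap.sub_apply, smul_sub]
  rw [sub_sub_sub_comm, h1, h2]
  abel

lemma Cov.add {D : Module.End ℂ V} {A B : VertexOperator ℂ V} (hA : Cov D A) (hB : Cov D B) :
    Cov D (A + B) := fun n x => by
  have h1 := hA n x
  have h2 := hB n x
  simp only [map_add, Pi.add_apply, LinearMap.add_apply, smul_add]
  rw [add_sub_add_comm, h1, h2]
  abel

lemma cov_zero (D : Module.End ℂ V) : Cov D 0 := fun n x => by simp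

/-- A translation covariant field `A(z)` with `A(z) 1` regular and with value `0` at `z = 0` kills
the vacuum. -/
lemma Cov.kills_vac {D : Module.End ℂ V} {A : VertexOperator ℂ V} (hA : Cov D A) {v : V}
    (hD : D v = 0) (h : ∀ n : ℤ, -1 ≤ n → (A[[n]]) v = 0) (n : ℤ) : (A[[n]]) v = 0 := by
  have key : ∀ k : ℕ, ∀ n : ℤ, -1 - (k : ℤ) ≤ n → (A[[n]]) v = 0 := by
    intro k
    induction k with
    | zero => intro n hn; exact h n (by simpa using hn)
    | succ k ih =>
      intro n hn
      by_cases hn' : -1 ≤ n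
      · exact h n hn'
      -- By the induction hypothesis and `D v = 0`, covariance at `n + 1` reads `(n + 1) A_(n) v =
      -- 0`, and `n + 1 ≠ 0` because `n < -1`.
      · have := hA (n + 1) v
        rw [ih (n + 1) (by push_cast at hn; lia), hD, map_zero, map_zero, sub_zero,
          add_sub_cancel_right, eq_comm, neg_eq_zero, smul_eq_zero] at this
        exact this.resolve_left (by exact_mod_cast (by lia : n + 1 ≠ 0))
  exact key (-1 - n).toNat n (by lia)

/-- The uniqueness part of Goddard's theorem, one step: vectors killed by a field are preserved
by the modes of fields local to it. -/
lemma Loc.kills {s : ℂ} {A B : VertexOperator ℂ V} (h : Loc s A B) {x : V}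
    (hx : ∀ n : ℤ, (A[[n]]) x = 0) (n m : ℤ) : (A[[n]]) ((B[[m]]) x) = 0 := by
  obtain ⟨N, hN⟩ := h
  have : (fun l m => (A[[l]]) ((B[[m]]) x)) = 0 := by
    -- Since `A` kills `x`, the distribution `A(z) B(w) x` equals the commutator applied to `x`, so
    -- `(z - w)^N` kills it; being truncated in `w`, it vanishes.
    refine Trunc.eq_zero (n := N) (trunc_modes A B x) ?_
    have e : (fun l m => (A[[l]]) ((B[[m]]) x)) = fun l m => fcomm s A B l m x := by
      ext l m
      simp [fcomm_apply, hx]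
    rw [e]
    ext l m
    refine (dzw_pow_map (LinearMap.applyₗ x) N (fcomm s A B) l m).trans ?_
    rw [hN]
    rfl
  exact congrFun (congrFun this n) m

end Locality

/-! ## Commutation relations of the modes of the generating fields -/

/-- The partial derivatives commute. -/
class CommPartials {d : ℕ} (A : Type*) [CommRing A] [Algebra ℂ A] [Partials d A] : Prop where
  pd_comm : ∀ (i j : Fin d) (f : A), pd i (pd j f) = pd j (pd i f)

/-! ### Weyl and Clifford relations of creation operators and partial derivatives. -/

section Creation

variable {d : ℕ} {A : Type*} [CommRing A] [Algebra ℂ A]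

lemma createBeta_single (v : BosonVar d) (m : Mono d) (a : A) :
    createBeta v (Finsupp.single m a) = Finsupp.single (v ::ₘ m.1, m.2) a := by
  simp [createBeta]

lemma createAlpha_single (v : BosonVar d) (m : Mono d) (a : A) :
    createAlpha v (Finsupp.single m a) = Finsupp.single (m.1, v ::ₘ m.2.1, m.2.2) a := by
  simp [createAlpha]

lemma derivBeta_single (v : BosonVar d) (m : Mono d) (a : A) :
    derivBeta v (Finsupp.single m a) =
      (m.1.count v : ℂ) • Finsupp.single (m.1.erase v, m.2) a := by
  simp [derivBeta]

lemma derivAlpha_single (v : BosonVar d) (m : Mono d) (a : A) :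
    derivAlpha v (Finsupp.single m a) =
      (m.2.1.count v : ℂ) • Finsupp.single (m.1, m.2.1.erase v, m.2.2) a := by
  simp [derivAlpha]

lemma createFermion_single (v : FermionVar d) (m : Mono d) (a : A) :
    createFermion v (Finsupp.single m a) = if v ∈ m.2.2 then 0 else
      fermionSign v m.2.2 • Finsupp.single (m.1, m.2.1, insert v m.2.2) a := by
  by_cases h : v ∈ m.2.2 <;> simp [createFermion, h]

lemma derivFermion_single (v : FermionVar d) (m : Mono d) (a : A) :
    derivFermion v (Finsupp.single m a) = if v ∈ m.2.2 then
      fermionSign v m.2.2 • Finsupp.single (m.1, m.2.1, m.2.2.erase v) a else 0 := by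
  by_cases h : v ∈ m.2.2 <;> simp [derivFermion, h]

lemma mulFun_single (f : A) (m : Mono d) (a : A) :
    mulFun f (Finsupp.single m a) = Finsupp.single m (f * a) := by
  simp [mulFun]

lemma parityOp_single (m : Mono d) (a : A) :
    parityOp (Finsupp.single m a) = ((-1 : ℂ) ^ m.2.2.card) • Finsupp.single m a := by
  simp [parityOp]

lemma end_ext {S T : Module.End ℂ (Fock d A)}
    (h : ∀ m a, S (Finsupp.single m a) = T (Finsupp.single m a)) : S = T :=
  Finsupp.lhom_ext h

lemma fermionSign_of_lt {v : FermionVar d} {S : Finset (FermionVar d)} (h : ∀ w ∈ S, v < w) :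
    fermionSign v S = 1 := by
  rw [fermionSign, Finset.filter_false_of_mem fun w hw => (h w hw).le.not_gt]
  simp

lemma fermionSign_insert {v w : FermionVar d} {S : Finset (FermionVar d)} (h : w ∉ S) :
    fermionSign v (insert w S) = (if w < v then -1 else 1) * fermionSign v S := by
  rw [fermionSign, fermionSign, Finset.filter_insert]
  split
  · rw [Finset.card_insert_of_notMem (by simp [h]), pow_succ']
  · rw [one_mul]

lemma fermionSign_erase {v w : FermionVar d} {S : Finset (FermionVar d)} (h : w ∈ S) :
    fermionSign v (S.erase w) = (if w < v then -1 else 1) * fermionSign v S := by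
  have := fermionSign_insert (v := v) (Finset.notMem_erase w S)
  rw [Finset.insert_erase h] at this
  rw [this]
  split <;> simp

lemma fermionSign_mul_self (v : FermionVar d) (S : Finset (FermionVar d)) :
    fermionSign v S * fermionSign v S = 1 := by
  rw [fermionSign, ← mul_pow]
  simp

/-- The Fock space is spanned by the vectors obtained from functions by creation operators. -/
lemma fock_induction {U : Submodule ℂ (Fock d A)} (hF : ∀ f, stF f ∈ U)
    (hβ : ∀ v, ∀ x ∈ U, createBeta v x ∈ U) (hα : ∀ v, ∀ x ∈ U, createAlpha v x ∈ U)
    (hφ : ∀ v, ∀ x ∈ U, createFermion v x ∈ U) (x : Fock d A) : x ∈ U := by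
  induction x using Finsupp.induction_linear with
  | zero => exact U.zero_mem
  | add x y hx hy => exact U.add_mem hx hy
  | single m f =>
    obtain ⟨M, N, S⟩ := m
    induction M using Multiset.induction_on with
    | cons v M ih => simpa [createBeta_single] using hβ v _ ih
    | empty =>
      induction N using Multiset.induction_on with
      | cons v N ih => simpa [createAlpha_single] using hα v _ ih
      | empty =>
        -- Inserting a label below all others makes the fermionic sign equal to `1`.
        induction S using Finset.induction_on_min with
        | empty => exact hF f
        | insert v S hv ih =>
          have := hφ v _ ih
          rwa [createFermion_single, if_neg fun h => (hv v h).false, fermionSign_of_lt hv,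
            one_smul] at this

/-- A family of operators vanishes if this can be checked on functions and propagates along
creation operators. -/
lemma family_eq_zero {ι : Type*} (E : ι → Module.End ℂ (Fock d A)) (hF : ∀ i f, E i (stF f) = 0)
    (hβ : ∀ i v x, (∀ j, E j x = 0) → E i (createBeta v x) = 0)
    (hα : ∀ i v x, (∀ j, E j x = 0) → E i (createAlpha v x) = 0)
    (hφ : ∀ i v x, (∀ j, E j x = 0) → E i (createFermion v x) = 0) (i : ι) : E i = 0 := by
  have h := fock_induction (U := ⨅ i, LinearMap.ker (E i)) (by simpa using fun f i => hF i f)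
    (fun v x hx => by simp only [Submodule.mem_iInf, LinearMap.mem_ker] at hx ⊢
                      exact fun i => hβ i v x hx)
    (fun v x hx => by simp only [Submodule.mem_iInf, LinearMap.mem_ker] at hx ⊢
                      exact fun i => hα i v x hx)
    (fun v x hx => by simp only [Submodule.mem_iInf, LinearMap.mem_ker] at hx ⊢
                      exact fun i => hφ i v x hx)
  refine LinearMap.ext fun x => ?_
  have := h x
  simp only [Submodule.mem_iInf, LinearMap.mem_ker] at this
  exact this i

lemma commute_createBeta_createBeta (v w : BosonVar d) :
    Commute (createBeta v : Module.End ℂ (Fock d A)) (createBeta w) :=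
  end_ext fun m a => by simp [createBeta_single, Multiset.cons_swap]

lemma commute_createAlpha_createAlpha (v w : BosonVar d) :
    Commute (createAlpha v : Module.End ℂ (Fock d A)) (createAlpha w) :=
  end_ext fun m a => by simp [createAlpha_single, Multiset.cons_swap]

lemma commute_createBeta_createAlpha (v w : BosonVar d) :
    Commute (createBeta v : Module.End ℂ (Fock d A)) (createAlpha w) :=
  end_ext fun m a => by simp [createAlpha_single, createBeta_single]

lemma commute_createBeta_createFermion (v : BosonVar d) (w : FermionVar d) :
    Commute (createBeta v : Module.End ℂ (Fock d A)) (createFermion w) :=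
  end_ext fun m a => by
    by_cases h : w ∈ m.2.2 <;> simp [createFermion_single, createBeta_single, h]

lemma commute_createAlpha_createFermion (v : BosonVar d) (w : FermionVar d) :
    Commute (createAlpha v : Module.End ℂ (Fock d A)) (createFermion w) :=
  end_ext fun m a => by
    by_cases h : w ∈ m.2.2 <;> simp [createFermion_single, createAlpha_single, h]

lemma commute_derivBeta_createAlpha (v w : BosonVar d) :
    Commute (derivBeta v : Module.End ℂ (Fock d A)) (createAlpha w) :=
  end_ext fun m a => by simp [createAlpha_single, derivBeta_single]

lemma commute_derivBeta_createFermion (v : BosonVar d) (w : FermionVar d) :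
    Commute (derivBeta v : Module.End ℂ (Fock d A)) (createFermion w) :=
  end_ext fun m a => by
    by_cases h : w ∈ m.2.2
    · simp [createFermion_single, derivBeta_single, h]
    · simp only [Module.End.mul_apply, createFermion_single, derivBeta_single, h, if_false,
        map_smul]
      rw [smul_comm]

lemma commute_derivAlpha_createBeta (v w : BosonVar d) :
    Commute (derivAlpha v : Module.End ℂ (Fock d A)) (createBeta w) :=
  end_ext fun m a => by simp [createBeta_single, derivAlpha_single]

lemma commute_derivAlpha_createFermion (v : BosonVar d) (w : FermionVar d) :
    Commute (derivAlpha v : Module.End ℂ (Fock d A)) (createFermion w) :=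
  end_ext fun m a => by
    by_cases h : w ∈ m.2.2
    · simp [createFermion_single, derivAlpha_single, h]
    · simp only [Module.End.mul_apply, createFermion_single, derivAlpha_single, h, if_false,
        map_smul]
      rw [smul_comm]

lemma commute_derivFermion_createBeta (v : FermionVar d) (w : BosonVar d) :
    Commute (derivFermion v : Module.End ℂ (Fock d A)) (createBeta w) :=
  end_ext fun m a => by
    by_cases h : v ∈ m.2.2 <;> simp [derivFermion_single, createBeta_single, h]

lemma commute_derivFermion_createAlpha (v : FermionVar d) (w : BosonVar d) :
    Commute (derivFermion v : Module.End ℂ (Fock d A)) (createAlpha w) :=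
  end_ext fun m a => by
    by_cases h : v ∈ m.2.2 <;> simp [derivFermion_single, createAlpha_single, h]

lemma commute_mulFun_createBeta (f : A) (v : BosonVar d) :
    Commute (mulFun f : Module.End ℂ (Fock d A)) (createBeta v) :=
  end_ext fun m a => by simp [-Finsupp.single_mul, -Finsupp.smul_single, mulFun_single, createBeta_single]

lemma commute_mulFun_createAlpha (f : A) (v : BosonVar d) :
    Commute (mulFun f : Module.End ℂ (Fock d A)) (createAlpha v) :=
  end_ext fun m a => by simp [-Finsupp.single_mul, -Finsupp.smul_single, mulFun_single, createAlpha_single]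

lemma commute_mulFun_createFermion (f : A) (v : FermionVar d) :
    Commute (mulFun f : Module.End ℂ (Fock d A)) (createFermion v) :=
  end_ext fun m a => by
    by_cases h : v ∈ m.2.2 <;> simp [-Finsupp.single_mul, -Finsupp.smul_single, mulFun_single, createFermion_single, h]

lemma commute_mulFun_derivBeta (f : A) (v : BosonVar d) :
    Commute (mulFun f : Module.End ℂ (Fock d A)) (derivBeta v) :=
  end_ext fun m a => by simp [-Finsupp.single_mul, -Finsupp.smul_single, mulFun_single, derivBeta_single]

lemma commute_mulFun_derivAlpha (f : A) (v : BosonVar d) :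
    Commute (mulFun f : Module.End ℂ (Fock d A)) (derivAlpha v) :=
  end_ext fun m a => by simp [-Finsupp.single_mul, -Finsupp.smul_single, mulFun_single, derivAlpha_single]

lemma commute_mulFun_derivFermion (f : A) (v : FermionVar d) :
    Commute (mulFun f : Module.End ℂ (Fock d A)) (derivFermion v) :=
  end_ext fun m a => by
    by_cases h : v ∈ m.2.2 <;> simp [-Finsupp.single_mul, -Finsupp.smul_single, mulFun_single, derivFermion_single, h]

lemma commute_mulFun_mulFun (f g : A) :
    Commute (mulFun f : Module.End ℂ (Fock d A)) (mulFun g) :=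
  end_ext fun m a => by simp [-Finsupp.single_mul, -Finsupp.smul_single, mulFun_single, mul_left_comm]

lemma derivBeta_createBeta (v w : BosonVar d) (x : Fock d A) :
    derivBeta v (createBeta w x) = createBeta w (derivBeta v x) + if v = w then x else 0 := by
  have : derivBeta v ∘ₗ createBeta w = createBeta w ∘ₗ derivBeta v +
      (if v = w then LinearMap.id else 0 : Module.End ℂ (Fock d A)) := by
    refine end_ext fun m a => ?_
    simp only [LinearMap.comp_apply, LinearMap.add_apply, createBeta_single, derivBeta_single,
      map_smul]
    by_cases h : v = w
    · subst h
      rw [Multiset.erase_cons_head, Multiset.count_cons_self, if_pos rfl, LinearMap.id_apply]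
      by_cases hm : v ∈ m.1
      · simp only [Multiset.cons_erase hm]
        push_cast
        rw [add_smul, one_smul]
      · simp [Multiset.count_eq_zero_of_notMem hm]
    · simp [h, Multiset.erase_cons_tail _ (Ne.symm h), Multiset.count_cons_of_ne h]
  have h := LinearMap.congr_fun this x
  simp only [LinearMap.comp_apply, LinearMap.add_apply] at h
  rw [h]
  split <;> rfl

lemma derivAlpha_createAlpha (v w : BosonVar d) (x : Fock d A) :
    derivAlpha v (createAlpha w x) = createAlpha w (derivAlpha v x) + if v = w then x else 0 := by
  have : derivAlpha v ∘ₗ createAlpha w = createAlpha w ∘ₗ derivAlpha v +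
      (if v = w then LinearMap.id else 0 : Module.End ℂ (Fock d A)) := by
    refine end_ext fun m a => ?_
    simp only [LinearMap.comp_apply, LinearMap.add_apply, createAlpha_single, derivAlpha_single,
      map_smul]
    by_cases h : v = w
    · subst h
      rw [Multiset.erase_cons_head, Multiset.count_cons_self, if_pos rfl, LinearMap.id_apply]
      by_cases hm : v ∈ m.2.1
      · simp only [Multiset.cons_erase hm]
        push_cast
        rw [add_smul, one_smul]
      · simp [Multiset.count_eq_zero_of_notMem hm]
    · simp [h, Multiset.erase_cons_tail _ (Ne.symm h), Multiset.count_cons_of_ne h]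
  have h := LinearMap.congr_fun this x
  simp only [LinearMap.comp_apply, LinearMap.add_apply] at h
  rw [h]
  split <;> rfl

/-- For distinct labels exactly one of the two orders of insertion passes over the other label,
which produces the sign. For equal labels both sides vanish. -/
lemma createFermion_createFermion (v w : FermionVar d) (x : Fock d A) :
    createFermion v (createFermion w x) = -createFermion w (createFermion v x) := by
  have : createFermion v ∘ₗ createFermion w =
      -(createFermion w ∘ₗ createFermion v : Module.End ℂ (Fock d A)) := by
    refine end_ext fun m a => ?_
    simp only [LinearMap.comp_apply, LinearMap.neg_apply, createFermion_single]
    by_cases h : v = w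
    · subst h
      by_cases hm : v ∈ m.2.2 <;> simp [hm, createFermion_single]
    · by_cases hv : v ∈ m.2.2
      · by_cases hw : w ∈ m.2.2 <;> simp [hv, hw, createFermion_single]
      · by_cases hw : w ∈ m.2.2
        · simp [hv, hw, createFermion_single]
        · simp only [hv, hw, if_false, map_smul, createFermion_single, Finset.mem_insert, h,
            Ne.symm h, or_self, fermionSign_insert hv, fermionSign_insert hw, smul_smul,
            Finset.insert_comm v w, ← neg_smul]
          congr 1
          rcases lt_or_gt_of_ne h with h' | h' <;> simp [h', h'.le.not_gt] <;> ring
  exact LinearMap.congr_fun this x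

lemma derivFermion_createFermion (v w : FermionVar d) (x : Fock d A) :
    derivFermion v (createFermion w x) =
      -createFermion w (derivFermion v x) + if v = w then x else 0 := by
  have : derivFermion v ∘ₗ createFermion w =
      -(createFermion w ∘ₗ derivFermion v : Module.End ℂ (Fock d A)) +
      (if v = w then LinearMap.id else 0 : Module.End ℂ (Fock d A)) := by
    refine end_ext fun m a => ?_
    simp only [LinearMap.comp_apply, LinearMap.neg_apply, LinearMap.add_apply,
      createFermion_single, derivFermion_single]
    by_cases h : v = w
    · subst h
      by_cases hm : v ∈ m.2.2
      · simp [hm, createFermion_single, fermionSign_erase hm, smul_smul, fermionSign_mul_self]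
      · simp [hm, derivFermion_single, fermionSign_insert hm, smul_smul, fermionSign_mul_self]
    · by_cases hv : v ∈ m.2.2
      · by_cases hw : w ∈ m.2.2
        · simp [hv, hw, h, createFermion_single, Ne.symm h]
        · simp only [hv, hw, if_false, if_true, map_smul, createFermion_single,
            derivFermion_single, Finset.mem_insert, h, or_true, Finset.mem_erase, and_false,
            fermionSign_insert hw, fermionSign_erase hv, smul_smul, ← neg_smul,
            Finset.erase_insert_of_ne (Ne.symm h), LinearMap.zero_apply, add_zero]
          congr 1
          rcases lt_or_gt_of_ne h with h' | h' <;> simp [h', h'.le.not_gt] <;> ring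
      · by_cases hw : w ∈ m.2.2 <;> simp [hv, hw, h, derivFermion_single]
  have h := LinearMap.congr_fun this x
  simp only [LinearMap.comp_apply, LinearMap.add_apply, LinearMap.neg_apply] at h
  rw [h]
  split <;> rfl

@[simp] lemma derivBeta_stF (v : BosonVar d) (f : A) : derivBeta v (stF f) = 0 := by
  simp [stF, derivBeta_single]

@[simp] lemma derivAlpha_stF (v : BosonVar d) (f : A) : derivAlpha v (stF f) = 0 := by
  simp [stF, derivAlpha_single]

@[simp] lemma derivFermion_stF (v : FermionVar d) (f : A) : derivFermion v (stF f) = 0 := by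
  simp [stF, derivFermion_single]

@[simp] lemma mulFun_stF (f g : A) : (mulFun f : Module.End ℂ (Fock d A)) (stF g) = stF (f * g) :=
  mulFun_single f _ g

lemma commute_apply {W : Type*} [AddCommGroup W] [Module ℂ W] {S T : Module.End ℂ W}
    (h : Commute S T) (x : W) : S (T x) = T (S x) :=
  LinearMap.congr_fun h.eq x

lemma commute_of_creation {S T : Module.End ℂ (Fock d A)} (hF : ∀ f, S (T (stF f)) = T (S (stF f)))
    (hβ : ∀ v x, S (T x) = T (S x) → S (T (createBeta v x)) = T (S (createBeta v x)))
    (hα : ∀ v x, S (T x) = T (S x) → S (T (createAlpha v x)) = T (S (createAlpha v x)))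
    (hφ : ∀ v x, S (T x) = T (S x) → S (T (createFermion v x)) = T (S (createFermion v x))) :
    Commute S T := by
  have := family_eq_zero (fun _ : Unit => S * T - T * S) (fun _ f => sub_eq_zero.2 (hF f))
    (fun _ v x h => sub_eq_zero.2 (hβ v x (sub_eq_zero.1 (h ()))))
    (fun _ v x h => sub_eq_zero.2 (hα v x (sub_eq_zero.1 (h ()))))
    (fun _ v x h => sub_eq_zero.2 (hφ v x (sub_eq_zero.1 (h ())))) ()
  exact sub_eq_zero.1 this

lemma commute_derivBeta_derivBeta (v w : BosonVar d) :
    Commute (derivBeta v : Module.End ℂ (Fock d A)) (derivBeta w) := by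
  refine commute_of_creation (by simp) (fun u x h => ?_) (fun u x h => ?_) (fun u x h => ?_)
  · simp only [derivBeta_createBeta, map_add, h, apply_ite (derivBeta _), map_zero]
    abel
  · simp only [commute_apply (commute_derivBeta_createAlpha (A := A) _ _), h]
  · simp only [commute_apply (commute_derivBeta_createFermion (A := A) _ _), h]

lemma commute_derivAlpha_derivAlpha (v w : BosonVar d) :
    Commute (derivAlpha v : Module.End ℂ (Fock d A)) (derivAlpha w) := by
  refine commute_of_creation (by simp) (fun u x h => ?_) (fun u x h => ?_) (fun u x h => ?_)
  · simp only [commute_apply (commute_derivAlpha_createBeta (A := A) _ _), h]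
  · simp only [derivAlpha_createAlpha, map_add, h, apply_ite (derivAlpha _), map_zero]
    abel
  · simp only [commute_apply (commute_derivAlpha_createFermion (A := A) _ _), h]

lemma commute_derivBeta_derivAlpha (v w : BosonVar d) :
    Commute (derivBeta v : Module.End ℂ (Fock d A)) (derivAlpha w) := by
  refine commute_of_creation (by simp) (fun u x h => ?_) (fun u x h => ?_) (fun u x h => ?_)
  · simp only [commute_apply (commute_derivAlpha_createBeta (A := A) _ _), derivBeta_createBeta, map_add, h,
      apply_ite (derivAlpha _), map_zero]
  · simp only [commute_apply (commute_derivBeta_createAlpha (A := A) _ _), derivAlpha_createAlpha, map_add, h,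
      apply_ite (derivBeta _), map_zero]
  · simp only [commute_apply (commute_derivAlpha_createFermion (A := A) _ _),
      commute_apply (commute_derivBeta_createFermion (A := A) _ _), h]

lemma commute_derivBeta_derivFermion (v : BosonVar d) (w : FermionVar d) :
    Commute (derivBeta v : Module.End ℂ (Fock d A)) (derivFermion w) := by
  refine commute_of_creation (by simp) (fun u x h => ?_) (fun u x h => ?_) (fun u x h => ?_)
  · simp only [commute_apply (commute_derivFermion_createBeta (A := A) _ _), derivBeta_createBeta, map_add, h,
      apply_ite (derivFermion _), map_zero]
  · simp only [commute_apply (commute_derivBeta_createAlpha (A := A) _ _),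
      commute_apply (commute_derivFermion_createAlpha (A := A) _ _), h]
  · simp only [commute_apply (commute_derivBeta_createFermion (A := A) _ _), derivFermion_createFermion,
      map_add, map_neg, h, apply_ite (derivBeta _), map_zero]

lemma commute_derivAlpha_derivFermion (v : BosonVar d) (w : FermionVar d) :
    Commute (derivAlpha v : Module.End ℂ (Fock d A)) (derivFermion w) := by
  refine commute_of_creation (by simp) (fun u x h => ?_) (fun u x h => ?_) (fun u x h => ?_)
  · simp only [commute_apply (commute_derivAlpha_createBeta (A := A) _ _),
      commute_apply (commute_derivFermion_createBeta (A := A) _ _), h]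
  · simp only [commute_apply (commute_derivFermion_createAlpha (A := A) _ _), derivAlpha_createAlpha, map_add, h,
      apply_ite (derivFermion _), map_zero]
  · simp only [commute_apply (commute_derivAlpha_createFermion (A := A) _ _), derivFermion_createFermion,
      map_add, map_neg, h, apply_ite (derivAlpha _), map_zero]

lemma derivFermion_derivFermion (v w : FermionVar d) (x : Fock d A) :
    derivFermion v (derivFermion w x) = -derivFermion w (derivFermion v x) := by
  have := family_eq_zero (fun _ : Unit => (derivFermion v * derivFermion w +
    derivFermion w * derivFermion v : Module.End ℂ (Fock d A)))
    (fun _ f => by simp) (fun _ u x h => ?_) (fun _ u x h => ?_) (fun _ u x h => ?_) ()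
  · exact eq_neg_of_add_eq_zero_left (LinearMap.congr_fun this x)
  all_goals
    have h := h ()
    simp only [LinearMap.add_apply, Module.End.mul_apply] at h ⊢
  · simp only [commute_apply (commute_derivFermion_createBeta (A := A) _ _), ← map_add, h, map_zero]
  · simp only [commute_apply (commute_derivFermion_createAlpha (A := A) _ _), ← map_add, h, map_zero]
  · have h' : createFermion u (derivFermion v (derivFermion w x)) +
        createFermion u (derivFermion w (derivFermion v x)) = 0 := by rw [← map_add, h, map_zero]
    simp only [derivFermion_createFermion, map_add, map_neg, apply_ite (derivFermion _), map_zero]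
    rw [eq_neg_of_add_eq_zero_left h']
    abel

end Creation

/-! ### Modes of the fields of functions. -/

section FunModes

variable {d : ℕ} {A : Type*} [CommRing A] [Algebra ℂ A] [Partials d A]

/-- The `n`-th mode of the part of `f(z)` with nonnegative powers of `z` on vectors without
`β`. -/
abbrev taylor (n : ℤ) (f : A) : Module.End ℂ (Fock d A) := funOnWord [] f n

lemma taylor_of_nonneg {n : ℤ} (hn : 0 ≤ n) (f : A) :
    (taylor n f : Module.End ℂ (Fock d A)) = 0 := by
  obtain ⟨k, rfl⟩ := Int.eq_ofNat_of_zero_le hn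
  rfl

lemma taylor_neg_one (f : A) : (taylor (-1) f : Module.End ℂ (Fock d A)) = mulFun f := by
  change jet 0 f = _
  rw [jet]

/-- The Euler recursion defining `jet`, in terms of the mode index; for `n ≥ -1` both sides vanish.
The range `M` is free beyond `-n - 1`, since the further terms are zero, so that recursions for
different `n` can be compared over one range. -/
lemma taylor_rec (n : ℤ) (f : A) {M : ℕ} (hM : -n - 1 ≤ M) :
    (-(n : ℂ) - 1) • (taylor n f : Module.End ℂ (Fock d A)) =
      ∑ j ∈ Finset.range M, ∑ l, createAlpha (l, j) * taylor (n + 1 + j) (pd l f) := by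
  have h0 : ∀ (j : ℕ), -n - 1 ≤ j → ∀ l,
      createAlpha (l, j) * (taylor (n + 1 + j) (pd l f) : Module.End ℂ (Fock d A)) = 0 := by
    intro j hj l
    rw [taylor_of_nonneg (by lia)]
    exact LinearMap.comp_zero _
  match n with
  | .ofNat k =>
    rw [taylor_of_nonneg (by simp), smul_zero, Finset.sum_eq_zero]
    exact fun j _ => Finset.sum_eq_zero fun l _ => h0 j (by simp; lia) l
  | .negSucc 0 =>
    rw [Finset.sum_eq_zero fun j _ => Finset.sum_eq_zero fun l _ => h0 j (by simp) l]
    simp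
  | .negSucc (k + 1) =>
    have hk : k + 1 ≤ M := by rw [Int.negSucc_eq] at hM; push_cast at hM; lia
    rw [← Finset.sum_subset (Finset.range_mono hk) fun j _ hj => Finset.sum_eq_zero fun l _ =>
      h0 j (by rw [Int.negSucc_eq]; push_cast; simp at hj; lia) l]
    change _ • jet (k + 1) f = _
    rw [jet, Finset.sum_range, smul_smul]
    have : (-((Int.negSucc (k + 1) : ℤ) : ℂ) - 1) * ((k : ℂ) + 1)⁻¹ = 1 := by
      rw [Int.negSucc_eq]
      push_cast
      have : (k : ℂ) + 1 ≠ 0 := by exact_mod_cast Nat.succ_ne_zero k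
      field_simp
      ring
    rw [this, one_smul]
    refine Finset.sum_congr rfl fun j _ => Finset.sum_congr rfl fun l _ => ?_
    have : Int.negSucc (k + 1) + 1 + (j : ℕ) = Int.negSucc (k - j) := by
      have := j.2
      rw [Int.negSucc_eq, Int.negSucc_eq]
      push_cast [Nat.cast_sub (show (j : ℕ) ≤ k by lia)]
      ring
    rw [this]
    rfl

/-- The recursion expresses the index `n` through indices larger than `n`, so induction descends
from `-1`; the function varies because it gets differentiated. -/
lemma taylor_induction {P : ℤ → A → Prop} (h0 : ∀ n f, 0 ≤ n → P n f) (h1 : ∀ f, P (-1) f)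
    (h2 : ∀ n f, n < -1 → (∀ (j : ℕ) g, P (n + 1 + j) g) → P n f) (n : ℤ) (f : A) : P n f := by
  have key : ∀ (k : ℕ) (n : ℤ), -1 - (k : ℤ) ≤ n → ∀ f, P n f := by
    intro k
    induction k with
    | zero =>
      intro n hn f
      rcases (show -1 ≤ n by simpa using hn).eq_or_lt with h | h
      · rw [← h]; exact h1 f
      · exact h0 n f (by lia)
    | succ k ih =>
      intro n hn f
      by_cases hn' : -1 - (k : ℤ) ≤ n
      · exact ih n hn' f
      · exact h2 n f (by lia) fun j g => ih _ (by push_cast at hn; lia) g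
  exact key (-1 - n).toNat n (by lia) f

lemma smul_left_cancel_of_lt {n : ℤ} (hn : n < -1) {W : Type*} [AddCommGroup W] [Module ℂ W]
    {x y : W} (h : (-(n : ℂ) - 1) • x = (-(n : ℂ) - 1) • y) : x = y := by
  have : (-(n : ℂ) - 1) ≠ 0 := by
    intro h0
    have h1 : ((-n - 1 : ℤ) : ℂ) = 0 := by push_cast; exact h0
    have h2 := Int.cast_eq_zero.1 h1
    lia
  exact smul_right_injective W this h

lemma commute_taylor {X : Module.End ℂ (Fock d A)} (hα : ∀ v, Commute X (createAlpha v))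
    (hf : ∀ f, Commute X (mulFun f)) (n : ℤ) (f : A) : Commute X (taylor n f) := by
  refine taylor_induction (P := fun n f => Commute X (taylor n f)) (fun n f hn => ?_)
    (fun f => ?_) (fun n f hn ih => ?_) n f
  · rw [taylor_of_nonneg hn]
    exact Commute.zero_right X
  · rw [taylor_neg_one]
    exact hf f
  · have : Commute X ((-(n : ℂ) - 1) • taylor n f) := by
      rw [taylor_rec n f (M := (-n - 1).toNat) (by lia)]
      exact Commute.sum_right _ _ _ fun j _ => Commute.sum_right _ _ _ fun l _ =>
        (hα _).mul_right (ih j _)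
    refine smul_left_cancel_of_lt hn ?_
    have := this.eq
    rwa [mul_smul_comm, smul_mul_assoc] at this

lemma commute_createAlpha_taylor (v : BosonVar d) (n : ℤ) (f : A) :
    Commute (createAlpha v) (taylor n f) :=
  commute_taylor (fun _ => commute_createAlpha_createAlpha _ _)
    (fun _ => (commute_mulFun_createAlpha _ _).symm) n f

lemma commute_mulFun_taylor (g : A) (n : ℤ) (f : A) : Commute (mulFun g) (taylor n f) :=
  commute_taylor (fun _ => commute_mulFun_createAlpha _ _)
    (fun _ => commute_mulFun_mulFun _ _) n f


lemma derivGamma_taylor (i : Fin d) [CommPartials A] (n : ℤ) (f : A) :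
    derivGamma i * taylor n f = taylor n f * derivGamma i + taylor n (pd i f) := by
  refine taylor_induction (P := fun n f => derivGamma i * taylor n f =
    taylor n f * derivGamma i + taylor n (pd i f)) (fun n f hn => ?_) (fun f => ?_)
    (fun n f hn ih => ?_) n f
  · simp only [taylor_of_nonneg hn, mul_zero, zero_mul, add_zero]
  · simp only [taylor_neg_one]
    refine end_ext fun m a => ?_
    simp [mulFun, derivGamma, -Finsupp.single_mul, ← Finsupp.single_add, mul_comm a]
  · refine smul_left_cancel_of_lt hn ?_
    rw [smul_add, ← mul_smul_comm, ← smul_mul_assoc,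
      taylor_rec n f (M := (-n - 1).toNat) (by lia),
      taylor_rec n (pd i f) (M := (-n - 1).toNat) (by lia)]
    simp only [Finset.mul_sum, Finset.sum_mul, ← Finset.sum_add_distrib]
    refine Finset.sum_congr rfl fun j _ => Finset.sum_congr rfl fun l _ => ?_
    have : Commute (derivGamma i) (createAlpha (A := A) (l, j)) :=
      end_ext fun m a => by simp [createAlpha_single, derivGamma]
    rw [← mul_assoc, this.eq, mul_assoc, ih, mul_add, mul_assoc, CommPartials.pd_comm]

/-- In `f(γ + ∑ α_(-j) zʲ / j)` the operator `(k+1) ∂/∂αⁱ_(-k-1)` acts as `z^(k+1) ∂/∂γⁱ`, which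
shifts the mode index by `k + 1`. -/
lemma derivAlpha_taylor (i : Fin d) (k : ℕ) [CommPartials A] (n : ℤ) (f : A) :
    (((k : ℂ) + 1) • derivAlpha (i, k)) * taylor n f =
      taylor n f * (((k : ℂ) + 1) • derivAlpha (i, k)) + taylor (n + k + 1) (pd i f) := by
  set X : Module.End ℂ (Fock d A) := ((k : ℂ) + 1) • derivAlpha (i, k) with hX
  refine taylor_induction (P := fun n f => X * taylor n f =
    taylor n f * X + taylor (n + k + 1) (pd i f)) (fun n f hn => ?_) (fun f => ?_)
    (fun n f hn ih => ?_) n f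
  · simp only [taylor_of_nonneg hn, taylor_of_nonneg (show 0 ≤ n + k + 1 by lia), mul_zero,
      zero_mul, add_zero]
  · rw [taylor_neg_one, taylor_of_nonneg (by lia), add_zero, hX]
    exact (((commute_mulFun_derivAlpha f (i, k)).smul_right _).eq).symm
  · refine smul_left_cancel_of_lt hn ?_
    have hα : ∀ l j, X * createAlpha (l, j) = createAlpha (l, j) * X +
        if (i, k) = (l, j) then ((k : ℂ) + 1) • 1 else 0 := fun l j => by
      refine LinearMap.ext fun x => ?_
      simp only [hX, Module.End.mul_apply, LinearMap.smul_apply, derivAlpha_createAlpha,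
        LinearMap.add_apply, smul_add, map_smul]
      split <;> simp
    -- The range has to contain `j = k`, where the derivative meets the `α` written in front in the
    -- recursion.
    set M := max (-n - 1).toNat (k + 1) with hM
    have e := taylor_rec (n + k + 1) (pd i f) (M := M) (by lia)
    rw [smul_add, ← mul_smul_comm, ← smul_mul_assoc, taylor_rec n f (M := M) (by lia)]
    -- Here `-n - 1 = (-(n + k + 1) - 1) + (k + 1)`. The first part is the recursion for `∂f/∂γⁱ`,
    -- the second is accounted for by differentiating the `α` in front.
    have e' : (-(n : ℂ) - 1) • (taylor (n + k + 1) (pd i f) : Module.End ℂ (Fock d A)) =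
        ∑ j ∈ Finset.range M, ∑ l,
          createAlpha (l, j) * taylor (n + k + 1 + 1 + j) (pd l (pd i f)) +
          ((k : ℂ) + 1) • taylor (n + k + 1) (pd i f) := by
      rw [← e]
      push_cast
      module
    rw [e']
    have hs : ∑ j ∈ Finset.range M, ∑ l, (if (i, k) = (l, j) then ((k : ℂ) + 1) •
        (1 : Module.End ℂ (Fock d A)) else 0) * taylor (n + 1 + j) (pd l f) =
        ((k : ℂ) + 1) • taylor (n + k + 1) (pd i f) := by
      rw [Finset.sum_eq_single_of_mem k (by simp [hM]), Finset.sum_eq_single_of_mem i (by simp)]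
      · rw [if_pos rfl, smul_mul_assoc, one_mul, show n + 1 + k = n + k + 1 by ring]
      · intro l _ hl
        rw [if_neg (by simp [Ne.symm hl]), zero_mul]
      · intro j _ hj
        refine Finset.sum_eq_zero fun l _ => ?_
        rw [if_neg (by simp [Ne.symm hj]), zero_mul]
    rw [← hs]
    simp only [Finset.mul_sum, Finset.sum_mul, ← Finset.sum_add_distrib]
    refine Finset.sum_congr rfl fun j _ => Finset.sum_congr rfl fun l _ => ?_
    rw [← mul_assoc, hα, add_mul, mul_assoc, ih, mul_add, mul_assoc, CommPartials.pd_comm,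
      show n + 1 + j + k + 1 = n + k + 1 + 1 + j by ring]
    abel

lemma commute_funOnWord {X : Module.End ℂ (Fock d A)} (hβ : ∀ v, Commute X (createBeta v))
    (hα : ∀ v, Commute X (createAlpha v)) (hf : ∀ f, Commute X (mulFun f))
    (L : List (BosonVar d)) (f : A) (n : ℤ) : Commute X (funOnWord L f n) := by
  induction L generalizing f n with
  | nil => exact commute_taylor hα hf n f
  | cons v L ih =>
    rw [funOnWord]
    refine LinearMap.ext fun x => ?_
    simp only [Module.End.mul_apply, LinearMap.sub_apply, LinearMap.comp_apply, map_sub,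
      commute_apply (hβ v), commute_apply (ih _ _)]

/-- Needed because `funMode` uses the arbitrary ordering `Multiset.toList`. A transposition changes
nothing, since creation operators commute and second partial derivatives are symmetric. -/
lemma funOnWord_perm [CommPartials A] {L L' : List (BosonVar d)} (h : L.Perm L') (f : A) (n : ℤ) :
    (funOnWord L f n : Module.End ℂ (Fock d A)) = funOnWord L' f n := by
  induction h generalizing f n with
  | nil => rfl
  | cons v _ ih => rw [funOnWord, funOnWord, ih, ih]
  | trans _ _ ih ih' => rw [ih, ih']
  | swap v w L =>
    simp only [funOnWord]
    refine LinearMap.ext fun x => ?_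
    simp only [LinearMap.sub_apply, LinearMap.comp_apply, map_sub]
    rw [commute_apply (commute_createBeta_createBeta w v), CommPartials.pd_comm v.1 w.1,
      show n - ((w.2 : ℤ) + 1) - ((v.2 : ℤ) + 1) = n - ((v.2 : ℤ) + 1) - ((w.2 : ℤ) + 1) by ring]
    abel

lemma funMode_single (f : A) (n : ℤ) (m : Mono d) (a : A) :
    funMode f n (Finsupp.single m a) = funOnWord m.1.toList f n (Finsupp.single (0, m.2) a) := by
  simp [funMode]

lemma funMode_stF (f : A) (n : ℤ) (g : A) :
    (funMode f n : Module.End ℂ (Fock d A)) (stF g) = taylor n f (stF g) := by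
  rw [stF, funMode_single]
  simp

lemma funMode_createBeta [CommPartials A] (f : A) (n : ℤ) (v : BosonVar d) (x : Fock d A) :
    funMode f n (createBeta v x) =
      createBeta v (funMode f n x) - funMode (pd v.1 f) (n - (v.2 + 1)) x := by
  have : funMode f n * createBeta v =
      createBeta v * funMode f n - funMode (pd v.1 f) (n - (v.2 + 1)) :=
    end_ext fun m a => by
      simp only [Module.End.mul_apply, LinearMap.sub_apply, createBeta_single, funMode_single]
      have hp : (v ::ₘ m.1).toList.Perm (v :: m.1.toList) := by
        rw [← Multiset.coe_eq_coe, Multiset.coe_toList, ← Multiset.cons_coe, Multiset.coe_toList]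
      rw [funOnWord_perm hp, funOnWord]
      rfl
  exact LinearMap.congr_fun this x

/-- For operators that do not touch the `β` part of a monomial; `hX` expresses that the word of
`β`'s used to compute the function mode stays the same. -/
lemma commute_funMode_of {X : Module.End ℂ (Fock d A)} (hβ : ∀ v, Commute X (createBeta v))
    (hα : ∀ v, Commute X (createAlpha v)) (hf : ∀ f, Commute X (mulFun f))
    (hX : ∀ m a f n, funMode f n (X (Finsupp.single m a)) =
      funOnWord m.1.toList f n (X (Finsupp.single (0, m.2) a))) (f : A) (n : ℤ) :
    Commute X (funMode f n) :=
  end_ext fun m a => by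
    rw [Module.End.mul_apply, Module.End.mul_apply, funMode_single,
      commute_apply (commute_funOnWord hβ hα hf _ _ _), hX]

lemma commute_createAlpha_funMode (v : BosonVar d) (f : A) (n : ℤ) :
    Commute (createAlpha v) (funMode f n) :=
  commute_funMode_of (fun _ => (commute_createBeta_createAlpha _ _).symm)
    (fun _ => commute_createAlpha_createAlpha _ _) (fun _ => (commute_mulFun_createAlpha _ _).symm)
    (fun m a f n => by simp only [createAlpha_single, funMode_single]) f n

lemma commute_createFermion_funMode (v : FermionVar d) (f : A) (n : ℤ) :
    Commute (createFermion v) (funMode f n) :=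
  commute_funMode_of (fun _ => (commute_createBeta_createFermion _ _).symm)
    (fun _ => (commute_createAlpha_createFermion _ _).symm)
    (fun _ => (commute_mulFun_createFermion _ _).symm)
    (fun m a f n => by
      simp only [createFermion_single]
      split
      · simp
      · simp only [map_smul, funMode_single]) f n

lemma commute_mulFun_funMode (g f : A) (n : ℤ) :
    Commute (mulFun g : Module.End ℂ (Fock d A)) (funMode f n) :=
  commute_funMode_of (fun _ => commute_mulFun_createBeta _ _)
    (fun _ => commute_mulFun_createAlpha _ _) (fun _ => commute_mulFun_mulFun _ _)
    (fun m a f n => by simp only [mulFun_single, funMode_single]) f n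

lemma commute_funMode_taylor (g : A) (m : ℤ) (n : ℤ) (f : A) :
    Commute (funMode g m : Module.End ℂ (Fock d A)) (taylor n f) :=
  commute_taylor (fun _ => (commute_createAlpha_funMode _ _ _).symm)
    (fun _ => (commute_mulFun_funMode _ _ _).symm) n f

variable [CommPartials A]

/-- Commutators `[X, f_n]` with function modes can be computed on functions. -/
lemma funMode_bracket {X : Module.End ℂ (Fock d A)} (T : A → ℤ → Module.End ℂ (Fock d A))
    (s : ℂ) (hF : ∀ f n g, X (funMode f n (stF g)) = funMode f n (X (stF g)) + T f n (stF g))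
    (hβ : ∀ v, ∃ Z : Module.End ℂ (Fock d A),
      (∀ x, X (createBeta v x) = createBeta v (X x) + Z x) ∧ ∀ f n x, T f n (createBeta v x) =
        createBeta v (T f n x) - T (pd v.1 f) (n - (v.2 + 1)) x +
          (Z (funMode f n x) - funMode f n (Z x)))
    (hα : ∀ v, ∃ Z : Module.End ℂ (Fock d A), (∀ f n, Commute Z (funMode f n)) ∧
      ∀ x, X (createAlpha v x) = createAlpha v (X x) + Z x)
    (hφ : ∀ v, ∃ Z : Module.End ℂ (Fock d A), (∀ f n, Commute Z (funMode f n)) ∧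
      ∀ x, X (createFermion v x) = s • createFermion v (X x) + Z x)
    (hTα : ∀ f n v x, T f n (createAlpha v x) = createAlpha v (T f n x))
    (hTφ : ∀ f n v x, T f n (createFermion v x) = s • createFermion v (T f n x))
    (f : A) (n : ℤ) (x : Fock d A) : X (funMode f n x) = funMode f n (X x) + T f n x := by
  have := family_eq_zero (fun i : A × ℤ => X * funMode i.1 i.2 - funMode i.1 i.2 * X - T i.1 i.2)
    (fun i g => ?_) (fun i v x h => ?_) (fun i v x h => ?_) (fun i v x h => ?_) (f, n)
  · have := LinearMap.congr_fun this x
    simp only [LinearMap.sub_apply, Module.End.mul_apply, LinearMap.zero_apply] at this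
    rw [sub_sub] at this
    exact sub_eq_zero.1 this
  · simp only [LinearMap.sub_apply, Module.End.mul_apply, hF]
    abel
  all_goals
    simp only [LinearMap.sub_apply, Module.End.mul_apply] at h ⊢
    replace h : ∀ f n, X (funMode f n x) = funMode f n (X x) + T f n x := fun f n => by
      rw [← sub_eq_zero, ← h (f, n)]
      abel
  · obtain ⟨Z, e, hTβ⟩ := hβ v
    simp only [funMode_createBeta, map_sub, e, h, map_add, hTβ]
    abel
  · obtain ⟨Z, hZ, e⟩ := hα v
    simp only [← commute_apply (commute_createAlpha_funMode (A := A) _ _ _), e, h, map_add, hTα,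
      commute_apply (hZ _ _)]
    abel
  · obtain ⟨Z, hZ, e⟩ := hφ v
    simp only [← commute_apply (commute_createFermion_funMode (A := A) _ _ _), e, h, map_add, hTφ,
      commute_apply (hZ _ _), map_smul, smul_add]
    abel

end FunModes

/-! ### Commutators of the modes of `β`, `α`, `b`, `c`. -/

section ModeRelations

variable {d : ℕ} {A : Type*} [CommRing A] [Algebra ℂ A] [Partials d A]

lemma parityOp_parityOp (x : Fock d A) : parityOp (parityOp x) = x := by
  have : parityOp * parityOp = (1 : Module.End ℂ (Fock d A)) := end_ext fun m a => by
    simp only [Module.End.mul_apply, parityOp_single, map_smul, smul_smul, ← mul_pow]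
    simp
  exact LinearMap.congr_fun this x

lemma commute_parityOp_createBeta (v : BosonVar d) :
    Commute (parityOp : Module.End ℂ (Fock d A)) (createBeta v) :=
  end_ext fun m a => by simp [parityOp_single, createBeta_single]

lemma commute_parityOp_createAlpha (v : BosonVar d) :
    Commute (parityOp : Module.End ℂ (Fock d A)) (createAlpha v) :=
  end_ext fun m a => by simp [parityOp_single, createAlpha_single]

lemma commute_parityOp_mulFun (f : A) :
    Commute (parityOp : Module.End ℂ (Fock d A)) (mulFun f) :=
  end_ext fun m a => by
    simp [parityOp_single, mulFun_single, -Finsupp.single_mul, -Finsupp.smul_single]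

lemma commute_parityOp_derivBeta (v : BosonVar d) :
    Commute (parityOp : Module.End ℂ (Fock d A)) (derivBeta v) :=
  end_ext fun m a => by
    simp only [Module.End.mul_apply, parityOp_single, derivBeta_single, map_smul]
    rw [smul_comm]

lemma commute_parityOp_derivAlpha (v : BosonVar d) :
    Commute (parityOp : Module.End ℂ (Fock d A)) (derivAlpha v) :=
  end_ext fun m a => by
    simp only [Module.End.mul_apply, parityOp_single, derivAlpha_single, map_smul]
    rw [smul_comm]

lemma derivGamma_single (i : Fin d) (m : Mono d) (a : A) :
    derivGamma i (Finsupp.single m a) = Finsupp.single m (pd i a) := by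
  simp [derivGamma]

lemma commute_parityOp_derivGamma (i : Fin d) :
    Commute (parityOp : Module.End ℂ (Fock d A)) (derivGamma i) :=
  end_ext fun m a => by
    simp only [Module.End.mul_apply, parityOp_single, derivGamma_single, map_smul]

lemma parityOp_createFermion (v : FermionVar d) (x : Fock d A) :
    parityOp (createFermion v x) = -createFermion v (parityOp x) := by
  have : parityOp ∘ₗ createFermion v =
      -(createFermion v ∘ₗ parityOp : Module.End ℂ (Fock d A)) := end_ext fun m a => by
    simp only [LinearMap.comp_apply, LinearMap.neg_apply, parityOp_single, createFermion_single,
      map_smul]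
    by_cases h : v ∈ m.2.2
    · simp [h]
    · simp only [h, if_false, map_smul, parityOp_single, Finset.card_insert_of_notMem h, pow_succ,
        smul_smul, ← neg_smul]
      congr 1
      ring
  exact LinearMap.congr_fun this x

lemma parityOp_derivFermion (v : FermionVar d) (x : Fock d A) :
    parityOp (derivFermion v x) = -derivFermion v (parityOp x) := by
  have : parityOp ∘ₗ derivFermion v =
      -(derivFermion v ∘ₗ parityOp : Module.End ℂ (Fock d A)) := end_ext fun m a => by
    simp only [LinearMap.comp_apply, LinearMap.neg_apply, parityOp_single, derivFermion_single,
      map_smul]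
    by_cases h : v ∈ m.2.2
    · simp only [h, if_true, map_smul, parityOp_single, smul_smul, ← neg_smul]
      congr 1
      rw [← Finset.card_erase_add_one h, pow_succ]
      ring
    · simp [h]
  exact LinearMap.congr_fun this x

lemma parityOp_stF (f : A) : parityOp (stF f : Fock d A) = stF f := by
  rw [stF, parityOp_single]
  simp

lemma commute_derivGamma_createBeta (i : Fin d) (v : BosonVar d) :
    Commute (derivGamma i : Module.End ℂ (Fock d A)) (createBeta v) :=
  end_ext fun m a => by simp [derivGamma_single, createBeta_single]

lemma commute_derivGamma_createAlpha (i : Fin d) (v : BosonVar d) :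
    Commute (derivGamma i : Module.End ℂ (Fock d A)) (createAlpha v) :=
  end_ext fun m a => by simp [derivGamma_single, createAlpha_single]

lemma commute_derivGamma_derivBeta (i : Fin d) (v : BosonVar d) :
    Commute (derivGamma i : Module.End ℂ (Fock d A)) (derivBeta v) :=
  end_ext fun m a => by
    simp only [Module.End.mul_apply, derivGamma_single, derivBeta_single, map_smul]

lemma commute_derivGamma_derivAlpha (i : Fin d) (v : BosonVar d) :
    Commute (derivGamma i : Module.End ℂ (Fock d A)) (derivAlpha v) :=
  end_ext fun m a => by
    simp only [Module.End.mul_apply, derivGamma_single, derivAlpha_single, map_smul]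

lemma commute_derivGamma_createFermion (i : Fin d) (v : FermionVar d) :
    Commute (derivGamma i : Module.End ℂ (Fock d A)) (createFermion v) :=
  end_ext fun m a => by
    by_cases h : v ∈ m.2.2
    · simp [derivGamma_single, createFermion_single, h]
    · simp only [Module.End.mul_apply, derivGamma_single, createFermion_single, h, if_false,
        map_smul]

lemma commute_derivGamma_derivFermion (i : Fin d) (v : FermionVar d) :
    Commute (derivGamma i : Module.End ℂ (Fock d A)) (derivFermion v) :=
  end_ext fun m a => by
    by_cases h : v ∈ m.2.2
    · simp only [Module.End.mul_apply, derivGamma_single, derivFermion_single, h, if_true,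
        map_smul]
    · simp [derivGamma_single, derivFermion_single, h]

lemma commute_derivGamma_derivGamma [CommPartials A] (i j : Fin d) :
    Commute (derivGamma i : Module.End ℂ (Fock d A)) (derivGamma j) :=
  end_ext fun m a => by simp [derivGamma_single, CommPartials.pd_comm i j]

lemma commute_betaMode {X : Module.End ℂ (Fock d A)} (hc : ∀ v, Commute X (createBeta v))
    (hγ : ∀ i, Commute X (derivGamma i)) (hd : ∀ v, Commute X (derivAlpha v)) (i : Fin d) (n : ℤ) :
    Commute X (betaMode i n) :=
  match n with
  | .negSucc k => hc _
  | .ofNat 0 => hγ i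
  | .ofNat (k + 1) => (hd _).smul_right _

lemma commute_alphaMode {X : Module.End ℂ (Fock d A)} (hc : ∀ v, Commute X (createAlpha v))
    (hd : ∀ v, Commute X (derivBeta v)) (i : Fin d) (n : ℤ) : Commute X (alphaMode i n) :=
  match n with
  | .negSucc k => hc _
  | .ofNat 0 => Commute.zero_right _
  | .ofNat (k + 1) => (hd _).smul_right _

lemma commute_bMode {X : Module.End ℂ (Fock d A)} (hc : ∀ v, Commute X (createFermion v))
    (hd : ∀ v, Commute X (derivFermion v)) (i : Fin d) (n : ℤ) : Commute X (bMode i n) :=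
  match n with
  | .negSucc k => hc _
  | .ofNat k => hd _

lemma commute_cMode {X : Module.End ℂ (Fock d A)} (hc : ∀ v, Commute X (createFermion v))
    (hd : ∀ v, Commute X (derivFermion v)) (i : Fin d) (n : ℤ) : Commute X (cMode i n) :=
  match n with
  | .negSucc k => hc _
  | .ofNat k => hd _

lemma commute_betaMode_createFermion (i : Fin d) (n : ℤ) (v : FermionVar d) :
    Commute (betaMode i n : Module.End ℂ (Fock d A)) (createFermion v) :=
  (commute_betaMode (fun _ => (commute_createBeta_createFermion _ _).symm)
    (fun _ => (commute_derivGamma_createFermion _ _).symm)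
    (fun _ => (commute_derivAlpha_createFermion _ _).symm) i n).symm

lemma commute_betaMode_derivFermion (i : Fin d) (n : ℤ) (v : FermionVar d) :
    Commute (betaMode i n : Module.End ℂ (Fock d A)) (derivFermion v) :=
  (commute_betaMode (fun _ => commute_derivFermion_createBeta _ _)
    (fun _ => (commute_derivGamma_derivFermion _ _).symm)
    (fun _ => (commute_derivAlpha_derivFermion _ _).symm) i n).symm

lemma commute_alphaMode_createFermion (i : Fin d) (n : ℤ) (v : FermionVar d) :
    Commute (alphaMode i n : Module.End ℂ (Fock d A)) (createFermion v) :=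
  (commute_alphaMode (fun _ => (commute_createAlpha_createFermion _ _).symm)
    (fun _ => (commute_derivBeta_createFermion _ _).symm) i n).symm

lemma commute_alphaMode_derivFermion (i : Fin d) (n : ℤ) (v : FermionVar d) :
    Commute (alphaMode i n : Module.End ℂ (Fock d A)) (derivFermion v) :=
  (commute_alphaMode (fun _ => commute_derivFermion_createAlpha _ _)
    (fun _ => (commute_derivBeta_derivFermion _ _).symm) i n).symm

lemma commute_betaMode_bMode (i j : Fin d) (m n : ℤ) :
    Commute (betaMode i m : Module.End ℂ (Fock d A)) (bMode j n) :=
  commute_bMode (commute_betaMode_createFermion i m) (commute_betaMode_derivFermion i m) j n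

lemma commute_betaMode_cMode (i j : Fin d) (m n : ℤ) :
    Commute (betaMode i m : Module.End ℂ (Fock d A)) (cMode j n) :=
  commute_cMode (commute_betaMode_createFermion i m) (commute_betaMode_derivFermion i m) j n

lemma commute_alphaMode_bMode (i j : Fin d) (m n : ℤ) :
    Commute (alphaMode i m : Module.End ℂ (Fock d A)) (bMode j n) :=
  commute_bMode (commute_alphaMode_createFermion i m) (commute_alphaMode_derivFermion i m) j n

lemma commute_alphaMode_cMode (i j : Fin d) (m n : ℤ) :
    Commute (alphaMode i m : Module.End ℂ (Fock d A)) (cMode j n) :=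
  commute_cMode (commute_alphaMode_createFermion i m) (commute_alphaMode_derivFermion i m) j n

lemma commute_betaMode_betaMode [CommPartials A] (i j : Fin d) (m n : ℤ) :
    Commute (betaMode i m : Module.End ℂ (Fock d A)) (betaMode j n) :=
  commute_betaMode
    (fun v => (commute_betaMode (fun w => commute_createBeta_createBeta v w)
      (fun _ => (commute_derivGamma_createBeta _ _).symm)
      (fun _ => (commute_derivAlpha_createBeta _ _).symm) i m).symm)
    (fun l => (commute_betaMode (fun w => commute_derivGamma_createBeta _ _)
      (fun _ => commute_derivGamma_derivGamma _ _)
      (fun _ => commute_derivGamma_derivAlpha _ _) i m).symm)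
    (fun v => (commute_betaMode (fun w => commute_derivAlpha_createBeta _ _)
      (fun _ => (commute_derivGamma_derivAlpha _ _).symm)
      (fun _ => commute_derivAlpha_derivAlpha _ _) i m).symm) j n

lemma commute_alphaMode_alphaMode (i j : Fin d) (m n : ℤ) :
    Commute (alphaMode i m : Module.End ℂ (Fock d A)) (alphaMode j n) :=
  commute_alphaMode
    (fun v => (commute_alphaMode (fun w => commute_createAlpha_createAlpha v w)
      (fun _ => (commute_derivBeta_createAlpha _ _).symm) i m).symm)
    (fun v => (commute_alphaMode (fun w => commute_derivBeta_createAlpha _ _)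
      (fun _ => commute_derivBeta_derivBeta _ _) i m).symm) j n

/-- This is the expansion `βⁱ(z) αʲ(w) ∼ δᵢⱼ (z - w)⁻²`. By the signs of the indices, only a
creation operator facing its own partial derivative contributes. -/
lemma betaMode_alphaMode (i j : Fin d) (m n : ℤ) (x : Fock d A) :
    betaMode i m (alphaMode j n x) = alphaMode j n (betaMode i m x) +
      if i = j ∧ m + n = 0 then (m : ℂ) • x else 0 := by
  match m, n with
  | .negSucc k, .negSucc l =>
    rw [if_neg (by rintro ⟨-, h⟩; rw [Int.negSucc_eq] at h; simp at h; lia), add_zero]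
    exact commute_apply (commute_createBeta_createAlpha _ _) x
  | .negSucc k, .ofNat 0 =>
    rw [if_neg (by rintro ⟨-, h⟩; rw [Int.negSucc_eq] at h; simp at h; lia), add_zero]
    exact map_zero _
  | .negSucc k, .ofNat (l + 1) =>
    have e : (i = j ∧ Int.negSucc k + Int.ofNat (l + 1) = 0) ↔ ((j, l) = (i, k)) := by
      simp [Int.negSucc_eq]; lia
    simp only [e]
    change createBeta (i, k) (((l : ℂ) + 1) • derivBeta (j, l) x) =
      ((l : ℂ) + 1) • derivBeta (j, l) (createBeta (i, k) x) + _
    rw [derivBeta_createBeta, map_smul, smul_add, add_assoc, left_eq_add]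
    split
    · rename_i h
      rw [← (Prod.mk.inj h).2, ← add_smul]
      simp
    · simp
  | .ofNat 0, .negSucc l =>
    rw [if_neg (by rintro ⟨-, h⟩; rw [Int.negSucc_eq] at h; simp at h; lia), add_zero]
    exact commute_apply (commute_derivGamma_createAlpha _ _) x
  | .ofNat 0, .ofNat 0 =>
    change derivGamma i 0 = (0 : Fock d A) + _
    simp
  | .ofNat 0, .ofNat (l + 1) =>
    rw [if_neg (by rintro ⟨-, h⟩; simp at h; lia), add_zero]
    exact commute_apply ((commute_derivGamma_derivBeta _ _).smul_right _) x
  | .ofNat (k + 1), .negSucc l =>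
    have e : (i = j ∧ Int.ofNat (k + 1) + Int.negSucc l = 0) ↔ ((i, k) = (j, l)) := by
      simp [Int.negSucc_eq]; lia
    simp only [e]
    change ((k : ℂ) + 1) • derivAlpha (i, k) (createAlpha (j, l) x) =
      createAlpha (j, l) (((k : ℂ) + 1) • derivAlpha (i, k) x) + _
    rw [derivAlpha_createAlpha, map_smul, smul_add]
    congr 1
    split <;> simp
  | .ofNat (k + 1), .ofNat 0 =>
    rw [if_neg (by rintro ⟨-, h⟩; simp at h; lia), add_zero]
    exact map_zero _
  | .ofNat (k + 1), .ofNat (l + 1) =>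
    rw [if_neg (by rintro ⟨-, h⟩; simp at h; lia), add_zero]
    exact commute_apply
      (((commute_derivBeta_derivAlpha _ _).symm.smul_right _).smul_left _) x

lemma bMode_bMode (i j : Fin d) (m n : ℤ) (x : Fock d A) :
    bMode i m (bMode j n x) = -bMode j n (bMode i m x) := by
  match m, n with
  | .negSucc k, .negSucc l => exact createFermion_createFermion _ _ x
  | .negSucc k, .ofNat l =>
    have := derivFermion_createFermion (cVar j l) (bVar i k) x
    rw [if_neg (by simp), add_zero] at this
    exact (neg_eq_iff_eq_neg.2 this).symm
  | .ofNat k, .negSucc l =>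
    have := derivFermion_createFermion (cVar i k) (bVar j l) x
    rwa [if_neg (by simp), add_zero] at this
  | .ofNat k, .ofNat l => exact derivFermion_derivFermion _ _ x

lemma cMode_cMode (i j : Fin d) (m n : ℤ) (x : Fock d A) :
    cMode i m (cMode j n x) = -cMode j n (cMode i m x) := by
  match m, n with
  | .negSucc k, .negSucc l => exact createFermion_createFermion _ _ x
  | .negSucc k, .ofNat l =>
    have := derivFermion_createFermion (bVar j l) (cVar i k) x
    rw [if_neg (by simp), add_zero] at this
    exact (neg_eq_iff_eq_neg.2 this).symm
  | .ofNat k, .negSucc l =>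
    have := derivFermion_createFermion (bVar i k) (cVar j l) x
    rwa [if_neg (by simp), add_zero] at this
  | .ofNat k, .ofNat l => exact derivFermion_derivFermion _ _ x

lemma bMode_cMode (i j : Fin d) (m n : ℤ) (x : Fock d A) :
    bMode i m (cMode j n x) = -cMode j n (bMode i m x) +
      if i = j ∧ m + n = -1 then x else 0 := by
  match m, n with
  | .negSucc k, .negSucc l =>
    rw [if_neg (by rintro ⟨-, h⟩; rw [Int.negSucc_eq] at h; simp at h; lia), add_zero]
    exact createFermion_createFermion _ _ x
  | .negSucc k, .ofNat l =>
    have e : (i = j ∧ Int.negSucc k + Int.ofNat l = -1) ↔ (bVar j l = bVar i k) := by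
      simp [Int.negSucc_eq]; lia
    simp only [e]
    have := derivFermion_createFermion (bVar j l) (bVar i k) x
    change createFermion (bVar i k) (derivFermion (bVar j l) x) =
      -derivFermion (bVar j l) (createFermion (bVar i k) x) + _
    rw [this]
    abel
  | .ofNat k, .negSucc l =>
    have e : (i = j ∧ Int.ofNat k + Int.negSucc l = -1) ↔ (cVar i k = cVar j l) := by
      simp [Int.negSucc_eq]; lia
    simp only [e]
    exact derivFermion_createFermion (cVar i k) (cVar j l) x
  | .ofNat k, .ofNat l =>
    rw [if_neg (by rintro ⟨-, h⟩; simp at h; lia), add_zero]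
    exact derivFermion_derivFermion _ _ x

/-! ### Commutators with the modes of functions. -/

section FunModeRelations

variable [CommPartials A]

lemma commute_derivBeta_funMode (v : BosonVar d) (f : A) (n : ℤ) :
    Commute (derivBeta v) (funMode f n) := by
  refine LinearMap.ext fun x => ?_
  -- The expected bracket is zero, and the correction `Z` is the contraction of `∂/∂β` with a
  -- creation operator `β`, a scalar.
  have := funMode_bracket (X := derivBeta (A := A) v) (fun _ _ => 0) 1 (fun f n g => ?_)
    (fun w => ⟨if v = w then 1 else 0, fun x => ?_, fun f n x => ?_⟩)
    (fun w => ⟨0, fun _ _ => Commute.zero_left _, fun x => ?_⟩)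
    (fun w => ⟨0, fun _ _ => Commute.zero_left _, fun x => ?_⟩)
    (by simp) (by simp) f n x
  · simpa using this
  · rw [funMode_stF, commute_apply (commute_taylor (fun _ => commute_derivBeta_createAlpha _ _)
      (fun _ => (commute_mulFun_derivBeta _ _).symm) n f)]
    simp
  · rw [derivBeta_createBeta]
    split <;> rfl
  · split <;> simp
  · simp [commute_apply (commute_derivBeta_createAlpha (A := A) _ _)]
  · simp [commute_apply (commute_derivBeta_createFermion (A := A) _ _)]

lemma commute_derivFermion_funMode (v : FermionVar d) (f : A) (n : ℤ) :
    Commute (derivFermion v) (funMode f n) := by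
  refine LinearMap.ext fun x => ?_
  have := funMode_bracket (X := derivFermion (A := A) v) (fun _ _ => 0) (-1) (fun f n g => ?_)
    (fun w => ⟨0, fun x => ?_, fun f n x => ?_⟩)
    (fun w => ⟨0, fun _ _ => Commute.zero_left _, fun x => ?_⟩)
    (fun w => ⟨if v = w then 1 else 0, fun _ _ => ?_, fun x => ?_⟩)
    (by simp) (by simp) f n x
  · simpa using this
  · rw [funMode_stF, commute_apply (commute_taylor (fun _ => commute_derivFermion_createAlpha _ _)
      (fun _ => (commute_mulFun_derivFermion _ _).symm) n f)]
    simp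
  · simp [commute_apply (commute_derivFermion_createBeta (A := A) _ _)]
  · simp
  · simp [commute_apply (commute_derivFermion_createAlpha (A := A) _ _)]
  · split
    · exact Commute.one_left _
    · exact Commute.zero_left _
  · rw [derivFermion_createFermion]
    split <;> simp

/-- This is the expansion `βⁱ(z) f(w) ∼ (∂f/∂γⁱ)(w) (z - w)⁻¹`. For `m < 0` it is how `funMode` was
built. For `m = 0` and `m > 0` it holds on functions by `derivGamma_taylor` and `derivAlpha_taylor`
and spreads along creation operators. -/
lemma betaMode_funMode (i : Fin d) (m : ℤ) (f : A) (n : ℤ) (x : Fock d A) :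
    betaMode i m (funMode f n x) = funMode f n (betaMode i m x) + funMode (pd i f) (m + n) x := by
  match m with
  | .negSucc k =>
    change createBeta (i, k) (funMode f n x) = funMode f n (createBeta (i, k) x) + _
    rw [funMode_createBeta, show n - ((k : ℤ) + 1) = Int.negSucc k + n by
      rw [Int.negSucc_eq]; ring]
    simp
  | .ofNat 0 =>
    change derivGamma i _ = _
    rw [show Int.ofNat 0 + n = n by simp]
    refine funMode_bracket (X := derivGamma (A := A) i) (fun f n => funMode (pd i f) n) 1
      (fun f n g => ?_) (fun w => ⟨0, fun x => ?_, fun f n x => ?_⟩)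
      (fun w => ⟨0, fun _ _ => Commute.zero_left _, fun x => ?_⟩)
      (fun w => ⟨0, fun _ _ => Commute.zero_left _, fun x => ?_⟩)
      (fun f n v x => ?_) (fun f n v x => ?_) f n x
    · have e : derivGamma i (stF g) = stF (pd i g) := derivGamma_single i _ g
      rw [funMode_stF, funMode_stF, e, funMode_stF, ← e]
      exact LinearMap.congr_fun (derivGamma_taylor i n f) _
    · simp [commute_apply (commute_derivGamma_createBeta (A := A) _ _)]
    · simp [funMode_createBeta, CommPartials.pd_comm i]
    · simp [commute_apply (commute_derivGamma_createAlpha (A := A) _ _)]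
    · simp [commute_apply (commute_derivGamma_createFermion (A := A) _ _)]
    · exact (commute_apply (commute_createAlpha_funMode _ _ _) x).symm
    · rw [one_smul]
      exact (commute_apply (commute_createFermion_funMode _ _ _) x).symm
  | .ofNat (k + 1) =>
    change (((k : ℂ) + 1) • derivAlpha (i, k)) _ =
      funMode f n ((((k : ℂ) + 1) • derivAlpha (i, k)) x) + _
    rw [show Int.ofNat (k + 1) + n = n + k + 1 by simp; ring]
    refine funMode_bracket (X := ((k : ℂ) + 1) • derivAlpha (A := A) (i, k))
      (fun f n => funMode (pd i f) (n + k + 1)) 1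
      (fun f n g => ?_) (fun w => ⟨0, fun x => ?_, fun f n x => ?_⟩)
      (fun w => ⟨if (i, k) = w then ((k : ℂ) + 1) • 1 else 0, fun _ _ => ?_, fun x => ?_⟩)
      (fun w => ⟨0, fun _ _ => Commute.zero_left _, fun x => ?_⟩)
      (fun f n v x => ?_) (fun f n v x => ?_) f n x
    · have e := LinearMap.congr_fun (derivAlpha_taylor i k n f) (stF g)
      rw [funMode_stF, funMode_stF]
      refine e.trans ?_
      simp
    · simp [commute_apply (commute_derivAlpha_createBeta (A := A) _ _)]
    · simp only [funMode_createBeta, CommPartials.pd_comm i, LinearMap.zero_apply, map_zero,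
        sub_self, add_zero]
      rw [show n + k + 1 - ((w.2 : ℤ) + 1) = n - (w.2 + 1) + k + 1 by ring]
    · split
      · exact (Commute.one_left _).smul_left _
      · exact Commute.zero_left _
    · simp only [LinearMap.smul_apply, derivAlpha_createAlpha, smul_add, map_smul]
      split <;> simp
    · simp [commute_apply (commute_derivAlpha_createFermion (A := A) _ _)]
    · exact (commute_apply (commute_createAlpha_funMode _ _ _) x).symm
    · rw [one_smul]
      exact (commute_apply (commute_createFermion_funMode _ _ _) x).symm

lemma commute_alphaMode_funMode (i : Fin d) (m : ℤ) (f : A) (n : ℤ) :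
    Commute (alphaMode i m) (funMode f n) :=
  (commute_alphaMode (fun _ => (commute_createAlpha_funMode _ _ _).symm)
    (fun _ => (commute_derivBeta_funMode _ _ _).symm) i m).symm

lemma commute_bMode_funMode (i : Fin d) (m : ℤ) (f : A) (n : ℤ) :
    Commute (bMode i m) (funMode f n) :=
  (commute_bMode (fun _ => (commute_createFermion_funMode _ _ _).symm)
    (fun _ => (commute_derivFermion_funMode _ _ _).symm) i m).symm

lemma commute_cMode_funMode (i : Fin d) (m : ℤ) (f : A) (n : ℤ) :
    Commute (cMode i m) (funMode f n) :=
  (commute_cMode (fun _ => (commute_createFermion_funMode _ _ _).symm)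
    (fun _ => (commute_derivFermion_funMode _ _ _).symm) i m).symm

/-- Passing a `β` differentiates one of the two functions and shifts its mode, so the induction must
treat all functions and modes simultaneously. -/
lemma commute_funMode_funMode (f g : A) (m n : ℤ) :
    Commute (funMode f m : Module.End ℂ (Fock d A)) (funMode g n) := by
  have := family_eq_zero (fun i : (A × ℤ) × (A × ℤ) =>
    (funMode i.1.1 i.1.2 * funMode i.2.1 i.2.2 - funMode i.2.1 i.2.2 * funMode i.1.1 i.1.2 :
      Module.End ℂ (Fock d A))) (fun i h => ?_) (fun i v x h => ?_) (fun i v x h => ?_)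
      (fun i v x h => ?_) ((f, m), (g, n))
  · exact sub_eq_zero.1 this
  all_goals simp only [LinearMap.sub_apply, Module.End.mul_apply]
  · have key : ∀ (f : A) (m : ℤ) (g : A) (n : ℤ), funMode f m (funMode g n (stF h)) =
        taylor n g (taylor m f (stF h)) := fun f m g n => by
      rw [funMode_stF, commute_apply (commute_funMode_taylor _ _ _ _), funMode_stF]
    rw [key, key, commute_apply (commute_taylor (fun _ => (commute_createAlpha_taylor _ _ _).symm)
        (fun _ => (commute_mulFun_taylor _ _ _).symm) _ _), sub_self]
  all_goals
    simp only [LinearMap.sub_apply, Module.End.mul_apply] at h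
    replace h : ∀ f m g n, funMode f m (funMode g n x) = funMode g n (funMode f m x) :=
      fun f m g n => sub_eq_zero.1 (h ((f, m), (g, n)))
  · simp only [funMode_createBeta, map_sub, h i.1.1 i.1.2 i.2.1 i.2.2,
      h i.1.1 i.1.2 (pd v.1 i.2.1), h (pd v.1 i.1.1) _ i.2.1]
    abel
  · simp only [← commute_apply (commute_createAlpha_funMode (A := A) _ _ _), h i.1.1, sub_self]
  · simp only [← commute_apply (commute_createFermion_funMode (A := A) _ _ _), h i.1.1, sub_self]

lemma commute_parityOp_funMode (f : A) (n : ℤ) :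
    Commute (parityOp : Module.End ℂ (Fock d A)) (funMode f n) := by
  refine LinearMap.ext fun x => ?_
  have := funMode_bracket (X := parityOp (A := A)) (fun _ _ => 0) (-1) (fun f n g => ?_)
    (fun w => ⟨0, fun x => ?_, fun f n x => ?_⟩)
    (fun w => ⟨0, fun _ _ => Commute.zero_left _, fun x => ?_⟩)
    (fun w => ⟨0, fun _ _ => Commute.zero_left _, fun x => ?_⟩)
    (by simp) (by simp) f n x
  · simpa using this
  · rw [funMode_stF, commute_apply (commute_taylor (fun _ => commute_parityOp_createAlpha _)
      (fun _ => commute_parityOp_mulFun _) n f), parityOp_stF, funMode_stF]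
    simp
  · simp [commute_apply (commute_parityOp_createBeta (A := A) _)]
  · simp
  · simp [commute_apply (commute_parityOp_createAlpha (A := A) _)]
  · simp [parityOp_createFermion]

end FunModeRelations

lemma parityOp_bMode (i : Fin d) (n : ℤ) (x : Fock d A) :
    parityOp (bMode i n x) = -bMode i n (parityOp x) :=
  match n with
  | .negSucc _ => parityOp_createFermion _ x
  | .ofNat _ => parityOp_derivFermion _ x

lemma parityOp_cMode (i : Fin d) (n : ℤ) (x : Fock d A) :
    parityOp (cMode i n x) = -cMode i n (parityOp x) :=
  match n with
  | .negSucc _ => parityOp_createFermion _ x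
  | .ofNat _ => parityOp_derivFermion _ x

lemma commute_parityOp_betaMode (i : Fin d) (n : ℤ) :
    Commute (parityOp : Module.End ℂ (Fock d A)) (betaMode i n) :=
  commute_betaMode commute_parityOp_createBeta commute_parityOp_derivGamma
    commute_parityOp_derivAlpha i n

lemma commute_parityOp_alphaMode (i : Fin d) (n : ℤ) :
    Commute (parityOp : Module.End ℂ (Fock d A)) (alphaMode i n) :=
  commute_alphaMode commute_parityOp_createAlpha commute_parityOp_derivBeta i n

end ModeRelations

/-! ## Generating fields: locality and translation covariance -/

section Generators

/-- Labels of the generating fields. -/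
inductive Gen (d : ℕ) (A : Type*)
  | beta (i : Fin d)
  | alpha (i : Fin d)
  | b (i : Fin d)
  | c (i : Fin d)
  | fn (f : A)

variable {d : ℕ} {A : Type*} [CommRing A] [Algebra ℂ A] [Partials d A]

/-- The generating field with a given label. -/
def Gen.field : Gen d A → VertexOperator ℂ (Fock d A)
  | .beta i => betaField i
  | .alpha i => alphaField i
  | .b i => bField i
  | .c i => cField i
  | .fn f => funField f

/-- The parity of a generating field. -/
def Gen.par : Gen d A → ℕ
  | .beta _ => 0
  | .alpha _ => 0
  | .b _ => 1
  | .c _ => 1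
  | .fn _ => 0

@[simp] lemma betaField_ncoeff (i : Fin d) (n : ℤ) :
    (betaField i : VertexOperator ℂ (Fock d A))[[n]] = betaMode i n :=
  fieldOfModes_ncoeff _ (exists_betaMode_eq_zero i) n

@[simp] lemma alphaField_ncoeff (i : Fin d) (n : ℤ) :
    (alphaField i : VertexOperator ℂ (Fock d A))[[n]] = alphaMode i n :=
  fieldOfModes_ncoeff _ (exists_alphaMode_eq_zero i) n

@[simp] lemma bField_ncoeff (i : Fin d) (n : ℤ) :
    (bField i : VertexOperator ℂ (Fock d A))[[n]] = bMode i n :=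
  fieldOfModes_ncoeff _ (exists_bMode_eq_zero i) n

@[simp] lemma cField_ncoeff (i : Fin d) (n : ℤ) :
    (cField i : VertexOperator ℂ (Fock d A))[[n]] = cMode i n :=
  fieldOfModes_ncoeff _ (exists_cMode_eq_zero i) n

section LocalityCriteria

variable {V : Type*} [AddCommGroup V] [Module ℂ V]

lemma loc_of_commute {B C : VertexOperator ℂ V} (h : ∀ l m : ℤ, Commute (B[[l]]) (C[[m]])) :
    Loc 1 B C := ⟨0, by
  ext l m x
  rw [pow_zero, Module.End.one_apply, fcomm_apply, commute_apply (h l m)]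
  simp⟩

lemma loc_of_anticommute {B C : VertexOperator ℂ V}
    (h : ∀ (l m : ℤ) x, (B[[l]]) ((C[[m]]) x) = -(C[[m]]) ((B[[l]]) x)) : Loc (-1) B C := ⟨0, by
  ext l m x
  rw [pow_zero, Module.End.one_apply, fcomm_apply, h]
  simp⟩

/-- Such a commutator is a field times the delta distribution, which `z - w` kills. -/
lemma loc_of_fcomm_add {s : ℂ} {B C : VertexOperator ℂ V} (T : ℤ → Module.End ℂ V)
    (h : ∀ (l m : ℤ), fcomm s B C l m = T (l + m)) : Loc s B C := ⟨1, by
  ext l m x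
  rw [pow_one, dzw_apply, h, h, show l + 1 + m = l + (m + 1) by ring, sub_self]
  rfl⟩

/-- The factor `l` turns the delta distribution into a derivative of it, so the second power of `z -
w` is needed. -/
lemma loc_of_fcomm_mul_add {s : ℂ} {B C : VertexOperator ℂ V} (T : ℤ → Module.End ℂ V)
    (h : ∀ (l m : ℤ), fcomm s B C l m = (l : ℂ) • T (l + m)) : Loc s B C := ⟨2, by
  ext l m x
  simp only [dzw_pow_succ, pow_zero, Module.End.one_apply, dzw_apply, h]
  rw [show l + 1 + 1 + m = l + m + 2 by ring, show l + 1 + (m + 1) = l + m + 2 by ring,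
    show l + (m + 1 + 1) = l + m + 2 by ring, ← sub_smul, ← sub_smul, ← sub_smul]
  push_cast
  ring_nf
  simp⟩

end LocalityCriteria

lemma loc_betaField_alphaField (i j : Fin d) :
    Loc 1 (betaField i : VertexOperator ℂ (Fock d A)) (alphaField j) := by
  refine loc_of_fcomm_mul_add (fun n => if i = j ∧ n = 0 then 1 else 0) fun l m => ?_
  refine LinearMap.ext fun x => ?_
  rw [fcomm_apply, betaField_ncoeff, alphaField_ncoeff, betaMode_alphaMode, one_smul,
    add_sub_cancel_left]
  split <;> simp

lemma loc_bField_cField (i j : Fin d) :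
    Loc (-1) (bField i : VertexOperator ℂ (Fock d A)) (cField j) := by
  refine loc_of_fcomm_add (fun n => if i = j ∧ n = -1 then 1 else 0) fun l m => ?_
  refine LinearMap.ext fun x => ?_
  rw [fcomm_apply, bField_ncoeff, cField_ncoeff, bMode_cMode, neg_one_smul, sub_neg_eq_add,
    add_right_comm, neg_add_cancel, zero_add]
  split <;> simp

lemma loc_betaField_funField [CommPartials A] (i : Fin d) (f : A) :
    Loc 1 (betaField i : VertexOperator ℂ (Fock d A)) (funField f) := by
  refine loc_of_fcomm_add (fun n => funMode (pd i f) n) fun l m => ?_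
  refine LinearMap.ext fun x => ?_
  rw [fcomm_apply, betaField_ncoeff, funField_ncoeff, betaMode_funMode, one_smul,
    add_sub_cancel_left]

lemma Gen.loc [CommPartials A] (g h : Gen d A) :
    Loc ((-1) ^ (g.par * h.par)) g.field h.field := by
  have s1 : (1 : ℂ) * 1 = 1 := one_mul 1
  have s2 : (-1 : ℂ) * -1 = 1 := by norm_num
  cases g <;> cases h <;> simp only [Gen.par, Gen.field, mul_zero, mul_one, pow_zero,
    pow_one]
  · exact loc_of_commute fun l m => by simpa using commute_betaMode_betaMode _ _ _ _
  · exact loc_betaField_alphaField _ _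
  · exact loc_of_commute fun l m => by simpa using commute_betaMode_bMode _ _ _ _
  · exact loc_of_commute fun l m => by simpa using commute_betaMode_cMode _ _ _ _
  · exact loc_betaField_funField _ _
  · exact (loc_betaField_alphaField _ _).symm s1
  · exact loc_of_commute fun l m => by simpa using commute_alphaMode_alphaMode _ _ _ _
  · exact loc_of_commute fun l m => by simpa using commute_alphaMode_bMode _ _ _ _
  · exact loc_of_commute fun l m => by simpa using commute_alphaMode_cMode _ _ _ _
  · exact loc_of_commute fun l m => by simpa using commute_alphaMode_funMode _ _ _ _
  · exact loc_of_commute fun l m => by simpa using (commute_betaMode_bMode _ _ _ _).symm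
  · exact loc_of_commute fun l m => by simpa using (commute_alphaMode_bMode _ _ _ _).symm
  · exact loc_of_anticommute fun l m x => by simpa using bMode_bMode _ _ _ _ x
  · exact loc_bField_cField _ _
  · exact loc_of_commute fun l m => by simpa using commute_bMode_funMode _ _ _ _
  · exact loc_of_commute fun l m => by simpa using (commute_betaMode_cMode _ _ _ _).symm
  · exact loc_of_commute fun l m => by simpa using (commute_alphaMode_cMode _ _ _ _).symm
  · exact (loc_bField_cField _ _).symm s2
  · exact loc_of_anticommute fun l m x => by simpa using cMode_cMode _ _ _ _ x
  · exact loc_of_commute fun l m => by simpa using commute_cMode_funMode _ _ _ _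
  · exact (loc_betaField_funField _ _).symm s1
  · exact loc_of_commute fun l m => by simpa using (commute_alphaMode_funMode _ _ _ _).symm
  · exact loc_of_commute fun l m => by simpa using (commute_bMode_funMode _ _ _ _).symm
  · exact loc_of_commute fun l m => by simpa using (commute_cMode_funMode _ _ _ _).symm
  · exact loc_of_commute fun l m => by simpa using commute_funMode_funMode _ _ _ _

lemma Gen.parityOp_comp [CommPartials A] (g : Gen d A) (n : ℤ) :
    parityOp ∘ₗ (g.field[[n]]) ∘ₗ parityOp = (-1 : ℂ) ^ g.par • (g.field[[n]]) := by
  refine LinearMap.ext fun x => ?_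
  cases g <;> simp only [Gen.par, Gen.field, LinearMap.comp_apply, LinearMap.smul_apply, pow_zero,
    pow_one, one_smul, neg_one_smul]
  · simp [commute_apply (commute_parityOp_betaMode (A := A) _ _), parityOp_parityOp]
  · simp [commute_apply (commute_parityOp_alphaMode (A := A) _ _), parityOp_parityOp]
  · simp [parityOp_bMode, parityOp_parityOp]
  · simp [parityOp_cMode, parityOp_parityOp]
  · simp [commute_apply (commute_parityOp_funMode (A := A) _ _), parityOp_parityOp]

/-- The vacuum vector of the Fock space. -/
lemma vac_eq : (VertexData.vac : Fock d A) = stF 1 := rfl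

lemma Gen.kills_stF (g : Gen d A) {n : ℤ} (hn : 0 < n) (f : A) : (g.field[[n]]) (stF f) = 0 := by
  obtain ⟨k, rfl⟩ : ∃ k : ℕ, n = .ofNat (k + 1) := ⟨(n - 1).toNat, by simp; lia⟩
  cases g
  · simp only [Gen.field, betaField_ncoeff]
    change ((k : ℂ) + 1) • derivAlpha _ (stF f) = 0
    simp
  · simp only [Gen.field, alphaField_ncoeff]
    change ((k : ℂ) + 1) • derivBeta _ (stF f) = 0
    simp
  · simp only [Gen.field, bField_ncoeff]
    exact derivFermion_stF _ _
  · simp only [Gen.field, cField_ncoeff]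
    exact derivFermion_stF _ _
  · simp only [Gen.field, funField_ncoeff]
    rw [funMode_stF, taylor_of_nonneg (by simp; lia)]
    rfl

lemma betaMode_zero_stF (i : Fin d) (f : A) : betaMode i 0 (stF f) = stF (pd i f) :=
  derivGamma_single i _ f

lemma alphaMode_zero (i : Fin d) : (alphaMode i 0 : Module.End ℂ (Fock d A)) = 0 := rfl

lemma bMode_stF (i : Fin d) {n : ℤ} (hn : 0 ≤ n) (f : A) : bMode i n (stF f) = 0 := by
  obtain ⟨k, rfl⟩ := Int.eq_ofNat_of_zero_le hn
  exact derivFermion_stF _ f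

lemma cMode_stF (i : Fin d) {n : ℤ} (hn : 0 ≤ n) (f : A) : cMode i n (stF f) = 0 := by
  obtain ⟨k, rfl⟩ := Int.eq_ofNat_of_zero_le hn
  exact derivFermion_stF _ f

lemma funMode_stF_of_nonneg (g : A) {n : ℤ} (hn : 0 ≤ n) (f : A) :
    funMode g n (stF f : Fock d A) = 0 := by
  rw [funMode_stF, taylor_of_nonneg hn]
  rfl

lemma Gen.kills_vac (g : Gen d A) {n : ℤ} (hn : 0 ≤ n) :
    (g.field[[n]]) (VertexData.vac : Fock d A) = 0 := by
  rcases hn.eq_or_lt with rfl | hn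
  · rw [vac_eq]
    cases g
    · simp only [Gen.field, betaField_ncoeff]
      rw [betaMode_zero_stF, Derivation.map_one_eq_zero]
      exact Finsupp.single_zero _
    · simp [Gen.field, alphaMode_zero]
    · simpa [Gen.field] using bMode_stF _ le_rfl _
    · simpa [Gen.field] using cMode_stF _ le_rfl _
    · simpa [Gen.field] using funMode_stF_of_nonneg _ le_rfl _
  · exact g.kills_stF hn 1

lemma fermionVar_cases {P : FermionVar d → Prop} (hb : ∀ i k, P (bVar i k))
    (hc : ∀ i k, P (cVar i k)) (v : FermionVar d) : P v := by
  obtain ⟨(_ | _), i, k⟩ := v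
  · exact hb i k
  · exact hc i k

/-- The Fock space is generated from the vacuum by the modes of the generating fields. -/
lemma fock_induction_gen {U : Submodule ℂ (Fock d A)} (h1 : VertexData.vac ∈ U)
    (h : ∀ (g : Gen d A) (n : ℤ) x, x ∈ U → (g.field[[n]]) x ∈ U) (x : Fock d A) : x ∈ U := by
  refine fock_induction (fun f => ?_) (fun v x hx => ?_) (fun v x hx => ?_) (fun v => ?_) x
  · have := h (.fn f) (-1) _ h1
    simp only [Gen.field, funField_ncoeff] at this
    rwa [vac_eq, funMode_stF, taylor_neg_one, mulFun_stF, mul_one] at this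
  · have := h (.beta v.1) (Int.negSucc v.2) x hx
    simp only [Gen.field, betaField_ncoeff] at this
    exact this
  · have := h (.alpha v.1) (Int.negSucc v.2) x hx
    simp only [Gen.field, alphaField_ncoeff] at this
    exact this
  · refine fermionVar_cases (P := fun v => ∀ x ∈ U, createFermion v x ∈ U) (fun i k x hx => ?_) (fun i k x hx => ?_) v
    · have := h (.b i) (Int.negSucc k) x hx
      simp only [Gen.field, bField_ncoeff] at this
      exact this
    · have := h (.c i) (Int.negSucc k) x hx
      simp only [Gen.field, cField_ncoeff] at this
      exact this

/-- The uniqueness part of Goddard's theorem: a field that is local with respect to the generating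
fields and kills the vacuum is zero. -/
lemma field_eq_zero_of_loc {B : VertexOperator ℂ (Fock d A)}
    (h : ∀ g : Gen d A, ∃ s, Loc s B g.field) (h1 : ∀ n : ℤ, (B[[n]]) VertexData.vac = 0) :
    B = 0 := by
  have key := fock_induction_gen (U := ⨅ n : ℤ, LinearMap.ker (B[[n]])) (by simpa using h1)
    (fun g m x hx => by
      simp only [Submodule.mem_iInf, LinearMap.mem_ker] at hx ⊢
      obtain ⟨s, hs⟩ := h g
      exact fun n => hs.kills hx n m)
  refine field_ext fun n => LinearMap.ext fun x => ?_
  have := key x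
  simp only [Submodule.mem_iInf, LinearMap.mem_ker] at this
  simpa using this n

/-! ### The translation operator -/

/-- The translation operator, as the zero mode of the conformal vector. -/
def transOp : Module.End ℂ (Fock d A) :=
  ∑ i, (wickMode 1 (betaField i) 0 (alphaField i) 0 +
    wickMode parityOp (cField i) 1 (bField i) 0)

lemma wickMode_bracket {V : Type*} [AddCommGroup V] [Module ℂ V] (τ : Module.End ℂ V)
    (u : VertexOperator ℂ V) (k : ℕ) (B : VertexOperator ℂ V) (n : ℤ) (X : Module.End ℂ V)
    (x : V) : wickMode τ u k B n (X x) - X (wickMode τ u k B n x) =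
      ∑ᶠ j : ℕ, (wickTerm τ u k B n j (X x) - X (wickTerm τ u k B n j x)) := by
  rw [wickMode_apply, wickMode_apply, finsum_sub_distrib (wickTerm_finite τ u k B n _)]
  · congr 1
    exact X.toAddMonoidHom.map_finsum (wickTerm_finite τ u k B n x)
  · exact (wickTerm_finite τ u k B n x).subset fun j hj h => hj (by
      simp only at h ⊢
      rw [h, map_zero])

lemma wickTerm_beta_alpha (i : Fin d) (j : ℕ) (x : Fock d A) :
    wickTerm 1 (betaField i) 0 (alphaField i) 0 j x =
      betaMode i (-1 - j) (alphaMode i j x) + alphaMode i (-1 - j) (betaMode i j x) := by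
  simp [wickTerm]

lemma wickTerm_c_b (i : Fin d) (j : ℕ) (x : Fock d A) :
    wickTerm parityOp (cField i) 1 (bField i) 0 j x =
      ((j : ℂ) + 1) • (cMode i (-2 - j) (bMode i j x) + bMode i (-2 - j) (cMode i j x)) := by
  simp only [wickTerm, LinearMap.smul_apply, LinearMap.add_apply, LinearMap.comp_apply,
    cField_ncoeff, bField_ncoeff, parityOp_bMode, parityOp_parityOp]
  rw [show (1 + j).choose j = j + 1 by
    rw [add_comm, Nat.choose_succ_self_right] ]
  rw [show -(((1 : ℕ) : ℤ) + 1) - (j : ℤ) = -2 - j by push_cast; ring, zero_add,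
    show 0 - (((1 : ℕ) : ℤ) + 1) - (j : ℤ) = -2 - j by push_cast; ring, pow_one, neg_one_smul,
    neg_neg]
  push_cast
  rfl

/-- Separates the `βα` summands from the `cb` summands. A generator of one kind commutes with the
other kind, so in each application one of `y`, `z` is zero. -/
lemma transOp_bracket (X : Module.End ℂ (Fock d A)) (x : Fock d A)
    (y z : Fin d → Fock d A)
    (hy : ∀ i, ∑ᶠ j : ℕ, (betaMode i (-1 - j) (alphaMode i j (X x)) +
        alphaMode i (-1 - j) (betaMode i j (X x)) - X (betaMode i (-1 - j) (alphaMode i j x) +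
        alphaMode i (-1 - j) (betaMode i j x))) = y i)
    (hz : ∀ i, ∑ᶠ j : ℕ, (((j : ℂ) + 1) • (cMode i (-2 - j) (bMode i j (X x)) +
        bMode i (-2 - j) (cMode i j (X x))) - X (((j : ℂ) + 1) • (cMode i (-2 - j) (bMode i j x) +
        bMode i (-2 - j) (cMode i j x)))) = z i) :
    transOp (X x) - X (transOp x) = ∑ i, (y i + z i) := by
  simp only [transOp, LinearMap.sum_apply, LinearMap.add_apply, map_sum, map_add,
    ← Finset.sum_sub_distrib]
  refine Finset.sum_congr rfl fun i _ => ?_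
  rw [← hy, ← hz, add_sub_add_comm, wickMode_bracket, wickMode_bracket]
  simp only [wickTerm_beta_alpha, wickTerm_c_b]

lemma alphaMode_betaMode (i j : Fin d) (m n : ℤ) (x : Fock d A) :
    alphaMode i m (betaMode j n x) = betaMode j n (alphaMode i m x) +
      if i = j ∧ m + n = 0 then (m : ℂ) • x else 0 := by
  rw [betaMode_alphaMode, add_assoc, left_eq_add]
  by_cases h : i = j ∧ m + n = 0
  · obtain ⟨rfl, h⟩ := h
    rw [if_pos ⟨rfl, by lia⟩, if_pos ⟨rfl, h⟩, ← add_smul, add_comm]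
    rw [← Int.cast_add, h]
    simp
  · rw [if_neg (fun h' => h ⟨h'.1.symm, by lia⟩), if_neg h, add_zero]

lemma cMode_bMode (i j : Fin d) (m n : ℤ) (x : Fock d A) :
    cMode i m (bMode j n x) = -bMode j n (cMode i m x) +
      if i = j ∧ m + n = -1 then x else 0 := by
  rw [bMode_cMode]
  have : (j = i ∧ n + m = -1) ↔ (i = j ∧ m + n = -1) := by
    rw [eq_comm, add_comm]
  simp only [this]
  abel

lemma cov_betaField [CommPartials A] (l : Fin d) :
    Cov transOp (betaField l : VertexOperator ℂ (Fock d A)) := fun n x => by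
  rw [betaField_ncoeff, betaField_ncoeff,
    transOp_bracket (betaMode l n) x (fun i => if i = l then -((n : ℂ) • betaMode l (n - 1) x)
      else 0) 0 (fun i => ?_) (fun i => ?_)]
  · simp
  · have e : ∀ j : ℕ, betaMode i (-1 - j) (alphaMode i j (betaMode l n x)) +
        alphaMode i (-1 - j) (betaMode i j (betaMode l n x)) -
        betaMode l n (betaMode i (-1 - j) (alphaMode i j x) +
        alphaMode i (-1 - j) (betaMode i j x)) =
        (if i = l ∧ (j : ℤ) + n = 0 then (j : ℂ) • betaMode i (-1 - j) x else 0) +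
        if i = l ∧ -1 - (j : ℤ) + n = 0 then (-1 - (j : ℂ)) • betaMode i j x else 0 := fun j => by
      rw [commute_apply (commute_betaMode_betaMode (A := A) i l j n), alphaMode_betaMode,
        alphaMode_betaMode, map_add, map_add, ← commute_apply (commute_betaMode_betaMode (A := A) i l _ n)]
      simp only [apply_ite (betaMode i _), map_smul, map_zero]
      push_cast
      abel
    simp only [e]
    by_cases hi : i = l
    · subst hi
      simp only [true_and, if_true]
      -- A single summand contributes: `j = -n` if `n ≤ 0`, and `j = n - 1` if `n > 0`.
      rcases le_or_gt n 0 with hn | hn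
      · obtain ⟨k, rfl⟩ : ∃ k : ℕ, n = -k := ⟨(-n).toNat, by lia⟩
        rw [finsum_eq_single _ k fun j hj => by rw [if_neg (by lia), if_neg (by lia), add_zero],
          if_pos (by lia), if_neg (by lia), add_zero,
          show -1 - (k : ℤ) = -(k : ℤ) - 1 by ring]
        push_cast
        module
      · obtain ⟨k, rfl⟩ : ∃ k : ℕ, n = k + 1 := ⟨(n - 1).toNat, by lia⟩
        rw [finsum_eq_single _ k fun j hj => by rw [if_neg (by lia), if_neg (by lia), add_zero],
          if_neg (by lia), if_pos (by lia), zero_add, add_sub_cancel_right]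
        push_cast
        module
    · simp [hi]
  · rw [Pi.zero_apply]
    refine finsum_eq_zero_of_forall_eq_zero fun j => ?_
    simp only [← commute_apply (commute_betaMode_bMode (A := A) _ _ _ _),
      ← commute_apply (commute_betaMode_cMode (A := A) _ _ _ _), map_smul, map_add, sub_self]

lemma cov_alphaField (l : Fin d) :
    Cov transOp (alphaField l : VertexOperator ℂ (Fock d A)) := fun n x => by
  rw [alphaField_ncoeff, alphaField_ncoeff,
    transOp_bracket (alphaMode l n) x (fun i => if i = l then -((n : ℂ) • alphaMode l (n - 1) x)
      else 0) 0 (fun i => ?_) (fun i => ?_)]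
  · simp
  · have e : ∀ j : ℕ, betaMode i (-1 - j) (alphaMode i j (alphaMode l n x)) +
        alphaMode i (-1 - j) (betaMode i j (alphaMode l n x)) -
        alphaMode l n (betaMode i (-1 - j) (alphaMode i j x) +
        alphaMode i (-1 - j) (betaMode i j x)) =
        (if i = l ∧ (j : ℤ) + n = 0 then (j : ℂ) • alphaMode i (-1 - j) x else 0) +
        if i = l ∧ -1 - (j : ℤ) + n = 0 then (-1 - (j : ℂ)) • alphaMode i j x else 0 := fun j => by
      rw [commute_apply (commute_alphaMode_alphaMode (A := A) i l j n),
        betaMode_alphaMode i l (-1 - j) n, betaMode_alphaMode i l j n, map_add, map_add, ← commute_apply (commute_alphaMode_alphaMode (A := A) i l _ n)]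
      simp only [apply_ite (alphaMode i _), map_smul, map_zero]
      push_cast
      abel
    simp only [e]
    by_cases hi : i = l
    · subst hi
      simp only [true_and, if_true]
      rcases le_or_gt n 0 with hn | hn
      · obtain ⟨k, rfl⟩ : ∃ k : ℕ, n = -k := ⟨(-n).toNat, by lia⟩
        rw [finsum_eq_single _ k fun j hj => by rw [if_neg (by lia), if_neg (by lia), add_zero],
          if_pos (by lia), if_neg (by lia), add_zero,
          show -1 - (k : ℤ) = -(k : ℤ) - 1 by ring]
        push_cast
        module
      · obtain ⟨k, rfl⟩ : ∃ k : ℕ, n = k + 1 := ⟨(n - 1).toNat, by lia⟩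
        rw [finsum_eq_single _ k fun j hj => by rw [if_neg (by lia), if_neg (by lia), add_zero],
          if_neg (by lia), if_pos (by lia), zero_add, add_sub_cancel_right]
        push_cast
        module
    · simp [hi]
  · rw [Pi.zero_apply]
    refine finsum_eq_zero_of_forall_eq_zero fun j => ?_
    simp only [← commute_apply (commute_alphaMode_bMode (A := A) _ _ _ _),
      ← commute_apply (commute_alphaMode_cMode (A := A) _ _ _ _), map_smul, map_add, sub_self]

lemma cov_bField (l : Fin d) :
    Cov transOp (bField l : VertexOperator ℂ (Fock d A)) := fun n x => by
  rw [bField_ncoeff, bField_ncoeff,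
    transOp_bracket (bMode l n) x 0 (fun i => if i = l then -((n : ℂ) • bMode l (n - 1) x)
      else 0) (fun i => ?_) (fun i => ?_)]
  · simp
  · rw [Pi.zero_apply]
    refine finsum_eq_zero_of_forall_eq_zero fun j => ?_
    simp only [commute_apply (commute_alphaMode_bMode (A := A) _ _ _ _),
      commute_apply (commute_betaMode_bMode (A := A) _ _ _ _), map_add, sub_self]
  · have e : ∀ j : ℕ, ((j : ℂ) + 1) • (cMode i (-2 - j) (bMode i j (bMode l n x)) +
        bMode i (-2 - j) (cMode i j (bMode l n x))) -
        bMode l n (((j : ℂ) + 1) • (cMode i (-2 - j) (bMode i j x) +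
        bMode i (-2 - j) (cMode i j x))) =
        (if i = l ∧ (j : ℤ) + n = -1 then ((j : ℂ) + 1) • bMode i (-2 - j) x else 0) -
        if i = l ∧ -2 - (j : ℤ) + n = -1 then ((j : ℂ) + 1) • bMode i j x else 0 := fun j => by
      rw [bMode_bMode i l j n, map_neg, cMode_bMode i l (-2 - j) n, cMode_bMode i l j n, map_add,
        map_smul, map_add, map_neg, bMode_bMode i l (-2 - j) n]
      simp only [apply_ite (bMode i _), map_zero, smul_add, smul_neg, neg_neg, neg_add,
        smul_ite, smul_zero]
      abel
    simp only [e]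
    by_cases hi : i = l
    · subst hi
      simp only [true_and, if_true]
      -- The contributing summand is `j = -n - 1` for `n < 0` and `j = n - 1` for `n > 0`. For `n =
      -- 0` there is none, in agreement with the factor `n`.
      rcases lt_or_ge n 0 with hn | hn
      · obtain ⟨k, rfl⟩ : ∃ k : ℕ, n = -(k + 1) := ⟨(-n - 1).toNat, by lia⟩
        rw [finsum_eq_single _ k fun j hj => by rw [if_neg (by lia), if_neg (by lia), sub_zero],
          if_pos (by lia), if_neg (by lia), sub_zero,
          show -2 - (k : ℤ) = -((k : ℤ) + 1) - 1 by ring]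
        push_cast
        module
      · rcases hn.eq_or_lt with rfl | hn
        · rw [finsum_eq_zero_of_forall_eq_zero fun j => by
            rw [if_neg (by lia), if_neg (by lia), sub_zero] ]
          simp
        · obtain ⟨k, rfl⟩ : ∃ k : ℕ, n = k + 1 := ⟨(n - 1).toNat, by lia⟩
          rw [finsum_eq_single _ k fun j hj => by rw [if_neg (by lia), if_neg (by lia), sub_zero],
            if_neg (by lia), if_pos (by lia), zero_sub, add_sub_cancel_right]
          push_cast
          module
    · simp [hi]

lemma cov_cField (l : Fin d) :
    Cov transOp (cField l : VertexOperator ℂ (Fock d A)) := fun n x => by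
  rw [cField_ncoeff, cField_ncoeff,
    transOp_bracket (cMode l n) x 0 (fun i => if i = l then -((n : ℂ) • cMode l (n - 1) x)
      else 0) (fun i => ?_) (fun i => ?_)]
  · simp
  · rw [Pi.zero_apply]
    refine finsum_eq_zero_of_forall_eq_zero fun j => ?_
    simp only [commute_apply (commute_alphaMode_cMode (A := A) _ _ _ _),
      commute_apply (commute_betaMode_cMode (A := A) _ _ _ _), map_add, sub_self]
  · have e : ∀ j : ℕ, ((j : ℂ) + 1) • (cMode i (-2 - j) (bMode i j (cMode l n x)) +
        bMode i (-2 - j) (cMode i j (cMode l n x))) -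
        cMode l n (((j : ℂ) + 1) • (cMode i (-2 - j) (bMode i j x) +
        bMode i (-2 - j) (cMode i j x))) =
        (if i = l ∧ (j : ℤ) + n = -1 then ((j : ℂ) + 1) • cMode i (-2 - j) x else 0) -
        if i = l ∧ -2 - (j : ℤ) + n = -1 then ((j : ℂ) + 1) • cMode i j x else 0 := fun j => by
      rw [cMode_cMode i l j n, map_neg, bMode_cMode i l (-2 - j) n, bMode_cMode i l j n, map_add,
        map_smul, map_add, map_neg, cMode_cMode i l (-2 - j) n]
      simp only [apply_ite (cMode i _), map_zero, smul_add, smul_neg, neg_neg, neg_add,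
        smul_ite, smul_zero]
      abel
    simp only [e]
    by_cases hi : i = l
    · subst hi
      simp only [true_and, if_true]
      rcases lt_or_ge n 0 with hn | hn
      · obtain ⟨k, rfl⟩ : ∃ k : ℕ, n = -(k + 1) := ⟨(-n - 1).toNat, by lia⟩
        rw [finsum_eq_single _ k fun j hj => by rw [if_neg (by lia), if_neg (by lia), sub_zero],
          if_pos (by lia), if_neg (by lia), sub_zero,
          show -2 - (k : ℤ) = -((k : ℤ) + 1) - 1 by ring]
        push_cast
        module
      · rcases hn.eq_or_lt with rfl | hn
        · rw [finsum_eq_zero_of_forall_eq_zero fun j => by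
            rw [if_neg (by lia), if_neg (by lia), sub_zero] ]
          simp
        · obtain ⟨k, rfl⟩ : ∃ k : ℕ, n = k + 1 := ⟨(n - 1).toNat, by lia⟩
          rw [finsum_eq_single _ k fun j hj => by rw [if_neg (by lia), if_neg (by lia), sub_zero],
            if_neg (by lia), if_pos (by lia), zero_sub, add_sub_cancel_right]
          push_cast
          module
    · simp [hi]

/-- Among the modes in `transOp` only `βⁱ_(0) = ∂/∂γⁱ` fails to commute with multiplication by `f`,
and it occurs in the summand `j = 0` next to `αⁱ_(-1)`. -/
lemma transOp_mulFun (f : A) (x : Fock d A) :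
    transOp (mulFun f x) =
      mulFun f (transOp x) + ∑ i, createAlpha (i, 0) (mulFun (pd i f) x) := by
  rw [← sub_eq_iff_eq_add', transOp_bracket (mulFun f) x
    (fun i => createAlpha (i, 0) (mulFun (pd i f) x)) 0 (fun i => ?_) (fun i => ?_)]
  · simp
  · have hα := fun n => commute_apply (commute_alphaMode (X := mulFun (A := A) f)
      (commute_mulFun_createAlpha f) (commute_mulFun_derivBeta f) i n)
    have hβ : ∀ k : ℕ, ∀ x, mulFun f (betaMode i (-1 - (k : ℤ)) x) =
        betaMode i (-1 - k) (mulFun f x) := fun k x => by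
      rw [show -1 - (k : ℤ) = Int.negSucc k by rw [Int.negSucc_eq]; ring]
      exact commute_apply (commute_mulFun_createBeta f _) x
    rw [finsum_eq_single _ 0 fun j hj => ?_]
    · simp only [Nat.cast_zero, sub_zero, alphaMode_zero, LinearMap.zero_apply, map_zero, zero_add,
        hα, ← map_sub]
      change createAlpha (i, 0) _ = _
      congr 1
      change derivGamma i (mulFun f x) - mulFun f (derivGamma i x) = _
      have : derivGamma i * mulFun f - mulFun f * derivGamma i =
          (mulFun (pd i f) : Module.End ℂ (Fock d A)) := end_ext fun m a => by
        simp [mulFun_single, derivGamma_single, -Finsupp.single_mul, mul_comm a]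
      exact LinearMap.congr_fun this x
    · obtain ⟨k, rfl⟩ := Nat.exists_eq_succ_of_ne_zero hj
      have : ∀ x, mulFun f (betaMode i ((k.succ : ℕ) : ℤ) x) =
          betaMode i ((k.succ : ℕ) : ℤ) (mulFun f x) :=
        commute_apply ((commute_mulFun_derivAlpha f (i, k)).smul_right _)
      simp only [map_add, hα, hβ, this, sub_self]
  · rw [Pi.zero_apply]
    refine finsum_eq_zero_of_forall_eq_zero fun j => ?_
    simp only [map_smul, map_add, commute_apply (commute_bMode (X := mulFun (A := A) f)
        (commute_mulFun_createFermion f) (commute_mulFun_derivFermion f) _ _),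
      commute_apply (commute_cMode (X := mulFun (A := A) f)
        (commute_mulFun_createFermion f) (commute_mulFun_derivFermion f) _ _), sub_self]

lemma transOp_vac : transOp (VertexData.vac : Fock d A) = 0 := by
  simp only [transOp, LinearMap.sum_apply, LinearMap.add_apply, wickMode_apply]
  refine Finset.sum_eq_zero fun i _ => ?_
  have hβ : ∀ j : ℕ, betaMode i j (VertexData.vac : Fock d A) = 0 := fun j => by
    simpa [Gen.field] using Gen.kills_vac (.beta i) (show (0 : ℤ) ≤ j by simp)
  have hα : ∀ j : ℕ, alphaMode i j (VertexData.vac : Fock d A) = 0 := fun j => by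
    simpa [Gen.field] using Gen.kills_vac (.alpha i) (show (0 : ℤ) ≤ j by simp)
  have hb : ∀ j : ℕ, bMode i j (VertexData.vac : Fock d A) = 0 := fun j => by
    simpa [Gen.field] using Gen.kills_vac (.b i) (show (0 : ℤ) ≤ j by simp)
  have hc : ∀ j : ℕ, cMode i j (VertexData.vac : Fock d A) = 0 := fun j => by
    simpa [Gen.field] using Gen.kills_vac (.c i) (show (0 : ℤ) ≤ j by simp)
  simp only [wickTerm_beta_alpha, wickTerm_c_b, hβ, hα, hb, hc, map_zero, add_zero, smul_zero,
    finsum_zero]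

lemma transOp_stF (f : A) :
    transOp (stF f : Fock d A) = ∑ i, createAlpha (i, 0) (stF (pd i f)) := by
  have := transOp_mulFun f (VertexData.vac : Fock d A)
  rwa [transOp_vac, map_zero, zero_add, vac_eq, mulFun_stF, mul_one,
    Finset.sum_congr rfl fun i _ => by rw [mulFun_stF, mul_one] ] at this

lemma transOp_createAlpha (i : Fin d) (k : ℕ) (x : Fock d A) :
    transOp (createAlpha (i, k) x) =
      createAlpha (i, k) (transOp x) + ((k : ℂ) + 1) • createAlpha (i, k + 1) x := by
  have := cov_alphaField i (Int.negSucc k) x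
  rw [alphaField_ncoeff, alphaField_ncoeff, sub_eq_iff_eq_add', Int.negSucc_sub_one] at this
  refine this.trans ?_
  rw [Int.negSucc_eq, ← neg_smul]
  push_cast
  rw [neg_neg]
  rfl

/-- Induction along the Euler recursion; the base `n = -1` is `transOp_mulFun`. -/
lemma transOp_taylor (n : ℤ) (f : A) (x : Fock d A) :
    transOp (taylor n f x) = taylor n f (transOp x) - (n : ℂ) • taylor (n - 1) f x := by
  refine taylor_induction (P := fun n f => ∀ x : Fock d A, transOp (taylor n f x) =
    taylor n f (transOp x) - (n : ℂ) • taylor (n - 1) f x) (fun n f hn x => ?_) (fun f x => ?_)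
    (fun n f hn ih x => ?_) n f x
  · rw [taylor_of_nonneg hn]
    simp only [LinearMap.zero_apply, map_zero]
    rcases hn.eq_or_lt with rfl | hn
    · simp
    · rw [taylor_of_nonneg (by lia)]
      simp
  · have e := LinearMap.congr_fun (taylor_rec (d := d) (A := A) (-1 - 1) f (M := 1)
      (by norm_num)) x
    rw [taylor_neg_one]
    simp only [Finset.sum_range_one, LinearMap.smul_apply, LinearMap.sum_apply,
      Module.End.mul_apply] at e
    norm_num [taylor_neg_one] at e ⊢
    rw [e, transOp_mulFun]
  · refine smul_left_cancel_of_lt hn ?_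
    set M := (-n).toNat with hM
    have r0 := LinearMap.congr_fun (taylor_rec (d := d) (A := A) n f (M := M) (by lia))
    have e := LinearMap.congr_fun (taylor_rec (d := d) (A := A) (n - 1) f (M := M + 1)
      (by lia)) x
    simp only [LinearMap.smul_apply, LinearMap.sum_apply, Module.End.mul_apply] at e r0
    rw [smul_sub, ← map_smul transOp, r0, r0]
    have e' : (-(n : ℂ) - 1) • (n : ℂ) • taylor (n - 1) f x =
        ((n : ℂ) + 1) • ∑ j ∈ Finset.range (M + 1), ∑ l,
          createAlpha (l, j) (taylor (n + j) (pd l f) x) := by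
      simp only [show ∀ j : ℕ, n + (j : ℤ) = n - 1 + 1 + j from fun j => by ring]
      rw [← e]
      push_cast
      module
    -- Write `n + 1 = (n + 1 + j) - j`. The first part matches the derivative of the `taylor`
    -- factor; the second, after shifting `j` by one, matches the derivative of the factor `α`. The
    -- last term of the first part has mode index `0` and vanishes.
    have e1 : ∑ j ∈ Finset.range (M + 1), ∑ l, ((n : ℂ) + 1 + j) •
          (createAlpha (l, j) (taylor (n + j) (pd l f) x)) =
        ∑ j ∈ Finset.range M, ∑ l, ((n : ℂ) + 1 + j) •
          (createAlpha (l, j) (taylor (n + j) (pd l f) x)) := by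
      rw [Finset.sum_range_succ, Finset.sum_eq_zero (s := Finset.univ), add_zero]
      intro l _
      rw [taylor_of_nonneg (by lia)]
      simp
    have e2 : ∑ j ∈ Finset.range (M + 1), ∑ l, (j : ℂ) •
          (createAlpha (l, j) (taylor (n + j) (pd l f) x)) =
        ∑ j ∈ Finset.range M, ∑ l, ((j : ℂ) + 1) •
          (createAlpha (l, j + 1) (taylor (n + 1 + j) (pd l f) x)) := by
      rw [Finset.sum_range_succ']
      simp only [Nat.cast_zero, zero_smul, Finset.sum_const_zero, add_zero]
      refine Finset.sum_congr rfl fun j _ => Finset.sum_congr rfl fun l _ => ?_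
      push_cast
      rw [show n + ((j : ℤ) + 1) = n + 1 + j by ring]
    have e3 : (-(n : ℂ) - 1) • (n : ℂ) • taylor (n - 1) f x =
        ∑ j ∈ Finset.range M, ∑ l, ((n : ℂ) + 1 + j) •
          (createAlpha (l, j) (taylor (n + j) (pd l f) x)) -
        ∑ j ∈ Finset.range M, ∑ l, ((j : ℂ) + 1) •
          (createAlpha (l, j + 1) (taylor (n + 1 + j) (pd l f) x)) := by
      rw [← e1, ← e2, e', Finset.smul_sum, ← Finset.sum_sub_distrib]
      refine Finset.sum_congr rfl fun j _ => ?_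
      rw [Finset.smul_sum, ← Finset.sum_sub_distrib]
      refine Finset.sum_congr rfl fun l _ => ?_
      rw [← sub_smul, add_sub_cancel_right]
    rw [e3]
    simp only [map_sum, ← Finset.sum_sub_distrib]
    refine Finset.sum_congr rfl fun j _ => Finset.sum_congr rfl fun l _ => ?_
    rw [transOp_createAlpha, ih, map_sub, map_smul, show n + 1 + (j : ℤ) - 1 = n + j by ring]
    push_cast
    abel

/-- The corrections `Z` required by `funMode_bracket` are the brackets of `transOp` with creation
operators, each a multiple of the next creation operator of the same kind. -/
lemma cov_funField [CommPartials A] (f : A) :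
    Cov transOp (funField f : VertexOperator ℂ (Fock d A)) := fun n x => by
  rw [funField_ncoeff, funField_ncoeff, sub_eq_iff_eq_add']
  refine funMode_bracket (X := transOp (A := A)) (fun f n => -((n : ℂ) • funMode f (n - 1))) 1
    (fun f n g => ?_) (fun v => ⟨((v.2 : ℂ) + 1) • createBeta (v.1, v.2 + 1), fun x => ?_,
      fun f n x => ?_⟩)
    (fun v => ⟨((v.2 : ℂ) + 1) • createAlpha (v.1, v.2 + 1), fun f n => ?_, fun x => ?_⟩)
    (fermionVar_cases (fun i k => ⟨((k : ℂ) + 1) • createFermion (bVar i (k + 1)),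
      fun f n => ?_, fun x => ?_⟩) (fun i k => ⟨((k : ℂ) + 1) • createFermion (cVar i (k + 1)),
      fun f n => ?_, fun x => ?_⟩))
    (fun f n v x => ?_) (fun f n v x => ?_) f n x
  · have e : funMode f n (transOp (stF g : Fock d A)) = taylor n f (transOp (stF g)) := by
      rw [transOp_stF, map_sum, map_sum]
      refine Finset.sum_congr rfl fun i _ => ?_
      rw [← commute_apply (commute_createAlpha_funMode _ _ _), funMode_stF,
        commute_apply (commute_createAlpha_taylor _ _ _)]
    rw [e, funMode_stF, transOp_taylor, LinearMap.neg_apply, LinearMap.smul_apply, funMode_stF,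
      sub_eq_add_neg]
  · have := cov_betaField v.1 (Int.negSucc v.2) x
    rw [betaField_ncoeff, betaField_ncoeff, sub_eq_iff_eq_add', Int.negSucc_sub_one] at this
    refine this.trans ?_
    rw [Int.negSucc_eq, ← neg_smul]
    push_cast
    rw [neg_neg]
    rfl
  · simp only [LinearMap.neg_apply, LinearMap.smul_apply, funMode_createBeta, map_neg, map_smul]
    push_cast
    rw [show n - ((v.2 : ℤ) + 1 + 1) = n - 1 - (v.2 + 1) by ring,
      show n - ((v.2 : ℤ) + 1) - 1 = n - 1 - (v.2 + 1) by ring]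
    module
  · exact (commute_createAlpha_funMode _ _ _).smul_left _
  · exact transOp_createAlpha v.1 v.2 x
  · exact (commute_createFermion_funMode _ _ _).smul_left _
  · have := cov_bField i (Int.negSucc k) x
    rw [bField_ncoeff, bField_ncoeff, sub_eq_iff_eq_add', Int.negSucc_sub_one] at this
    refine this.trans ?_
    rw [Int.negSucc_eq, ← neg_smul, one_smul]
    push_cast
    rw [neg_neg]
    rfl
  · exact (commute_createFermion_funMode _ _ _).smul_left _
  · have := cov_cField i (Int.negSucc k) x
    rw [cField_ncoeff, cField_ncoeff, sub_eq_iff_eq_add', Int.negSucc_sub_one] at this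
    refine this.trans ?_
    rw [Int.negSucc_eq, ← neg_smul, one_smul]
    push_cast
    rw [neg_neg]
    rfl
  · simp only [LinearMap.neg_apply, LinearMap.smul_apply, map_neg, map_smul,
      commute_apply (commute_createAlpha_funMode (A := A) _ _ _)]
  · simp only [LinearMap.neg_apply, LinearMap.smul_apply, map_neg, map_smul, one_smul,
      commute_apply (commute_createFermion_funMode (A := A) _ _ _)]

lemma Gen.cov [CommPartials A] (g : Gen d A) : Cov transOp g.field := by
  cases g
  · exact cov_betaField _
  · exact cov_alphaField _
  · exact cov_bField _
  · exact cov_cField _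
  · exact cov_funField _

end Generators

/-! ## The state-field correspondence -/

section StateField

lemma neg_one_pow_mul_self (n : ℕ) : (-1 : ℂ) ^ n * (-1) ^ n = 1 := by
  rw [← mul_pow]; simp

variable {d : ℕ} {A : Type*} [CommRing A] [Algebra ℂ A] [Partials d A]

/-- Fields of parity `p` that are creative, translation covariant and local with respect to the
generating fields. -/
structure IsHomField (p : ℕ) (S : VertexOperator ℂ (Fock d A)) : Prop where
  par : ∀ (n : ℤ) x, parityOp ((S[[n]]) x) = (-1 : ℂ) ^ p • (S[[n]]) (parityOp x)
  creative : ∀ n : ℤ, 0 ≤ n → (S[[n]]) VertexData.vac = 0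
  cov : Cov transOp S
  loc : ∀ g : Gen d A, Loc ((-1) ^ (p * g.par)) S g.field

lemma IsHomField.par_pow {p : ℕ} {S : VertexOperator ℂ (Fock d A)} (hS : IsHomField p S)
    (q : ℕ) (n : ℤ) (x : Fock d A) :
    (parityOp ^ q : Module.End ℂ (Fock d A)) ((S[[n]]) x) =
      (-1 : ℂ) ^ (q * p) • (S[[n]]) ((parityOp ^ q : Module.End ℂ (Fock d A)) x) := by
  induction q generalizing x with
  | zero => simp
  | succ q ih =>
    rw [pow_succ, Module.End.mul_apply, Module.End.mul_apply, hS.par, map_smul, ih, smul_smul,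
      ← pow_add]
    congr 2
    ring

lemma parityOp_pow_pow (q : ℕ) (x : Fock d A) : (parityOp ^ q : Module.End ℂ (Fock d A))
    ((parityOp ^ q : Module.End ℂ (Fock d A)) x) = x := by
  rw [← Module.End.mul_apply, ← pow_add, ← two_mul, pow_mul]
  have : (parityOp ^ 2 : Module.End ℂ (Fock d A)) = 1 := LinearMap.ext fun x => by
    rw [pow_two, Module.End.mul_apply, parityOp_parityOp]; rfl
  rw [this, one_pow]
  rfl

lemma IsHomField.conj {p : ℕ} {S : VertexOperator ℂ (Fock d A)} (hS : IsHomField p S)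
    (q : ℕ) (n : ℤ) : (parityOp ^ q : Module.End ℂ (Fock d A)) ∘ₗ (S[[n]]) ∘ₗ (parityOp ^ q) =
      (-1 : ℂ) ^ (q * p) • (S[[n]]) := LinearMap.ext fun x => by
  rw [LinearMap.comp_apply, LinearMap.comp_apply, hS.par_pow, parityOp_pow_pow]
  rfl

lemma Gen.isHomField [CommPartials A] (g : Gen d A) : IsHomField g.par g.field where
  par n x := by
    have := LinearMap.congr_fun (g.parityOp_comp n) (parityOp x)
    simpa [parityOp_parityOp] using this
  creative n hn := g.kills_vac hn
  cov := g.cov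
  loc h := g.loc h

/-- For a left factor of parity `p`, the sign operator of the normally ordered product is `parityOp
^ p`. Locality with the generators is Dong's lemma. -/
lemma IsHomField.wick {p q : ℕ} {S R : VertexOperator ℂ (Fock d A)} (hS : IsHomField p S)
    (hR : IsHomField q R) (h : Loc ((-1) ^ (p * q)) S R) (k : ℕ) :
    IsHomField (p + q) (wick (parityOp ^ p) S k R) where
  par n x := by
    rw [wick_ncoeff, wickMode_apply, wickMode_apply, smul_finsum]
    refine (parityOp.toAddMonoidHom.map_finsum (wickTerm_finite _ S k R n x)).trans ?_
    refine finsum_congr fun j => ?_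
    change parityOp _ = _
    have e : ∀ y, parityOp ((parityOp ^ p : Module.End ℂ (Fock d A)) y) =
        (parityOp ^ p : Module.End ℂ (Fock d A)) (parityOp y) :=
      commute_apply (Commute.self_pow parityOp p)
    simp only [wickTerm, LinearMap.smul_apply, LinearMap.add_apply, LinearMap.comp_apply,
      map_smul, map_add, e, hS.par, hR.par, pow_add]
    module
  creative n hn := by
    rw [wick_ncoeff, wickMode_apply]
    refine finsum_eq_zero_of_forall_eq_zero fun j => ?_
    simp [wickTerm, hR.creative (n + j) (by lia), hS.creative j (by lia)]
  cov := hS.cov.wick hR.cov (hR.conj p) k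
  loc g := by
    have := (hS.loc g).wick (hR.loc g) h (hR.conj p) k
    rwa [← pow_add, ← add_mul] at this

/-- Creativity removes every term of `(z - w)^n [S(z), R(w)] 1` in this range except `S_(l+n) R_(-1)
1`. With `l = 0` this shows that the residue product is creative and finds its state. -/
lemma fcomm_vac {S R : VertexOperator ℂ (Fock d A)}
    (hS : ∀ n : ℤ, 0 ≤ n → (S[[n]]) VertexData.vac = 0)
    (hR : ∀ n : ℤ, 0 ≤ n → (R[[n]]) VertexData.vac = 0) (s : ℂ) (n : ℕ) (l m : ℤ) (hl : 0 ≤ l) :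
    (0 ≤ m → (dzw ^ n) (fcomm s S R) l m VertexData.vac = 0) ∧ (m = -1 →
      (dzw ^ n) (fcomm s S R) l m VertexData.vac = (S[[l + n]]) ((R[[-1]]) VertexData.vac)) := by
  induction n generalizing l m with
  | zero =>
    rw [pow_zero, Module.End.one_apply, fcomm_apply, hS l hl]
    refine ⟨fun hm => ?_, fun hm => ?_⟩
    · simp [hR m hm]
    · simp [hm]
  | succ n ih =>
    rw [dzw_pow_succ', dzw_apply, LinearMap.sub_apply]
    refine ⟨fun hm => ?_, fun hm => ?_⟩
    · rw [(ih (l + 1) m (by lia)).1 hm, (ih l (m + 1) hl).1 (by lia), sub_zero]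
    · rw [(ih (l + 1) m (by lia)).2 hm, (ih l (m + 1) hl).1 (by lia), sub_zero]
      push_cast
      rw [show l + 1 + (n : ℤ) = l + (n + 1) by ring]

lemma IsHomField.resProd {p q : ℕ} {S R : VertexOperator ℂ (Fock d A)} (hS : IsHomField p S)
    (hR : IsHomField q R) (h : Loc ((-1) ^ (p * q)) S R) (k : ℕ) :
    IsHomField (p + q) (resProd ((-1) ^ (p * q)) k S R) where
  par n x := by
    let L : Module.End ℂ (Fock d A) →ₗ[ℂ] Fock d A :=
      parityOp ∘ₗ LinearMap.applyₗ x - ((-1 : ℂ) ^ (p + q)) • LinearMap.applyₗ (parityOp x)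
    have e := dzw_pow_map L k (fcomm ((-1) ^ (p * q)) S R) 0 n
    have e0 : (fun l m => L (fcomm ((-1) ^ (p * q)) S R l m)) = 0 := by
      ext1 l; ext1 m
      change parityOp (fcomm _ S R l m x) - (-1 : ℂ) ^ (p + q) • fcomm _ S R l m (parityOp x) = 0
      simp only [fcomm_apply, map_sub, map_smul, hS.par, hR.par, pow_add]
      module
    rw [e0, map_zero] at e
    rw [resProd_ncoeff]
    exact sub_eq_zero.1 e.symm
  creative n hn := by
    rw [resProd_ncoeff]
    exact (fcomm_vac hS.creative hR.creative _ k 0 n le_rfl).1 hn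
  cov := hS.cov.resProd hR.cov _ k
  loc g := by
    have := (hS.loc g).resProd (hR.loc g) h k
    rwa [← pow_add, ← add_mul] at this

/-- Iterated normally ordered products of generating fields. -/
inductive Built : ℕ → VertexOperator ℂ (Fock d A) → Prop
  | fn (f : A) : Built 0 (funField f)
  | wick (g : Gen d A) (k : ℕ) {p : ℕ} {S : VertexOperator ℂ (Fock d A)} (hS : Built p S) :
      Built (g.par + p) (wick (parityOp ^ g.par) g.field k S)

lemma Built.isHomField [CommPartials A] {p : ℕ} {S : VertexOperator ℂ (Fock d A)}
    (h : Built p S) : IsHomField p S := by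
  induction h with
  | fn f => exact Gen.isHomField (.fn f)
  | wick g k hS ih =>
    refine g.isHomField.wick ih ?_ k
    rw [mul_comm]
    exact (ih.loc g).symm (neg_one_pow_mul_self _)

/-- Locality is assumed only with respect to generating fields; Dong's lemma extends it along the
construction of `R`. -/
lemma IsHomField.loc_built [CommPartials A] {p q : ℕ} {S R : VertexOperator ℂ (Fock d A)}
    (hS : IsHomField p S) (hR : Built q R) : Loc ((-1) ^ (p * q)) S R := by
  induction hR with
  | fn f => exact hS.loc (.fn f)
  | @wick g k q R hR ih =>
    have h1 := ((hS.loc g).symm (neg_one_pow_mul_self _)).wick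
      (ih.symm (neg_one_pow_mul_self _)) ((hR.isHomField.loc g).symm (neg_one_pow_mul_self _))
      (fun n => by rw [hR.isHomField.conj, mul_comm]) k
    rw [← pow_add, ← mul_add] at h1
    exact h1.symm (neg_one_pow_mul_self _)

lemma stateField_single (m : Mono d) (f : A) :
    stateField (Finsupp.single m f) = monoField m (funField f) := by
  simp [stateField]

lemma built_stateField (m : Mono d) (f : A) :
    Built m.2.2.card (stateField (Finsupp.single m f)) := by
  rw [stateField_single, monoField, Module.End.mul_apply, Module.End.mul_apply]
  have hβ : ∀ (L : List (BosonVar d)) {p : ℕ} {S : VertexOperator ℂ (Fock d A)}, Built p S →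
      Built p ((L.map fun v => ChiralDeRham.wick 1 (betaField v.1) v.2).prod S) := by
    intro L p S h
    induction L with
    | nil => exact h
    | cons v L ih =>
      have := Built.wick (.beta v.1) v.2 ih
      rwa [Gen.par, pow_zero, zero_add] at this
  have hα : ∀ (L : List (BosonVar d)) {p : ℕ} {S : VertexOperator ℂ (Fock d A)}, Built p S →
      Built p ((L.map fun v => ChiralDeRham.wick 1 (alphaField v.1) v.2).prod S) := by
    intro L p S h
    induction L with
    | nil => exact h
    | cons v L ih =>
      have := Built.wick (.alpha v.1) v.2 ih
      rwa [Gen.par, pow_zero, zero_add] at this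
  refine hβ _ (hα _ ?_)
  rw [← Finset.length_sort (s := m.2.2) (· ≤ ·)]
  induction (m.2.2.sort (· ≤ ·)) with
  | nil => exact .fn f
  | cons v L ih =>
    rw [List.map_cons, List.prod_cons, List.length_cons, add_comm]
    obtain ⟨(_ | _), i, k⟩ := v
    · exact Built.wick (.b i) k ih
    · exact Built.wick (.c i) k ih

/-- On the vacuum the annihilation half vanishes, and of the creation half only `j = 0` survives at
mode `-1`. Iterating this rebuilds a monomial from its creation operators, which is the vacuum
axiom. -/
lemma wick_vac {τ : Module.End ℂ (Fock d A)} {S R : VertexOperator ℂ (Fock d A)}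
    (hS : ∀ n : ℤ, 0 ≤ n → (S[[n]]) VertexData.vac = 0)
    (hR : ∀ n : ℤ, 0 ≤ n → (R[[n]]) VertexData.vac = 0) (k : ℕ) :
    (∀ n : ℤ, 0 ≤ n → ((wick τ S k R)[[n]]) VertexData.vac = 0) ∧
      ((wick τ S k R)[[-1]]) VertexData.vac =
        (S[[Int.negSucc k]]) ((R[[-1]]) VertexData.vac) := by
  refine ⟨fun n hn => ?_, ?_⟩
  · rw [wick_ncoeff, wickMode_apply]
    refine finsum_eq_zero_of_forall_eq_zero fun j => ?_
    simp [wickTerm, hR (n + j) (by lia), hS j (by lia)]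
  · rw [wick_ncoeff, wickMode_apply, finsum_eq_single _ 0 fun j hj => ?_]
    · simp only [wickTerm, LinearMap.smul_apply, LinearMap.add_apply, LinearMap.comp_apply]
      rw [hS _ (by simp), Int.negSucc_eq]
      simp
    · simp [wickTerm, hR (-1 + j) (by lia), hS j (by lia)]

lemma wick_list_vac {ι : Type*} {τ : Module.End ℂ (Fock d A)}
    (u : ι → VertexOperator ℂ (Fock d A)) (k : ι → ℕ)
    (hu : ∀ i (n : ℤ), 0 ≤ n → ((u i)[[n]]) VertexData.vac = 0)
    {R : VertexOperator ℂ (Fock d A)}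
    (hR : ∀ n : ℤ, 0 ≤ n → (R[[n]]) VertexData.vac = 0) (L : List ι) :
    (∀ n : ℤ, 0 ≤ n →
      ((((L.map fun i => wick τ (u i) (k i)).prod R))[[n]]) VertexData.vac = 0) ∧
      ((((L.map fun i => wick τ (u i) (k i)).prod R))[[-1]]) VertexData.vac =
        (L.map fun i => ((u i)[[Int.negSucc (k i)]])).prod ((R[[-1]]) VertexData.vac) := by
  induction L with
  | nil => exact ⟨hR, rfl⟩
  | cons i L ih =>
    simp only [List.map_cons, List.prod_cons, Module.End.mul_apply, ← ih.2]
    exact wick_vac (hu i) ih.1 (k i)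

lemma prod_createBeta (L : List (BosonVar d)) (n : Multiset (BosonVar d) × Finset (FermionVar d))
    (f : A) : (L.map fun v => createBeta v).prod (Finsupp.single (0, n) f : Fock d A) =
      Finsupp.single ((L : Multiset (BosonVar d)), n) f := by
  induction L with
  | nil => rfl
  | cons v L ih =>
    rw [List.map_cons, List.prod_cons, Module.End.mul_apply, ih, createBeta_single]
    rfl

lemma prod_createAlpha (L : List (BosonVar d)) (s : Finset (FermionVar d))
    (f : A) : (L.map fun v => createAlpha v).prod (Finsupp.single (0, 0, s) f : Fock d A) =
      Finsupp.single (0, (L : Multiset (BosonVar d)), s) f := by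
  induction L with
  | nil => rfl
  | cons v L ih =>
    rw [List.map_cons, List.prod_cons, Module.End.mul_apply, ih, createAlpha_single]
    rfl

lemma prod_createFermion (L : List (FermionVar d)) (hL : L.Pairwise (· < ·))
    (f : A) : (L.map fun v => createFermion v).prod (Finsupp.single (0, 0, ∅) f : Fock d A) =
      Finsupp.single (0, 0, L.toFinset) f := by
  induction L with
  | nil => rfl
  | cons v L ih =>
    rw [List.pairwise_cons] at hL
    rw [List.map_cons, List.prod_cons, Module.End.mul_apply, ih hL.2, createFermion_single,
      if_neg fun h => lt_irrefl _ (hL.1 v (List.mem_toFinset.1 h)),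
      fermionSign_of_lt fun w hw => hL.1 w (List.mem_toFinset.1 hw), one_smul,
      List.toFinset_cons]

lemma prod_create (m : Mono d) (f : A) :
    (m.1.toList.map fun v => createBeta v).prod ((m.2.1.toList.map fun v => createAlpha v).prod
      (((m.2.2.sort (· ≤ ·)).map fun v => createFermion v).prod (stF f : Fock d A))) =
      Finsupp.single m f := by
  rw [stF, prod_createFermion _ (m.2.2.sortedLT_sort.pairwise), Finset.sort_toFinset,
    prod_createAlpha, prod_createBeta, Multiset.coe_toList, Multiset.coe_toList]

/-- The vacuum axiom `a_(-1) 1 = a`. -/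
lemma stateField_vac [CommPartials A] (a : Fock d A) :
    ((stateField a)[[-1]]) VertexData.vac = a := by
  induction a using Finsupp.induction_linear with
  | zero => simp
  | add a b ha hb => simp [ha, hb]
  | single m f =>
    rw [stateField_single, monoField, Module.End.mul_apply, Module.End.mul_apply]
    have h0 : ∀ n : ℤ, 0 ≤ n → ((funField f)[[n]]) (VertexData.vac : Fock d A) = 0 :=
      fun n hn => Gen.kills_vac (.fn f) hn
    have h1 := wick_list_vac (τ := parityOp) (fun v : FermionVar d => if (ofLex v).1 then
      cField (ofLex (ofLex v).2).1 else bField (ofLex (ofLex v).2).1)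
      (fun v => (ofLex (ofLex v).2).2) (fun v n hn => by
        split
        · exact Gen.kills_vac (.c _) hn
        · exact Gen.kills_vac (.b _) hn) h0 (m.2.2.sort (· ≤ ·))
    have h2 := wick_list_vac (τ := 1) (fun v : BosonVar d => alphaField v.1)
      (fun v => v.2) (fun v n hn => Gen.kills_vac (.alpha _) hn) h1.1 m.2.1.toList
    have h3 := wick_list_vac (τ := 1) (fun v : BosonVar d => betaField v.1)
      (fun v => v.2) (fun v n hn => Gen.kills_vac (.beta _) hn) h2.1 m.1.toList
    rw [h3.2, h2.2, h1.2, funField_ncoeff, vac_eq, funMode_stF, taylor_neg_one, mulFun_stF,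
      mul_one, ← prod_create m f]
    congr 4
    · funext v; exact betaField_ncoeff _ _
    · funext v; exact alphaField_ncoeff _ _
    congr 3
    funext v
    obtain ⟨(_ | _), i, k⟩ := v
    · exact bField_ncoeff _ _
    · exact cField_ncoeff _ _

lemma IsHomField.zero (p : ℕ) : IsHomField p (0 : VertexOperator ℂ (Fock d A)) where
  par n x := by simp
  creative n _ := by simp
  cov := cov_zero _
  loc g := (loc_zero _ _).symm (neg_one_pow_mul_self _)

lemma IsHomField.add {p : ℕ} {S R : VertexOperator ℂ (Fock d A)} (hS : IsHomField p S)
    (hR : IsHomField p R) : IsHomField p (S + R) where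
  par n x := by simp [hS.par, hR.par]
  creative n hn := by simp [hS.creative n hn, hR.creative n hn]
  cov := hS.cov.add hR.cov
  loc g := (((hS.loc g).symm (neg_one_pow_mul_self _)).add
    ((hR.loc g).symm (neg_one_pow_mul_self _))).symm (neg_one_pow_mul_self _)

lemma IsHomField.congr {p q : ℕ} (h : (-1 : ℂ) ^ p = (-1) ^ q) {S : VertexOperator ℂ (Fock d A)}
    (hS : IsHomField p S) : IsHomField q S where
  par n x := by rw [← h, hS.par]
  creative := hS.creative
  cov := hS.cov
  loc g := by
    have := hS.loc g
    rwa [pow_mul, h, ← pow_mul] at this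

/-- Vectors of parity `p`. -/
def IsHom (p : ℕ) (a : Fock d A) : Prop := parityOp a = (-1 : ℂ) ^ p • a

/-- A homogeneous vector is supported on monomials of the matching parity, so additive claims can be
checked on those. -/
lemma IsHom.induction {p : ℕ} {P : Fock d A → Prop} (h0 : P 0)
    (hadd : ∀ a b, P a → P b → P (a + b))
    (hs : ∀ m f, (-1 : ℂ) ^ m.2.2.card = (-1) ^ p → P (Finsupp.single m f))
    {a : Fock d A} (ha : IsHom p a) : P a := by
  have hm : ∀ m ∈ a.support, (-1 : ℂ) ^ m.2.2.card = (-1) ^ p := by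
    intro m hm
    have e : ∀ x : Fock d A, parityOp x m = (-1 : ℂ) ^ m.2.2.card • x m := fun x => by
      induction x using Finsupp.induction_linear with
      | zero => simp
      | add x y hx hy => simp [hx, hy]
      | single n f =>
        rw [parityOp_single, Finsupp.smul_apply]
        by_cases h : n = m
        · rw [h]
        · rw [Finsupp.single_eq_of_ne (Ne.symm h), smul_zero, smul_zero]
    have h1 := e a
    rw [ha, Finsupp.smul_apply, eq_comm, ← sub_eq_zero, ← sub_smul, smul_eq_zero] at h1
    exact sub_eq_zero.1 (h1.resolve_right (Finsupp.mem_support_iff.1 hm))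
  rw [← Finsupp.sum_single a, Finsupp.sum]
  exact Finset.sum_induction _ P hadd h0 fun m h => hs m _ (hm m h)

lemma isHomField_stateField [CommPartials A] {p : ℕ} {a : Fock d A} (ha : IsHom p a) :
    IsHomField p (stateField a) :=
  IsHom.induction (P := fun a => IsHomField p (stateField a)) (by simpa using .zero p)
    (fun a b ha hb => by simpa using ha.add hb)
    (fun m f h => (built_stateField m f).isHomField.congr h) ha

/-- **Goddard's uniqueness theorem.** -/
lemma IsHomField.ext [CommPartials A] {p : ℕ} {S R : VertexOperator ℂ (Fock d A)}
    (hS : IsHomField p S) (hR : IsHomField p R)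
    (h : (S[[-1]]) VertexData.vac = (R[[-1]]) VertexData.vac) : S = R := by
  refine sub_eq_zero.1 (field_eq_zero_of_loc (fun g => ⟨_, (loc_sub
    ((hS.loc g).symm (neg_one_pow_mul_self _))
    ((hR.loc g).symm (neg_one_pow_mul_self _))).symm (neg_one_pow_mul_self _)⟩) ?_)
  refine (hS.cov.sub hR.cov).kills_vac transOp_vac fun n hn => ?_
  rw [map_sub, Pi.sub_apply, LinearMap.sub_apply]
  rcases hn.eq_or_lt with rfl | hn
  · rw [h, sub_self]
  · rw [hS.creative n (by lia), hR.creative n (by lia), sub_self]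

lemma parityOp_vac : parityOp (VertexData.vac : Fock d A) = VertexData.vac := parityOp_stF 1

lemma IsHomField.isHom {p : ℕ} {S : VertexOperator ℂ (Fock d A)} (hS : IsHomField p S) :
    IsHom p ((S[[-1]]) VertexData.vac) := by
  rw [IsHom, hS.par, parityOp_vac]

/-- Goddard's theorem in the form in which it is applied: to recognise a field, it suffices to
compute its state. -/
lemma IsHomField.eq_stateField [CommPartials A] {p : ℕ} {S : VertexOperator ℂ (Fock d A)}
    (hS : IsHomField p S) : S = stateField ((S[[-1]]) VertexData.vac) :=
  hS.ext (isHomField_stateField hS.isHom) (stateField_vac _).symm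

lemma loc_stateField [CommPartials A] {p q : ℕ} {a b : Fock d A} (ha : IsHom p a)
    (hb : IsHom q b) : Loc ((-1) ^ (p * q)) (stateField a) (stateField b) := by
  refine IsHom.induction (P := fun b => Loc ((-1) ^ (p * q)) (stateField a) (stateField b))
    ?_ (fun b c hb hc => ?_) (fun m f h => ?_) hb
  · rw [map_zero]
    exact loc_zero _ _
  · rw [map_add]
    exact hb.add hc
  · have := (isHomField_stateField ha).loc_built (built_stateField m f)
    rwa [mul_comm, pow_mul, h, ← pow_mul, mul_comm] at this

lemma nprod_apply (n : ℤ) (a b : Fock d A) :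
    VertexData.nprod n a b = ((stateField a)[[n]]) b := rfl

lemma isHom_nprod [CommPartials A] {p q : ℕ} {a b : Fock d A} (ha : IsHom p a) (hb : IsHom q b)
    (n : ℤ) : IsHom (p + q) (VertexData.nprod n a b) := by
  rw [IsHom, nprod_apply, (isHomField_stateField ha).par, hb, map_smul, smul_smul, pow_add]

lemma fock_hom_induction {P : Fock d A → Prop} (hadd : ∀ a b, P a → P b → P (a + b))
    (h : ∀ p a, IsHom p a → P a) (a : Fock d A) : P a := by
  induction a using Finsupp.induction_linear with
  | zero => exact h 0 0 (by simp [IsHom])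
  | add a b ha hb => exact hadd a b ha hb
  | single m f => exact h m.2.2.card _ (parityOp_single m f)

/-- The field of `a_(-k-1) b` is the normally ordered product. -/
lemma stateField_nprod_negSucc [CommPartials A] {p : ℕ} {a : Fock d A} (ha : IsHom p a) (k : ℕ)
    (b : Fock d A) : stateField (VertexData.nprod (Int.negSucc k) a b) =
      wick (parityOp ^ p) (stateField a) k (stateField b) := by
  refine fock_hom_induction (P := fun b => stateField (VertexData.nprod (Int.negSucc k) a b) =
    wick (parityOp ^ p) (stateField a) k (stateField b)) (fun b b' h h' => ?_)
    (fun q b h => ?_) b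
  · rw [map_add, map_add, map_add, map_add, h, h']
  · have hA := isHomField_stateField ha
    have hB := isHomField_stateField h
    have := (hA.wick hB (loc_stateField ha h) k).eq_stateField
    rw [this, (wick_vac hA.creative hB.creative k).2, stateField_vac]
    rfl

lemma resProd_stateField [CommPartials A] {p q : ℕ} {a b : Fock d A} (ha : IsHom p a)
    (hb : IsHom q b) (n : ℕ) : resProd ((-1) ^ (p * q)) n (stateField a) (stateField b) =
      stateField (VertexData.nprod n a b) := by
  have hA := isHomField_stateField ha
  have hB := isHomField_stateField hb
  have := (hA.resProd hB (loc_stateField ha hb) n).eq_stateField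
  rw [this, resProd_ncoeff, (fcomm_vac hA.creative hB.creative _ n 0 (-1) le_rfl).2 rfl,
    stateField_vac, zero_add]
  rfl

/-- Borcherds' commutator formula. -/
lemma exists_commutator_formula [CommPartials A] {p q : ℕ} {a b : Fock d A} (ha : IsHom p a)
    (hb : IsHom q b) : ∃ N : ℕ, ∀ (l m : ℤ) (x : Fock d A),
      ((stateField a)[[l]]) (((stateField b)[[m]]) x) = (-1 : ℂ) ^ (p * q) •
        ((stateField b)[[m]]) (((stateField a)[[l]]) x) + ∑ j ∈ Finset.range (N + 1),
      ((Ring.choose l j : ℤ) : ℂ) •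
        ((stateField (VertexData.nprod (j : ℤ) a b))[[l + m - j]]) x := by
  obtain ⟨N, hN⟩ := loc_stateField ha hb
  refine ⟨N, fun l m x => ?_⟩
  -- One more power of `z - w` than necessary ensures that the index `j = 0` is in the sum; the two
  -- lemmas below single it out.
  have := LinearMap.congr_fun (fcomm_eq_sum (N := N + 1)
    (by rw [dzw_pow_succ', hN, map_zero]) l m) x
  rw [fcomm_apply, sub_eq_iff_eq_add'] at this
  rw [this, LinearMap.sum_apply]
  simp only [resProd_stateField ha hb, LinearMap.smul_apply]

/-- The commutator of two fields whose operator product expansion has a simple pole. -/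
lemma commutator_of_simple_pole [CommPartials A] {p q : ℕ} {a b : Fock d A} (ha : IsHom p a)
    (hb : IsHom q b) (h : ∀ n : ℤ, 0 < n → VertexData.nprod n a b = 0) (l m : ℤ) (x : Fock d A) :
    ((stateField a)[[l]]) (((stateField b)[[m]]) x) = (-1 : ℂ) ^ (p * q) •
      ((stateField b)[[m]]) (((stateField a)[[l]]) x) +
        ((stateField (VertexData.nprod 0 a b))[[l + m]]) x := by
  obtain ⟨N, hN⟩ := exists_commutator_formula ha hb
  rw [hN, Finset.sum_eq_single_of_mem 0 (by simp) fun j _ hj => ?_]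
  · simp
  · rw [h j (by lia)]
    simp

/-- Zero modes are derivations. -/
lemma zeroMode_bracket [CommPartials A] {p q : ℕ} {a b : Fock d A} (ha : IsHom p a)
    (hb : IsHom q b) (m : ℤ) (x : Fock d A) :
    ((stateField a)[[0]]) (((stateField b)[[m]]) x) = (-1 : ℂ) ^ (p * q) •
      ((stateField b)[[m]]) (((stateField a)[[0]]) x) +
        ((stateField (((stateField a)[[0]]) b))[[m]]) x := by
  obtain ⟨N, hN⟩ := exists_commutator_formula ha hb
  rw [hN, Finset.sum_eq_single_of_mem 0 (by simp) fun j _ hj => ?_]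
  · simp [nprod_apply]
  · rw [Ring.choose_zero_pos ℤ (by lia)]
    simp

lemma Gen.stateField_eq [CommPartials A] (g : Gen d A) :
    stateField ((g.field[[-1]]) VertexData.vac) = g.field :=
  g.isHomField.eq_stateField.symm

lemma stateField_stF [CommPartials A] (f : A) : stateField (stF f : Fock d A) = funField f := by
  rw [stF, stateField_single, monoField]
  simp

lemma stBeta_eq (i : Fin d) : stBeta A i = createBeta (i, 0) VertexData.vac := by
  rw [vac_eq, stF, createBeta_single]
  rfl

lemma stB_eq (i : Fin d) : stB A i = createFermion (bVar i 0) VertexData.vac := by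
  rw [vac_eq, stF, createFermion_single, if_neg (by simp), fermionSign_of_lt (by simp), one_smul]
  rfl

lemma stC_eq (i : Fin d) : stC A i = createFermion (cVar i 0) VertexData.vac := by
  rw [vac_eq, stF, createFermion_single, if_neg (by simp), fermionSign_of_lt (by simp), one_smul]
  rfl

lemma stateField_stBeta [CommPartials A] (i : Fin d) : stateField (stBeta A i) = betaField i := by
  have := Gen.stateField_eq (Gen.beta i : Gen d A)
  rw [stBeta_eq]
  rwa [Gen.field, betaField_ncoeff] at this

lemma stateField_stB [CommPartials A] (i : Fin d) : stateField (stB A i) = bField i := by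
  have := Gen.stateField_eq (Gen.b i : Gen d A)
  rw [stB_eq]
  rwa [Gen.field, bField_ncoeff] at this

lemma stateField_stC [CommPartials A] (i : Fin d) : stateField (stC A i) = cField i := by
  have := Gen.stateField_eq (Gen.c i : Gen d A)
  rw [stC_eq]
  rwa [Gen.field, cField_ncoeff] at this

lemma stateField_alpha [CommPartials A] (i : Fin d) :
    stateField (createAlpha (i, 0) VertexData.vac : Fock d A) = alphaField i := by
  have := Gen.stateField_eq (Gen.alpha i : Gen d A)
  rwa [Gen.field, alphaField_ncoeff] at this

lemma exists_idMode_eq_zero (x : Fock d A) :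
    ∃ N : ℤ, ∀ n, N ≤ n → (if n = -1 then 1 else 0 : Module.End ℂ (Fock d A)) x = 0 :=
  ⟨0, fun n hn => by rw [if_neg (by lia)]; rfl⟩

/-- The field of the vacuum is the identity. -/
lemma stateField_vac_ncoeff [CommPartials A] (n : ℤ) :
    ((stateField (VertexData.vac : Fock d A))[[n]]) = if n = -1 then 1 else 0 := by
  have e := fieldOfModes_ncoeff (V := Fock d A) (fun n => if n = -1 then 1 else 0)
    exists_idMode_eq_zero
  have h : IsHomField 0 (fieldOfModes (V := Fock d A) (fun n => if n = -1 then 1 else 0)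
      exists_idMode_eq_zero) :=
    { par := fun n x => by rw [e]; split <;> simp
      creative := fun n hn => by rw [e, if_neg (by lia)]; rfl
      cov := fun n x => by
        rw [e, e]
        by_cases h : n = 0
        · simp [h]
        · rw [if_neg (show ¬ n - 1 = -1 by lia)]
          split <;> simp
      loc := fun g => by
        rw [zero_mul, pow_zero]
        refine loc_of_commute fun l m => ?_
        rw [e]
        split
        · exact Commute.one_left _
        · exact Commute.zero_left _ }
  have := h.eq_stateField
  rw [e, if_pos rfl, Module.End.one_apply] at this
  rw [← this, e]

/-- The field of the derivative of a state. -/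
lemma stateField_transOp [CommPartials A] (a : Fock d A) (n : ℤ) (x : Fock d A) :
    ((stateField (transOp a))[[n]]) x = -((n : ℂ) • ((stateField a)[[n - 1]]) x) := by
  refine fock_hom_induction (P := fun a => ((stateField (transOp a))[[n]]) x =
    -((n : ℂ) • ((stateField a)[[n - 1]]) x)) (fun a b h h' => ?_) (fun p a h => ?_) a
  · simp only [map_add, Pi.add_apply, LinearMap.add_apply, h, h', smul_add, neg_add]
  · have h1 := (isHomField_stateField h).cov (-1) VertexData.vac
    rw [stateField_vac, transOp_vac, map_zero, sub_zero] at h1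
    have h2 := stateField_nprod_negSucc h 1 VertexData.vac
    -- The state `∂a` is `a_(-2) 1`, so its field is the normally ordered product of `∂a(z)` with
    -- the identity field. The latter has only the mode `-1`, so at most one summand survives.
    have h3 : transOp a = VertexData.nprod (Int.negSucc 1) a VertexData.vac := by
      rw [h1, nprod_apply]
      norm_num
      rfl
    rw [h3, h2, wick_ncoeff, wickMode_apply]
    simp only [wickTerm, stateField_vac_ncoeff, LinearMap.smul_apply, LinearMap.add_apply,
      LinearMap.comp_apply]
    have hc : ∀ j : ℕ, (1 + j).choose j = j + 1 := fun j => by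
      rw [add_comm, Nat.choose_succ_self_right]
    rcases lt_trichotomy n 0 with hn | rfl | hn
    · obtain ⟨k, rfl⟩ : ∃ k : ℕ, n = -1 - k := ⟨(-1 - n).toNat, by lia⟩
      rw [finsum_eq_single _ k fun j hj => ?_]
      · rw [if_pos (by lia), if_neg (by lia), hc,
          show -(((1 : ℕ) : ℤ) + 1) - (k : ℤ) = -1 - k - 1 by push_cast; ring]
        simp only [Module.End.one_apply, LinearMap.zero_apply, map_zero, smul_zero, add_zero]
        push_cast
        module
      · rw [if_neg (by lia), if_neg (by lia)]
        simp
    · rw [finsum_eq_zero_of_forall_eq_zero fun j => ?_]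
      · simp
      · rw [if_neg (by lia), if_neg (by lia)]
        simp
    · obtain ⟨k, rfl⟩ : ∃ k : ℕ, n = k + 1 := ⟨(n - 1).toNat, by lia⟩
      rw [finsum_eq_single _ k fun j hj => ?_]
      · rw [if_neg (by lia), if_pos (by lia), hc, add_sub_cancel_right]
        simp only [Module.End.one_apply, LinearMap.zero_apply, map_zero, zero_add, pow_one,
          parityOp_pow_pow]
        push_cast
        module
      · rw [if_neg (by lia), if_neg (by lia)]
        simp

lemma transOp_eq [CommPartials A] (a : Fock d A) :
    transOp a = VertexData.nprod (-2) a VertexData.vac := by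
  have := stateField_transOp a (-1) VertexData.vac
  rw [stateField_vac] at this
  rw [this, nprod_apply]
  norm_num

end StateField

/-! ## Homomorphisms given by free field systems -/

section FreeSystems

variable {d : ℕ} {A B : Type*} [CommRing A] [Algebra ℂ A] [Partials d A]
  [CommRing B] [Algebra ℂ B] [Partials d B]

/-- The central term in the commutator of the generating fields `β` and `α`. -/
def Gen.pair : Gen d B → Gen d B → ℤ → ℤ → ℂ
  | .beta i, .alpha j, l, m => if i = j ∧ l + m = 0 then l else 0
  | .alpha i, .beta j, l, m => if i = j ∧ l + m = 0 then l else 0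
  | _, _, _, _ => 0

/-- The simple pole in the operator product expansion of two generating fields (other than `α`),
an element of `B`. -/
def Gen.pole : Gen d B → Gen d B → B
  | .beta i, .fn f => pd i f
  | .fn f, .beta i => -pd i f
  | .b i, .c j => if i = j then 1 else 0
  | .c i, .b j => if i = j then 1 else 0
  | _, _ => 0

lemma Gen.pole_symm (g h : Gen d B) : h.pole g = -((-1 : ℂ) ^ (g.par * h.par) • g.pole h) := by
  cases g <;> cases h <;> simp only [Gen.pole, Gen.par, mul_zero, pow_zero, one_smul,
    neg_zero, mul_one, pow_one, neg_one_smul, neg_neg, smul_zero]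
  all_goals simp only [eq_comm]

lemma Gen.pair_symm (g h : Gen d B) (l m : ℤ) :
    h.pair g m l = -((-1 : ℂ) ^ (g.par * h.par) * g.pair h l m) := by
  cases g <;> cases h <;> simp only [Gen.pair, Gen.par, mul_zero, neg_zero]
  · rename_i i j
    by_cases h : i = j ∧ l + m = 0
    · rw [if_pos h, if_pos ⟨h.1.symm, by lia⟩, show m = -l by lia]
      simp
    · rw [if_neg h, if_neg fun h' => h ⟨h'.1.symm, by lia⟩]
      simp
  · rename_i i j
    by_cases h : i = j ∧ l + m = 0
    · rw [if_pos h, if_pos ⟨h.1.symm, by lia⟩, show m = -l by lia]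
      simp
    · rw [if_neg h, if_neg fun h' => h ⟨h'.1.symm, by lia⟩]
      simp

lemma funMode_zero (n : ℤ) : (funMode (0 : A) n : Module.End ℂ (Fock d A)) = 0 := by
  rw [← funField_ncoeff, map_zero]
  simp

lemma funMode_one [CommPartials A] (n : ℤ) :
    (funMode (1 : A) n : Module.End ℂ (Fock d A)) = if n = -1 then 1 else 0 := by
  rw [← funField_ncoeff, ← stateField_stF, ← vac_eq, stateField_vac_ncoeff]

lemma funMode_smul (c : ℂ) (f : A) (n : ℤ) :
    (funMode (c • f) n : Module.End ℂ (Fock d A)) = c • funMode f n := by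
  rw [← funField_ncoeff, map_smul]
  simp

lemma funMode_neg (f : A) (n : ℤ) :
    (funMode (-f) n : Module.End ℂ (Fock d A)) = -funMode f n := by
  rw [← funField_ncoeff, map_neg]
  simp

/-- Reverses a commutation relation, so that each unordered pair of generators needs to be treated
only once. -/
lemma commutator_symm {V : Type*} [AddCommGroup V] [Module ℂ V] {s : ℂ} (hs : s * s = 1)
    {S R P : Module.End ℂ V} {c : ℂ}
    (h : ∀ x, S (R x) = s • R (S x) + c • x + P x) (x : V) :
    R (S x) = s • S (R x) + (-(s * c)) • x + (-(s • P)) x := by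
  rw [h, LinearMap.neg_apply, LinearMap.smul_apply, smul_add, smul_add, smul_smul, hs]
  module

variable (B) in
/-- A system of states in `𝒲 ⊗ A` whose fields satisfy the relations of the generating fields of
`𝒲 ⊗ B`. -/
structure FreeSystem [CommPartials A] where
  hom : B →ₐ[ℂ] A
  st : Gen d B → Fock d A
  isHom : ∀ g, IsHom g.par (st g)
  st_fn : ∀ f, st (.fn f) = stF (hom f)
  rel : ∀ (g h : Gen d B) (l m : ℤ) (x : Fock d A),
    ((stateField (st g))[[l]]) (((stateField (st h))[[m]]) x) =
      (-1 : ℂ) ^ (g.par * h.par) • ((stateField (st h))[[m]]) (((stateField (st g))[[l]]) x) +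
        g.pair h l m • x + funMode (hom (g.pole h)) (l + m) x
  -- Annihilation of functions: the nonnegative modes in the base case of `FreeSystem.map_mode`.
  ann : ∀ (g : Gen d B) (n : ℤ), 0 ≤ n → ∀ f : B,
    ((stateField (st g))[[n]]) (stF (hom f)) = if n = 0 then stF (hom (g.pole (.fn f))) else 0
  -- The Euler recursion for the transformed functions. It determines their modes below `-1` on
  -- functions through the modes of `α`.
  jet : ∀ (n : ℤ) (f g : B) (M : ℕ), -n ≤ M → (-(n : ℂ) - 1) •
    (funMode (hom f) n) (stF (hom g) : Fock d A) = ∑ j ∈ Finset.range M, ∑ i,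
      ((stateField (st (.alpha i)))[[Int.negSucc j]])
        (funMode (hom (pd i f)) (n + 1 + j) (stF (hom g)))

/-- The generating fields of `𝒲 ⊗ B` satisfy the defining relations. -/
lemma Gen.rel [CommPartials B] (g h : Gen d B) (l m : ℤ) (x : Fock d B) :
    (g.field[[l]]) ((h.field[[m]]) x) = (-1 : ℂ) ^ (g.par * h.par) • (h.field[[m]])
      ((g.field[[l]]) x) + g.pair h l m • x + funMode (g.pole h) (l + m) x := by
  have hs : ∀ g h : Gen d B, (∀ (l m : ℤ) (x : Fock d B),
      (g.field[[l]]) ((h.field[[m]]) x) = (-1 : ℂ) ^ (g.par * h.par) • (h.field[[m]])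
      ((g.field[[l]]) x) + g.pair h l m • x + funMode (g.pole h) (l + m) x) →
      ∀ (l m : ℤ) (x : Fock d B),
      (h.field[[l]]) ((g.field[[m]]) x) = (-1 : ℂ) ^ (h.par * g.par) • (g.field[[m]])
      ((h.field[[l]]) x) + h.pair g l m • x + funMode (h.pole g) (l + m) x := by
    intro g h H l m x
    rw [commutator_symm (neg_one_pow_mul_self _) (H m l), mul_comm h.par, ← Gen.pair_symm,
      Gen.pole_symm g h, funMode_neg, funMode_smul, add_comm m l]
  have h1 : ∀ (i : Fin d) (h : Gen d B) (l m : ℤ) (x : Fock d B),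
      ((Gen.beta i).field[[l]]) ((h.field[[m]]) x) = (-1 : ℂ) ^ ((Gen.beta i : Gen d B).par * h.par) •
      (h.field[[m]]) (((Gen.beta i).field[[l]]) x) + (Gen.beta i).pair h l m • x +
        funMode ((Gen.beta i).pole h) (l + m) x := by
    intro i h l m x
    cases h <;> simp only [Gen.par, Gen.pair, Gen.pole, Gen.field, mul_zero, zero_mul, pow_zero,
      one_smul, zero_smul, add_zero, funMode_zero, LinearMap.zero_apply, betaField_ncoeff,
      alphaField_ncoeff, bField_ncoeff, cField_ncoeff, funField_ncoeff]
    · exact commute_apply (commute_betaMode_betaMode _ _ _ _) x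
    · rw [betaMode_alphaMode]
      split <;> simp
    · exact commute_apply (commute_betaMode_bMode _ _ _ _) x
    · exact commute_apply (commute_betaMode_cMode _ _ _ _) x
    · exact betaMode_funMode _ _ _ _ x
  have h2 : ∀ (f : B) (h : Gen d B) (l m : ℤ) (x : Fock d B),
      ((Gen.fn f).field[[l]]) ((h.field[[m]]) x) = (-1 : ℂ) ^ ((Gen.fn f : Gen d B).par * h.par) •
      (h.field[[m]]) (((Gen.fn f).field[[l]]) x) + (Gen.fn f).pair h l m • x +
        funMode ((Gen.fn f).pole h) (l + m) x := by
    intro f h l m x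
    cases h
    · exact hs _ _ (h1 _ _) l m x
    all_goals simp only [Gen.par, Gen.pair, Gen.pole, Gen.field, mul_zero, zero_mul, pow_zero,
      one_smul, zero_smul, add_zero, funMode_zero, LinearMap.zero_apply, alphaField_ncoeff,
      bField_ncoeff, cField_ncoeff, funField_ncoeff]
    · exact (commute_apply (commute_alphaMode_funMode _ _ _ _) x).symm
    · exact (commute_apply (commute_bMode_funMode _ _ _ _) x).symm
    · exact (commute_apply (commute_cMode_funMode _ _ _ _) x).symm
    · exact commute_apply (commute_funMode_funMode _ _ _ _) x
  have h3 : ∀ (i : Fin d) (h : Gen d B) (l m : ℤ) (x : Fock d B),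
      ((Gen.alpha i).field[[l]]) ((h.field[[m]]) x) = (-1 : ℂ) ^ ((Gen.alpha i : Gen d B).par * h.par) •
      (h.field[[m]]) (((Gen.alpha i).field[[l]]) x) + (Gen.alpha i).pair h l m • x +
        funMode ((Gen.alpha i).pole h) (l + m) x := by
    intro f h l m x
    cases h
    · exact hs _ _ (h1 _ _) l m x
    on_goal 4 => exact hs _ _ (h2 _ _) l m x
    all_goals simp only [Gen.par, Gen.pair, Gen.pole, Gen.field, mul_zero, zero_mul, pow_zero,
      one_smul, zero_smul, add_zero, funMode_zero, LinearMap.zero_apply, alphaField_ncoeff,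
      bField_ncoeff, cField_ncoeff]
    · exact commute_apply (commute_alphaMode_alphaMode _ _ _ _) x
    · exact commute_apply (commute_alphaMode_bMode _ _ _ _) x
    · exact commute_apply (commute_alphaMode_cMode _ _ _ _) x
  have h4 : ∀ (i : Fin d) (h : Gen d B) (l m : ℤ) (x : Fock d B),
      ((Gen.b i).field[[l]]) ((h.field[[m]]) x) = (-1 : ℂ) ^ ((Gen.b i : Gen d B).par * h.par) •
      (h.field[[m]]) (((Gen.b i).field[[l]]) x) + (Gen.b i).pair h l m • x +
        funMode ((Gen.b i).pole h) (l + m) x := by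
    intro f h l m x
    cases h
    · exact hs _ _ (h1 _ _) l m x
    · exact hs _ _ (h3 _ _) l m x
    on_goal 3 => exact hs _ _ (h2 _ _) l m x
    all_goals simp only [Gen.par, Gen.pair, Gen.pole, Gen.field, mul_one, pow_one, neg_one_smul,
      zero_smul, add_zero, funMode_zero, LinearMap.zero_apply, bField_ncoeff, cField_ncoeff]
    · exact bMode_bMode _ _ _ _ x
    · rename_i i
      rw [bMode_cMode]
      by_cases h : f = i
      · simp only [h, true_and, if_true, funMode_one]
        split <;> simp
      · simp [h, funMode_zero]
  cases g
  · exact h1 _ _ l m x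
  · exact h3 _ _ l m x
  · exact h4 _ _ l m x
  · cases h
    · exact hs _ _ (h1 _ _) l m x
    · exact hs _ _ (h3 _ _) l m x
    · exact hs _ _ (h4 _ _) l m x
    on_goal 2 => exact hs _ _ (h2 _ _) l m x
    simp only [Gen.par, Gen.pair, Gen.pole, Gen.field, mul_one, pow_one, neg_one_smul,
      zero_smul, add_zero, funMode_zero, LinearMap.zero_apply, cField_ncoeff]
    exact cMode_cMode _ _ _ _ x
  · exact h2 _ _ l m x

lemma Gen.ann (g : Gen d B) (n : ℤ) (hn : 0 ≤ n) (f : B) :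
    (g.field[[n]]) (stF f) = if n = 0 then stF (g.pole (.fn f)) else 0 := by
  have h0 : (stF 0 : Fock d B) = 0 := Finsupp.single_zero _
  rcases hn.eq_or_lt with rfl | hn
  · rw [if_pos rfl]
    cases g <;> simp only [Gen.pole, Gen.field, betaField_ncoeff,
      alphaField_ncoeff, bField_ncoeff, cField_ncoeff, funField_ncoeff, h0]
    · exact betaMode_zero_stF _ _
    · rw [alphaMode_zero]; rfl
    · exact bMode_stF _ le_rfl _
    · exact cMode_stF _ le_rfl _
    · exact funMode_stF_of_nonneg _ le_rfl _
  · rw [if_neg (by lia), g.kills_stF hn]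

/-- The odd generating field with a given label. -/
def fermionGen (v : FermionVar d) : Gen d B :=
  if (ofLex v).1 then .c (ofLex (ofLex v).2).1 else .b (ofLex (ofLex v).2).1

lemma fermionGen_par (v : FermionVar d) : (fermionGen v : Gen d B).par = 1 := by
  rw [fermionGen]; split <;> rfl

lemma fermionGen_mode (v : FermionVar d) :
    ((fermionGen v : Gen d B).field[[Int.negSucc (ofLex (ofLex v).2).2]]) = createFermion v := by
  obtain ⟨(_ | _), i, k⟩ := v
  · exact bField_ncoeff _ _
  · exact cField_ncoeff _ _

namespace FreeSystem

variable [CommPartials A] (F : FreeSystem (A := A) B)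

/-- The modes of the fields of a free field system. -/
def mode (g : Gen d B) (n : ℤ) : Module.End ℂ (Fock d A) := (stateField (F.st g))[[n]]

/-- The odd creation operators of a free field system. -/
def fermion (v : FermionVar d) : Module.End ℂ (Fock d A) :=
  F.mode (fermionGen v) (Int.negSucc (ofLex (ofLex v).2).2)

/-- The linear map `𝒲 ⊗ B → 𝒲 ⊗ A` given by a free field system. -/
def map : Fock d B →ₗ[ℂ] Fock d A :=
  Finsupp.lsum ℂ fun m => ((m.1.toList.map fun v => F.mode (.beta v.1) (Int.negSucc v.2)).prod *
    (m.2.1.toList.map fun v => F.mode (.alpha v.1) (Int.negSucc v.2)).prod *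
    ((m.2.2.sort (· ≤ ·)).map F.fermion).prod) ∘ₗ Finsupp.lsingle (0, 0, ∅) ∘ₗ F.hom.toLinearMap

lemma map_single (m : Mono d) (f : B) : F.map (Finsupp.single m f) =
    (m.1.toList.map fun v => F.mode (.beta v.1) (Int.negSucc v.2)).prod
      ((m.2.1.toList.map fun v => F.mode (.alpha v.1) (Int.negSucc v.2)).prod
        (((m.2.2.sort (· ≤ ·)).map F.fermion).prod (stF (F.hom f)))) := by
  rw [map, Finsupp.lsum_single]
  rfl

lemma map_stF (f : B) : F.map (stF f) = stF (F.hom f) := by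
  rw [stF, map_single]
  simp

lemma mode_fn (f : B) (n : ℤ) : F.mode (.fn f) n = funMode (F.hom f) n := by
  rw [mode, F.st_fn, stateField_stF, funField_ncoeff]

lemma mode_mode (g h : Gen d B) (l m : ℤ) (x : Fock d A) :
    F.mode g l (F.mode h m x) = (-1 : ℂ) ^ (g.par * h.par) • F.mode h m (F.mode g l x) +
        g.pair h l m • x + funMode (F.hom (g.pole h)) (l + m) x := F.rel g h l m x

/-- The pole of `b` and `c` is a constant, whose only mode has index `-1`. Two creation indices
never add up to `-1`, so the odd creation operators of a free field system anticommute. -/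
lemma funMode_ite (p : Prop) [Decidable p] {n : ℤ} (hn : n ≠ -1) :
    (funMode (if p then 1 else 0 : A) n : Module.End ℂ (Fock d A)) = 0 := by
  split
  · rw [funMode_one, if_neg hn]
  · rw [funMode_zero]

lemma commute_beta_beta (v w : BosonVar d) :
    Commute (F.mode (.beta v.1) (Int.negSucc v.2)) (F.mode (.beta w.1) (Int.negSucc w.2)) :=
  LinearMap.ext fun x => by
    simp [mode_mode F (.beta v.1), Gen.pair, Gen.pole, Gen.par, funMode_zero]

lemma commute_alpha_alpha (v w : BosonVar d) :
    Commute (F.mode (.alpha v.1) (Int.negSucc v.2)) (F.mode (.alpha w.1) (Int.negSucc w.2)) :=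
  LinearMap.ext fun x => by
    simp [mode_mode F (.alpha v.1), Gen.pair, Gen.pole, Gen.par, funMode_zero]

lemma commute_beta_alpha (v w : BosonVar d) :
    Commute (F.mode (.beta v.1) (Int.negSucc v.2)) (F.mode (.alpha w.1) (Int.negSucc w.2)) :=
  LinearMap.ext fun x => by
    rw [Module.End.mul_apply, mode_mode F (.beta v.1), Gen.pair, if_neg (by lia)]
    simp [Gen.pole, Gen.par, funMode_zero]

lemma commute_beta_fermion (v : BosonVar d) (w : FermionVar d) :
    Commute (F.mode (.beta v.1) (Int.negSucc v.2)) (F.fermion w) :=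
  LinearMap.ext fun x => by
    rw [Module.End.mul_apply, fermion, mode_mode F (.beta v.1), fermionGen]
    split <;> simp [Gen.pair, Gen.pole, Gen.par, funMode_zero]

lemma commute_alpha_fermion (v : BosonVar d) (w : FermionVar d) :
    Commute (F.mode (.alpha v.1) (Int.negSucc v.2)) (F.fermion w) :=
  LinearMap.ext fun x => by
    rw [Module.End.mul_apply, fermion, mode_mode F (.alpha v.1), fermionGen]
    split <;> simp [Gen.pair, Gen.pole, Gen.par, funMode_zero]

lemma fermion_fermion (v w : FermionVar d) (x : Fock d A) :
    F.fermion v (F.fermion w x) = -F.fermion w (F.fermion v x) := by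
  rw [fermion, fermion, mode_mode F, fermionGen, fermionGen]
  split <;> split <;> simp only [Gen.pair, Gen.pole, Gen.par, funMode_zero, map_zero] <;>
    simp [funMode_ite (d := d) (A := A) _ (show Int.negSucc (ofLex (ofLex v).2).2 +
      Int.negSucc (ofLex (ofLex w).2).2 ≠ -1 by lia)]

lemma fermion_self (v : FermionVar d) (x : Fock d A) : F.fermion v (F.fermion v x) = 0 := by
  have := F.fermion_fermion v v x
  rwa [← sub_eq_zero, sub_neg_eq_add, ← two_smul ℂ, smul_eq_zero_iff_right two_ne_zero] at this

lemma list_prod_perm {V ι : Type*} [AddCommGroup V] [Module ℂ V] (f : ι → Module.End ℂ V)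
    (hf : ∀ i j, Commute (f i) (f j)) {L L' : List ι} (h : L.Perm L') :
    (L.map f).prod = (L'.map f).prod := by
  induction h with
  | nil => rfl
  | cons i h ih => rw [List.map_cons, List.map_cons, List.prod_cons, List.prod_cons, ih]
  | swap i j L =>
    simp only [List.map_cons, List.prod_cons, ← mul_assoc, (hf i j).eq]
  | trans h h' ih ih' => exact ih.trans ih'

lemma perm_toList_cons {ι : Type*} (v : ι) (s : Multiset ι) :
    (v ::ₘ s).toList.Perm (v :: s.toList) := Multiset.coe_eq_coe.1 (by
  rw [Multiset.coe_toList, ← Multiset.cons_coe, Multiset.coe_toList])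

lemma sort_insert {v : FermionVar d} {s : Finset (FermionVar d)} (hv : v ∉ s) :
    (insert v s).sort (· ≤ ·) = (s.sort (· ≤ ·)).orderedInsert (· ≤ ·) v := by
  refine List.Perm.eq_of_pairwise' (Finset.pairwise_sort _ _)
    ((Finset.pairwise_sort s (· ≤ ·)).orderedInsert v _)
    (Multiset.coe_eq_coe.1 ?_) (r := (· ≤ ·))
  rw [Finset.sort_eq, Finset.insert_val_of_notMem hv,
    Multiset.coe_eq_coe.2 (List.perm_orderedInsert _ _ _), ← Multiset.cons_coe, Finset.sort_eq]

lemma map_createBeta (v : BosonVar d) (x : Fock d B) :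
    F.map (createBeta v x) = F.mode (.beta v.1) (Int.negSucc v.2) (F.map x) := by
  refine LinearMap.congr_fun (Finsupp.lhom_ext (φ := F.map ∘ₗ createBeta v)
    (ψ := F.mode (.beta v.1) (Int.negSucc v.2) ∘ₗ F.map) fun m f => ?_) x
  rw [LinearMap.comp_apply, LinearMap.comp_apply, createBeta_single, map_single, map_single,
    list_prod_perm (fun v : BosonVar d => F.mode (.beta v.1) (Int.negSucc v.2))
      (fun _ _ => F.commute_beta_beta _ _) (L' := v :: m.1.toList)
      (perm_toList_cons _ _)]
  rfl

lemma map_createAlpha (v : BosonVar d) (x : Fock d B) :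
    F.map (createAlpha v x) = F.mode (.alpha v.1) (Int.negSucc v.2) (F.map x) := by
  refine LinearMap.congr_fun (Finsupp.lhom_ext (φ := F.map ∘ₗ createAlpha v)
    (ψ := F.mode (.alpha v.1) (Int.negSucc v.2) ∘ₗ F.map) fun m f => ?_) x
  rw [LinearMap.comp_apply, LinearMap.comp_apply, createAlpha_single, map_single, map_single,
    list_prod_perm (fun v : BosonVar d => F.mode (.alpha v.1) (Int.negSucc v.2))
      (fun _ _ => F.commute_alpha_alpha _ _) (L' := v :: m.2.1.toList)
      (perm_toList_cons _ _), List.map_cons, List.prod_cons, Module.End.mul_apply]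
  refine (commute_apply (Commute.list_prod_right _ _ fun S hS => ?_) _).symm
  obtain ⟨w, -, rfl⟩ := List.mem_map.1 hS
  exact (F.commute_beta_alpha w v).symm

/-- Each smaller label that is passed contributes a factor `-1`, and `fermionSign` counts these
labels. -/
lemma fermion_orderedInsert (v : FermionVar d) (L : List (FermionVar d)) (hL : L.Pairwise (· < ·))
    (hv : v ∉ L) (x : Fock d A) : ((L.orderedInsert (· ≤ ·) v).map F.fermion).prod x =
      fermionSign v L.toFinset • F.fermion v ((L.map F.fermion).prod x) := by
  induction L with
  | nil => simp [fermionSign]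
  | cons w L ih =>
    rw [List.pairwise_cons] at hL
    rw [List.mem_cons, not_or] at hv
    have hw : w ∉ L.toFinset := fun h => lt_irrefl _ (hL.1 w (List.mem_toFinset.1 h))
    rw [List.orderedInsert, List.toFinset_cons, fermionSign_insert hw]
    split
    · rename_i h
      rw [if_neg h.not_gt, fermionSign_of_lt fun u hu =>
        h.trans_lt (hL.1 u (List.mem_toFinset.1 hu))]
      simp
    · rename_i h
      rw [if_pos (not_le.1 h), List.map_cons, List.prod_cons, Module.End.mul_apply, ih hL.2 hv.2,
        map_smul, F.fermion_fermion w v, List.map_cons, List.prod_cons, Module.End.mul_apply]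
      module

lemma fermion_prod_mem (v : FermionVar d) (L : List (FermionVar d)) (hv : v ∈ L) (x : Fock d A) :
    F.fermion v ((L.map F.fermion).prod x) = 0 := by
  induction L with
  | nil => simp at hv
  | cons w L ih =>
    rw [List.map_cons, List.prod_cons, Module.End.mul_apply]
    rcases List.mem_cons.1 hv with rfl | hv
    · exact F.fermion_self v _
    · rw [F.fermion_fermion, ih hv, map_zero, neg_zero]

lemma map_createFermion (v : FermionVar d) (x : Fock d B) :
    F.map (createFermion v x) = F.fermion v (F.map x) := by
  refine LinearMap.congr_fun (Finsupp.lhom_ext (φ := F.map ∘ₗ createFermion v)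
    (ψ := F.fermion v ∘ₗ F.map) fun m f => ?_) x
  have hβ : ∀ y, F.fermion v
      ((m.1.toList.map fun v => F.mode (.beta v.1) (Int.negSucc v.2)).prod y) =
      (m.1.toList.map fun v => F.mode (.beta v.1) (Int.negSucc v.2)).prod (F.fermion v y) :=
    commute_apply (Commute.list_prod_right _ _ fun S hS => by
      obtain ⟨w, -, rfl⟩ := List.mem_map.1 hS
      exact (F.commute_beta_fermion w v).symm)
  have hα : ∀ y, F.fermion v
      ((m.2.1.toList.map fun v => F.mode (.alpha v.1) (Int.negSucc v.2)).prod y) =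
      (m.2.1.toList.map fun v => F.mode (.alpha v.1) (Int.negSucc v.2)).prod (F.fermion v y) :=
    commute_apply (Commute.list_prod_right _ _ fun S hS => by
      obtain ⟨w, -, rfl⟩ := List.mem_map.1 hS
      exact (F.commute_alpha_fermion w v).symm)
  rw [LinearMap.comp_apply, LinearMap.comp_apply, createFermion_single, map_single, hβ, hα]
  by_cases hv : v ∈ m.2.2
  · rw [if_pos hv, fermion_prod_mem F v _ ((Finset.mem_sort _).2 hv)]
    simp
  · rw [if_neg hv, map_smul, map_single, ← map_smul, ← map_smul]
    congr 2
    rw [sort_insert hv, F.fermion_orderedInsert v _ m.2.2.sortedLT_sort.pairwise (by simpa using hv),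
      Finset.sort_toFinset, smul_smul, fermionSign_mul_self, one_smul]

/-- The recursion `taylor_rec` in the source and `FreeSystem.jet` in the target have the same form,
and `map` takes one `α` to the other. The mode `-1` is multiplicativity of `F.hom`. -/
lemma map_funMode_stF [CommPartials B] (f g : B) (n : ℤ) :
    F.map (funMode f n (stF g)) = funMode (F.hom f) n (stF (F.hom g)) := by
  rcases le_or_gt 0 n with hn | hn
  · rw [funMode_stF_of_nonneg _ hn, funMode_stF_of_nonneg _ hn, map_zero]
  · obtain ⟨k, rfl⟩ : ∃ k : ℕ, n = -1 - k := ⟨(-1 - n).toNat, by lia⟩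
    clear hn
    induction k using Nat.strong_induction_on generalizing f with
    | _ k ih =>
      rcases k with _ | k
      · have : (-1 : ℤ) - ((0 : ℕ) : ℤ) = -1 := by simp
        rw [this, funMode_stF, funMode_stF, taylor_neg_one, taylor_neg_one, mulFun_stF, mulFun_stF,
          map_stF, map_mul]
      · have h1 := F.jet (-1 - ((k + 1 : ℕ) : ℤ)) f g (k + 2) (by push_cast; lia)
        have h2 := LinearMap.congr_fun (taylor_rec (d := d) (A := B) (-1 - ((k + 1 : ℕ) : ℤ)) f
          (M := k + 2) (by push_cast; lia)) (stF g)
        have hk : (-(((-1 - ((k + 1 : ℕ) : ℤ) : ℤ)) : ℂ) - 1) ≠ 0 := by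
          push_cast
          rw [show -(-1 - ((k : ℂ) + 1)) - 1 = ((k + 1 : ℕ) : ℂ) by push_cast; ring]
          exact_mod_cast Nat.succ_ne_zero k
        refine smul_right_injective _ hk ?_
        simp only [LinearMap.smul_apply, LinearMap.sum_apply, Module.End.mul_apply] at h2
        simp only
        rw [h1, ← map_smul, funMode_stF, h2, map_sum]
        refine Finset.sum_congr rfl fun j _ => ?_
        rw [map_sum]
        refine Finset.sum_congr rfl fun i _ => ?_
        rw [map_createAlpha, ← funMode_stF, mode]
        congr 1
        rcases le_or_gt (k + 1) j with hj | hj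
        · rw [funMode_stF_of_nonneg _ (by lia), funMode_stF_of_nonneg _ (by lia), map_zero]
        · have := ih (k - j) (by lia) (pd i f)
          rwa [show -1 - ((k - j : ℕ) : ℤ) = -1 - ((k + 1 : ℕ) : ℤ) + 1 + j by lia] at this

/-- Negative modes of `β`, `α`, `b`, `c` are the creation operators, which `map` respects by
construction. Function fields are excluded because their negative modes are not creation operators.
-/
lemma map_create (h : Gen d B) (hh : h.par = 1 ∨ h.par = 0 ∧ ∀ f, h ≠ .fn f) (k : ℕ) (x : Fock d B) :
    F.map ((h.field[[Int.negSucc k]]) x) = F.mode h (Int.negSucc k) (F.map x) := by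
  cases h
  · rw [Gen.field, betaField_ncoeff]
    exact F.map_createBeta (_, k) x
  · rw [Gen.field, alphaField_ncoeff]
    exact F.map_createAlpha (_, k) x
  · rw [Gen.field, bField_ncoeff]
    exact F.map_createFermion (bVar _ k) x
  · rw [Gen.field, cField_ncoeff]
    exact F.map_createFermion (cVar _ k) x
  · rename_i f
    rcases hh with hh | hh
    · exact absurd hh zero_ne_one
    · exact absurd rfl (hh.2 f)

/-- The vectors on which `map` intertwines all modes of all generators form a subspace. It contains
the functions, and it is stable under creation operators because both sides obey the same
commutation relations, whose pole terms are again modes of generating fields. -/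
lemma map_mode [CommPartials B] (g : Gen d B) (n : ℤ) (x : Fock d B) :
    F.map ((g.field[[n]]) x) = F.mode g n (F.map x) := by
  let U : Submodule ℂ (Fock d B) := ⨅ g : Gen d B, ⨅ n : ℤ,
    LinearMap.ker (F.map ∘ₗ (g.field[[n]]) - F.mode g n ∘ₗ F.map)
  have hU : ∀ x, x ∈ U ↔ ∀ (g : Gen d B) (n : ℤ),
      F.map ((g.field[[n]]) x) = F.mode g n (F.map x) := fun x => by
    simp [U, Submodule.mem_iInf, sub_eq_zero]
  have hstep : ∀ (h : Gen d B) (hh : h.par = 1 ∨ h.par = 0 ∧ ∀ f, h ≠ .fn f) (k : ℕ), ∀ x ∈ U,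
      (h.field[[Int.negSucc k]]) x ∈ U := fun h hh k x hx => by
    rw [hU] at hx ⊢
    intro g n
    have hf := hx (.fn (g.pole h)) (n + Int.negSucc k)
    rw [Gen.field, funField_ncoeff, mode_fn] at hf
    rw [Gen.rel, map_add, map_add, map_smul, map_smul, F.map_create h hh, F.map_create h hh,
      mode_mode, hx, hf]
  refine (hU x).1 (fock_induction (U := U) (fun f => (hU _).2 fun g n => ?_) (fun v x hx => ?_)
    (fun v x hx => ?_) (fun v => ?_) x) g n
  · rcases le_or_gt 0 n with hn | hn
    · rw [Gen.ann g n hn, map_stF, mode, F.ann g n hn]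
      split
      · rw [map_stF]
      · rw [map_zero]
    · obtain ⟨k, rfl⟩ := Int.eq_negSucc_of_lt_zero hn
      cases g
      case fn g => rw [Gen.field, funField_ncoeff, map_funMode_stF, mode_fn, map_stF]
      all_goals refine F.map_create _ ?_ k _
      · exact .inr ⟨rfl, by simp⟩
      · exact .inr ⟨rfl, by simp⟩
      · exact .inl rfl
      · exact .inl rfl
  · have := hstep (.beta v.1) (.inr ⟨rfl, by simp⟩) v.2 x hx
    rwa [Gen.field, betaField_ncoeff] at this
  · have := hstep (.alpha v.1) (.inr ⟨rfl, by simp⟩) v.2 x hx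
    rwa [Gen.field, alphaField_ncoeff] at this
  · intro x hx
    rw [← fermionGen_mode]
    exact hstep _ (.inl (fermionGen_par v)) _ x hx

lemma map_parityOp (x : Fock d B) : F.map (parityOp x) = parityOp (F.map x) := by
  have key := fock_induction (U := LinearMap.ker (F.map ∘ₗ parityOp - parityOp ∘ₗ F.map))
    (fun f => ?_) (fun v x hx => ?_) (fun v x hx => ?_) (fun v x hx => ?_) x
  · exact sub_eq_zero.1 key
  · simp [map_stF, parityOp_stF]
  all_goals
    simp only [LinearMap.mem_ker, LinearMap.sub_apply, LinearMap.comp_apply, sub_eq_zero] at hx ⊢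
  · rw [commute_apply (commute_parityOp_createBeta v), map_createBeta, map_createBeta, hx,
      mode, (isHomField_stateField (F.isHom _)).par, Gen.par, pow_zero, one_smul]
  · rw [commute_apply (commute_parityOp_createAlpha v), map_createAlpha, map_createAlpha, hx,
      mode, (isHomField_stateField (F.isHom _)).par, Gen.par, pow_zero, one_smul]
  · rw [parityOp_createFermion, map_neg, map_createFermion, map_createFermion, hx, fermion, mode,
      (isHomField_stateField (F.isHom _)).par, fermionGen_par, pow_one, neg_one_smul]

lemma map_wickMode {S R : VertexOperator ℂ (Fock d B)} {S' R' : VertexOperator ℂ (Fock d A)}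
    (hS : ∀ (n : ℤ) x, F.map ((S[[n]]) x) = (S'[[n]]) (F.map x))
    (hR : ∀ (n : ℤ) x, F.map ((R[[n]]) x) = (R'[[n]]) (F.map x)) (p k : ℕ) (n : ℤ)
    (x : Fock d B) : F.map (wickMode (parityOp ^ p) S k R n x) =
      wickMode (parityOp ^ p) S' k R' n (F.map x) := by
  have hp : ∀ x, F.map ((parityOp ^ p : Module.End ℂ (Fock d B)) x) =
      (parityOp ^ p : Module.End ℂ (Fock d A)) (F.map x) := by
    induction p with
    | zero => exact fun _ => rfl
    | succ p ih =>
      intro x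
      rw [pow_succ, pow_succ, Module.End.mul_apply, Module.End.mul_apply, ih, map_parityOp]
  rw [wickMode_apply, wickMode_apply]
  refine (F.map.toAddMonoidHom.map_finsum (wickTerm_finite _ S k R n x)).trans ?_
  refine finsum_congr fun j => ?_
  change F.map _ = _
  simp only [wickTerm, LinearMap.smul_apply, LinearMap.add_apply, LinearMap.comp_apply, map_smul,
    map_add, hS, hR, hp]

/-- The map given by a free field system is a homomorphism of vertex algebras. -/
lemma map_nprod [CommPartials B] (n : ℤ) (a b : Fock d B) :
    F.map (VertexData.nprod n a b) = VertexData.nprod n (F.map a) (F.map b) := by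
  let U : Submodule ℂ (Fock d B) :=
    { carrier := {a | ∀ (n : ℤ) b, F.map (((stateField a)[[n]]) b) =
        ((stateField (F.map a))[[n]]) (F.map b)}
      zero_mem' := fun n b => by simp
      add_mem' := fun ha hb n x => by simp [ha n x, hb n x]
      smul_mem' := fun c a ha n x => by simp [ha n x] }
  -- On both sides, the field of `h_(-k-1) x` is the normally ordered product of the field of `h`
  -- and the field of `x`. The claim for all modes of `x` therefore passes to `h_(-k-1) x`.
  have hstep : ∀ (h : Gen d B) (hh : h.par = 1 ∨ h.par = 0 ∧ ∀ f, h ≠ .fn f) (k : ℕ), ∀ x ∈ U,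
      (h.field[[Int.negSucc k]]) x ∈ U := fun h hh k x hx n b => by
    have h1 := stateField_nprod_negSucc (h.isHomField.isHom) k x
    have h2 := stateField_nprod_negSucc (F.isHom h) k (F.map x)
    rw [nprod_apply, h.stateField_eq] at h1
    rw [F.map_create h hh, mode, h1]
    rw [nprod_apply] at h2
    rw [h2, wick_ncoeff, wick_ncoeff]
    exact F.map_wickMode (F.map_mode h) hx _ _ _ _
  refine fock_induction (U := U) (fun f n b => ?_) (fun v x hx => ?_)
    (fun v x hx => ?_) (fun v x hx => ?_) a n b
  · rw [stateField_stF, map_stF, stateField_stF, funField_ncoeff, funField_ncoeff]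
    have := F.map_mode (.fn f) n b
    rwa [Gen.field, funField_ncoeff, mode_fn] at this
  · have := hstep (.beta v.1) (.inr ⟨rfl, by simp⟩) v.2 x hx
    rwa [Gen.field, betaField_ncoeff] at this
  · have := hstep (.alpha v.1) (.inr ⟨rfl, by simp⟩) v.2 x hx
    rwa [Gen.field, alphaField_ncoeff] at this
  · rw [← fermionGen_mode]
    exact hstep _ (.inl (fermionGen_par v)) _ x hx

lemma map_vac : F.map VertexData.vac = VertexData.vac := by
  rw [vac_eq, map_stF, map_one, ← vac_eq]

/-- The map given by a free field system sends the generators to the given states. -/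
lemma map_gen [CommPartials B] (g : Gen d B) :
    F.map ((g.field[[-1]]) VertexData.vac) = F.st g := by
  rw [map_mode, map_vac, mode, stateField_vac]

end FreeSystem

end FreeSystems

/-! ## The chiral de Rham differential -/

section Differential

variable {d : ℕ} {A : Type*} [CommRing A] [Algebra ℂ A] [Partials d A]

lemma isHom_zero (p : ℕ) : IsHom p (0 : Fock d A) := by simp [IsHom]

lemma IsHom.add {p : ℕ} {a b : Fock d A} (ha : IsHom p a) (hb : IsHom p b) : IsHom p (a + b) := by
  rw [IsHom] at *
  rw [map_add, ha, hb, smul_add]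

lemma IsHom.sum {ι : Type*} {s : Finset ι} {p : ℕ} {a : ι → Fock d A} (ha : ∀ i, IsHom p (a i)) :
    IsHom p (∑ i ∈ s, a i) :=
  Finset.sum_induction _ (IsHom p) (fun _ _ => .add) (isHom_zero p) fun i _ => ha i

lemma isHom_stF (f : A) : IsHom 0 (stF f : Fock d A) := by
  rw [IsHom, parityOp_stF, pow_zero, one_smul]

lemma Gen.isHom_mode [CommPartials A] (g : Gen d A) (n : ℤ) {q : ℕ} {x : Fock d A}
    (hx : IsHom q x) : IsHom (g.par + q) ((g.field[[n]]) x) := by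
  rw [IsHom, g.isHomField.par, hx, map_smul, smul_smul, pow_add]

/-- The state `∑ βⁱ_(-1) cⁱ`, whose zero mode is the chiral de Rham differential. -/
def diffState : Fock d A := ∑ i, betaMode i (-1) (cMode i (-1) VertexData.vac)

/-- The chiral de Rham differential. -/
def diffOp : Module.End ℂ (Fock d A) := (stateField diffState)[[0]]

lemma isHom_betaMode [CommPartials A] (i : Fin d) (n : ℤ) {q : ℕ} {x : Fock d A} (hx : IsHom q x) :
    IsHom q (betaMode i n x) := by
  have := Gen.isHom_mode (.beta i) n hx
  rwa [Gen.field, betaField_ncoeff, Gen.par, zero_add] at this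

lemma isHom_bMode [CommPartials A] (i : Fin d) (n : ℤ) {q : ℕ} {x : Fock d A} (hx : IsHom q x) :
    IsHom (1 + q) (bMode i n x) := by
  have := Gen.isHom_mode (.b i) n hx
  rwa [Gen.field, bField_ncoeff, Gen.par] at this

lemma isHom_cMode [CommPartials A] (i : Fin d) (n : ℤ) {q : ℕ} {x : Fock d A} (hx : IsHom q x) :
    IsHom (1 + q) (cMode i n x) := by
  have := Gen.isHom_mode (.c i) n hx
  rwa [Gen.field, cField_ncoeff, Gen.par] at this

lemma isHom_vac : IsHom 0 (VertexData.vac : Fock d A) := isHom_stF 1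

lemma isHom_diffState [CommPartials A] : IsHom 1 (diffState : Fock d A) :=
  IsHom.sum fun i => isHom_betaMode i _ (isHom_cMode i _ isHom_vac)

lemma stB_eq_bMode (i : Fin d) : stB A i = bMode i (-1) VertexData.vac := stB_eq i

lemma stC_eq_cMode (i : Fin d) : stC A i = cMode i (-1) VertexData.vac := stC_eq i

lemma stBeta_eq_betaMode (i : Fin d) : stBeta A i = betaMode i (-1) VertexData.vac := stBeta_eq i

lemma isHom_stB [CommPartials A] (i : Fin d) : IsHom 1 (stB A i) := by
  rw [stB_eq_bMode]
  exact isHom_bMode i (-1) isHom_vac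

lemma isHom_stC [CommPartials A] (i : Fin d) : IsHom 1 (stC A i) := by
  rw [stC_eq_cMode]
  exact isHom_cMode i (-1) isHom_vac

lemma isHom_stBeta [CommPartials A] (i : Fin d) : IsHom 0 (stBeta A i) := by
  rw [stBeta_eq_betaMode]
  exact isHom_betaMode i (-1) isHom_vac

lemma diffOp_apply [CommPartials A] (x : Fock d A) : diffOp x = ∑ i, ∑ᶠ j : ℕ,
    (betaMode i (-1 - j) (cMode i j x) + cMode i (-1 - j) (betaMode i j x)) := by
  have h : ∀ i, betaMode i (-1) (cMode i (-1) (VertexData.vac : Fock d A)) =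
      VertexData.nprod (Int.negSucc 0) (stBeta A i) (stC A i) := fun i => by
    rw [nprod_apply, stateField_stBeta, betaField_ncoeff, stC_eq]
    rfl
  rw [diffOp, diffState]
  simp only [h, map_sum, Finset.sum_apply, LinearMap.sum_apply]
  refine Finset.sum_congr rfl fun i _ => ?_
  rw [stateField_nprod_negSucc (isHom_stBeta i), wick_ncoeff, wickMode_apply, stateField_stBeta,
    stateField_stC]
  refine finsum_congr fun j => ?_
  simp [wickTerm]

lemma diffOp_apply_of [CommPartials A] {x : Fock d A} (hc : ∀ i (j : ℤ), 0 < j → cMode i j x = 0)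
    (hβ : ∀ i (j : ℤ), 0 < j → betaMode i j x = 0) : diffOp x = ∑ i,
    (betaMode i (-1) (cMode i 0 x) + cMode i (-1) (betaMode i 0 x)) := by
  rw [diffOp_apply]
  refine Finset.sum_congr rfl fun i _ => ?_
  rw [finsum_eq_single _ 0 fun j hj => by
    rw [hc i j (by lia), hβ i j (by lia), map_zero, map_zero, add_zero] ]
  simp

lemma betaMode_stF_of_pos (i : Fin d) {n : ℤ} (hn : 0 < n) (f : A) :
    betaMode i n (stF f) = 0 := by
  have := Gen.kills_stF (.beta i) hn f
  rwa [Gen.field, betaField_ncoeff] at this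

lemma betaMode_vac (i : Fin d) {n : ℤ} (hn : 0 ≤ n) :
    betaMode i n (VertexData.vac : Fock d A) = 0 := by
  have := Gen.kills_vac (A := A) (.beta i) hn
  rwa [Gen.field, betaField_ncoeff] at this

lemma diffOp_stF [CommPartials A] (f : A) :
    diffOp (stF f : Fock d A) = ∑ i, cMode i (-1) (stF (pd i f)) := by
  rw [diffOp_apply_of (fun i j hj => cMode_stF i hj.le f) fun i j hj => betaMode_stF_of_pos i hj f]
  refine Finset.sum_congr rfl fun i _ => ?_
  rw [cMode_stF i le_rfl, map_zero, zero_add, betaMode_zero_stF]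

lemma diffOp_vac [CommPartials A] : diffOp (VertexData.vac : Fock d A) = 0 := by
  rw [vac_eq, diffOp_stF]
  refine Finset.sum_eq_zero fun i _ => ?_
  rw [Derivation.map_one_eq_zero, stF, Finsupp.single_zero, map_zero]

/-- A zero mode of an odd state is an odd derivation of all products. -/
lemma diffOp_bracket [CommPartials A] {q : ℕ} {b : Fock d A} (hb : IsHom q b) (m : ℤ)
    (x : Fock d A) : diffOp (((stateField b)[[m]]) x) =
      (-1 : ℂ) ^ q • ((stateField b)[[m]]) (diffOp x) + ((stateField (diffOp b))[[m]]) x := by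
  have := zeroMode_bracket isHom_diffState hb m x
  rwa [one_mul] at this

/-- Only the contraction of `cⁱ_(0)` with `bⁱ_(-1)` contributes. This identity is what allows
relations for `β` to be derived from relations for `b`. -/
lemma diffOp_stB [CommPartials A] (i : Fin d) : diffOp (stB A i) = stBeta A i := by
  rw [stB_eq_bMode, diffOp_apply_of]
  · rw [Finset.sum_eq_single i]
    · rw [cMode_bMode, commute_apply (commute_betaMode_bMode (A := A) i i 0 (-1)), betaMode_vac i le_rfl,
        vac_eq, cMode_stF i le_rfl, if_pos (by simp), map_zero, neg_zero, zero_add, map_zero,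
        add_zero, stBeta_eq_betaMode, vac_eq]
    · intro j _ hj
      rw [cMode_bMode, commute_apply (commute_betaMode_bMode (A := A) j i 0 (-1)), betaMode_vac j le_rfl,
        vac_eq, cMode_stF j le_rfl, if_neg (by simp [hj]), map_zero, neg_zero, zero_add, map_zero,
        map_zero, add_zero]
    · simp
  · intro j k hk
    rw [cMode_bMode, vac_eq, cMode_stF j hk.le, if_neg (by lia), map_zero, neg_zero, zero_add]
  · intro j k hk
    rw [commute_apply (commute_betaMode_bMode _ _ _ _), betaMode_vac j hk.le, map_zero]

lemma diffOp_stC [CommPartials A] (i : Fin d) : diffOp (stC A i) = 0 := by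
  have hc : ∀ j (k : ℤ), 0 ≤ k → cMode j k (stC A i) = 0 := fun j k hk => by
    rw [stC_eq_cMode, cMode_cMode, vac_eq, cMode_stF j hk, map_zero, neg_zero]
  have hβ : ∀ j (k : ℤ), 0 ≤ k → betaMode j k (stC A i) = 0 := fun j k hk => by
    rw [stC_eq_cMode, commute_apply (commute_betaMode_cMode _ _ _ _), betaMode_vac j hk, map_zero]
  rw [diffOp_apply_of (fun j k hk => hc j k hk.le) fun j k hk => hβ j k hk.le]
  exact Finset.sum_eq_zero fun j _ => by
    rw [hc j 0 le_rfl, hβ j 0 le_rfl, map_zero, map_zero, add_zero]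

lemma diffOp_stBeta [CommPartials A] (i : Fin d) : diffOp (stBeta A i) = 0 := by
  have hc : ∀ j (k : ℤ), 0 ≤ k → cMode j k (stBeta A i) = 0 := fun j k hk => by
    rw [stBeta_eq_betaMode, ← commute_apply (commute_betaMode_cMode _ _ _ _), vac_eq, cMode_stF j hk, map_zero]
  have hβ : ∀ j (k : ℤ), 0 ≤ k → betaMode j k (stBeta A i) = 0 := fun j k hk => by
    rw [stBeta_eq_betaMode, commute_apply (commute_betaMode_betaMode _ _ _ _), betaMode_vac j hk, map_zero]
  rw [diffOp_apply_of (fun j k hk => hc j k hk.le) fun j k hk => hβ j k hk.le]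
  exact Finset.sum_eq_zero fun j _ => by
    rw [hc j 0 le_rfl, hβ j 0 le_rfl, map_zero, map_zero, add_zero]

lemma diffOp_bMode [CommPartials A] (i : Fin d) (n : ℤ) (x : Fock d A) :
    diffOp (bMode i n x) = -bMode i n (diffOp x) + betaMode i n x := by
  have := diffOp_bracket (isHom_stB i) n x
  rwa [diffOp_stB, stateField_stB, stateField_stBeta, bField_ncoeff, betaField_ncoeff, pow_one,
    neg_one_smul] at this

lemma diffOp_cMode [CommPartials A] (i : Fin d) (n : ℤ) (x : Fock d A) :
    diffOp (cMode i n x) = -cMode i n (diffOp x) := by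
  have := diffOp_bracket (isHom_stC i) n x
  rwa [diffOp_stC, stateField_stC, cField_ncoeff, map_zero, pow_one, neg_one_smul, map_zero,
    Pi.zero_apply, LinearMap.zero_apply, add_zero] at this

lemma diffOp_betaMode [CommPartials A] (i : Fin d) (n : ℤ) (x : Fock d A) :
    diffOp (betaMode i n x) = betaMode i n (diffOp x) := by
  have := diffOp_bracket (isHom_stBeta i) n x
  rwa [diffOp_stBeta, stateField_stBeta, betaField_ncoeff, map_zero, pow_zero, one_smul, map_zero,
    Pi.zero_apply, LinearMap.zero_apply, add_zero] at this

/-- The differential kills the state whose zero mode it is, so as an odd derivation it anticommutes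
with itself, and `Q² = -Q²`. -/
lemma diffOp_diffOp [CommPartials A] (x : Fock d A) : diffOp (diffOp x) = 0 := by
  have h := diffOp_bracket isHom_diffState 0 x
  have h0 : diffOp (diffState : Fock d A) = 0 := by
    rw [diffState, map_sum]
    refine Finset.sum_eq_zero fun i _ => ?_
    rw [diffOp_betaMode, diffOp_cMode, diffOp_vac, map_zero, neg_zero, map_zero]
  rw [h0, map_zero, map_zero, Pi.zero_apply, LinearMap.zero_apply, add_zero, pow_one,
    neg_one_smul] at h
  change diffOp (diffOp x) = -diffOp (diffOp x) at h
  rwa [← sub_eq_zero, sub_neg_eq_add, ← two_smul ℂ, smul_eq_zero_iff_right two_ne_zero] at h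

lemma isHom_diffOp [CommPartials A] {q : ℕ} {x : Fock d A} (hx : IsHom q x) :
    IsHom (1 + q) (diffOp x) := isHom_nprod isHom_diffState hx 0

/-- Modes of the field of the state `g_(-1) f`. -/
lemma stateField_gen_stF [CommPartials A] (g : Gen d A) (f : A) {n : ℤ} (hn : 0 ≤ n)
    {x : Fock d A} (h1 : ∀ m : ℤ, 0 < m → funMode f m x = 0)
    (h2 : ∀ m : ℤ, 0 < m → (g.field[[m]]) x = 0) :
    ((stateField ((g.field[[-1]]) (stF f)))[[n]]) x =
      (g.field[[-1]]) (funMode f n x) + funMode f (n - 1) ((g.field[[0]]) x) := by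
  have h := stateField_nprod_negSucc g.isHomField.isHom 0 (stF f)
  rw [nprod_apply, g.stateField_eq, stateField_stF] at h
  change stateField ((g.field[[-1]]) (stF f)) = _ at h
  rw [h, wick_ncoeff, wickMode_apply, finsum_eq_single _ 0 fun j hj => ?_]
  · have hc := LinearMap.congr_fun ((Gen.isHomField (.fn f)).conj g.par (n - 1)) ((g.field[[0]]) x)
    simp only [show (Gen.fn f : Gen d A).par = 0 from rfl, show (Gen.fn f).field = funField f from rfl,
      mul_zero, pow_zero, one_smul, LinearMap.comp_apply, funField_ncoeff] at hc
    simp [wickTerm, hc]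
  · simp only [wickTerm, funField_ncoeff, LinearMap.smul_apply, LinearMap.add_apply,
      LinearMap.comp_apply]
    rw [h1 _ (by lia), h2 _ (by lia)]
    simp

end Differential

/-! ## Coordinate changes -/

section Coordinates

variable {d : ℕ} {A B : Type*} [CommRing A] [Algebra ℂ A] [Partials d A]
  [CommRing B] [Algebra ℂ B] [Partials d B]

variable (A B) in
/-- A change of coordinates: a homomorphism `B → A` that satisfies the chain rule with respect to
coordinates on `B`, and has an invertible Jacobian matrix. -/
structure Coords where
  hom : B →ₐ[ℂ] A
  coord : Fin d → B
  pd_coord : ∀ i j, pd j (coord i) = if i = j then 1 else 0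
  inv : Fin d → Fin d → A
  chain : ∀ j f, pd j (hom f) = ∑ i, hom (pd i f) * pd j (hom (coord i))
  jac_inv : ∀ i j, ∑ k, pd k (hom (coord i)) * inv k j = if i = j then 1 else 0

namespace Coords

variable (C : Coords A B)

lemma inv_jac (i j : Fin d) : ∑ k, C.inv i k * pd j (C.hom (C.coord k)) = if i = j then 1 else 0 := by
  have h : (Matrix.of fun i k => pd k (C.hom (C.coord i))) * Matrix.of C.inv = 1 := by
    ext i j
    rw [Matrix.mul_apply, Matrix.one_apply]
    exact C.jac_inv i j
  have := congrArg (fun M : Matrix (Fin d) (Fin d) A => M i j) (mul_eq_one_comm.1 h)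
  simpa only [Matrix.mul_apply, Matrix.one_apply, Matrix.of_apply] using this

/-- Differentiate `J⁻¹ J = 1` and multiply by `J⁻¹` on the right. -/
lemma pd_inv (m l i : Fin d) : pd m (C.inv l i) =
    -∑ k, ∑ b, C.inv l k * pd m (pd b (C.hom (C.coord k))) * C.inv b i := by
  have h : ∀ b, ∑ k, pd m (C.inv l k) * pd b (C.hom (C.coord k)) =
      -∑ k, C.inv l k * pd m (pd b (C.hom (C.coord k))) := fun b => by
    have := congrArg (pd m) (C.inv_jac l b)
    rw [map_sum, apply_ite (pd m), Derivation.map_one_eq_zero, map_zero, ite_self] at this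
    simp only [Derivation.leibniz, smul_eq_mul, Finset.sum_add_distrib] at this
    rw [eq_neg_iff_add_eq_zero, add_comm]
    simpa only [mul_comm (pd m (C.inv l _))] using this
  calc pd m (C.inv l i) = ∑ k, pd m (C.inv l k) * ∑ b, pd b (C.hom (C.coord k)) * C.inv b i := by
        simp [C.jac_inv]
    _ = ∑ b, (∑ k, pd m (C.inv l k) * pd b (C.hom (C.coord k))) * C.inv b i := by
        simp only [Finset.mul_sum, Finset.sum_mul]
        rw [Finset.sum_comm]
        simp only [mul_assoc]
    _ = _ := by
        simp only [h, neg_mul, Finset.sum_mul, Finset.sum_neg_distrib]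
        rw [Finset.sum_comm]

/-- The coordinate vector fields commute. -/
lemma frame_symm [CommPartials A] (i j l : Fin d) : ∑ m, C.inv m j * pd m (C.inv l i) =
    ∑ m, C.inv m i * pd m (C.inv l j) := by
  simp only [pd_inv, mul_neg, Finset.sum_neg_distrib, Finset.mul_sum]
  rw [neg_inj, Finset.sum_comm, Finset.sum_comm (s := Finset.univ (α := Fin d))]
  rw [Finset.sum_comm]
  conv_rhs => rw [Finset.sum_comm]
  refine Finset.sum_congr rfl fun k _ => ?_
  rw [Finset.sum_comm]
  refine Finset.sum_congr rfl fun m _ => Finset.sum_congr rfl fun b _ => ?_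
  rw [CommPartials.pd_comm m b]
  ring

/-- The state `b̃ⁱ`. -/
def stateB (i : Fin d) : Fock d A := ∑ j, bMode j (-1) (stF (C.inv j i))

/-- The states of the transformed generators. -/
def state : Gen d B → Fock d A
  | .beta i => diffOp (C.stateB i)
  | .alpha i => transOp (stF (C.hom (C.coord i)))
  | .b i => C.stateB i
  | .c i => diffOp (stF (C.hom (C.coord i)))
  | .fn f => stF (C.hom f)

variable [CommPartials A]

lemma isHom_stateB (i : Fin d) : IsHom 1 (C.stateB i) :=
  IsHom.sum fun j => isHom_bMode j _ (isHom_stF _)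

lemma isHom_congr {p q : ℕ} (h : (-1 : ℂ) ^ p = (-1) ^ q) {a : Fock d A} (ha : IsHom p a) :
    IsHom q a := by
  rwa [IsHom, ← h]

lemma isHom_state (g : Gen d B) : IsHom g.par (C.state g) := by
  cases g
  · exact isHom_congr (by norm_num [Gen.par]) (isHom_diffOp (C.isHom_stateB _))
  · have := isHom_nprod (isHom_stF (d := d) (C.hom (C.coord ‹_›))) isHom_vac (-2)
    rwa [← transOp_eq] at this
  · exact C.isHom_stateB _
  · exact isHom_diffOp (isHom_stF _)
  · exact isHom_stF _

lemma funMode_bMode_stF (f g : A) (j : Fin d) {n : ℤ} (hn : 0 ≤ n) :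
    funMode f n (bMode j (-1) (stF g) : Fock d A) = 0 := by
  rw [← commute_apply (commute_bMode_funMode _ _ _ _), funMode_stF_of_nonneg _ hn, map_zero]

lemma funMode_cMode_stF (f g : A) (j : Fin d) {n : ℤ} (hn : 0 ≤ n) :
    funMode f n (cMode j (-1) (stF g) : Fock d A) = 0 := by
  rw [← commute_apply (commute_cMode_funMode _ _ _ _), funMode_stF_of_nonneg _ hn, map_zero]

lemma stateB_nprod (i : Fin d) {n : ℤ} (hn : 0 ≤ n) {x : Fock d A}
    (h1 : ∀ f, ∀ m : ℤ, 0 < m → funMode f m x = 0)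
    (h2 : ∀ j, ∀ m : ℤ, 0 < m → bMode j m x = 0) :
    ((stateField (C.stateB i))[[n]]) x = ∑ j, (bMode j (-1) (funMode (C.inv j i) n x) +
      funMode (C.inv j i) (n - 1) (bMode j 0 x)) := by
  have h : ∀ j, ((stateField (bMode j (-1) (stF (C.inv j i))))[[n]]) x =
      bMode j (-1) (funMode (C.inv j i) n x) + funMode (C.inv j i) (n - 1) (bMode j 0 x) :=
    fun j => by
      have := stateField_gen_stF (.b j) (C.inv j i) hn (h1 _) (x := x)
        (fun m hm => by rw [Gen.field, bField_ncoeff]; exact h2 j m hm)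
      simpa only [Gen.field, bField_ncoeff] using this
  rw [stateB]
  simp only [map_sum, Finset.sum_apply, LinearMap.sum_apply, h]

/-- Contraction of a coordinate vector field with a one-form: `b` annihilates functions and pairs
with `c`, which leaves a simple pole. -/
lemma stateB_cMode_stF (i : Fin d) (n : ℤ) (hn : 0 ≤ n) (h : Fin d → A) :
    ((stateField (C.stateB i))[[n]]) (∑ k, cMode k (-1) (stF (h k))) =
      if n = 0 then stF (∑ k, C.inv k i * h k) else 0 := by
  have hb : ∀ (j : Fin d) (m : ℤ), 0 ≤ m → bMode j m (∑ k, cMode k (-1) (stF (h k))) =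
      if m = 0 then stF (h j) else 0 := fun j m hm => by
    simp only [map_sum, bMode_cMode, bMode_stF _ hm, map_zero, neg_zero, zero_add]
    by_cases h0 : m = 0
    · rw [if_pos h0, Finset.sum_eq_single j (fun k _ hk => if_neg fun h' => hk h'.1.symm)
        (by simp), if_pos ⟨rfl, by lia⟩]
    · rw [if_neg h0, Finset.sum_eq_zero fun k _ => if_neg (by lia)]
  have hf : ∀ f (m : ℤ), 0 ≤ m → funMode f m (∑ k, cMode k (-1) (stF (h k)) : Fock d A) = 0 :=
    fun f m hm => by simp only [map_sum, funMode_cMode_stF _ _ _ hm, Finset.sum_const_zero]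
  rw [C.stateB_nprod i hn (fun f m hm => hf f m hm.le)
    (fun j m hm => by rw [hb j m hm.le, if_neg (by lia)])]
  simp only [hf _ n hn, hb _ 0 le_rfl, map_zero, zero_add, if_true]
  split
  · rename_i h0
    subst h0
    simp only [zero_sub, funMode_stF, taylor_neg_one, mulFun_stF]
    exact (map_sum (Finsupp.singleAddHom (0, 0, ∅)) _ _).symm
  · exact Finset.sum_eq_zero fun j _ => funMode_stF_of_nonneg _ (by lia) _

lemma stateB_stateB (i j : Fin d) (n : ℤ) (hn : 0 ≤ n) :
    ((stateField (C.stateB i))[[n]]) (C.stateB j) = 0 := by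
  have hb : ∀ (k : Fin d) (m : ℤ), 0 ≤ m → bMode k m (C.stateB j) = 0 := fun k m hm => by
    simp only [stateB, map_sum, bMode_bMode k, bMode_stF _ hm, map_zero, neg_zero,
      Finset.sum_const_zero]
  have hf : ∀ f (m : ℤ), 0 ≤ m → funMode f m (C.stateB j) = 0 :=
    fun f m hm => by simp only [stateB, map_sum, funMode_bMode_stF _ _ _ hm, Finset.sum_const_zero]
  rw [C.stateB_nprod i hn (fun f m hm => hf f m hm.le) (fun j m hm => hb j m hm.le)]
  simp only [hf _ n hn, hb _ 0 le_rfl, map_zero, zero_add, Finset.sum_const_zero]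

lemma stateB_stF (i : Fin d) (f : A) (n : ℤ) (hn : 0 ≤ n) :
    ((stateField (C.stateB i))[[n]]) (stF f) = 0 := by
  rw [C.stateB_nprod i hn (fun g m hm => funMode_stF_of_nonneg g hm.le f)
    (fun j m hm => bMode_stF j hm.le f)]
  simp only [funMode_stF_of_nonneg _ hn, bMode_stF _ le_rfl, map_zero, zero_add,
    Finset.sum_const_zero]

lemma diffOp_stateB (i : Fin d) : diffOp (C.stateB i) = ∑ j, (betaMode j (-1) (stF (C.inv j i)) -
    ∑ k, bMode j (-1) (cMode k (-1) (stF (pd k (C.inv j i))))) := by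
  rw [stateB, map_sum]
  refine Finset.sum_congr rfl fun j _ => ?_
  rw [diffOp_bMode, diffOp_stF, map_sum]
  abel

lemma stF_sum {ι : Type*} (s : Finset ι) (f : ι → A) :
    (stF (∑ i ∈ s, f i) : Fock d A) = ∑ i ∈ s, stF (f i) :=
  map_sum (Finsupp.singleAddHom (0, 0, ∅)) f s

/-- The essential expansion. Its simple pole has two contributions: the functions in `b̃ⁱ` are
differentiated by `β̃ʲ`, and the `b`'s in `b̃ⁱ` contract with the `c`'s in `β̃ʲ`. They add up to the
Lie bracket of two coordinate vector fields, which is zero. -/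
lemma stateB_diffOp_stateB (i j : Fin d) (n : ℤ) (hn : 0 ≤ n) :
    ((stateField (C.stateB i))[[n]]) (diffOp (C.stateB j)) = 0 := by
  have hf : ∀ f (m : ℤ), 0 ≤ m → funMode f m (diffOp (C.stateB j)) =
      if m = 0 then -stF (∑ k, pd k f * C.inv k j) else 0 := fun f m hm => by
    have e1 : ∀ k, funMode f m (betaMode k (-1) (stF (C.inv k j))) =
        if m = 0 then -stF (pd k f * C.inv k j) else 0 := fun k => by
      have := betaMode_funMode k (-1) f m (stF (C.inv k j))
      rw [funMode_stF_of_nonneg _ hm, map_zero, eq_comm, add_eq_zero_iff_eq_neg] at this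
      rw [this]
      split
      · rename_i h; rw [h, add_zero, funMode_stF, taylor_neg_one, mulFun_stF]
      · rw [funMode_stF_of_nonneg _ (by lia), neg_zero]
    have e2 : ∀ k l g, funMode f m (bMode k (-1) (cMode l (-1) (stF g))) = (0 : Fock d A) :=
      fun k l g => by
        rw [← commute_apply (commute_bMode_funMode _ _ _ _), funMode_cMode_stF _ _ _ hm, map_zero]
    rw [diffOp_stateB]
    simp only [map_sum, map_sub, e1, e2, Finset.sum_const_zero, sub_zero]
    split
    · rw [stF_sum, Finset.sum_neg_distrib]
    · exact Finset.sum_const_zero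
  have hb : ∀ (k : Fin d) (m : ℤ), 0 ≤ m → bMode k m (diffOp (C.stateB j)) =
      if m = 0 then ∑ l, bMode l (-1) (stF (pd k (C.inv l j))) else 0 := fun k m hm => by
    have e1 : ∀ l g, bMode k m (betaMode l (-1) (stF g)) = (0 : Fock d A) := fun l g => by
      rw [← commute_apply (commute_betaMode_bMode _ _ _ _), bMode_stF _ hm, map_zero]
    have e2 : ∀ l r g, bMode k m (bMode l (-1) (cMode r (-1) (stF g))) =
        -(if k = r ∧ m = 0 then bMode l (-1) (stF g) else 0 : Fock d A) := fun l r g => by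
      rw [bMode_bMode k, bMode_cMode, bMode_stF _ hm, map_zero, neg_zero, zero_add,
        apply_ite (bMode l (-1)), map_zero]
      congr 2
      simp
    rw [diffOp_stateB]
    simp only [map_sum, map_sub, e1, e2, zero_sub, Finset.sum_neg_distrib, neg_neg]
    split
    · rename_i h
      refine Finset.sum_congr rfl fun l _ => ?_
      simp [h]
    · rename_i h
      simp [h]
  rw [C.stateB_nprod i hn (fun f m hm => by rw [hf f m hm.le, if_neg (by lia)])
    (fun j m hm => by rw [hb _ m hm.le, if_neg (by lia)])]
  simp only [hf _ n hn, hb _ 0 le_rfl, if_true]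
  split
  · rename_i h0
    subst h0
    simp only [map_neg, map_sum, ← commute_apply (commute_bMode_funMode (A := A) _ _ _ _), zero_sub,
      funMode_stF, taylor_neg_one, mulFun_stF, Finset.sum_add_distrib, Finset.sum_neg_distrib]
    rw [Finset.sum_comm (s := Finset.univ) (t := Finset.univ)]
    -- The coefficients of each `b_(-1)` are the derivatives of one frame field along the other, in
    -- the two orders; they cancel by symmetry.
    simp only [← map_sum, ← stF_sum, C.frame_symm j i]
    simp only [mul_comm, neg_add_cancel]
  · refine Finset.sum_eq_zero fun k _ => ?_
    simp only [map_zero, zero_add, map_sum, ← commute_apply (commute_bMode_funMode (A := A) _ _ _ _)]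
    exact Finset.sum_eq_zero fun l _ => by rw [funMode_stF_of_nonneg _ (by lia), map_zero]

end Coords

end Coordinates

/-! ### The transformed generators form a free field system. -/

section CoordinateSystems

variable {d : ℕ} {A B : Type*} [CommRing A] [Algebra ℂ A] [Partials d A]
  [CommRing B] [Algebra ℂ B] [Partials d B]

namespace Coords

variable (C : Coords A B) [CommPartials A]

lemma stF_zero : (stF 0 : Fock d A) = 0 := Finsupp.single_zero _

/-- By the chain rule, the vector fields formed from the inverse Jacobian act on functions of the
new coordinates as the new partial derivatives. -/
lemma inv_pd (i : Fin d) (f : B) : ∑ k, C.inv k i * pd k (C.hom f) = C.hom (pd i f) := by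
  simp only [C.chain _ f, Finset.mul_sum]
  rw [Finset.sum_comm]
  have : ∀ j, ∑ k, C.inv k i * (C.hom (pd j f) * pd k (C.hom (C.coord j))) =
      C.hom (pd j f) * if j = i then 1 else 0 := fun j => by
    rw [← C.jac_inv, Finset.mul_sum]
    exact Finset.sum_congr rfl fun k _ => by ring
  simp only [this, mul_ite, mul_one, mul_zero, Finset.sum_ite_eq', Finset.mem_univ, if_true]

/-- The field of `β̃` is the anticommutator of `Q` with the field of `b̃`, so poles of `β̃` are
obtained from those of `b̃`. -/
lemma diffOp_stateB_mode (i : Fin d) (n : ℤ) (x : Fock d A) :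
    ((stateField (diffOp (C.stateB i)))[[n]]) x = diffOp (((stateField (C.stateB i))[[n]]) x) +
      ((stateField (C.stateB i))[[n]]) (diffOp x) := by
  rw [diffOp_bracket (C.isHom_stateB i), pow_one, neg_one_smul]
  abel

/-- The operator product expansions of the transformed generators have the expected poles. -/
def HasPole (g h : Gen d B) : Prop := ∀ n : ℤ, 0 ≤ n →
  ((stateField (C.state g))[[n]]) (C.state h) = if n = 0 then stF (C.hom (g.pole h)) else 0

lemma hasPole_beta_fn (i : Fin d) (f : B) : C.HasPole (.beta i) (.fn f) := fun n hn => by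
  simp only [state, Gen.pole]
  rw [diffOp_stateB_mode, C.stateB_stF i _ n hn, map_zero, zero_add, diffOp_stF,
    C.stateB_cMode_stF i n hn, inv_pd]

lemma hasPole_b_c (i j : Fin d) : C.HasPole (.b i) (.c j) := fun n hn => by
  simp only [state, Gen.pole]
  rw [diffOp_stF, C.stateB_cMode_stF i n hn]
  simp only [mul_comm (C.inv _ _), C.jac_inv]
  simp only [apply_ite C.hom, map_one, map_zero, eq_comm]

lemma hasPole_beta_c (i j : Fin d) : C.HasPole (.beta i) (.c j) := fun n hn => by
  have := C.hasPole_b_c i j n hn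
  simp only [state, Gen.pole] at this ⊢
  rw [diffOp_stateB_mode, this, diffOp_diffOp, map_zero, add_zero, map_zero, stF_zero, ite_self,
    apply_ite diffOp, apply_ite C.hom, map_one, map_zero, map_zero]
  split
  · split
    · exact diffOp_vac
    · rw [stF_zero, map_zero]
  · rfl

lemma hasPole_beta_beta (i j : Fin d) : C.HasPole (.beta i) (.beta j) := fun n hn => by
  simp only [state, Gen.pole]
  rw [diffOp_stateB_mode, C.stateB_diffOp_stateB i j n hn, diffOp_diffOp]
  simp [stF_zero]

lemma hasPole_b_beta (i j : Fin d) : C.HasPole (.b i) (.beta j) := fun n hn => by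
  simp only [state, Gen.pole]
  rw [C.stateB_diffOp_stateB i j n hn]
  simp [stF_zero]

lemma hasPole_b_b (i j : Fin d) : C.HasPole (.b i) (.b j) := fun n hn => by
  simp only [state, Gen.pole]
  rw [C.stateB_stateB i j n hn]
  simp [stF_zero]

lemma hasPole_fn_fn (f g : B) : C.HasPole (.fn f) (.fn g) := fun n hn => by
  simp only [state, Gen.pole]
  rw [stateField_stF, funField_ncoeff, funMode_stF_of_nonneg _ hn]
  simp [stF_zero]

lemma hasPole_fn_b (f : B) (j : Fin d) : C.HasPole (.fn f) (.b j) := fun n hn => by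
  simp only [state, Gen.pole]
  rw [stateField_stF, funField_ncoeff, stateB, map_sum]
  simp [stF_zero, funMode_bMode_stF _ _ _ hn]

lemma hasPole_fn_c (f : B) (j : Fin d) : C.HasPole (.fn f) (.c j) := fun n hn => by
  simp only [state, Gen.pole]
  rw [stateField_stF, funField_ncoeff, diffOp_stF, map_sum]
  simp [stF_zero, funMode_cMode_stF _ _ _ hn]

/-- Apply `Q` to the regular expansion of `γ̃ⁱ` with `c̃ʲ`, using `Q c̃ʲ = 0`. -/
lemma hasPole_c_c (i j : Fin d) : C.HasPole (.c i) (.c j) := fun n hn => by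
  have h := C.hasPole_fn_c (C.coord i) j n hn
  have h' := diffOp_bracket (isHom_stF (C.hom (C.coord i))) n (C.state (.c j))
  simp only [state, Gen.pole, map_zero, stF_zero, ite_self] at h h' ⊢
  rw [h, diffOp_diffOp, map_zero, map_zero, smul_zero, zero_add] at h'
  exact h'.symm

/-- The commutation relations of the generators, for the transformed generators. -/
def Rel (g h : Gen d B) : Prop := ∀ (l m : ℤ) (x : Fock d A),
    ((stateField (C.state g))[[l]]) (((stateField (C.state h))[[m]]) x) =
      (-1 : ℂ) ^ (g.par * h.par) • ((stateField (C.state h))[[m]])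
        (((stateField (C.state g))[[l]]) x) +
        g.pair h l m • x + funMode (C.hom (g.pole h)) (l + m) x

variable {C} in
lemma Rel.symm {g h : Gen d B} (H : C.Rel g h) : C.Rel h g := fun l m x => by
  rw [commutator_symm (neg_one_pow_mul_self _) (H m l), mul_comm h.par, ← Gen.pair_symm,
    Gen.pole_symm g h, map_neg, map_smul, funMode_neg, funMode_smul, add_comm m l]

variable {C} in
lemma HasPole.rel {g h : Gen d B} (H : C.HasPole g h) (hp : ∀ l m, g.pair h l m = 0) :
    C.Rel g h := fun l m x => by
  rw [commutator_of_simple_pole (C.isHom_state g) (C.isHom_state h) (fun n hn => by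
    rw [nprod_apply, H n hn.le, if_neg (by lia)]), nprod_apply, H 0 le_rfl, if_pos rfl,
    stateField_stF, funField_ncoeff, hp, zero_smul, add_zero]

lemma alpha_mode (i : Fin d) (n : ℤ) (x : Fock d A) :
    ((stateField (C.state (.alpha i)))[[n]]) x =
      -((n : ℂ) • funMode (C.hom (C.coord i)) (n - 1) x) := by
  simp only [state]
  rw [stateField_transOp, stateField_stF, funField_ncoeff]

lemma fn_mode (f : B) (n : ℤ) :
    ((stateField (C.state (.fn f)))[[n]]) = funMode (C.hom f) n := by
  simp only [state]
  rw [stateField_stF, funField_ncoeff]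

lemma rel_fn_beta (f : B) (i : Fin d) : C.Rel (.fn f) (.beta i) :=
  ((C.hasPole_beta_fn i f).rel fun _ _ => rfl).symm

lemma rel_fn_fn (f g : B) : C.Rel (.fn f) (.fn g) := (C.hasPole_fn_fn f g).rel fun _ _ => rfl

/-- Relations with the fields of coordinates give relations with their derivatives. -/
lemma rel_alpha {g : Gen d B} {i : Fin d} (H : C.Rel g (.fn (C.coord i)))
    (hg : ∀ l m x, g.pair (.alpha i) l m • x + funMode (C.hom (g.pole (.alpha i))) (l + m) x =
      -((m : ℂ) • (g.pair (.fn (C.coord i)) l (m - 1) • x +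
        funMode (C.hom (g.pole (.fn (C.coord i)))) (l + (m - 1)) x))) :
    C.Rel g (.alpha i) := fun l m x => by
  have := H l (m - 1) x
  rw [fn_mode] at this
  rw [alpha_mode, alpha_mode, map_neg, map_smul, this, add_assoc, add_assoc, hg]
  simp only [Gen.par, mul_zero, pow_zero, one_smul, smul_add, neg_add]

/-- Differentiating the simple pole `δᵢⱼ` of `β̃ⁱ` with `γ̃ʲ` gives the double pole. The constant
`1` has only the mode `-1`, hence the condition `l + m = 0`. -/
lemma rel_beta_alpha (i j : Fin d) : C.Rel (.beta i) (.alpha j) := by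
  refine C.rel_alpha (C.rel_fn_beta _ i).symm fun l m x => ?_
  simp only [Gen.pair, Gen.pole, map_zero, funMode_zero, LinearMap.zero_apply, add_zero, zero_smul,
    zero_add, C.pd_coord, apply_ite C.hom, map_one]
  by_cases h : i = j
  · subst h
    simp only [true_and, if_true, funMode_one]
    by_cases h : l + m = 0
    · rw [if_pos h, if_pos (by lia), show l = -m by lia]
      simp
    · rw [if_neg h, if_neg (by lia)]
      simp
  · rw [if_neg fun h' => h h'.1, if_neg (Ne.symm h)]
    simp [funMode_zero]

lemma rel_alpha' {g : Gen d B} {i : Fin d} (H : C.Rel g (.fn (C.coord i)))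
    (h1 : ∀ l m, g.pair (.alpha i) l m = 0) (h2 : g.pole (.alpha i) = 0)
    (h3 : ∀ l m, g.pair (.fn (C.coord i)) l m = 0) (h4 : g.pole (.fn (C.coord i)) = 0) :
    C.Rel g (.alpha i) :=
  C.rel_alpha H fun l m x => by simp [h1, h2, h3, h4, funMode_zero]

lemma rel_fn_alpha (f : B) (i : Fin d) : C.Rel (.fn f) (.alpha i) :=
  C.rel_alpha' (C.rel_fn_fn _ _) (fun _ _ => rfl) rfl (fun _ _ => rfl) rfl

lemma rel_fn_b (f : B) (i : Fin d) : C.Rel (.fn f) (.b i) :=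
  (C.hasPole_fn_b f i).rel fun _ _ => rfl

lemma rel_fn_c (f : B) (i : Fin d) : C.Rel (.fn f) (.c i) :=
  (C.hasPole_fn_c f i).rel fun _ _ => rfl

lemma rel_fn (f : B) (g : Gen d B) : C.Rel (.fn f) g := by
  cases g
  · exact C.rel_fn_beta _ _
  · exact C.rel_fn_alpha _ _
  · exact C.rel_fn_b _ _
  · exact C.rel_fn_c _ _
  · exact C.rel_fn_fn _ _

lemma rel_alpha_gen (i : Fin d) (g : Gen d B) : C.Rel (.alpha i) g := by
  cases g
  · exact (C.rel_beta_alpha _ _).symm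
  · exact C.rel_alpha' (C.rel_fn_alpha _ _).symm (fun _ _ => rfl) rfl (fun _ _ => rfl) rfl
  · exact (C.rel_alpha' (C.rel_fn_b _ _).symm (fun _ _ => rfl) rfl (fun _ _ => rfl) rfl).symm
  · exact (C.rel_alpha' (C.rel_fn_c _ _).symm (fun _ _ => rfl) rfl (fun _ _ => rfl) rfl).symm
  · exact (C.rel_fn_alpha _ _).symm

lemma rel (g h : Gen d B) : C.Rel g h := by
  cases g with
  | alpha i => exact C.rel_alpha_gen _ _
  | fn f => exact C.rel_fn _ _
  | beta i =>
    cases h with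
    | alpha j => exact (C.rel_alpha_gen _ _).symm
    | fn f => exact (C.rel_fn _ _).symm
    | beta j => exact (C.hasPole_beta_beta i j).rel fun _ _ => rfl
    | b j => exact ((C.hasPole_b_beta j i).rel fun _ _ => rfl).symm
    | c j => exact (C.hasPole_beta_c i j).rel fun _ _ => rfl
  | b i =>
    cases h with
    | alpha j => exact (C.rel_alpha_gen _ _).symm
    | fn f => exact (C.rel_fn _ _).symm
    | beta j => exact (C.hasPole_b_beta i j).rel fun _ _ => rfl
    | b j => exact (C.hasPole_b_b i j).rel fun _ _ => rfl
    | c j => exact (C.hasPole_b_c i j).rel fun _ _ => rfl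
  | c i =>
    cases h with
    | alpha j => exact (C.rel_alpha_gen _ _).symm
    | fn f => exact (C.rel_fn _ _).symm
    | beta j => exact ((C.hasPole_beta_c j i).rel fun _ _ => rfl).symm
    | b j => exact ((C.hasPole_b_c j i).rel fun _ _ => rfl).symm
    | c j => exact (C.hasPole_c_c i j).rel fun _ _ => rfl

lemma alpha_mode_stF (i : Fin d) {n : ℤ} (hn : 0 ≤ n) (f : A) :
    ((stateField (C.state (.alpha i)))[[n]]) (stF f) = 0 := by
  rw [alpha_mode]
  rcases hn.eq_or_lt with rfl | hn
  · simp
  · rw [funMode_stF_of_nonneg _ (by lia)]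
    simp

lemma diffOp_stF_mode (f g : A) {n : ℤ} (hn : 0 ≤ n) :
    ((stateField (diffOp (stF f)))[[n]]) (stF g : Fock d A) = 0 := by
  have h := diffOp_bracket (isHom_stF f) n (stF g : Fock d A)
  rw [stateField_stF, funField_ncoeff, funMode_stF_of_nonneg _ hn, map_zero, diffOp_stF g,
    map_sum, Finset.sum_eq_zero fun i _ => funMode_cMode_stF _ _ _ hn, smul_zero, zero_add] at h
  exact h.symm

lemma state_ann (g : Gen d B) (n : ℤ) (hn : 0 ≤ n) (f : B) :
    ((stateField (C.state g))[[n]]) (stF (C.hom f)) =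
      if n = 0 then stF (C.hom (g.pole (.fn f))) else 0 := by
  cases g with
  | beta i => exact C.hasPole_beta_fn i f n hn
  | alpha i => rw [C.alpha_mode_stF i hn]; simp [Gen.pole, stF_zero]
  | b i =>
    simp only [state]
    rw [C.stateB_stF i _ n hn]; simp [Gen.pole, stF_zero]
  | c i =>
    simp only [state]
    rw [diffOp_stF_mode _ _ hn]; simp [Gen.pole, stF_zero]
  | fn g => exact C.hasPole_fn_fn g f n hn

/-- The chain rule for `∂f`: expand both sides in the old `α`. -/
lemma transOp_stF_eq (f : B) : transOp (stF (C.hom f) : Fock d A) =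
    ∑ i, VertexData.nprod (Int.negSucc 0) (C.state (.alpha i)) (stF (C.hom (pd i f))) := by
  have h : ∀ g h : A, funMode g (-2) (stF h : Fock d A) =
      ∑ i, createAlpha (i, 0) (stF (pd i g * h)) := fun g h => by
    have := LinearMap.congr_fun (taylor_rec (d := d) (A := A) (-2) g (M := 2) (by norm_num)) (stF h)
    simp only [Finset.sum_range_succ, Finset.sum_range_zero, zero_add, LinearMap.smul_apply,
      LinearMap.add_apply, LinearMap.sum_apply, Module.End.mul_apply] at this
    norm_num at this
    rw [funMode_stF, this]
    simp [taylor_neg_one, taylor_of_nonneg]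
  have h2 : ∀ i, VertexData.nprod (Int.negSucc 0) (C.state (.alpha i)) (stF (C.hom (pd i f))) =
      ∑ l, createAlpha (l, 0) (stF (pd l (C.hom (C.coord i)) * C.hom (pd i f)) : Fock d A) :=
    fun i => by
      rw [nprod_apply, alpha_mode]
      rw [show Int.negSucc 0 - 1 = -2 from rfl, h]
      simp
  simp only [h2]
  rw [Finset.sum_comm, transOp_stF]
  refine Finset.sum_congr rfl fun l _ => ?_
  rw [← map_sum, ← stF_sum, C.chain l f]
  simp only [mul_comm]

/-- Compare the modes of both sides of `transOp_stF_eq`. On the left, a derivative multiplies the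
mode by `-(n + 1)`. On the right stands a normally ordered product whose annihilation half vanishes
on functions. -/
lemma state_jet (n : ℤ) (f g : B) (M : ℕ) (hM : -n ≤ M) : (-(n : ℂ) - 1) •
    (funMode (C.hom f) n) (stF (C.hom g) : Fock d A) = ∑ j ∈ Finset.range M, ∑ i,
      ((stateField (C.state (.alpha i)))[[Int.negSucc j]])
        (funMode (C.hom (pd i f)) (n + 1 + j) (stF (C.hom g))) := by
  have h := stateField_transOp (stF (C.hom f) : Fock d A) (n + 1) (stF (C.hom g))
  rw [stateField_stF, funField_ncoeff, add_sub_cancel_right] at h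
  have e : (-(n : ℂ) - 1) • (funMode (C.hom f) n) (stF (C.hom g) : Fock d A) =
      -(((n + 1 : ℤ) : ℂ) • funMode (C.hom f) n (stF (C.hom g))) := by
    push_cast
    module
  rw [e, ← h, transOp_stF_eq, Finset.sum_comm]
  simp only [map_sum, Finset.sum_apply, LinearMap.sum_apply]
  refine Finset.sum_congr rfl fun i _ => ?_
  rw [stateField_nprod_negSucc (C.isHom_state _), wick_ncoeff, wickMode_apply,
    finsum_eq_sum_of_support_subset (s := Finset.range M)]
  · refine Finset.sum_congr rfl fun j _ => ?_
    simp only [wickTerm, LinearMap.smul_apply, LinearMap.add_apply, LinearMap.comp_apply,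
      C.alpha_mode_stF i (Int.natCast_nonneg j), map_zero, smul_zero, add_zero, stateField_stF,
      funField_ncoeff]
    rw [show -(((0 : ℕ) : ℤ) + 1) - (j : ℤ) = Int.negSucc j by rw [Int.negSucc_eq]; push_cast; ring]
    simp
  · intro j hj
    by_contra hj'
    refine hj ?_
    simp only [wickTerm, LinearMap.smul_apply, LinearMap.add_apply, LinearMap.comp_apply,
      C.alpha_mode_stF i (Int.natCast_nonneg j), map_zero, smul_zero, add_zero, stateField_stF,
      funField_ncoeff]
    rw [funMode_stF_of_nonneg _ (by simp at hj'; lia), map_zero, smul_zero]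

/-- The free field system given by a change of coordinates. -/
def system : FreeSystem (A := A) B where
  hom := C.hom
  st := C.state
  isHom := C.isHom_state
  st_fn _ := rfl
  rel := C.rel
  ann := C.state_ann
  jet := C.state_jet

/-- The homomorphism of vertex algebras given by a change of coordinates. -/
def map : Fock d B →ₗ[ℂ] Fock d A := C.system.map

variable [CommPartials B]

lemma map_nprod (n : ℤ) (a b : Fock d B) :
    C.map (VertexData.nprod n a b) = VertexData.nprod n (C.map a) (C.map b) :=
  C.system.map_nprod n a b

lemma map_vac : C.map VertexData.vac = VertexData.vac := C.system.map_vac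

lemma map_parityOp (x : Fock d B) : C.map (parityOp x) = parityOp (C.map x) :=
  C.system.map_parityOp x

lemma map_stF (f : B) : C.map (stF f) = stF (C.hom f) := C.system.map_stF f

lemma map_stB (i : Fin d) : C.map (stB B i) = C.stateB i := by
  have := C.system.map_gen (.b i)
  rwa [Gen.field, bField_ncoeff, ← stB_eq_bMode] at this

lemma map_stC (i : Fin d) : C.map (stC B i) = diffOp (stF (C.hom (C.coord i))) := by
  have := C.system.map_gen (.c i)
  rwa [Gen.field, cField_ncoeff, ← stC_eq_cMode] at this

lemma map_stBeta (i : Fin d) : C.map (stBeta B i) = diffOp (C.stateB i) := by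
  have := C.system.map_gen (.beta i)
  rwa [Gen.field, betaField_ncoeff, ← stBeta_eq_betaMode] at this

end Coords

end CoordinateSystems

/-! ### Uniqueness of homomorphisms, compatibility with the differential, functoriality. -/

section HomExt

variable {d : ℕ} {A B : Type*} [CommRing A] [Algebra ℂ A] [Partials d A]
  [CommRing B] [Algebra ℂ B] [Partials d B]

/-- The vertex algebra `𝒲 ⊗ B` is generated by functions, `b`, `c` and `β`. -/
lemma mem_of_generators [CommPartials B] (S : VertexSubalgebra (Fock d B)) (coord : Fin d → B)
    (hcoord : ∀ i j, pd j (coord i) = if i = j then 1 else 0)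
    (hF : ∀ f, stF f ∈ S.toSubmodule) (hb : ∀ i, stB B i ∈ S.toSubmodule)
    (hc : ∀ i, stC B i ∈ S.toSubmodule) (hβ : ∀ i, stBeta B i ∈ S.toSubmodule) (x : Fock d B) :
    x ∈ S.toSubmodule := by
  refine fock_induction_gen S.vac_mem (fun g n x hx => ?_) x
  have key : ∀ a, a ∈ S.toSubmodule → ((stateField a)[[n]]) x ∈ S.toSubmodule :=
    fun a ha => S.nprod_mem n ha hx
  cases g with
  | beta i => rw [Gen.field, ← stateField_stBeta]; exact key _ (hβ i)
  | b i => rw [Gen.field, ← stateField_stB]; exact key _ (hb i)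
  | c i => rw [Gen.field, ← stateField_stC]; exact key _ (hc i)
  | fn f => rw [Gen.field, ← stateField_stF]; exact key _ (hF f)
  | alpha i =>
    rw [Gen.field, ← stateField_alpha]
    refine key _ ?_
    have : createAlpha (i, 0) (VertexData.vac : Fock d B) = transOp (stF (coord i)) := by
      rw [transOp_stF, Finset.sum_eq_single i (fun j _ hj => ?_) (by simp), hcoord, if_pos rfl,
        vac_eq]
      rw [hcoord, if_neg (Ne.symm hj), Coords.stF_zero, map_zero]
    rw [this, transOp_eq]
    exact S.nprod_mem _ (hF _) S.vac_mem

/-- Homomorphisms are determined by their values on functions, `b`, `c` and `β`. -/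
lemma hom_ext [CommPartials B] {V : Type*} [AddCommGroup V] [Module ℂ V] [VertexData V]
    {T T' : Fock d B →ₗ[ℂ] V} (coord : Fin d → B)
    (hcoord : ∀ i j, pd j (coord i) = if i = j then 1 else 0)
    (h1 : T VertexData.vac = T' VertexData.vac)
    (hT : ∀ n a b, T (VertexData.nprod n a b) = VertexData.nprod n (T a) (T b))
    (hT' : ∀ n a b, T' (VertexData.nprod n a b) = VertexData.nprod n (T' a) (T' b))
    (hF : ∀ f, T (stF f) = T' (stF f)) (hb : ∀ i, T (stB B i) = T' (stB B i))
    (hc : ∀ i, T (stC B i) = T' (stC B i)) (hβ : ∀ i, T (stBeta B i) = T' (stBeta B i)) :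
    T = T' := by
  let S : VertexSubalgebra (Fock d B) :=
    { LinearMap.eqLocus T T' with
      vac_mem' := h1
      nprod_mem' := fun n a b ha hb => by
        change T a = T' a at ha
        change T b = T' b at hb
        change T _ = T' _
        rw [hT, hT', ha, hb] }
  exact LinearMap.ext fun x => mem_of_generators S coord hcoord hF hb hc hβ x

lemma diffOp_nprod [CommPartials A] (n : ℤ) (a b : Fock d A) :
    diffOp (VertexData.nprod n a b) =
      VertexData.nprod n (parityOp a) (diffOp b) + VertexData.nprod n (diffOp a) b := by
  refine fock_hom_induction (P := fun a => diffOp (VertexData.nprod n a b) =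
      VertexData.nprod n (parityOp a) (diffOp b) + VertexData.nprod n (diffOp a) b)
    (fun a a' h h' => ?_) (fun p a h => ?_) a
  · simp only [map_add, LinearMap.add_apply, h, h']
    abel
  · rw [nprod_apply, diffOp_bracket h, h, map_smul]
    rfl

namespace Coords

variable [CommPartials A] [CommPartials B] (C : Coords A B)

/-- The Leibniz rule `(Qf) g = Q(fg) - f Qg`. -/
lemma stateField_diffOp_stF (f g : A) : ((stateField (diffOp (stF f)))[[-1]]) (stF g : Fock d A) =
    ∑ i, cMode i (-1) (stF (pd i f * g)) := by
  have h := diffOp_bracket (isHom_stF f) (-1) (stF g : Fock d A)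
  rw [stateField_stF, funField_ncoeff, funMode_stF, taylor_neg_one, mulFun_stF, diffOp_stF,
    diffOp_stF, map_sum, pow_zero, one_smul] at h
  simp only [← commute_apply (commute_cMode_funMode (A := A) _ _ _ _), funMode_stF, taylor_neg_one,
    mulFun_stF, Derivation.leibniz, smul_eq_mul] at h
  rw [← sub_eq_iff_eq_add', ← Finset.sum_sub_distrib] at h
  rw [← h]
  refine Finset.sum_congr rfl fun i _ => ?_
  rw [← map_sub, stF, stF, stF, ← Finsupp.single_sub, add_sub_cancel_left, mul_comm]

lemma map_diffOp_stF (f : B) : C.map (diffOp (stF f)) = diffOp (C.map (stF f)) := by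
  have e : ∀ i g, cMode i (-1) (stF g) = VertexData.nprod (-1) (stC B i) (stF g) := fun i g => by
    rw [nprod_apply, stateField_stC, cField_ncoeff]
  rw [diffOp_stF, map_sum, map_stF, diffOp_stF]
  simp only [e, C.map_nprod, map_stF, map_stC]
  simp only [nprod_apply, stateField_diffOp_stF, C.chain _ f]
  rw [Finset.sum_comm]
  refine Finset.sum_congr rfl fun l _ => ?_
  rw [← map_sum, ← stF_sum]
  simp only [mul_comm]

/-- The map given by a change of coordinates commutes with the chiral de Rham differential. -/
lemma map_diffOp (x : Fock d B) : C.map (diffOp x) = diffOp (C.map x) := by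
  let S : VertexSubalgebra (Fock d B) :=
    { LinearMap.eqLocus (C.map ∘ₗ diffOp) (diffOp ∘ₗ C.map) with
      vac_mem' := C.map_diffOp_stF 1
      nprod_mem' := fun n a b ha hb => by
        change C.map (diffOp a) = diffOp (C.map a) at ha
        change C.map (diffOp b) = diffOp (C.map b) at hb
        change C.map (diffOp _) = diffOp (C.map _)
        rw [diffOp_nprod, map_add, C.map_nprod, C.map_nprod, C.map_nprod, diffOp_nprod,
          C.map_parityOp, ha, hb] }
  refine mem_of_generators S C.coord C.pd_coord C.map_diffOp_stF (fun i => ?_) (fun i => ?_)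
    (fun i => ?_) x
  · change C.map (diffOp _) = diffOp (C.map _)
    rw [diffOp_stB, map_stBeta, map_stB]
  · change C.map (diffOp _) = diffOp (C.map _)
    rw [diffOp_stC, map_stC, diffOp_diffOp, map_zero]
  · change C.map (diffOp _) = diffOp (C.map _)
    rw [diffOp_stBeta, map_stBeta, diffOp_diffOp, map_zero]

lemma diffOp_stF_coord (i : Fin d) : diffOp (stF (C.coord i)) = stC B i := by
  rw [diffOp_stF, Finset.sum_eq_single i (fun j _ hj => ?_) (by simp), C.pd_coord, if_pos rfl,
    stC_eq_cMode, vac_eq]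
  rw [C.pd_coord, if_neg (Ne.symm hj), stF_zero, map_zero]

/-- A homomorphism that commutes with the differential is determined by its values on functions
and `b`. -/
lemma map_eq_of {E : Type*} [CommRing E] [Algebra ℂ E] [Partials d E] [CommPartials E]
    (T : Fock d B →ₗ[ℂ] Fock d E)
    (hT : ∀ n a b, T (VertexData.nprod n a b) = VertexData.nprod n (T a) (T b))
    (hd : ∀ x, T (diffOp x) = diffOp (T x)) (D : Coords E B)
    (hF : ∀ f, T (stF f) = stF (D.hom f)) (hb : ∀ i, T (stB B i) = D.stateB i) : T = D.map := by
  refine hom_ext D.coord D.pd_coord (by rw [vac_eq, hF, D.map_stF]) hT D.map_nprod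
    (fun f => by rw [hF, D.map_stF]) (fun i => by rw [hb, D.map_stB]) (fun i => ?_) (fun i => ?_)
  · rw [← D.diffOp_stF_coord, hd, hF, D.map_diffOp, map_stF]
  · rw [← diffOp_stB, hd, hb, D.map_diffOp, D.map_stB]

lemma inv_unique {H : Fin d → Fin d → A}
    (hH : ∀ i j, ∑ k, pd k (C.hom (C.coord i)) * H k j = if i = j then 1 else 0) : H = C.inv := by
  have h1 : (Matrix.of fun i k => pd k (C.hom (C.coord i))) * Matrix.of H = 1 := by
    ext i j
    rw [Matrix.mul_apply, Matrix.one_apply]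
    exact hH i j
  have h2 : Matrix.of C.inv * (Matrix.of fun i k => pd k (C.hom (C.coord i))) = 1 := by
    ext i j
    rw [Matrix.mul_apply, Matrix.one_apply]
    exact C.inv_jac i j
  exact Matrix.of.injective (left_inv_eq_right_inv h2 h1).symm

lemma inv_unique' {H : Fin d → Fin d → A}
    (hH : ∀ j f, ∑ k, H k j * pd k (C.hom f) = C.hom (pd j f)) : H = C.inv := by
  refine C.inv_unique fun i j => ?_
  have h := hH j (C.coord i)
  rw [C.pd_coord, apply_ite C.hom, map_one, map_zero] at h
  simpa only [mul_comm] using h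

lemma bMode_eq_nprod (i : Fin d) (x : Fock d B) :
    bMode i (-1) x = VertexData.nprod (-1) (stB B i) x := by
  rw [nprod_apply, stateField_stB, bField_ncoeff]

/-- The fields of `b̃` and of functions commute, so the product can be computed with the function
mode acting on the state `b̃`. -/
lemma stateB_nprod_stF (i : Fin d) (f : A) : VertexData.nprod (-1) (C.stateB i) (stF f) =
    ∑ k, bMode k (-1) (stF (C.inv k i * f)) := by
  have h := commutator_of_simple_pole (C.isHom_stateB i) (isHom_stF f) (fun n hn => by
    rw [nprod_apply, C.stateB_stF i _ n hn.le]) (-1) (-1) VertexData.vac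
  rw [nprod_apply 0, C.stateB_stF i _ 0 le_rfl, map_zero, stateField_vac, stateField_vac, mul_zero,
    pow_zero, one_smul, map_zero, Pi.zero_apply, LinearMap.zero_apply, add_zero, stateField_stF,
    funField_ncoeff] at h
  rw [nprod_apply, h, stateB, map_sum]
  refine Finset.sum_congr rfl fun k _ => ?_
  rw [← commute_apply (commute_bMode_funMode _ _ _ _), funMode_stF, taylor_neg_one, mulFun_stF,
    mul_comm]

/-- Functoriality. -/
lemma map_map {E : Type*} [CommRing E] [Algebra ℂ E] [Partials d E] [CommPartials E]
    (C' : Coords B E) (D : Coords A E) (hD : ∀ f, D.hom f = C.hom (C'.hom f)) (x : Fock d E) :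
    C.map (C'.map x) = D.map x := by
  refine LinearMap.congr_fun (map_eq_of (C.map ∘ₗ C'.map) (fun n a b => ?_) (fun x => ?_) D
    (fun f => ?_) (fun i => ?_)) x
  · simp only [LinearMap.comp_apply, C'.map_nprod, C.map_nprod]
  · simp only [LinearMap.comp_apply, map_diffOp]
  · rw [LinearMap.comp_apply, map_stF, map_stF, hD]
  -- The inverse Jacobian of a composite is the product of the inverse Jacobians. This follows from
  -- uniqueness of the frame with the right action on functions, without differentiating the
  -- composite.
  · have e : (fun k j => ∑ i, C.inv k i * C.hom (C'.inv i j)) = D.inv := by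
      refine D.inv_unique' fun j f => ?_
      simp only [hD, ← C'.inv_pd, map_sum, map_mul, Finset.sum_mul, ← C.inv_pd _ (C'.hom f),
        Finset.mul_sum]
      rw [Finset.sum_comm]
      exact Finset.sum_congr rfl fun k _ => Finset.sum_congr rfl fun l _ => by ring
    rw [LinearMap.comp_apply, map_stB, stateB, stateB, ← e]
    simp only [bMode_eq_nprod, map_sum, C.map_nprod, map_stB, map_stF, stateB_nprod_stF, stF_sum]
    rw [Finset.sum_comm]

end Coords

end HomExt

/-! ### Comparison with the explicit transformation formulas. -/

section Explicit

variable {d : ℕ} {A B : Type*} [CommRing A] [Algebra ℂ A] [Partials d A] [CommPartials A]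
  [CommRing B] [Algebra ℂ B] [Partials d B] [CommPartials B]

lemma funMode_vac (f : A) : funMode f (-1) VertexData.vac = (stF f : Fock d A) := by
  rw [vac_eq, funMode_stF, taylor_neg_one, mulFun_stF, mul_one]

lemma wickProd_stF (f : A) (a : Fock d A) : wickProd (stF f) a = funMode f (-1) a := by
  rw [wickProd, nprod_apply, stateField_stF, funField_ncoeff]

lemma wickProd_stF_stB (f : A) (j : Fin d) : wickProd (stF f) (stB A j) = bMode j (-1) (stF f) := by
  rw [wickProd_stF, stB_eq_bMode, ← commute_apply (commute_bMode_funMode (A := A) _ _ _ _),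
    funMode_vac]

lemma wickProd_stF_stC (f : A) (j : Fin d) : wickProd (stF f) (stC A j) = cMode j (-1) (stF f) := by
  rw [wickProd_stF, stC_eq_cMode, ← commute_apply (commute_cMode_funMode (A := A) _ _ _ _),
    funMode_vac]

/-- Reordering `f` and `β` is not free: their simple pole leaves the derivative term with mode `-2`.
-/
lemma wickProd_stF_stBeta (f : A) (j : Fin d) : wickProd (stF f) (stBeta A j) =
    betaMode j (-1) (stF f) - funMode (pd j f) (-2) VertexData.vac := by
  rw [wickProd_stF, stBeta_eq_betaMode, eq_sub_iff_add_eq]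
  have h := betaMode_funMode j (-1) f (-1) (VertexData.vac : Fock d A)
  rw [funMode_vac] at h
  rw [h]
  norm_num

/-- Only the summands `j = 0` and `j = 1` of the outer normally ordered product survive. The first
gives the reordered product, the second the contraction of `c` with `b`. -/
lemma wickProd_wickProd_stC_stB (f : A) (k j : Fin d) :
    wickProd (wickProd (stF f) (stC A k)) (stB A j) =
      -bMode j (-1) (cMode k (-1) (stF f)) +
        if k = j then funMode f (-2) VertexData.vac else 0 := by
  have hf : ∀ J : ℕ, funMode f (J : ℤ) (bMode j (-1) VertexData.vac : Fock d A) = 0 := fun J => by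
    rw [vac_eq, ← commute_apply (commute_bMode_funMode (A := A) _ _ _ _),
      funMode_stF_of_nonneg _ (by lia), map_zero]
  have h : stateField (VertexData.nprod (-1) (stF f) (stC A k)) = _ :=
    stateField_nprod_negSucc (isHom_stF f) 0 (stC A k)
  rw [wickProd, wickProd, nprod_apply, h, wick_ncoeff,
    wickMode_apply, stateField_stF, stateField_stC, stB_eq_bMode]
  rw [finsum_eq_sum_of_support_subset (s := Finset.range 2) _ fun J hJ => ?_]
  · rw [Finset.sum_range_succ, Finset.sum_range_one]
    simp only [wickTerm, LinearMap.smul_apply, LinearMap.add_apply, LinearMap.comp_apply,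
      funField_ncoeff, cField_ncoeff, hf, map_zero, smul_zero, add_zero]
    norm_num
    rw [cMode_bMode, cMode_bMode, vac_eq, cMode_stF _ le_rfl]
    simp only [map_zero, neg_zero, zero_add, ← vac_eq]
    norm_num
    rw [← commute_apply (commute_bMode_funMode (A := A) _ _ _ _),
      ← commute_apply (commute_cMode_funMode (A := A) _ _ _ _), funMode_vac]
    split <;> simp
  · by_contra hJ'
    refine hJ ?_
    have hJ2 : 1 < J := by simpa using hJ'
    simp only [wickTerm, LinearMap.smul_apply, LinearMap.add_apply, LinearMap.comp_apply,
      funField_ncoeff, cField_ncoeff, hf, map_zero, smul_zero, add_zero]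
    rw [cMode_bMode, vac_eq, cMode_stF _ (by lia), if_neg (by lia)]
    simp

namespace Coords

variable (C : Coords A B)

lemma stateB_eq_wickProd (i : Fin d) :
    C.stateB i = ∑ j, wickProd (stF (C.inv j i)) (stB A j) := by
  simp only [wickProd_stF_stB, stateB]

lemma diffOp_stF_eq_wickProd (f : A) :
    diffOp (stF f) = ∑ j, wickProd (stF (pd j f)) (stC A j) := by
  simp only [wickProd_stF_stC, diffOp_stF]

/-- The reordering term of `:f β:` and the contraction term of `:(:f c:) b:` are equal up to sign
and cancel. This explains why the `bc` correction in the formula for `β̃` has exactly this form and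
order. -/
lemma diffOp_stateB_eq_wickProd (i : Fin d) :
    diffOp (C.stateB i) = ∑ j, (wickProd (stF (C.inv j i)) (stBeta A j) +
      ∑ k, wickProd (wickProd (stF (pd k (C.inv j i))) (stC A k)) (stB A j)) := by
  rw [diffOp_stateB]
  refine Finset.sum_congr rfl fun j _ => ?_
  simp only [wickProd_stF_stBeta, wickProd_wickProd_stC_stB, Finset.sum_add_distrib,
    Finset.sum_ite_eq', Finset.mem_univ, if_true, Finset.sum_neg_distrib]
  abel

/-- The change of coordinates given by a homomorphism that is compatible with the partial
derivatives. -/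
def ofPreservesPd (φ : B →ₐ[ℂ] A) (hφ : PreservesPd φ) (coord : Fin d → B)
    (h : ∀ i j, pd j (coord i) = if i = j then 1 else 0) : Coords A B where
  hom := φ
  coord := coord
  pd_coord := h
  inv i j := if i = j then 1 else 0
  chain j f := by simp [← hφ _ _, h, apply_ite φ]
  jac_inv i j := by simp [← hφ _ _, h, apply_ite φ]

/-- Restriction maps are coordinate changes with identity Jacobian matrix, so their compatibility
with other coordinate changes becomes a case of `map_map`. -/
lemma map_ofPreservesPd (φ : B →ₐ[ℂ] A) (hφ : PreservesPd φ) (coord : Fin d → B)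
    (h : ∀ i j, pd j (coord i) = if i = j then 1 else 0) :
    (ofPreservesPd φ hφ coord h).map = fockMap φ := by
  have h0 : ∀ f, fockMap φ (stF f : Fock d B) = stF (φ f) := fun f => fockMap_single _ _ _
  have hb : ∀ i, fockMap φ (stB B i) = stB A i := fun i =>
    (fockMap_single _ _ _).trans (by rw [map_one]; rfl)
  have hc : ∀ i, fockMap φ (stC B i) = stC A i := fun i =>
    (fockMap_single _ _ _).trans (by rw [map_one]; rfl)
  have hβ : ∀ i, fockMap φ (stBeta B i) = stBeta A i := fun i =>
    (fockMap_single _ _ _).trans (by rw [map_one]; rfl)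
  have e : ∀ i, (ofPreservesPd φ hφ coord h).stateB i = stB A i := fun i => by
    rw [stateB, Finset.sum_eq_single i (fun j _ hj => ?_) (by simp)]
    · simp [ofPreservesPd, stB_eq_bMode, vac_eq]
    · simp [ofPreservesPd, hj, stF_zero]
  refine hom_ext coord h ?_ (map_nprod _) (fockMap_nprod hφ) (fun f => ?_) (fun i => ?_)
    (fun i => ?_) (fun i => ?_)
  · rw [map_vac, vac_eq, vac_eq, h0, map_one]
  · rw [map_stF, h0]; rfl
  · rw [map_stB, e, hb]
  · rw [map_stC, hc, diffOp_stF, stC_eq_cMode]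
    change ∑ j, cMode j (-1) (stF (pd j (φ (coord i)))) = _
    rw [Finset.sum_eq_single i (fun j _ hj => ?_) (by simp)]
    · rw [← hφ, h, if_pos rfl, map_one, vac_eq]
    · rw [← hφ, h, if_neg (Ne.symm hj), map_zero, stF_zero, map_zero]
  · rw [map_stBeta, e, hβ, diffOp_stB]

lemma fockMap_map {E : Type*} [CommRing E] [Algebra ℂ E] [Partials d E] [CommPartials E]
    (φ : A →ₐ[ℂ] E) (hφ : PreservesPd φ) (coord : Fin d → A)
    (h : ∀ i j, pd j (coord i) = if i = j then 1 else 0) (D : Coords E B)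
    (hD : ∀ f, D.hom f = φ (C.hom f)) (x : Fock d B) : fockMap φ (C.map x) = D.map x := by
  rw [← map_ofPreservesPd φ hφ coord h]
  exact map_map _ _ _ hD x

lemma map_fockMap {E : Type*} [CommRing E] [Algebra ℂ E] [Partials d E] [CommPartials E]
    (φ : E →ₐ[ℂ] B) (hφ : PreservesPd φ) (coord : Fin d → E)
    (h : ∀ i j, pd j (coord i) = if i = j then 1 else 0) (D : Coords A E)
    (hD : ∀ f, D.hom f = C.hom (φ f)) (x : Fock d E) : C.map (fockMap φ x) = D.map x := by
  rw [← map_ofPreservesPd φ hφ coord h]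
  exact map_map _ _ _ hD x

lemma map_eq_self (C : Coords A A) (hC : ∀ f, C.hom f = f) (x : Fock d A) : C.map x = x := by
  have : C.map = LinearMap.id := by
    refine (map_eq_of LinearMap.id (fun _ _ _ => rfl) (fun _ => rfl) C (fun f => ?_)
      fun i => ?_).symm
    · rw [hC]; rfl
    · have e : (fun i j => if i = j then 1 else 0) = C.inv :=
        C.inv_unique' fun j f => by simp [hC]
      rw [stateB, ← e, Finset.sum_eq_single i (fun j _ hj => by simp [hj, stF_zero]) (by simp)]
      simp [stB_eq_bMode, vac_eq]
  rw [this]; rfl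

end Coords

end Explicit

/-! ### Coordinate changes given by locally biholomorphic maps of `ℂᵈ`. -/

section LocalBiholomorphism

variable {d : ℕ} {S S' S'' : Set (Cn d)}

/-- The germ along `S` of a holomorphic function. -/
def Hol.mk (F : Cn d → ℂ) (hF : AnalyticOnNhd ℂ F S) : Hol S := ⟨F, F, hF, rfl⟩

lemma Hol.mk_eq {F G : Cn d → ℂ} {hF : AnalyticOnNhd ℂ F S} {hG : AnalyticOnNhd ℂ G S}
    (h : F =ᶠ[𝓝ˢ S] G) : Hol.mk F hF = Hol.mk G hG := Subtype.ext (Germ.coe_eq.2 h)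

lemma Hol.exists_mk (f : Hol S) : ∃ F hF, f = Hol.mk F hF := by
  obtain ⟨_, F, hF, rfl⟩ := f
  exact ⟨F, hF, rfl⟩

lemma Hol.pd_mk (i : Fin d) {F : Cn d → ℂ} (hF : AnalyticOnNhd ℂ F S) :
    pd i (Hol.mk F hF) = Hol.mk (partialDeriv i F) (analyticOnNhd_partialDeriv i hF) := rfl

lemma Hol.mk_mul {F G : Cn d → ℂ} (hF : AnalyticOnNhd ℂ F S) (hG : AnalyticOnNhd ℂ G S) :
    Hol.mk F hF * Hol.mk G hG = Hol.mk (F * G) (hF.mul hG) := rfl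

lemma Hol.mk_sum {ι : Type*} (s : Finset ι) {F : ι → Cn d → ℂ}
    (hF : ∀ i, AnalyticOnNhd ℂ (F i) S) :
    ∑ i ∈ s, Hol.mk (F i) (hF i) = Hol.mk (fun z => ∑ i ∈ s, F i z)
      (Finset.analyticOnNhd_fun_sum s fun i _ => hF i) := by
  classical
  induction s using Finset.induction_on with
  | empty => rfl
  | insert i s hi ih =>
    rw [Finset.sum_insert hi, ih]
    refine Subtype.ext (Germ.coe_eq.2 (Eventually.of_forall fun z => ?_))
    exact (Finset.sum_insert (f := fun i => F i z) hi).symm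

lemma Hol.mk_ite (p : Prop) [Decidable p] :
    (if p then 1 else 0 : Hol S) = Hol.mk (fun _ => if p then 1 else 0) analyticOnNhd_const := by
  split <;> rfl

lemma Hol.eventually_analyticAt {E : Type*} [NormedAddCommGroup E] [NormedSpace ℂ E]
    [CompleteSpace E]
    {f : Cn d → E} (hf : AnalyticOnNhd ℂ f S) :
    ∀ᶠ x in 𝓝ˢ S, AnalyticAt ℂ f x :=
  eventually_nhdsSet_iff_forall.2 fun x hx => (hf x hx).eventually_analyticAt

instance : CommPartials (Hol S) where
  pd_comm i j f := by
    obtain ⟨F, hF, rfl⟩ := f.exists_mk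
    simp only [Hol.pd_mk]
    refine Hol.mk_eq ?_
    filter_upwards [Hol.eventually_analyticAt hF] with z hz
    have h2 : DifferentiableAt ℂ (fderiv ℂ F) z := hz.fderiv.differentiableAt
    have e : ∀ (k l : Fin d), partialDeriv k (partialDeriv l F) z =
        fderiv ℂ (fderiv ℂ F) z (EuclideanSpace.single k 1) (EuclideanSpace.single l 1) := by
      intro k l
      have : partialDeriv l F = fun w => fderiv ℂ F w (EuclideanSpace.single l 1) := rfl
      rw [partialDeriv, this, fderiv_clm_apply h2 (differentiableAt_const _)]
      simp
    have hs : IsSymmSndFDerivAt ℂ F z :=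
      (hz.contDiffAt (n := ω)).isSymmSndFDerivAt (by simp)
    rw [e, e, hs]

lemma analyticOnNhd_coord (i : Fin d) : AnalyticOnNhd ℂ (fun z : Cn d => z i) S :=
  fun z _ => (EuclideanSpace.proj (𝕜 := ℂ) i).analyticAt z

/-- The germ of a coordinate function. -/
def coordGerm (S : Set (Cn d)) (i : Fin d) : Hol S :=
  Hol.mk (fun z => z i) (analyticOnNhd_coord i)

lemma pd_coordGerm (i j : Fin d) : pd j (coordGerm S i) = if i = j then 1 else 0 := by
  rw [coordGerm, Hol.pd_mk, Hol.mk_ite]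
  refine Hol.mk_eq (Eventually.of_forall fun z => ?_)
  have : fderiv ℂ (fun z : Cn d => z i) z = EuclideanSpace.proj i :=
    (EuclideanSpace.proj (𝕜 := ℂ) i).hasFDerivAt.fderiv
  simp only [partialDeriv, this]
  simp

lemma partialDeriv_coord_comp {f : Cn d → Cn d} {z : Cn d} (i j : Fin d)
    (hf : DifferentiableAt ℂ f z) :
    partialDeriv j ((fun z : Cn d => z i) ∘ f) z = jac f i j z := by
  have h1 := (EuclideanSpace.proj (𝕜 := ℂ) i).hasFDerivAt.comp z hf.hasFDerivAt
  have : fderiv ℂ ((fun z : Cn d => z i) ∘ f) z = _ := h1.fderiv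
  rw [partialDeriv, this]
  rfl

/-- `f` is a locally biholomorphic map, defined near `S`, that maps `S` to `S'`. -/
structure IsLB (f : Cn d → Cn d) (S S' : Set (Cn d)) : Prop where
  analytic : AnalyticOnNhd ℂ f S
  mapsTo : MapsTo f S S'
  invertible : ∀ x ∈ S, (fderiv ℂ f x).IsInvertible

namespace IsLB

variable {f : Cn d → Cn d}

lemma tendsto (h : IsLB f S S') : Tendsto f (𝓝ˢ S) (𝓝ˢ S') := by
  intro U hU
  rw [mem_nhdsSet_iff_forall] at hU
  rw [mem_map, mem_nhdsSet_iff_forall]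
  exact fun x hx => (h.analytic x hx).continuousAt (hU _ (h.mapsTo hx))

/-- Composition with a locally biholomorphic map. -/
def hom (h : IsLB f S S') : Hol S' →ₐ[ℂ] Hol S where
  toFun g := ⟨g.1.compTendsto f h.tendsto, by
    obtain ⟨F, hF, e⟩ := g.2
    exact ⟨F ∘ f, hF.comp h.analytic h.mapsTo, by rw [e]; rfl⟩⟩
  map_one' := rfl
  map_mul' := by
    rintro ⟨_, f, hf, rfl⟩ ⟨_, g, hg, rfl⟩
    rfl
  map_zero' := rfl
  map_add' := by
    rintro ⟨_, f, hf, rfl⟩ ⟨_, g, hg, rfl⟩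
    rfl
  commutes' _ := rfl

lemma hom_mk (h : IsLB f S S') {F : Cn d → ℂ} (hF : AnalyticOnNhd ℂ F S') :
    h.hom (Hol.mk F hF) = Hol.mk (F ∘ f) (hF.comp h.analytic h.mapsTo) := rfl

/-- Invertible operators form an open set. Invertibility on a neighbourhood is needed because the
identities in `coords` are between germs along `S`. -/
lemma eventually_invertible (h : IsLB f S S') : ∀ᶠ x in 𝓝ˢ S, (fderiv ℂ f x).IsInvertible := by
  refine eventually_nhdsSet_iff_forall.2 fun x hx => ?_
  obtain ⟨e, he⟩ := h.invertible x hx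
  have h1 := (h.analytic x hx).fderiv.continuousAt
  rw [ContinuousAt, ← he] at h1
  exact h1 e.nhds

lemma analyticOnNhd_invJac (h : IsLB f S S') (i j : Fin d) :
    AnalyticOnNhd ℂ (invJac f i j) S := fun x hx => by
  obtain ⟨e, he⟩ := h.invertible x hx
  have h1 : AnalyticAt ℂ ContinuousLinearMap.inverse (fderiv ℂ f x) := by
    rw [← analyticWithinAt_univ, ← contDiffWithinAt_omega_iff_analyticWithinAt,
      contDiffWithinAt_univ, ← he]
    exact contDiffAt_map_inverse e
  have h2 : AnalyticAt ℂ (fun z => (fderiv ℂ f z).inverse) x :=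
    AnalyticAt.comp (g := ContinuousLinearMap.inverse) h1 (h.analytic x hx).fderiv
  have h3 : AnalyticAt ℂ (fun z => (fderiv ℂ f z).inverse (EuclideanSpace.single j (1 : ℂ))) x :=
    AnalyticAt.comp (f := fun z => (fderiv ℂ f z).inverse)
      ((ContinuousLinearMap.apply ℂ (Cn d) (EuclideanSpace.single j (1 : ℂ))).analyticAt _) h2
  exact ((EuclideanSpace.proj (𝕜 := ℂ) i).analyticAt _).comp h3

lemma pd_hom_coordGerm (h : IsLB f S S') (i j : Fin d) :
    (pd j (h.hom (coordGerm S' i))).1 = (jac f i j : Germ (𝓝ˢ S) ℂ) := by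
  refine Germ.coe_eq.2 ?_
  filter_upwards [Hol.eventually_analyticAt h.analytic] with z hz
  exact partialDeriv_coord_comp i j hz.differentiableAt

/-- The change of coordinates on holomorphic functions given by a locally biholomorphic map. -/
def coords (h : IsLB f S S') : Coords (Hol S) (Hol S') where
  hom := h.hom
  coord := coordGerm S'
  pd_coord := pd_coordGerm
  inv i j := Hol.mk (invJac f i j) (h.analyticOnNhd_invJac i j)
  chain j g := by
    obtain ⟨F, hF, rfl⟩ := g.exists_mk
    simp only [Hol.pd_mk, coordGerm, hom_mk, Hol.mk_mul, Hol.mk_sum]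
    refine Hol.mk_eq ?_
    filter_upwards [Hol.eventually_analyticAt h.analytic,
      h.tendsto.eventually (Hol.eventually_analyticAt hF)] with z hz hFz
    have h1 : ∀ i, partialDeriv j ((fun z : Cn d => z i) ∘ f) z = jac f i j z :=
      fun i => partialDeriv_coord_comp i j hz.differentiableAt
    rw [partialDeriv, fderiv_comp z hFz.differentiableAt hz.differentiableAt]
    simp only [Pi.mul_apply, h1, Function.comp_apply, ContinuousLinearMap.comp_apply]
    simp only [partialDeriv, jac]
    conv_lhs => rw [← (EuclideanSpace.basisFun (Fin d) ℂ).sum_repr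
      (fderiv ℂ f z (EuclideanSpace.single j 1))]
    simp [mul_comm]
  jac_inv i j := by
    simp only [coordGerm, hom_mk, Hol.pd_mk, Hol.mk_mul, Hol.mk_sum, Hol.mk_ite]
    refine Hol.mk_eq ?_
    filter_upwards [Hol.eventually_analyticAt h.analytic, h.eventually_invertible] with z hz hi
    have h1 : ∀ k, partialDeriv k ((fun z : Cn d => z i) ∘ f) z = jac f i k z :=
      fun k => partialDeriv_coord_comp i k hz.differentiableAt
    simp only [Pi.mul_apply, h1, invJac, jac]
    obtain ⟨e, he⟩ := hi
    rw [← he, ContinuousLinearMap.inverse_equiv]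
    have h2 : e (e.symm (EuclideanSpace.single j (1 : ℂ))) i =
      ∑ k, e (EuclideanSpace.single k 1) i * (e.symm (EuclideanSpace.single j 1)) k := by
      conv_lhs => rw [← (EuclideanSpace.basisFun (Fin d) ℂ).sum_repr
        (e.symm (EuclideanSpace.single j 1))]
      simp [mul_comm]
    refine Eq.trans h2.symm ?_
    rw [e.apply_symm_apply]
    simp

/-- The homomorphism of vertex algebras given by a locally biholomorphic map. -/
def map (h : IsLB f S S') : OmegaOn S' →ₗ[ℂ] OmegaOn S := h.coords.map

lemma map_nprod (h : IsLB f S S') (n : ℤ) (a b : OmegaOn S') :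
    h.map (VertexData.nprod n a b) = VertexData.nprod n (h.map a) (h.map b) :=
  h.coords.map_nprod n a b

lemma mono {T T' : Set (Cn d)} (h : IsLB f S S') (hT : T ⊆ S) (hT' : MapsTo f T T') :
    IsLB f T T' :=
  ⟨h.analytic.mono hT, hT', fun x hx => h.invertible x (hT hx)⟩

lemma map_map {g k : Cn d → Cn d} (h : IsLB f S S') (hg : IsLB g S' S'') (hk : IsLB k S S'')
    (e : k =ᶠ[𝓝ˢ S] g ∘ f) (x : OmegaOn S'') : h.map (hg.map x) = hk.map x := by
  refine Coords.map_map _ _ _ (fun F => ?_) x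
  obtain ⟨F, hF, rfl⟩ := F.exists_mk
  exact Subtype.ext (Germ.coe_eq.2 (e.fun_comp F))

lemma map_eq_self {k : Cn d → Cn d} (hk : IsLB k S S) (e : k =ᶠ[𝓝ˢ S] id) (x : OmegaOn S) :
    hk.map x = x := by
  refine Coords.map_eq_self _ (fun F => ?_) x
  obtain ⟨F, hF, rfl⟩ := F.exists_mk
  exact Subtype.ext (Germ.coe_eq.2 (e.fun_comp F))

/-- Both composites are the homomorphism of `f` regarded as a map from `{x}` to `S'`. -/
lemma germAt_map {x y : Cn d} (h : IsLB f S S') (hx : x ∈ S) (hy : y ∈ S')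
    (h' : IsLB f {x} {y}) (a : OmegaOn S') : germAt hx (h.map a) = h'.map (germAt hy a) := by
  have hm : IsLB f {x} S' := h.mono (singleton_subset_iff.2 hx) fun z hz => by
    rw [mem_singleton_iff.1 hz]; exact h.mapsTo hx
  rw [germAt, germAt, map, map,
    h.coords.fockMap_map (Hol.res (singleton_subset_iff.2 hx)) (Hol.preservesPd_res _)
      (coordGerm S) pd_coordGerm hm.coords fun F => ?_,
    h'.coords.map_fockMap (Hol.res (singleton_subset_iff.2 hy)) (Hol.preservesPd_res _)
      (coordGerm S') pd_coordGerm hm.coords fun F => ?_]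
  all_goals
    obtain ⟨F, hF, rfl⟩ := F.exists_mk
    rfl

/-- The coordinate change is the graph of the homomorphism of vertex algebras. -/
lemma mem_coordChange {x y : Cn d} (h : IsLB f {x} {y}) (u : OmegaStalk x) (v : OmegaStalk y) :
    (u, v) ∈ (coordChange f x y).toSubmodule ↔ u = h.map v := by
  constructor
  · intro H
    -- The graph of `h.map` is a vertex subalgebra, and it contains the generating pairs by the
    -- explicit formulas.
    let T : VertexSubalgebra (OmegaStalk x × OmegaStalk y) :=
      { LinearMap.eqLocus (LinearMap.fst ℂ _ _) (h.map ∘ₗ LinearMap.snd ℂ _ _) with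
        vac_mem' := h.coords.map_vac.symm
        nprod_mem' := fun n a b ha hb => by
          change a.1 = h.map a.2 at ha
          change b.1 = h.map b.2 at hb
          change VertexData.nprod n a.1 b.1 = h.map (VertexData.nprod n a.2 b.2)
          rw [h.map_nprod, ha, hb] }
    refine H T fun w hw => ?_
    obtain ⟨u, v⟩ := w
    change u = h.map v
    change CoordGen f x y u v at hw
    cases hw with
    | func F u v hv hu =>
      rw [map, Coords.map_stF]
      congr 1
      refine Subtype.ext ?_
      change u.1 = v.1.compTendsto f h.tendsto
      rw [hu, hv]
      rfl
    | b i G hG =>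
      rw [map, Coords.map_stB, Coords.stateB_eq_wickProd]
      have : ∀ j, G j = h.coords.inv j i := fun j => Subtype.ext (hG j)
      simp only [this]
    | c i J hJ =>
      rw [map, Coords.map_stC, Coords.diffOp_stF_eq_wickProd]
      have : ∀ j, J j = pd j (h.coords.hom (h.coords.coord i)) := fun j =>
        Subtype.ext ((hJ j).trans (h.pd_hom_coordGerm i j).symm)
      simp only [this]
    | beta i G hG =>
      rw [map, Coords.map_stBeta, Coords.diffOp_stateB_eq_wickProd]
      have : ∀ j, G j = h.coords.inv j i := fun j => Subtype.ext (hG j)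
      simp only [this]
  · rintro rfl T hT
    -- Conversely, the `v` whose graph point lies in a given `T` form a vertex subalgebra, which
    -- contains all generators of the stalk at `y` as soon as `T` contains the generating pairs.
    let T' : VertexSubalgebra (OmegaStalk y) :=
      { T.toSubmodule.comap (h.map.prod LinearMap.id) with
        vac_mem' := by
          change (h.map VertexData.vac, VertexData.vac) ∈ T.toSubmodule
          rw [map, Coords.map_vac]
          exact T.vac_mem
        nprod_mem' := fun n a b ha hb => by
          change (h.map (VertexData.nprod n a b), VertexData.nprod n a b) ∈ T.toSubmodule
          rw [h.map_nprod]
          exact T.nprod_mem_prod n ha hb }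
    refine mem_of_generators T' (coordGerm _) pd_coordGerm (fun F => ?_) (fun i => ?_)
      (fun i => ?_) (fun i => ?_) v
    · obtain ⟨F, hF, rfl⟩ := F.exists_mk
      refine hT (a := (h.map _, _)) ?_
      change CoordGen f x y (h.map _) _
      rw [map, Coords.map_stF]
      exact CoordGen.func F _ _ rfl rfl
    · refine hT (a := (h.map _, _)) ?_
      change CoordGen f x y (h.map _) _
      rw [map, Coords.map_stB, Coords.stateB_eq_wickProd]
      exact CoordGen.b i (fun j => h.coords.inv j i) fun j => rfl
    · refine hT (a := (h.map _, _)) ?_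
      change CoordGen f x y (h.map _) _
      rw [map, Coords.map_stC, Coords.diffOp_stF_eq_wickProd]
      exact CoordGen.c i (fun j => pd j (h.coords.hom (h.coords.coord i)))
        fun j => h.pd_hom_coordGerm i j
    · refine hT (a := (h.map _, _)) ?_
      change CoordGen f x y (h.map _) _
      rw [map, Coords.map_stBeta, Coords.diffOp_stateB_eq_wickProd]
      exact CoordGen.beta i (fun j => h.coords.inv j i) fun j => rfl

end IsLB

end LocalBiholomorphism

/-! ### Parity as an eigenvalue. -/

section Parity

variable {d : ℕ} {A : Type*} [CommRing A] [Algebra ℂ A] [Partials d A]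

lemma parityOp_apply (a : Fock d A) (m : Mono d) :
    parityOp a m = (-1 : ℂ) ^ m.2.2.card • a m := by
  induction a using Finsupp.induction_linear with
  | zero => simp
  | add a b ha hb => rw [map_add, Finsupp.add_apply, ha, hb, Finsupp.add_apply, smul_add]
  | single n f =>
    rw [parityOp_single, Finsupp.smul_apply]
    by_cases h : n = m
    · rw [h]
    · rw [Finsupp.single_eq_of_ne' h, smul_zero, smul_zero]

/-- Parity is defined through monomials, which a coordinate change does not preserve; it does
commute with `parityOp`. -/
lemma mem_parity_iff (ε : ZMod 2) (a : Fock d A) :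
    a ∈ VertexData.parity ε ↔ parityOp a = (-1 : ℂ) ^ ε.val • a := by
  have key : ∀ n : ℕ, (-1 : ℂ) ^ n = (-1) ^ ε.val ↔ (n : ZMod 2) = ε := fun n => by
    fin_cases ε
    · exact (neg_one_pow_eq_one_iff_even (by norm_num)).trans ZMod.natCast_eq_zero_iff_even.symm
    · change (-1 : ℂ) ^ n = (-1) ^ 1 ↔ (n : ZMod 2) = 1
      rw [pow_one, neg_one_pow_eq_neg_one_iff_odd (by norm_num), ZMod.natCast_eq_one_iff_odd]
  change a ∈ Finsupp.supported A ℂ _ ↔ _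
  rw [Finsupp.mem_supported']
  constructor
  · intro h
    ext m
    rw [parityOp_apply, Finsupp.smul_apply]
    by_cases hm : (m.2.2.card : ZMod 2) = ε
    · rw [(key _).2 hm]
    · rw [h m hm, smul_zero, smul_zero]
  · intro h m hm
    have h' := DFunLike.congr_fun h m
    rw [parityOp_apply, Finsupp.smul_apply, ← sub_eq_zero, ← sub_smul] at h'
    exact (smul_eq_zero.1 h').resolve_left fun h0 => hm ((key _).1 (sub_eq_zero.1 h0))

end Parity

/-! ### Transport of germs along local biholomorphisms of manifolds. -/

section Transport

variable {d : ℕ} {X Y Z : Type*} [TopologicalSpace X] [ChartedSpace (Cn d) X]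
  [TopologicalSpace Y] [ChartedSpace (Cn d) Y] [TopologicalSpace Z] [ChartedSpace (Cn d) Z]

variable (d) in
/-- `q` is biholomorphic near `y`, and `q y = x`. -/
structure IsLD (q : Y → X) (y : Y) (x : X) : Prop where
  eq : q y = x
  smooth : ContMDiffAt 𝓘(ℂ, Cn d) 𝓘(ℂ, Cn d) ω q y
  exists_inv : ∃ r : X → Y, r x = y ∧ ContMDiffAt 𝓘(ℂ, Cn d) 𝓘(ℂ, Cn d) ω r x ∧
    r ∘ q =ᶠ[𝓝 y] id ∧ q ∘ r =ᶠ[𝓝 x] id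

namespace IsLD

variable {q : Y → X} {y : Y} {x : X}

lemma tendsto (h : IsLD d q y x) : Tendsto q (𝓝 y) (𝓝 x) := by
  have := h.smooth.continuousAt
  rwa [ContinuousAt, h.eq] at this

lemma refl (x : X) : IsLD d id x x :=
  ⟨rfl, contMDiffAt_id, id, rfl, contMDiffAt_id, EventuallyEq.rfl, EventuallyEq.rfl⟩

lemma exists_symm (h : IsLD d q y x) :
    ∃ r : X → Y, IsLD d r x y ∧ r ∘ q =ᶠ[𝓝 y] id ∧ q ∘ r =ᶠ[𝓝 x] id := by
  obtain ⟨r, h1, h2, h3, h4⟩ := h.exists_inv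
  exact ⟨r, ⟨h1, h2, q, h.eq, h.smooth, h4, h3⟩, h3, h4⟩

lemma contDiffAt_chart [IsManifold 𝓘(ℂ, Cn d) ω X] [IsManifold 𝓘(ℂ, Cn d) ω Y]
    (h : IsLD d q y x) (ψ : Chart d Y) (φ : Chart d X)
    (hψ : y ∈ ψ.1.source) (hφ : x ∈ φ.1.source) :
    ContDiffAt ℂ ω (φ.1 ∘ q ∘ ψ.1.symm) (ψ.1 y) := by
  have hy : ψ.1.symm (ψ.1 y) = y := ψ.1.left_inv hψ
  refine contMDiffAt_iff_contDiffAt.1 (ContMDiffAt.comp (ψ.1 y) (I' := 𝓘(ℂ, Cn d)) ?_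
    (ContMDiffAt.comp (ψ.1 y) (I' := 𝓘(ℂ, Cn d)) ?_
    (contMDiffAt_symm_of_mem_maximalAtlas ψ.2 (ψ.1.map_source hψ))))
  · rw [Function.comp_apply, hy, h.eq]
    exact contMDiffAt_of_mem_maximalAtlas φ.2 hφ
  · rw [hy]
    exact h.smooth

lemma eventually_chart (h : IsLD d q y x) (ψ : Chart d Y) (hψ : y ∈ ψ.1.source) {P : Y → Prop}
    (hP : ∀ᶠ z in 𝓝 y, P z) : ∀ᶠ z in 𝓝 (ψ.1 y), P (ψ.1.symm z) := by
  have := ψ.1.tendsto_symm hψ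
  exact this.eventually hP

/-- The expression in coordinates of a map that is biholomorphic near `y`. -/
lemma isLB [IsManifold 𝓘(ℂ, Cn d) ω X] [IsManifold 𝓘(ℂ, Cn d) ω Y]
    (h : IsLD d q y x) (ψ : Chart d Y) (φ : Chart d X)
    (hψ : y ∈ ψ.1.source) (hφ : x ∈ φ.1.source) :
    IsLB (φ.1 ∘ q ∘ ψ.1.symm) {ψ.1 y} {φ.1 x} := by
  obtain ⟨r, hr, e1, e2⟩ := h.exists_symm
  have hy : ψ.1.symm (ψ.1 y) = y := ψ.1.left_inv hψ
  have hx : φ.1.symm (φ.1 x) = x := φ.1.left_inv hφ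
  have a1 := h.contDiffAt_chart ψ φ hψ hφ
  have a2 := hr.contDiffAt_chart φ ψ hφ hψ
  have m1 : (φ.1 ∘ q ∘ ψ.1.symm) (ψ.1 y) = φ.1 x := by
    rw [Function.comp_apply, Function.comp_apply, hy, h.eq]
  have m2 : (ψ.1 ∘ r ∘ φ.1.symm) (φ.1 x) = ψ.1 y := by
    rw [Function.comp_apply, Function.comp_apply, hx, hr.eq]
  have b1 : (ψ.1 ∘ r ∘ φ.1.symm) ∘ (φ.1 ∘ q ∘ ψ.1.symm) =ᶠ[𝓝 (ψ.1 y)] id := by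
    filter_upwards [h.eventually_chart ψ hψ e1, h.eventually_chart ψ hψ
      (h.tendsto.eventually (φ.1.open_source.mem_nhds hφ)),
      ψ.1.open_target.mem_nhds (ψ.1.map_source hψ)] with z hz hz' ht
    simp only [Function.comp_apply, id] at hz ⊢
    rw [φ.1.left_inv hz', hz, ψ.1.right_inv ht]
  have b2 : (φ.1 ∘ q ∘ ψ.1.symm) ∘ (ψ.1 ∘ r ∘ φ.1.symm) =ᶠ[𝓝 (φ.1 x)] id := by
    filter_upwards [hr.eventually_chart φ hφ e2, hr.eventually_chart φ hφ
      (hr.tendsto.eventually (ψ.1.open_source.mem_nhds hψ)),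
      φ.1.open_target.mem_nhds (φ.1.map_source hφ)] with z hz hz' ht
    simp only [Function.comp_apply, id] at hz ⊢
    rw [ψ.1.left_inv hz', hz, φ.1.right_inv ht]
  have d1 : DifferentiableAt ℂ (φ.1 ∘ q ∘ ψ.1.symm) (ψ.1 y) := a1.differentiableAt (by simp)
  have d2 : DifferentiableAt ℂ (ψ.1 ∘ r ∘ φ.1.symm) (φ.1 x) := a2.differentiableAt (by simp)
  refine ⟨fun z hz => ?_, fun z hz => ?_, fun z hz => ?_⟩ <;> obtain rfl := mem_singleton_iff.1 hz
  · rw [← analyticWithinAt_univ, ← contDiffWithinAt_omega_iff_analyticWithinAt,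
      contDiffWithinAt_univ]
    exact a1
  · exact m1
  -- The chain rule applied to the two composites of the coordinate expressions of `q` and its local
  -- inverse.
  · refine ContinuousLinearMap.IsInvertible.of_inverse
      (g := fderiv ℂ (ψ.1 ∘ r ∘ φ.1.symm) (φ.1 x)) ?_ ?_
    · have := fderiv_comp (φ.1 x) (by rw [m2]; exact d1) d2
      rw [m2, b2.fderiv_eq, fderiv_id] at this
      exact this.symm
    · have := fderiv_comp (ψ.1 y) (by rw [m1]; exact d2) d1
      rw [m1, b1.fderiv_eq, fderiv_id] at this
      exact this.symm

section Germs

variable [IsManifold 𝓘(ℂ, Cn d) ω X] [IsManifold 𝓘(ℂ, Cn d) ω Y] [IsManifold 𝓘(ℂ, Cn d) ω Z]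

/-- The transport of germs along a map that is biholomorphic near `y`. -/
def tr (h : IsLD d q y x) (ψ : Chart d Y) (φ : Chart d X)
    (hψ : y ∈ ψ.1.source) (hφ : x ∈ φ.1.source) : OmegaStalk (φ.1 x) →ₗ[ℂ] OmegaStalk (ψ.1 y) :=
  (h.isLB ψ φ hψ hφ).map

lemma mem_coordChange (h : IsLD d q y x) (ψ : Chart d Y) (φ : Chart d X)
    (hψ : y ∈ ψ.1.source) (hφ : x ∈ φ.1.source) (u : OmegaStalk (ψ.1 y))
    (v : OmegaStalk (φ.1 x)) :
    (u, v) ∈ (coordChange (φ.1 ∘ q ∘ ψ.1.symm) (ψ.1 y) (φ.1 x)).toSubmodule ↔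
      u = h.tr ψ φ hψ hφ v :=
  (h.isLB ψ φ hψ hφ).mem_coordChange u v

lemma tr_tr {q' : X → Z} {z : Z} {k : Y → Z} (h : IsLD d q y x) (h' : IsLD d q' x z)
    (hk : IsLD d k y z) (e : k =ᶠ[𝓝 y] q' ∘ q) (ψ : Chart d Y) (φ : Chart d X) (χ : Chart d Z)
    (hψ : y ∈ ψ.1.source) (hφ : x ∈ φ.1.source) (hχ : z ∈ χ.1.source) (v : OmegaStalk (χ.1 z)) :
    h.tr ψ φ hψ hφ (h'.tr φ χ hφ hχ v) = hk.tr ψ χ hψ hχ v := by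
  refine IsLB.map_map _ _ _ ?_ v
  rw [nhdsSet_singleton]
  filter_upwards [h.eventually_chart ψ hψ e, h.eventually_chart ψ hψ
    (h.tendsto.eventually (φ.1.open_source.mem_nhds hφ))] with w hw hw'
  simp only [Function.comp_apply] at hw ⊢
  rw [φ.1.left_inv hw', hw]

lemma tr_self {k : Y → Y} (hk : IsLD d k y y) (e : k =ᶠ[𝓝 y] id) (ψ : Chart d Y)
    (hψ : y ∈ ψ.1.source) (v : OmegaStalk (ψ.1 y)) : hk.tr ψ ψ hψ hψ v = v := by
  refine IsLB.map_eq_self _ ?_ v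
  rw [nhdsSet_singleton]
  filter_upwards [hk.eventually_chart ψ hψ e, ψ.1.open_target.mem_nhds (ψ.1.map_source hψ)]
    with w hw ht
  simp only [Function.comp_apply, id] at hw ⊢
  rw [hw, ψ.1.right_inv ht]

lemma tr_tr_self {r : X → Y} (h : IsLD d q y x) (h' : IsLD d r x y) (e : r ∘ q =ᶠ[𝓝 y] id)
    (ψ : Chart d Y) (φ : Chart d X) (hψ : y ∈ ψ.1.source) (hφ : x ∈ φ.1.source)
    (v : OmegaStalk (ψ.1 y)) : h.tr ψ φ hψ hφ (h'.tr φ ψ hφ hψ v) = v := by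
  rw [h.tr_tr h' (refl y) e.symm, tr_self _ EventuallyEq.rfl]

/-- Transport along a local inverse undoes it. -/
lemma tr_injective (h : IsLD d q y x) (ψ : Chart d Y) (φ : Chart d X)
    (hψ : y ∈ ψ.1.source) (hφ : x ∈ φ.1.source) : Function.Injective (h.tr ψ φ hψ hφ) := by
  obtain ⟨r, hr, e1, e2⟩ := h.exists_symm
  exact Function.LeftInverse.injective fun v => hr.tr_tr_self h e2 φ ψ hφ hψ v

lemma tr_mem_parity (h : IsLD d q y x) (ψ : Chart d Y) (φ : Chart d X)
    (hψ : y ∈ ψ.1.source) (hφ : x ∈ φ.1.source) (ε : ZMod 2) (v : OmegaStalk (φ.1 x)) :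
    h.tr ψ φ hψ hφ v ∈ VertexData.parity ε ↔ v ∈ VertexData.parity ε := by
  rw [mem_parity_iff, mem_parity_iff, ← map_smul, tr, IsLB.map, ← Coords.map_parityOp]
  exact (h.tr_injective ψ φ hψ hφ).eq_iff

end Germs

end IsLD

end Transport

/-! ### Parity in subalgebras and in families. -/

section Parity

lemma VertexSubalgebra.mem_parity {V : Type*} [AddCommGroup V] [Module ℂ V] [VertexData V]
    (S : VertexSubalgebra V) (ε : ZMod 2) (a : S) :
    a ∈ VertexData.parity ε ↔ a.1 ∈ VertexData.parity ε := Iff.rfl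

lemma mem_parity_pi {ι : Type*} {V : ι → Type*} [∀ i, AddCommGroup (V i)] [∀ i, Module ℂ (V i)]
    [∀ i, VertexData (V i)] (ε : ZMod 2) (a : ∀ i, V i) :
    a ∈ VertexData.parity ε ↔ ∀ i, a i ∈ VertexData.parity ε := by
  change a ∈ Submodule.pi Set.univ _ ↔ _
  simp only [Submodule.mem_pi, Set.mem_univ, true_imp_iff]

end Parity

/-! ### Pullback of sections and descent along a normal covering. -/

section Covering

variable {d : ℕ} {X Y : Type*} [TopologicalSpace X] [ChartedSpace (Cn d) X]
  [TopologicalSpace Y] [ChartedSpace (Cn d) Y]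
  [IsManifold 𝓘(ℂ, Cn d) ω X] [IsManifold 𝓘(ℂ, Cn d) ω Y]

lemma IsLB.of_forall {f : Cn d → Cn d} {S S' : Set (Cn d)}
    (h : ∀ z ∈ S, ∃ w ∈ S', IsLB f {z} {w}) : IsLB f S S' where
  analytic z hz := by
    obtain ⟨w, -, hw⟩ := h z hz
    exact hw.analytic z rfl
  mapsTo z hz := by
    obtain ⟨w, hw', hw⟩ := h z hz
    rw [mem_singleton_iff.1 (hw.mapsTo rfl)]
    exact hw'
  invertible z hz := by
    obtain ⟨w, -, hw⟩ := h z hz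
    exact hw.invertible z rfl

/-- As `coordChange` is a graph, compatibility becomes an equation: the germs in two coordinate
systems are related by transport along the identity. -/
lemma IsCompatible.eq_tr {s : GermFamily d X} (hs : IsCompatible s) (φ ψ : Chart d X) (x : X)
    (hφ : x ∈ φ.1.source) (hψ : x ∈ ψ.1.source) :
    s φ ⟨x, hφ⟩ = (IsLD.refl x).tr φ ψ hφ hψ (s ψ ⟨x, hψ⟩) :=
  ((IsLD.refl x).mem_coordChange φ ψ hφ hψ _ _).1 (hs φ ψ x hφ hψ)

/-- A family of germs is locally given near `y` if it is transported from a locally given family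
by a locally biholomorphic map. -/
lemma IsLocallyGiven.transport {s : GermFamily d X} {t : GermFamily d Y} (hs : IsLocallyGiven s)
    {q : Y → X} {y : Y} {x : X} (h : IsLD d q y x) (ψ : Chart d Y) (φ : Chart d X)
    (hψ : y ∈ ψ.1.source) (hφ : x ∈ φ.1.source)
    (H : ∀ᶠ z in 𝓝 y, ∃ h' : IsLD d q z (q z), ∀ hψ' hφ',
      t ψ ⟨z, hψ'⟩ = h'.tr ψ φ hψ' hφ' (s φ ⟨q z, hφ'⟩)) :
    ∃ N : Set (Cn d), IsOpen N ∧ ψ.1 y ∈ N ∧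
      ∃ a : OmegaOn N, ∀ (z : ψ.1.source) (hz : ψ.1 z ∈ N), t ψ z = germAt hz a := by
  obtain ⟨N, hN, hxN, a, ha⟩ := hs φ ⟨x, hφ⟩
  have H2 : ∀ᶠ z in 𝓝 y, q z ∈ φ.1.source ∧ φ.1 (q z) ∈ N :=
    h.tendsto.eventually ((φ.1.open_source.eventually_mem hφ).and
      ((φ.1.continuousAt hφ).eventually (hN.eventually_mem hxN)))
  obtain ⟨U, hU, hUo, hyU⟩ := eventually_nhds_iff.1 (H.and H2)
  -- The coordinate expression of `q` on a whole neighbourhood carries the local representative `a`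
  -- to one section, whose germs are the transported germs by `IsLB.germAt_map`.
  have hLB : IsLB (φ.1 ∘ q ∘ ψ.1.symm) (ψ.1.target ∩ ψ.1.symm ⁻¹' U) N := by
    refine IsLB.of_forall fun z hz => ?_
    obtain ⟨⟨h', -⟩, h1, h2⟩ := hU _ hz.2
    have := h'.isLB ψ φ (ψ.1.map_target hz.1) h1
    rw [ψ.1.right_inv hz.1] at this
    exact ⟨_, h2, this⟩
  refine ⟨_, ψ.1.isOpen_inter_preimage_symm hUo,
    ⟨ψ.1.map_source hψ, by rwa [mem_preimage, ψ.1.left_inv hψ]⟩, hLB.map a, fun z hz => ?_⟩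
  have hzU : (z : Y) ∈ U := by
    have := hz.2
    rwa [mem_preimage, ψ.1.left_inv z.2] at this
  obtain ⟨⟨h', h3⟩, h1, h2⟩ := hU _ hzU
  rw [hLB.germAt_map hz h2 (h'.isLB ψ φ z.2 h1), ← ha ⟨q z, h1⟩ h2]
  exact h3 z.2 h1

variable (d) in
/-- The preferred coordinate system at a point. -/
def chartOf (x : X) : Chart d X := ⟨chartAt (Cn d) x, IsManifold.chart_mem_maximalAtlas x⟩

lemma mem_chartOf (x : X) : x ∈ (chartOf d x).1.source := mem_chart_source _ _

/-- The family of germs obtained by transporting the germ of `s` at `σ y` to `y` along `q y`. -/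
def transportFam {q : Y → Y → X} {σ : Y → X} (h : ∀ y, IsLD d (q y) y (σ y))
    (s : GermFamily d X) : GermFamily d Y := fun ψ y =>
  (h y).tr ψ (chartOf d (σ y)) y.2 (mem_chartOf _) (s (chartOf d (σ y)) ⟨σ y, mem_chartOf _⟩)

/-- The preferred chart used in the definition is immaterial, because `s` is compatible. -/
lemma transportFam_eq {q : Y → Y → X} {σ : Y → X} (h : ∀ y, IsLD d (q y) y (σ y))
    {s : GermFamily d X} (hs : IsCompatible s) (ψ : Chart d Y) (φ : Chart d X) (y : Y)
    (hψ : y ∈ ψ.1.source) (hφ : σ y ∈ φ.1.source) :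
    transportFam h s ψ ⟨y, hψ⟩ = (h y).tr ψ φ hψ hφ (s φ ⟨σ y, hφ⟩) := by
  rw [transportFam, hs.eq_tr (chartOf d (σ y)) φ (σ y) (mem_chartOf _) hφ]
  exact (h y).tr_tr (IsLD.refl _) (h y) EventuallyEq.rfl _ _ _ _ _ _ _

/-- Functoriality suffices: in all coordinate systems at `y` the germ is transported from one fixed
germ at `σ y`. -/
lemma isCompatible_transportFam {q : Y → Y → X} {σ : Y → X} (h : ∀ y, IsLD d (q y) y (σ y))
    (s : GermFamily d X) : IsCompatible (transportFam h s) := by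
  intro ψ ψ' y hψ hψ'
  refine ((IsLD.refl y).mem_coordChange ψ ψ' hψ hψ' _ _).2 ?_
  exact ((IsLD.refl y).tr_tr (h y) (h y) EventuallyEq.rfl _ _ _ _ _ _ _).symm

lemma IsPullback.eq_tr {p : Y → X} {s : GlobalSections d X} {t : GlobalSections d Y}
    (h : IsPullback p s t) {y : Y} {x : X} (hp : IsLD d p y x) (ψ : Chart d Y) (φ : Chart d X)
    (hψ : y ∈ ψ.1.source) (hφ : x ∈ φ.1.source) :
    t.1 ψ ⟨y, hψ⟩ = hp.tr ψ φ hψ hφ (s.1 φ ⟨x, hφ⟩) := by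
  obtain rfl := hp.eq
  exact (hp.mem_coordChange ψ φ hψ hφ _ _).1 (h ψ φ y hψ hφ)

lemma isPullback_of {p : Y → X} {s : GlobalSections d X} {t : GlobalSections d Y}
    (hp : ∀ y, IsLD d p y (p y)) (h : ∀ ψ φ y hψ hφ,
      t.1 ψ ⟨y, hψ⟩ = (hp y).tr ψ φ hψ hφ (s.1 φ ⟨p y, hφ⟩)) : IsPullback p s t :=
  fun ψ φ y hψ hφ => ((hp y).mem_coordChange ψ φ hψ hφ _ _).2 (h ψ φ y hψ hφ)

/-- The pullback of a section along a locally biholomorphic map. -/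
def pullback {p : Y → X} (hp : ∀ y, IsLD d p y (p y)) (s : GlobalSections d X) :
    GlobalSections d Y :=
  ⟨transportFam hp s.1, fun ψ y => s.2.1.transport (hp y) ψ (chartOf d (p y)) y.2 (mem_chartOf _)
    (Eventually.of_forall fun z => ⟨hp z, fun hψ hφ => transportFam_eq hp s.2.2 _ _ _ _ _⟩),
    isCompatible_transportFam hp s.1⟩

lemma isPullback_pullback {p : Y → X} (hp : ∀ y, IsLD d p y (p y)) (s : GlobalSections d X) :
    IsPullback p s (pullback hp s) :=
  isPullback_of hp fun ψ φ y hψ hφ => transportFam_eq hp s.2.2 ψ φ y hψ hφ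

lemma IsPullback.unique {p : Y → X} (hp : ∀ y, IsLD d p y (p y)) {s : GlobalSections d X}
    {t t' : GlobalSections d Y} (h : IsPullback p s t) (h' : IsPullback p s t') : t = t' := by
  refine Subtype.ext (funext fun ψ => funext fun y => ?_)
  exact (h.eq_tr (hp y) ψ _ y.2 (mem_chartOf _)).trans
    (h'.eq_tr (hp y) ψ _ y.2 (mem_chartOf _)).symm

/-- Every point of `X` has a preimage, and transport to it is injective on germs. -/
lemma IsPullback.injective {p : Y → X} (hp : ∀ y, IsLD d p y (p y)) (hs : Function.Surjective p)
    {s s' : GlobalSections d X} {t : GlobalSections d Y} (h : IsPullback p s t)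
    (h' : IsPullback p s' t) : s = s' := by
  refine Subtype.ext (funext fun φ => funext fun ⟨x, hx⟩ => ?_)
  obtain ⟨y, rfl⟩ := hs x
  exact (hp y).tr_injective (chartOf d y) φ (mem_chartOf _) hx
    ((h.eq_tr (hp y) _ φ (mem_chartOf _) hx).symm.trans (h'.eq_tr (hp y) _ φ (mem_chartOf _) hx))

lemma IsPullback.nprod {p : Y → X} {s s' : GlobalSections d X} {t t' : GlobalSections d Y}
    (h : IsPullback p s t) (h' : IsPullback p s' t') (n : ℤ) :
    IsPullback p (VertexData.nprod n s s') (VertexData.nprod n t t') := fun ψ φ y hψ hφ => by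
  rw [VertexSubalgebra.nprod_val, VertexSubalgebra.nprod_val, nprod_pi, nprod_pi, nprod_pi,
    nprod_pi]
  exact VertexSubalgebra.nprod_mem_prod _ n (h ψ φ y hψ hφ) (h' ψ φ y hψ hφ)

lemma GlobalSections.mem_parity_iff (s : GlobalSections d X) (ε : ZMod 2) :
    s ∈ VertexData.parity ε ↔ ∀ φ x, s.1 φ x ∈ VertexData.parity ε := by
  rw [VertexSubalgebra.mem_parity, mem_parity_pi]
  exact forall_congr' fun φ => mem_parity_pi ε _

lemma IsPullback.mem_parity_germ_iff {p : Y → X} {s : GlobalSections d X} {t : GlobalSections d Y}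
    (h : IsPullback p s t) {y : Y} {x : X} (hp : IsLD d p y x) (ψ : Chart d Y) (φ : Chart d X)
    (hψ : y ∈ ψ.1.source) (hφ : x ∈ φ.1.source) (ε : ZMod 2) :
    t.1 ψ ⟨y, hψ⟩ ∈ VertexData.parity ε ↔ s.1 φ ⟨x, hφ⟩ ∈ VertexData.parity ε := by
  rw [h.eq_tr hp ψ φ hψ hφ]
  exact hp.tr_mem_parity ψ φ hψ hφ ε _

lemma IsPullback.mem_parity_iff {p : Y → X} (hp : ∀ y, IsLD d p y (p y))
    (hs : Function.Surjective p) {s : GlobalSections d X} {t : GlobalSections d Y}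
    (h : IsPullback p s t) (ε : ZMod 2) :
    t ∈ VertexData.parity ε ↔ s ∈ VertexData.parity ε := by
  rw [GlobalSections.mem_parity_iff, GlobalSections.mem_parity_iff]
  constructor
  · rintro H φ ⟨x, hx⟩
    obtain ⟨y, rfl⟩ := hs x
    exact (h.mem_parity_germ_iff (hp y) _ φ (mem_chartOf _) hx ε).1 (H _ _)
  · rintro H ψ ⟨y, hy⟩
    exact (h.mem_parity_germ_iff (hp y) ψ _ hy (mem_chartOf _) ε).2 (H _ _)

/-- A covering transformation is only assumed to be a homeomorphism. Near `y` it equals a local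
inverse of `p` composed with `p`, hence it is holomorphic, and so is its inverse. -/
lemma IsLD.deck {p : Y → X} (hp : ∀ y, IsLD d p y (p y)) {g : Y ≃ₜ Y} (hg : g ∈ deckGroup p)
    (y : Y) : IsLD d g y (g y) := by
  have key : ∀ g ∈ deckGroup p, ∀ y, ContMDiffAt 𝓘(ℂ, Cn d) 𝓘(ℂ, Cn d) ω g y := by
    intro g hg y
    obtain ⟨r, hr, e1, e2⟩ := (hp (g y)).exists_symm
    have e : g =ᶠ[𝓝 y] r ∘ p := by
      filter_upwards [(g.continuous.tendsto y).eventually e1] with z hz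
      rw [Function.comp_apply, ← hg z]
      exact hz.symm
    have hr' := hr.smooth
    rw [hg y] at hr'
    exact (ContMDiffAt.comp y hr' (hp y).smooth).congr_of_eventuallyEq e
  refine ⟨rfl, key g hg y, g.symm, g.symm_apply_apply y,
    key g⁻¹ (inv_mem hg) _, Eventually.of_forall g.symm_apply_apply,
    Eventually.of_forall g.apply_symm_apply⟩

/-- Pullbacks are invariant under covering transformations. -/
lemma IsPullback.mem_invariantSections {p : Y → X} (hp : ∀ y, IsLD d p y (p y))
    {s : GlobalSections d X} {t : GlobalSections d Y} (h : IsPullback p s t) :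
    t ∈ (invariantSections p).toSubmodule := by
  intro g hg
  refine isPullback_of (IsLD.deck hp hg) fun ψ φ y hψ hφ => ?_
  have h1 : IsLD d p (g y) (p y) := by
    have := hp (g y)
    rwa [hg y] at this
  rw [h.eq_tr (hp y) ψ _ hψ (mem_chartOf _), h.eq_tr h1 φ _ hφ (mem_chartOf _)]
  exact ((IsLD.deck hp hg y).tr_tr h1 (hp y) (Eventually.of_forall fun z => (hg z).symm)
    _ _ _ _ _ _ _).symm

/-- Every invariant section is a pullback. -/
lemma exists_isPullback {p : Y → X} (hp : ∀ y, IsLD d p y (p y)) (hs : Function.Surjective p)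
    (hr : ∀ y, ∃ r : X → Y, IsLD d r (p y) y ∧ r ∘ p =ᶠ[𝓝 y] id ∧
      ∀ᶠ x in 𝓝 (p y), IsLD d r x (r x) ∧ p ∘ r =ᶠ[𝓝 x] id)
    (hnormal : ∀ y y' : Y, p y = p y' → ∃ g ∈ deckGroup p, g y = y')
    {t : GlobalSections d Y} (ht : t ∈ (invariantSections p).toSubmodule) :
    ∃ s : GlobalSections d X, IsPullback p s t := by
  -- `σ` is an arbitrary set-theoretic section of `p`. The descended germ at `x` is the germ of `t`
  -- at `σ x`, transported along the local inverse of `p` through `σ x`.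
  choose σ hσ using hs
  choose r hr1 hr2 hr3 using hr
  have hr1' : ∀ x, IsLD d (r (σ x)) x (σ x) := fun x => by
    have := hr1 (σ x)
    rwa [hσ] at this
  -- Independence of the choice of `σ`: some covering transformation `g` takes `y` to `σ (p y)`,
  -- invariance identifies the two germs of `t`, and near `y` the map `g` is the local inverse
  -- composed with `p`.
  have key : ∀ ψ φ y hψ hφ, t.1 ψ ⟨y, hψ⟩ =
      (hp y).tr ψ φ hψ hφ (transportFam hr1' t.1 φ ⟨p y, hφ⟩) := by
    intro ψ φ y hψ hφ
    obtain ⟨g, hg, hgy⟩ := hnormal y (σ (p y)) (hσ _).symm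
    have h1 : IsLD d g y (σ (p y)) := hgy ▸ IsLD.deck hp hg y
    rw [(ht g hg).eq_tr h1 ψ (chartOf d (σ (p y))) hψ (mem_chartOf _), transportFam]
    refine ((hp y).tr_tr (hr1' (p y)) h1 ?_ _ _ _ _ _ _ _).symm
    filter_upwards [h1.tendsto.eventually (hr2 (σ (p y)))] with z hz
    rw [Function.comp_apply, ← hg z]
    exact hz.symm
  refine ⟨⟨transportFam hr1' t.1, fun φ x => ?_, isCompatible_transportFam hr1' t.1⟩,
    isPullback_of hp key⟩
  -- Near `x` the single local inverse through `σ x` is used for all `z`, although `σ z` may lie on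
  -- another sheet; `key` shows that the germ is the same.
  refine t.2.1.transport (hr1' x) φ (chartOf d (σ x)) x.2 (mem_chartOf _) ?_
  have h3 := hr3 (σ x)
  rw [hσ] at h3
  filter_upwards [h3] with z ⟨hz, e⟩
  refine ⟨hz, fun hφ hψ => ?_⟩
  have e0 : p (r (σ x) z) = z := e.eq_of_nhds
  have h4 : IsLD d p (r (σ x) z) z := by
    have := hp (r (σ x) z)
    rwa [e0] at this
  have h5 : t.1 (chartOf d (σ x)) ⟨r (σ x) z, hψ⟩ =
      h4.tr _ φ hψ hφ (transportFam hr1' t.1 φ ⟨z, hφ⟩) := by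
    -- Replacing the point by a variable allows `z` to be eliminated in favour of its image under
    -- `p`, despite the dependent types.
    generalize r (σ x) z = y at h4 hψ
    obtain rfl := h4.eq
    exact key _ φ y hψ hφ
  rw [h5, hz.tr_tr_self h4 e]

/-- The inverse of one partial diffeomorphism through `y` serves all points near `p y`, which the
last clause needs for local givenness. -/
lemma exists_localInverse {p : Y → X} (h : IsLocalDiffeomorph 𝓘(ℂ, Cn d) 𝓘(ℂ, Cn d) ω p) (y : Y) :
    IsLD d p y (p y) ∧ ∃ r : X → Y, IsLD d r (p y) y ∧ r ∘ p =ᶠ[𝓝 y] id ∧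
      ∀ᶠ x in 𝓝 (p y), IsLD d r x (r x) ∧ p ∘ r =ᶠ[𝓝 x] id := by
  obtain ⟨Φ, hy, hΦ⟩ := h y
  have e1 : ∀ z ∈ Φ.source, Φ.invFun ∘ p =ᶠ[𝓝 z] id := fun z hz => by
    filter_upwards [Φ.open_source.mem_nhds hz] with w hw
    rw [Function.comp_apply, hΦ hw]
    exact Φ.left_inv' hw
  have e2 : ∀ x ∈ Φ.target, p ∘ Φ.invFun =ᶠ[𝓝 x] id := fun x hx => by
    filter_upwards [Φ.open_target.mem_nhds hx] with w hw
    rw [Function.comp_apply, hΦ (Φ.map_target' hw)]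
    exact Φ.right_inv' hw
  have h1 : ∀ z ∈ Φ.source, IsLD d p z (p z) := fun z hz => by
    have hpz : p z ∈ Φ.target := by rw [hΦ hz]; exact Φ.map_source' hz
    refine ⟨rfl, ?_, Φ.invFun, (e1 z hz).eq_of_nhds, ?_, e1 z hz, e2 _ hpz⟩
    · exact (Φ.contMDiffOn_toFun.contMDiffAt (Φ.open_source.mem_nhds hz)).congr_of_eventuallyEq
        (hΦ.eventuallyEq_of_mem (Φ.open_source.mem_nhds hz))
    · exact Φ.contMDiffOn_invFun.contMDiffAt (Φ.open_target.mem_nhds hpz)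
  have h2 : ∀ x ∈ Φ.target, IsLD d Φ.invFun x (Φ.invFun x) := fun x hx =>
    ⟨rfl, Φ.contMDiffOn_invFun.contMDiffAt (Φ.open_target.mem_nhds hx), p, (e2 x hx).eq_of_nhds,
      (h1 _ (Φ.map_target' hx)).smooth, e2 x hx, e1 _ (Φ.map_target' hx)⟩
  have hpy : p y ∈ Φ.target := by rw [hΦ hy]; exact Φ.map_source' hy
  refine ⟨h1 y hy, Φ.invFun, ?_, e1 y hy, ?_⟩
  · have := h2 _ hpy
    rwa [show Φ.invFun (p y) = y from (e1 y hy).eq_of_nhds] at this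
  · filter_upwards [Φ.open_target.mem_nhds hpy] with x hx
    exact ⟨h2 x hx, e2 x hx⟩

end Covering

/-! ### Operations in subalgebras, and translation. -/

section Val

/-- Translation is `a ↦ a_(-2) 1`, so preserving it is automatic. -/
lemma map_transl_of {V W : Type*} [AddCommGroup V] [Module ℂ V] [VertexData V]
    [AddCommGroup W] [Module ℂ W] [VertexData W] {T : V →ₗ[ℂ] W}
    (h1 : T VertexData.vac = VertexData.vac)
    (h2 : ∀ n a b, T (VertexData.nprod n a b) = VertexData.nprod n (T a) (T b)) (a : V) :
    T (transl a) = transl (T a) := by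
  change T (VertexData.nprod (-2) a VertexData.vac) = VertexData.nprod (-2) (T a) VertexData.vac
  rw [h2, h1]

variable {V : Type*} [AddCommGroup V] [Module ℂ V] [VertexData V] (S : VertexSubalgebra V)

lemma VertexSubalgebra.add_val (a b : S) : (a + b).1 = a.1 + b.1 := rfl

lemma VertexSubalgebra.smul_val (c : ℂ) (a : S) : (c • a).1 = c • a.1 := rfl

lemma VertexSubalgebra.vac_val : (VertexData.vac : S).1 = VertexData.vac := rfl

end Val

/-! ### The pullback as an isomorphism of vertex algebras. -/

section PullbackIso

variable {d : ℕ} {X Y : Type*} [TopologicalSpace X] [ChartedSpace (Cn d) X]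
  [TopologicalSpace Y] [ChartedSpace (Cn d) Y]
  [IsManifold 𝓘(ℂ, Cn d) ω X] [IsManifold 𝓘(ℂ, Cn d) ω Y]

lemma IsPullback.add {p : Y → X} {s s' : GlobalSections d X} {t t' : GlobalSections d Y}
    (h : IsPullback p s t) (h' : IsPullback p s' t') : IsPullback p (s + s') (t + t') :=
  fun ψ φ y hψ hφ => by
    rw [VertexSubalgebra.add_val, VertexSubalgebra.add_val]
    exact Submodule.add_mem _ (h ψ φ y hψ hφ) (h' ψ φ y hψ hφ)

lemma IsPullback.smul {p : Y → X} {s : GlobalSections d X} {t : GlobalSections d Y}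
    (h : IsPullback p s t) (c : ℂ) : IsPullback p (c • s) (c • t) :=
  fun ψ φ y hψ hφ => by
    rw [VertexSubalgebra.smul_val, VertexSubalgebra.smul_val]
    exact Submodule.smul_mem _ c (h ψ φ y hψ hφ)

lemma isPullback_vac (p : Y → X) :
    IsPullback p (VertexData.vac : GlobalSections d X) (VertexData.vac : GlobalSections d Y) :=
  fun ψ φ y hψ hφ => by
    rw [VertexSubalgebra.vac_val, VertexSubalgebra.vac_val]
    exact VertexSubalgebra.vac_mem _

lemma pullback_add {p : Y → X} (hp : ∀ y, IsLD d p y (p y)) (s s' : GlobalSections d X) :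
    pullback hp (s + s') = pullback hp s + pullback hp s' :=
  (isPullback_pullback hp _).unique hp
    ((isPullback_pullback hp s).add (isPullback_pullback hp s'))

lemma pullback_smul {p : Y → X} (hp : ∀ y, IsLD d p y (p y)) (c : ℂ) (s : GlobalSections d X) :
    pullback hp (c • s) = c • pullback hp s :=
  (isPullback_pullback hp _).unique hp ((isPullback_pullback hp s).smul c)

/-- The pullback as a linear map to the invariant sections. -/
def pullbackLinear {p : Y → X} (hp : ∀ y, IsLD d p y (p y)) :
    GlobalSections d X →ₗ[ℂ] invariantSections (d := d) p where
  toFun s := ⟨pullback hp s, (isPullback_pullback hp s).mem_invariantSections hp⟩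
  map_add' s s' := Subtype.ext (pullback_add hp s s')
  map_smul' c s := Subtype.ext (pullback_smul hp c s)

lemma pullbackLinear_val {p : Y → X} (hp : ∀ y, IsLD d p y (p y)) (s : GlobalSections d X) :
    (pullbackLinear hp s).1 = pullback hp s := rfl

lemma isPullback_iff {p : Y → X} (hp : ∀ y, IsLD d p y (p y)) (s : GlobalSections d X)
    (t : GlobalSections d Y) : IsPullback p s t ↔ (pullbackLinear hp s).1 = t :=
  ⟨fun h => (isPullback_pullback hp s).unique hp h,
    fun h => by rw [← h]; exact isPullback_pullback hp s⟩

lemma pullbackLinear_nprod {p : Y → X} (hp : ∀ y, IsLD d p y (p y)) (n : ℤ)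
    (s s' : GlobalSections d X) : pullbackLinear hp (VertexData.nprod n s s') =
      VertexData.nprod n (pullbackLinear hp s) (pullbackLinear hp s') :=
  Subtype.ext <| (isPullback_iff hp _ _).1
    ((isPullback_pullback hp s).nprod (isPullback_pullback hp s') n)

lemma pullbackLinear_vac {p : Y → X} (hp : ∀ y, IsLD d p y (p y)) :
    pullbackLinear hp VertexData.vac = VertexData.vac :=
  Subtype.ext <| (isPullback_iff hp _ _).1 (isPullback_vac p)

lemma pullbackLinear_bijective {p : Y → X} (hs : Function.Surjective p)
    (hloc : IsLocalDiffeomorph 𝓘(ℂ, Cn d) 𝓘(ℂ, Cn d) ω p)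
    (hnormal : ∀ y y' : Y, p y = p y' → ∃ g ∈ deckGroup p, g y = y')
    (hp : ∀ y, IsLD d p y (p y)) : Function.Bijective (pullbackLinear hp) := by
  constructor
  · intro s s' h
    have h1 := isPullback_pullback hp s
    have h2 := isPullback_pullback hp s'
    rw [← show pullback hp s = pullback hp s' from congrArg Subtype.val h] at h2
    exact h1.injective hp hs h2
  · intro t
    obtain ⟨s, h⟩ := exists_isPullback hp hs (fun y => (exists_localInverse hloc y).2) hnormal t.2
    exact ⟨s, Subtype.ext ((isPullback_iff hp _ _).1 h)⟩

lemma pullbackLinear_transl {p : Y → X} (hp : ∀ y, IsLD d p y (p y)) (s : GlobalSections d X) :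
    pullbackLinear hp (transl s) = transl (pullbackLinear hp s) :=
  map_transl_of (pullbackLinear_vac hp) (pullbackLinear_nprod hp) s

lemma pullbackLinear_mem_parity_iff {p : Y → X} (hs : Function.Surjective p)
    (hp : ∀ y, IsLD d p y (p y)) (ε : ZMod 2) (s : GlobalSections d X) :
    pullbackLinear hp s ∈ VertexData.parity ε ↔ s ∈ VertexData.parity ε := by
  rw [VertexSubalgebra.mem_parity, pullbackLinear_val]
  exact (isPullback_pullback hp s).mem_parity_iff hp hs ε

/-- The pullback along a normal covering map, as an isomorphism onto the invariant sections. -/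
def pullbackIso {p : Y → X} (hs : Function.Surjective p)
    (hloc : IsLocalDiffeomorph 𝓘(ℂ, Cn d) 𝓘(ℂ, Cn d) ω p)
    (hnormal : ∀ y y' : Y, p y = p y' → ∃ g ∈ deckGroup p, g y = y')
    (hp : ∀ y, IsLD d p y (p y)) :
    VertexIso (GlobalSections d X) (invariantSections (d := d) p) where
  __ := LinearEquiv.ofBijective (pullbackLinear hp) (pullbackLinear_bijective hs hloc hnormal hp)
  map_vac := pullbackLinear_vac hp
  map_nprod := pullbackLinear_nprod hp
  map_transl := pullbackLinear_transl hp
  map_parity ε s := pullbackLinear_mem_parity_iff hs hp ε s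

end PullbackIso

end
end ChiralDeRham

/-- The equivalence states both existence and uniqueness of the pullback: `t` is a pullback of `s`
exactly when it is the section underlying `Φ s`. Normality is expressed by transitivity of
`deckGroup p` on fibres. -/
theorem mainTheorem4 (d : ℕ) {X Y : Type*}
    [TopologicalSpace X] [CompactSpace X] [T2Space X]
    [ChartedSpace (EuclideanSpace ℂ (Fin d)) X]
    [IsManifold 𝓘(ℂ, EuclideanSpace ℂ (Fin d)) ω X]
    [TopologicalSpace Y] [CompactSpace Y] [T2Space Y]
    [ChartedSpace (EuclideanSpace ℂ (Fin d)) Y]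
    [IsManifold 𝓘(ℂ, EuclideanSpace ℂ (Fin d)) ω Y]
    (p : Y → X) (hp : IsCoveringMap p) (hsurj : Function.Surjective p)
    (hloc : IsLocalDiffeomorph 𝓘(ℂ, EuclideanSpace ℂ (Fin d)) 𝓘(ℂ, EuclideanSpace ℂ (Fin d)) ω p)
    (hfinite : ∀ x, (p ⁻¹' {x}).Finite)
    (hnormal : ∀ y y' : Y, p y = p y' → ∃ g ∈ ChiralDeRham.deckGroup p, g y = y') :
    ∃ Φ : ChiralDeRham.VertexIso (ChiralDeRham.GlobalSections d X)
        (ChiralDeRham.invariantSections (d := d) p),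
      ∀ (s : ChiralDeRham.GlobalSections d X) (t : ChiralDeRham.GlobalSections d Y),
        ChiralDeRham.IsPullback p s t ↔ (Φ.toLinearEquiv s).1 = t :=
  ⟨ChiralDeRham.pullbackIso hsurj hloc hnormal fun y =>
    (ChiralDeRham.exists_localInverse hloc y).1, fun s t => ChiralDeRham.isPullback_iff _ s t⟩
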